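/- Let $S$ be a scheme, let $d,r\ge 0$ be integers, and work on the big fppf site of schemes over $S$. Let $\mathbf{GL}_n$ be the sheaf of invertible $n\times n$ matrices, $\mathbf{PGL}_n$ the sheaf of algebra automorphisms of $\mathrm{M}_n(\mathcal O)$, and $\mathbb S_d$ the constant sheaf of permutations of $\{1,\dots,d\}$, which acts on $d$-th powers by permuting the factors. For a sheaf of groups $G$ let $H^1(S,G)$ be the set of isomorphism classes of $G$-torsors; a homomorphism $G\to H$ induces a map $H^1(S,G)\to H^1(S,H)$, sending a torsor $P$ to the contracted product $P\times^G H$. The Segre homomorphisms $$\mathrm{Seg}\colon (\mathbf{GL}_r)^d\rtimes\mathbb S_d\to\mathbf{GL}_{r^d},\qquad \mathrm{PSeg}\colon(\mathbf{PGL}_r)^d\rtimes\mathbb S_d\to\mathbf{PGL}_{r^d}$$ send $(A_1,\dots,A_d)\sigma$ to $(A_1\otimes\dots\otimes A_d)\circ j(\sigma)$, where $\mathcal O^{r^d}=(\mathcal O^r)^{\otimes d}$, respectively $\mathrm M_{r^d}(\mathcal O)=\mathrm M_r(\mathcal O)^{\otimes d}$, and $j(\sigma)(x_1\otimes\dots\otimes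 x_d)=x_{\sigma^{-1}(1)}\otimes\dots\otimes x_{\sigma^{-1}(d)}$. For a finite étale morphism $T\to S$ of constant degree $d$ and a module $\mathcal M$ on $T$, let $N_{T/S}(\mathcal M)$ be Ferrand's norm: over an affine $U\to S$ with $R=\mathcal O(U)$ and $R'=\mathcal O(T\times_S U)$, its sections are $\Gamma^d_R(\mathcal M(T\times_SU))\otimes_{\Gamma^d_R(R')}R$, where $\Gamma^d_R$ is the $d$-th divided power module and $\Gamma^d_R(R')\to R$ is the homomorphism corresponding to the norm of $R'$ over $R$; its sections over an arbitrary $X\to S$ are the compatible families of sections over all affine schemes over $X$. Let $\nu\colon m\mapsto\gamma_d(m)\otimes 1$ be the universal norm. (1) Consider pairs $(T\to S,\mathcal M)$ of a finite étale morphism of constant degree $d$ and a locally free $\mathcal O|_T$-module of constant rank $r$. The sheaf of isomorphisms from $(S^{\sqcup d}\to S,\mathcal O^r)$ to such a pair is a torsor under $(\mathbf{GL}_r)^d\rtimes\mathbb S_d$, and assigning to the pair the class $[(T\to S,\mathcal M)]$ of this torsor gives a bijection from isomorphism classes of pairs to $H^1(S,(\mathbf{GL}_r)^d\rtimes\mathbb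 S_d)$. The module $N_{T/S}(\mathcal M)$ is locally free of constant rank $r^d$, and the map induced by $\mathrm{Seg}$ is $$H^1(S,(\mathbf{GL}_r)^d\rtimes\mathbb S_d)\to H^1(S,\mathbf{GL}_{r^d}),\qquad[(T\to S,\mathcal M)]\mapsto[N_{T/S}(\mathcal M)],$$ where the class of a locally free module $\mathcal N$ of constant rank $n$ on $S$ is that of the torsor of isomorphisms $\mathcal O^n\to\mathcal N$. (2) Consider pairs $(T\to S,\mathcal A)$ of a finite étale morphism of constant degree $d$ and an Azumaya $\mathcal O|_T$-algebra of constant degree $r$. In the same way, by means of the sheaf of isomorphisms from $(S^{\sqcup d}\to S,\mathrm M_r(\mathcal O))$, the isomorphism classes of such pairs correspond bijectively to $H^1(S,(\mathbf{PGL}_r)^d\rtimes\mathbb S_d)$. There is exactly one structure of an $\mathcal O$-algebra on $N_{T/S}(\mathcal A)$ for which $\nu$ is multiplicative and preserves the unit; with it $N_{T/S}(\mathcal A)$ is an Azumaya algebra of constant degree $r^d$, and the map induced by $\mathrm{PSeg}$ is $$H^1(S,(\mathbf{PGL}_r)^d\rtimes\mathbb S_d)\to H^1(S,\mathbf{PGL}_{r^d}),\qquad[(T\to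 S,\mathcal A)]\mapsto[N_{T/S}(\mathcal A)],$$ where the class of an Azumaya algebra $\mathcal B$ of constant degree $n$ on $S$ is that of the torsor of algebra isomorphisms $\mathrm M_n(\mathcal O)\to\mathcal B$. -/

import Mathlib

open CategoryTheory Opposite AlgebraicGeometry

universe u

namespace SegreNorm

noncomputable section

/-! ## Torsors, first cohomology and the map induced by a group homomorphism -/

section Torsors

variable {C : Type (u + 1)} [Category.{u} C]

/-- A presheaf of sets with an operation of a presheaf of groups on the right, compatible with
restriction. The laws of a group action are part of `IsTorsor`. -/
structure RightGSet (G : Cᵒᵖ ⥤ GrpCat.{u}) where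
  /-- the underlying presheaf -/
  F : Cᵒᵖ ⥤ Type (u + 1)
  /-- the operation `p ↦ p · g` -/
  act {X : Cᵒᵖ} : F.obj X → G.obj X → F.obj X
  act_map {X Y : Cᵒᵖ} (f : X ⟶ Y) (p : F.obj X) (g : G.obj X) :
    F.map f (act p g) = act (F.map f p) (G.map f g)

/-- A (right) torsor under `G` for the topology `J`: a sheaf with a right action of `G`, simply
transitive on sections over every object, and having local sections. -/
structure IsTorsor (J : GrothendieckTopology C) {G : Cᵒᵖ ⥤ GrpCat.{u}} (P : RightGSet G) :
    Prop where
  isSheaf : Presieve.IsSheaf J P.F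
  act_one {X : Cᵒᵖ} (p : P.F.obj X) : P.act p 1 = p
  act_mul {X : Cᵒᵖ} (p : P.F.obj X) (g h : G.obj X) : P.act p (g * h) = P.act (P.act p g) h
  simply_transitive {X : Cᵒᵖ} (p q : P.F.obj X) : ∃! g : G.obj X, P.act p g = q
  locally_nonempty (X : C) : ∃ R ∈ J X, ∀ (Y : C) (f : Y ⟶ X), R f → Nonempty (P.F.obj (op Y))

/-- An isomorphism of presheaves of sets with a `G`-operation. -/
def RightGSet.Isom {G : Cᵒᵖ ⥤ GrpCat.{u}} (P Q : RightGSet G) : Prop :=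
  ∃ e : P.F ≅ Q.F, ∀ (X : Cᵒᵖ) (p : P.F.obj X) (g : G.obj X),
    e.hom.app X (P.act p g) = Q.act (e.hom.app X p) g

/-- Isomorphism classes of torsors. -/
def torsorSetoid (J : GrothendieckTopology C) (G : Cᵒᵖ ⥤ GrpCat.{u}) :
    Setoid {P : RightGSet G // IsTorsor J P} where
  r P Q := P.1.Isom Q.1
  iseqv :=
    { refl := fun P => ⟨Iso.refl _, fun X p g => rfl⟩
      symm := by
        rintro P Q ⟨e, he⟩
        refine ⟨e.symm, fun X p g => ?_⟩
        have h1 : ∀ x, e.hom.app X (e.inv.app X x) = x := fun x => by simp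
        have h2 : ∀ x, e.inv.app X (e.hom.app X x) = x := fun x => by simp
        have := he X (e.inv.app X p) g
        rw [h1] at this
        change e.inv.app X _ = _
        rw [← this, h2]
        rfl
      trans := by
        rintro P Q R ⟨e, he⟩ ⟨e', he'⟩
        refine ⟨e ≪≫ e', fun X p g => ?_⟩
        change e'.hom.app X (e.hom.app X _) = R.1.act (e'.hom.app X (e.hom.app X _)) g
        rw [he, he'] }

/-- The first non-abelian cohomology set: isomorphism classes of `G`-torsors for `J`. -/
def H1 (J : GrothendieckTopology C) (G : Cᵒᵖ ⥤ GrpCat.{u}) : Type (u + 2) :=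
  Quotient (torsorSetoid J G)

/-- The class of a torsor. -/
def H1.mk {J : GrothendieckTopology C} {G : Cᵒᵖ ⥤ GrpCat.{u}} {P : RightGSet G}
    (hP : IsTorsor J P) : H1 J G :=
  Quotient.mk (torsorSetoid J G) ⟨P, hP⟩

/-- Sections over `X` of the contracted product of `P` with `H` along `φ : G ⟶ H`: natural
families of maps `s : P(Y) → H(Y)`, for `Y ⟶ X`, with `s (p · g) = φ(g)⁻¹ * s p`. The class of
a pair `(p, h)` in the quotient of `P × H` by `(p · g, h) ∼ (p, φ(g) * h)` corresponds to the
family determined by `s p = h`. -/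
@[ext]
structure PushSection {G H : Cᵒᵖ ⥤ GrpCat.{u}} (φ : G ⟶ H) (P : RightGSet G) (X : C) :
    Type (u + 1) where
  /-- the family of maps -/
  app (Y : C) (y : Y ⟶ X) (p : P.F.obj (op Y)) : H.obj (op Y)
  app_map (Y Z : C) (y : Y ⟶ X) (z : Z ⟶ Y) (p : P.F.obj (op Y)) :
    app Z (z ≫ y) (P.F.map z.op p) = H.map z.op (app Y y p)
  app_act (Y : C) (y : Y ⟶ X) (p : P.F.obj (op Y)) (g : G.obj (op Y)) :
    app Y y (P.act p g) = (φ.app (op Y) g)⁻¹ * app Y y p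

namespace PushSection

variable {G H : Cᵒᵖ ⥤ GrpCat.{u}} {φ : G ⟶ H} {P : RightGSet G}

/-- Restriction of sections. -/
def res {X X' : C} (f : X' ⟶ X) (s : PushSection φ P X) : PushSection φ P X' where
  app Y y p := s.app Y (y ≫ f) p
  app_map Y Z y z p := by rw [Category.assoc, s.app_map]
  app_act Y y p g := s.app_act Y _ p g

/-- Right multiplication by a section of `H`. -/
def mul {X : C} (s : PushSection φ P X) (h : H.obj (op X)) : PushSection φ P X where
  app Y y p := s.app Y y p * H.map y.op h
  app_map Y Z y z p := by
    rw [s.app_map, map_mul, op_comp, H.map_comp, GrpCat.comp_apply]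
  app_act Y y p g := by rw [s.app_act, mul_assoc]

end PushSection

/-- The contracted product of `P` with `H` along `φ : G ⟶ H`, with `H` acting by right
multiplication. -/
def RightGSet.push {G H : Cᵒᵖ ⥤ GrpCat.{u}} (φ : G ⟶ H) (P : RightGSet G) : RightGSet H where
  F :=
    { obj := fun X => PushSection φ P X.unop
      map := fun f => TypeCat.ofHom (PushSection.res f.unop)
      map_id := fun X => by
        ext s Y y p
        exact congrArg (fun t => s.app Y t p) (Category.comp_id y)
      map_comp := fun f g => by
        ext s Y y p
        exact congrArg (fun t => s.app Y t p) (Category.assoc y _ _).symm }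
  act {X} s h := PushSection.mul s h
  act_map {X Y} f s h := by
    apply PushSection.ext
    funext Z z p
    change s.app Z (z ≫ f.unop) p * H.map (z ≫ f.unop).op h =
      s.app Z (z ≫ f.unop) p * H.map z.op (H.map f h)
    rw [op_comp, H.map_comp]
    rfl

end Torsors
section Push

variable {C : Type (u + 1)} [Category.{u} C] {J : GrothendieckTopology C}
  {G H : Cᵒᵖ ⥤ GrpCat.{u}} {φ : G ⟶ H} {P : RightGSet G}

theorem eq_of_locally_eq (hH : Presieve.IsSheaf J (H ⋙ forget GrpCat)) {X : C} {R : Sieve X}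
    (hR : R ∈ J X) (a b : H.obj (op X))
    (h : ∀ (Y : C) (f : Y ⟶ X), R f → H.map f.op a = H.map f.op b) : a = b :=
  (hH R hR).isSeparatedFor.ext (t₁ := a) (t₂ := b) fun Y f hf => h Y f hf

theorem exists_glue (hH : Presieve.IsSheaf J (H ⋙ forget GrpCat)) {X : C} {R : Sieve X}
    (hR : R ∈ J X) (x : ∀ (Y : C) (f : Y ⟶ X), R f → H.obj (op Y))
    (hx : ∀ (Y Z : C) (f : Y ⟶ X) (g : Z ⟶ Y) (hf : R f),
      x Z (g ≫ f) (R.downward_closed hf g) = H.map g.op (x Y f hf)) :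
    ∃ h : H.obj (op X), ∀ (Y : C) (f : Y ⟶ X) (hf : R f), H.map f.op h = x Y f hf := by
  let x' : Presieve.FamilyOfElements (H ⋙ forget GrpCat) R.arrows := fun Y f hf => x Y f hf
  have hx' : x'.Compatible := by
    rw [Presieve.compatible_iff_sieveCompatible]
    intro Y Z f g hf
    exact hx Y Z f g hf
  obtain ⟨t, ht, -⟩ := hH R hR x' hx'
  exact ⟨t, fun Y f hf => ht f hf⟩

theorem PushSection.app_congr {X Y : C} (s : PushSection φ P X) {y y' : Y ⟶ X} (h : y = y')
    (p : P.F.obj (op Y)) : s.app Y y p = s.app Y y' p := by rw [h]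

theorem RightGSet.push_map_app {X Y : C} (f : Y ⟶ X) (s : PushSection φ P X) (Z : C) (z : Z ⟶ Y)
    (p : P.F.obj (op Z)) :
    PushSection.app (X := Y) ((P.push φ).F.map f.op s) Z z p = s.app Z (z ≫ f) p := rfl

/-- The comparison of the values of two sections does not depend on the point. -/
theorem PushSection.inv_mul_app (hP : IsTorsor J P) {X Y : C} (s t : PushSection φ P X)
    (y : Y ⟶ X) (p q : P.F.obj (op Y)) :
    (s.app Y y p)⁻¹ * t.app Y y p = (s.app Y y q)⁻¹ * t.app Y y q := by
  obtain ⟨g, rfl, -⟩ := hP.simply_transitive p q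
  rw [s.app_act, t.app_act]
  group

theorem isSheaf_push (hH : Presieve.IsSheaf J (H ⋙ forget GrpCat)) :
    Presieve.IsSheaf J (P.push φ).F := by
  intro X R hR x hx
  rw [Presieve.compatible_iff_sieveCompatible] at hx
  let x' : ∀ (Y : C) (f : Y ⟶ X), R f → PushSection φ P Y := fun Y f hf => x f hf
  have hx' : ∀ (Y Z W : C) (f : Y ⟶ X) (g : Z ⟶ Y) (hf : R f) (w : W ⟶ Z)
      (p : P.F.obj (op W)), (x' Z (g ≫ f) (R.downward_closed hf g)).app W w p =
        (x' Y f hf).app W (w ≫ g) p := by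
    intro Y Z W f g hf w p
    have := hx f g hf
    change (PushSection.app (X := Z) (x (g ≫ f) _) W w p) = _
    rw [this]
    rfl
  have key : ∀ (Y : C) (y : Y ⟶ X) (p : P.F.obj (op Y)), ∃ h : H.obj (op Y),
      ∀ (Z : C) (z : Z ⟶ Y) (hz : R (z ≫ y)),
        H.map z.op h = (x' Z (z ≫ y) hz).app Z (𝟙 Z) (P.F.map z.op p) := by
    intro Y y p
    refine exists_glue hH (J.pullback_stable y hR)
      (fun Z z hz => (x' Z (z ≫ y) hz).app Z (𝟙 Z) (P.F.map z.op p)) ?_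
    intro Z W z w hz
    have h1 : (x' W ((w ≫ z) ≫ y) (by
        rw [Category.assoc]; exact R.downward_closed hz w)).app W (𝟙 W)
          (P.F.map (w ≫ z).op p) = (x' Z (z ≫ y) hz).app W (w ≫ 𝟙 Z)
            (P.F.map w.op (P.F.map z.op p)) := by
      have h2 := hx' Z W W (z ≫ y) w hz (𝟙 W) (P.F.map (w ≫ z).op p)
      have h3 : ∀ (f f' : W ⟶ X) (e : f = f') (hf : R f) (hf' : R f'),
          x' W f hf = x' W f' hf' := by
        rintro f _ rfl _ _; rfl
      rw [h3 _ _ (Category.assoc w z y) _ (R.downward_closed hz w), h2]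
      rw [PushSection.app_congr _ (show 𝟙 W ≫ w = w ≫ 𝟙 Z by simp)]
      rw [op_comp, P.F.map_comp]
      rfl
    refine h1.trans ?_
    rw [(x' Z (z ≫ y) hz).app_map]
  choose h hh using key
  have h3 : ∀ (Y : C) (f f' : Y ⟶ X) (e : f = f') (hf : R f) (hf' : R f'),
      x' Y f hf = x' Y f' hf' := by
    rintro Y f _ rfl _ _; rfl
  let s : PushSection φ P X :=
    { app := h
      app_map := by
        intro Y Z y z p
        refine eq_of_locally_eq hH (J.pullback_stable (z ≫ y) hR) _ _ fun W w hw => ?_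
        have hw' : R ((w ≫ z) ≫ y) := by rw [Category.assoc]; exact hw
        rw [hh _ _ _ _ _ hw, ← GrpCat.comp_apply, ← H.map_comp, ← op_comp, hh _ _ _ _ _ hw',
          h3 W _ _ (Category.assoc w z y) hw' hw, op_comp, P.F.map_comp]
        rfl
      app_act := by
        intro Y y p g
        refine eq_of_locally_eq hH (J.pullback_stable y hR) _ _ fun W w hw => ?_
        rw [hh _ _ _ _ _ hw, map_mul, map_inv, hh _ _ _ _ _ hw, P.act_map,
          PushSection.app_act]
        congr 2
        exact (ConcreteCategory.congr_hom (φ.naturality w.op) g) }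
  have hs : ∀ (Y Z : C) (f : Y ⟶ X) (hf : R f) (y : Z ⟶ Y) (p : P.F.obj (op Z)),
      h Z (y ≫ f) p = (x' Y f hf).app Z y p := by
    intro Y Z f hf y p
    have hz : R (𝟙 Z ≫ y ≫ f) := by
      rw [Category.id_comp]; exact R.downward_closed hf y
    have := hh Z (y ≫ f) p Z (𝟙 Z) hz
    rw [op_id, H.map_id, P.F.map_id] at this
    refine Eq.trans this ?_
    rw [h3 Z _ _ (Category.id_comp _) hz (R.downward_closed hf y), hx',
      PushSection.app_congr _ (Category.id_comp y)]
    rfl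
  refine ⟨s, ?_, ?_⟩
  · intro Y f hf
    apply PushSection.ext
    funext Z y p
    exact hs Y Z f hf y p
  · intro t ht
    apply PushSection.ext
    funext Y y p
    refine eq_of_locally_eq hH (J.pullback_stable y hR) _ _ fun W w hw => ?_
    have h4 : PushSection.app (X := X) t W (w ≫ y) (P.F.map w.op p) =
        h W (w ≫ y) (P.F.map w.op p) := by
      have h5 := hs W W (w ≫ y) hw (𝟙 W) (P.F.map w.op p)
      rw [Category.id_comp] at h5
      rw [h5]
      have h6 : x' W (w ≫ y) hw = (P.push φ).F.map (w ≫ y).op t := (ht _ hw).symm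
      rw [h6]
      exact PushSection.app_congr (X := X) t (Category.id_comp _).symm _
    exact ((PushSection.app_map (X := X) t Y W y w p).symm.trans h4).trans
      (s.app_map Y W y w p)

/-- The contracted product of a torsor with a sheaf of groups is a torsor. -/
theorem isTorsor_push (hH : Presieve.IsSheaf J (H ⋙ forget GrpCat)) (hP : IsTorsor J P) :
    IsTorsor J (P.push φ) where
  isSheaf := isSheaf_push hH
  act_one {X} p := by
    apply PushSection.ext
    funext Y y q
    change PushSection.app (X := X.unop) p Y y q * H.map y.op 1 = _
    rw [map_one, mul_one]
  act_mul {X} p g h := by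
    apply PushSection.ext
    funext Y y q
    change PushSection.app (X := X.unop) p Y y q * H.map y.op (g * h) =
      PushSection.app (X := X.unop) p Y y q * H.map y.op g * H.map y.op h
    rw [map_mul, mul_assoc]
  simply_transitive {X'} s' t' := by
    obtain ⟨X⟩ := X'
    let s : PushSection φ P X := s'
    let t : PushSection φ P X := t'
    obtain ⟨R, hR, hRP⟩ := hP.locally_nonempty X
    let p0 := fun Y f hf => Classical.choice (hRP Y f hf)
    obtain ⟨h, hh⟩ := exists_glue hH hR
      (fun Y f hf => (s.app Y f (p0 Y f hf))⁻¹ * t.app Y f (p0 Y f hf)) (by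
        intro Y Z f g hf
        dsimp only
        rw [map_mul, map_inv, ← s.app_map, ← t.app_map]
        exact PushSection.inv_mul_app hP s t _ _ _)
    refine ⟨h, ?_, ?_⟩
    · apply PushSection.ext
      funext Y y p
      change s.app Y y p * H.map y.op h = t.app Y y p
      refine eq_of_locally_eq hH (J.pullback_stable y hR) _ _ fun W w hw => ?_
      rw [map_mul, ← s.app_map, ← t.app_map, ← GrpCat.comp_apply, ← H.map_comp, ← op_comp,
        hh W (w ≫ y) hw, PushSection.inv_mul_app hP s t _ _ (P.F.map w.op p)]
      group
    · intro h' hh'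
      refine eq_of_locally_eq hH hR _ _ fun Y f hf => ?_
      rw [hh Y f hf]
      have : s.app Y f (p0 Y f hf) * H.map f.op h' = t.app Y f (p0 Y f hf) :=
        congrArg (fun r : PushSection φ P X => r.app Y f (p0 Y f hf)) hh'
      rw [← this]
      group
  locally_nonempty X := by
    obtain ⟨R, hR, hRP⟩ := hP.locally_nonempty X
    refine ⟨R, hR, fun Y f hf => ?_⟩
    obtain ⟨p0⟩ := hRP Y f hf
    choose g hg hg' using fun (Z : C) (z : Z ⟶ Y) (p : P.F.obj (op Z)) =>
      hP.simply_transitive (P.F.map z.op p0) p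
    exact ⟨(
      { app := fun Z z p => (φ.app (op Z) (g Z z p))⁻¹
        app_map := by
          intro Z W z w p
          rw [map_inv]
          congr 1
          have h1 : G.map w.op (g Z z p) = g W (w ≫ z) (P.F.map w.op p) := by
            apply hg'
            dsimp only
            rw [op_comp, P.F.map_comp]
            change P.act (P.F.map w.op (P.F.map z.op p0)) _ = _
            rw [← P.act_map, hg]
          rw [← h1]
          exact (ConcreteCategory.congr_hom (φ.naturality w.op) _)
        app_act := by
          intro Z z p k
          have h1 : g Z z p * k = g Z z (P.act p k) := by
            apply hg'
            dsimp only
            rw [hP.act_mul, hg]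
          rw [← h1, map_mul, mul_inv_rev] } : PushSection φ P Y)⟩

/-- Isomorphic torsors have isomorphic contracted products. -/
theorem isom_push {P Q : RightGSet G} (h : P.Isom Q) : (P.push φ).Isom (Q.push φ) := by
  obtain ⟨e, he⟩ := h
  have h1 : ∀ X x, e.hom.app X (e.inv.app X x) = x := fun X x => by simp
  have h2 : ∀ X x, e.inv.app X (e.hom.app X x) = x := fun X x => by simp
  have he' : ∀ (X : Cᵒᵖ) (q : Q.F.obj X) (g : G.obj X),
      e.inv.app X (Q.act q g) = P.act (e.inv.app X q) g := fun X q g => by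
    have := he X (e.inv.app X q) g
    rw [h1] at this
    rw [← this, h2]
  have n1 : ∀ {X Y : Cᵒᵖ} (f : X ⟶ Y) (p : P.F.obj X),
      e.hom.app Y (P.F.map f p) = Q.F.map f (e.hom.app X p) := fun f p =>
    ConcreteCategory.congr_hom (e.hom.naturality f) p
  have n2 : ∀ {X Y : Cᵒᵖ} (f : X ⟶ Y) (p : Q.F.obj X),
      e.inv.app Y (Q.F.map f p) = P.F.map f (e.inv.app X p) := fun f p =>
    ConcreteCategory.congr_hom (e.inv.naturality f) p
  let a : ∀ X : C, PushSection φ P X → PushSection φ Q X := fun X s =>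
    { app := fun Y y q => s.app Y y (e.inv.app _ q)
      app_map := fun Y Z y z q => by rw [n2, s.app_map]
      app_act := fun Y y q g => by rw [he', s.app_act] }
  let b : ∀ X : C, PushSection φ Q X → PushSection φ P X := fun X s =>
    { app := fun Y y q => s.app Y y (e.hom.app _ q)
      app_map := fun Y Z y z q => by rw [n1, s.app_map]
      app_act := fun Y y q g => by rw [he, s.app_act] }
  refine ⟨NatIso.ofComponents (fun X =>
    { hom := TypeCat.ofHom (a X.unop)
      inv := TypeCat.ofHom (b X.unop)
      hom_inv_id := ?_
      inv_hom_id := ?_ }) ?_, ?_⟩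
  · ext s
    apply PushSection.ext
    funext Y y p
    exact congrArg (PushSection.app (X := X.unop) s Y y) (h2 _ p)
  · ext s
    apply PushSection.ext
    funext Y y p
    exact congrArg (PushSection.app (X := X.unop) s Y y) (h1 _ p)
  · intro X Y f
    rfl
  · intro X s h
    rfl

/-- The map on first cohomology induced by a homomorphism `φ : G ⟶ H` to a sheaf of groups. -/
def H1.map (φ : G ⟶ H) (hH : Presieve.IsSheaf J (H ⋙ forget GrpCat)) : H1 J G → H1 J H :=
  Quotient.map (fun P => ⟨P.1.push φ, isTorsor_push hH P.2⟩) fun _ _ h => isom_push h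

end Push
/-! ## Sections chosen by a locally constant function -/

section LocallyConstantEval

variable {X : Scheme.{u}} {ι : Type}

/-- The open and closed subset where the locally constant function `f` takes the value `j`. -/
def fiberOpen (f : LocallyConstant X ι) (j : ι) : X.Opens :=
  ⟨f ⁻¹' {j}, f.isLocallyConstant.isOpen_fiber j⟩

theorem eq_of_germ_eq {a b : Γ(X, ⊤)}
    (h : ∀ x : X, X.presheaf.germ ⊤ x trivial a = X.presheaf.germ ⊤ x trivial b) : a = b :=
  TopCat.Presheaf.section_ext X.sheaf ⊤ a b fun x _ => h x

/-- For `f : X → ι` locally constant and global functions `a j`, the global function which is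
equal to `a j` on the open and closed subset `f⁻¹(j)`, for all `j`. -/
theorem exists_lcEval (f : LocallyConstant X ι) (a : ι → Γ(X, ⊤)) :
    ∃ s : Γ(X, ⊤), ∀ x : X,
      X.presheaf.germ ⊤ x trivial s = X.presheaf.germ ⊤ x trivial (a (f x)) := by
  obtain ⟨s, hs, -⟩ := X.sheaf.existsUnique_gluing' (fiberOpen f) ⊤ (fun j => homOfLE le_top)
    (fun x _ => by
      rw [TopologicalSpace.Opens.mem_iSup]
      exact ⟨f x, rfl⟩)
    (fun j => X.presheaf.map (homOfLE le_top).op (a j)) (by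
      intro i j
      by_cases hij : i = j
      · subst hij; rfl
      · refine TopCat.Presheaf.section_ext X.sheaf _ _ _ fun x hx => ?_
        exact absurd ((hx.1 : f x = i).symm.trans (hx.2 : f x = j)) hij)
  refine ⟨s, fun x => ?_⟩
  have h := hs (f x)
  have h' := congrArg (X.presheaf.germ (fiberOpen f (f x)) x rfl) h
  erw [TopCat.Presheaf.germ_res_apply, TopCat.Presheaf.germ_res_apply] at h'
  exact h'

/-- The ring homomorphism sending a family of global functions `a j` to the global function
which is equal to `a j` on the open and closed subset `f⁻¹(j)`, for all `j`. -/
def lcEval (f : LocallyConstant X ι) : (ι → Γ(X, ⊤)) →+* Γ(X, ⊤) where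
  toFun a := (exists_lcEval f a).choose
  map_one' := eq_of_germ_eq fun x => by
    rw [(exists_lcEval f _).choose_spec]; rfl
  map_zero' := eq_of_germ_eq fun x => by
    rw [(exists_lcEval f _).choose_spec]; rfl
  map_add' a b := eq_of_germ_eq fun x => by
    rw [map_add, (exists_lcEval f _).choose_spec, (exists_lcEval f _).choose_spec,
      (exists_lcEval f _).choose_spec, Pi.add_apply, map_add]
  map_mul' a b := eq_of_germ_eq fun x => by
    rw [map_mul, (exists_lcEval f _).choose_spec, (exists_lcEval f _).choose_spec,
      (exists_lcEval f _).choose_spec, Pi.mul_apply, map_mul]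

theorem germ_lcEval (f : LocallyConstant X ι) (a : ι → Γ(X, ⊤)) (x : X) :
    X.presheaf.germ ⊤ x trivial (lcEval f a) = X.presheaf.germ ⊤ x trivial (a (f x)) :=
  (exists_lcEval f a).choose_spec x

/-- Pullback of locally constant functions along a morphism of schemes. -/
def lcPull {Y : Scheme.{u}} (h : Y ⟶ X) {κ : Type*} (f : LocallyConstant X κ) :
    LocallyConstant Y κ :=
  f.comap h.base.hom

@[simp]
theorem lcPull_apply {Y : Scheme.{u}} (h : Y ⟶ X) {κ : Type*} (f : LocallyConstant X κ) (y : Y) :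
    lcPull h f y = f (h y) := rfl

theorem appTop_lcEval {Y : Scheme.{u}} (h : Y ⟶ X) (f : LocallyConstant X ι)
    (a : ι → Γ(X, ⊤)) :
    h.appTop (lcEval f a) = lcEval (lcPull h f) (fun j => h.appTop (a j)) := by
  have key : ∀ (y : Y) (s : Γ(X, ⊤)), Y.presheaf.germ ⊤ y trivial (h.appTop s) =
      h.stalkMap y (X.presheaf.germ ⊤ (h y) trivial s) := fun y s =>
    (Scheme.Hom.germ_stalkMap_apply h ⊤ y trivial s).symm
  refine eq_of_germ_eq fun y => ?_
  rw [germ_lcEval, key, key, germ_lcEval]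
  rfl

theorem lcEval_const (j : ι) (a : ι → Γ(X, ⊤)) : lcEval (LocallyConstant.const X j) a = a j :=
  eq_of_germ_eq fun x => by rw [germ_lcEval]; rfl

theorem lcEval_lcEval {κ : Type} (f : LocallyConstant X ι) (g : ι → LocallyConstant X κ)
    (k : LocallyConstant X κ) (hk : ∀ x, k x = g (f x) x) (a : κ → Γ(X, ⊤)) :
    lcEval f (fun i => lcEval (g i) a) = lcEval k a :=
  eq_of_germ_eq fun x => by rw [germ_lcEval, germ_lcEval, germ_lcEval, hk]

theorem lcEval_map {κ : Type} (f : LocallyConstant X ι) (q : ι → κ) (a : κ → Γ(X, ⊤)) :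
    lcEval (f.map q) a = lcEval f (fun i => a (q i)) :=
  eq_of_germ_eq fun x => by rw [germ_lcEval, germ_lcEval]; rfl

end LocallyConstantEval
/-! ## Groups depending functorially on a ring, and their semidirect products with the
constant sheaf of permutations -/

section RingGroups

/-- The `i`-th projection of a power of a ring. -/
def evalHom {ι : Type} (R : CommRingCat.{u}) (i : ι) : CommRingCat.of (ι → R) ⟶ R :=
  CommRingCat.ofHom (Pi.evalRingHom (fun _ : ι => (R : Type u)) i)

/-- The homomorphism to a power of a ring with given components. -/
def piHom {ι : Type} {R R' : CommRingCat.{u}} (f : ι → (R ⟶ R')) : R ⟶ CommRingCat.of (ι → R') :=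
  CommRingCat.ofHom (RingHom.pi fun i => (f i).hom)

theorem piHom_evalHom {ι : Type} {R R' : CommRingCat.{u}} (f : ι → (R ⟶ R')) (i : ι) :
    piHom f ≫ evalHom R' i = f i := rfl

/-- The homomorphism `lcEval` as a morphism of the category of rings. -/
def lcHom {X : Scheme.{u}} {ι : Type} (f : LocallyConstant X ι) :
    CommRingCat.of (ι → Γ(X, ⊤)) ⟶ Γ(X, ⊤) :=
  CommRingCat.ofHom (lcEval f)

/-- A functor from commutative rings to groups which commutes with finite powers of rings. -/
class PreservesFinPow (F : CommRingCat.{u} ⥤ GrpCat.{u}) : Prop where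
  bijective (ι : Type) [Finite ι] (R : CommRingCat.{u}) :
    Function.Bijective (fun (a : F.obj (CommRingCat.of (ι → R))) (i : ι) => F.map (evalHom R i) a)

theorem map_map_apply {F : CommRingCat.{u} ⥤ GrpCat.{u}} {R₁ R₂ R₃ : CommRingCat.{u}} (f : R₁ ⟶ R₂) (g : R₂ ⟶ R₃) (a : F.obj R₁) :
    F.map g (F.map f a) = F.map (f ≫ g) a := by
  rw [F.map_comp]; rfl

variable (F : CommRingCat.{u} ⥤ GrpCat.{u}) [PreservesFinPow F] {ι κ : Type} [Finite ι] [Finite κ]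
  {R R' : CommRingCat.{u}}

/-- The element of `F (ι → R)` with given components in `F R`. -/
def piElem (A : ι → F.obj R) : F.obj (CommRingCat.of (ι → R)) :=
  (Equiv.ofBijective _ (PreservesFinPow.bijective (F := F) ι R)).symm A

theorem map_eval_piElem (A : ι → F.obj R) (i : ι) : F.map (evalHom R i) (piElem F A) = A i :=
  congrFun ((Equiv.ofBijective _ (PreservesFinPow.bijective (F := F) ι R)).apply_symm_apply A) i

variable {F}

theorem pow_ext {a b : F.obj (CommRingCat.of (ι → R))}
    (h : ∀ i, F.map (evalHom R i) a = F.map (evalHom R i) b) : a = b :=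
  (PreservesFinPow.bijective (F := F) ι R).1 (funext h)

theorem piElem_map (f : ι → (R ⟶ R')) (a : F.obj R) :
    piElem F (fun i => F.map (f i) a) = F.map (piHom f) a :=
  pow_ext fun i => by rw [map_eval_piElem, map_map_apply, piHom_evalHom]

theorem piElem_comp (q : κ → ι) (A : ι → F.obj R) :
    piElem F (fun k => A (q k)) = F.map (piHom fun k => evalHom R (q k)) (piElem F A) := by
  rw [← piElem_map]
  congr 1
  funext k
  exact (map_eval_piElem F A (q k)).symm

theorem map_piElem (f : R ⟶ R') (A : ι → F.obj R) :
    F.map (piHom fun i : ι => evalHom R i ≫ f) (piElem F A) = piElem F (fun i => F.map f (A i)) := by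
  rw [← piElem_map]
  congr 1
  funext i
  rw [← map_map_apply, map_eval_piElem]

variable (F)

/-- The element of `F Γ(X, ⊤)` which is equal to `A j` on the open and closed subset `f⁻¹(j)`. -/
def glue {X : Scheme.{u}} (f : LocallyConstant X ι) (A : ι → F.obj Γ(X, ⊤)) : F.obj Γ(X, ⊤) :=
  F.map (lcHom f) (piElem F A)

variable {F} {X Y : Scheme.{u}}

theorem glue_mul (f : LocallyConstant X ι) (A B : ι → F.obj Γ(X, ⊤)) :
    glue F f (A * B) = glue F f A * glue F f B := by
  have : piElem F (A * B) = piElem F A * piElem F B := pow_ext fun i => by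
    rw [map_mul, map_eval_piElem, map_eval_piElem, map_eval_piElem, Pi.mul_apply]
  rw [glue, this, map_mul, glue, glue]

theorem glue_const_fun (f : LocallyConstant X ι) (a : F.obj Γ(X, ⊤)) :
    glue F f (fun _ => a) = a := by
  have h1 : (fun _ : ι => a) = fun i : ι => F.map (𝟙 Γ(X, ⊤)) a := by
    funext i
    rw [F.map_id]; rfl
  have h2 : piHom (fun _ : ι => 𝟙 Γ(X, ⊤)) ≫ lcHom f = 𝟙 _ := by
    ext s
    refine eq_of_germ_eq fun x => ?_
    change X.presheaf.germ ⊤ x trivial (lcEval f fun _ => s) = X.presheaf.germ ⊤ x trivial s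
    rw [germ_lcEval]
  rw [glue, h1, piElem_map, map_map_apply, h2, F.map_id]
  rfl

theorem glue_one (f : LocallyConstant X ι) : glue F f 1 = 1 := glue_const_fun f 1

theorem glue_const (j : ι) (A : ι → F.obj Γ(X, ⊤)) :
    glue F (LocallyConstant.const X j) A = A j := by
  have : lcHom (LocallyConstant.const X j) = evalHom Γ(X, ⊤) j := by
    ext a
    exact lcEval_const j a
  rw [glue, this, map_eval_piElem]

theorem glue_map (f : LocallyConstant X ι) (q : ι → κ) (A : κ → F.obj Γ(X, ⊤)) :
    glue F (f.map q) A = glue F f (fun i => A (q i)) := by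
  have : lcHom (f.map q) = piHom (fun i => evalHom Γ(X, ⊤) (q i)) ≫ lcHom f := by
    ext a
    exact lcEval_map f q a
  rw [glue, glue, piElem_comp q A, map_map_apply, this]

theorem glue_pair (p : LocallyConstant X (ι × κ)) (B : ι → κ → F.obj Γ(X, ⊤)) :
    glue F (p.map Prod.fst) (fun i => glue F (p.map Prod.snd) (B i)) =
      glue F p (fun q => B q.1 q.2) := by
  have h1 : (fun i => glue F (p.map Prod.snd) (B i)) = fun i =>
      F.map (piHom (fun k : κ => evalHom Γ(X, ⊤) (i, k)) ≫ lcHom (p.map Prod.snd))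
        (piElem F (fun q : ι × κ => B q.1 q.2)) := by
    funext i
    rw [← map_map_apply, ← piElem_comp (fun k : κ => (i, k)) (fun q : ι × κ => B q.1 q.2)]
    rfl
  have h2 : piHom (fun i : ι => piHom (fun k : κ => evalHom Γ(X, ⊤) (i, k)) ≫
      lcHom (p.map Prod.snd)) ≫ lcHom (p.map Prod.fst) = lcHom p := by
    ext a
    refine eq_of_germ_eq fun x => ?_
    change X.presheaf.germ ⊤ x trivial (lcEval (p.map Prod.fst) fun i =>
      lcEval (p.map Prod.snd) fun k => a (i, k)) = X.presheaf.germ ⊤ x trivial (lcEval p a)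
    rw [germ_lcEval, germ_lcEval, germ_lcEval]
    rfl
  rw [h1, glue, piElem_map, map_map_apply, h2]
  rfl

theorem map_glue (h : Y ⟶ X) (f : LocallyConstant X ι) (A : ι → F.obj Γ(X, ⊤)) :
    F.map h.appTop (glue F f A) = glue F (lcPull h f) (fun j => F.map h.appTop (A j)) := by
  have : lcHom f ≫ h.appTop = piHom (fun i => evalHom Γ(X, ⊤) i ≫ h.appTop) ≫
      lcHom (lcPull h f) := by
    ext a
    exact appTop_lcEval h f a
  rw [glue, glue, ← map_piElem, map_map_apply, map_map_apply, this]

/-- A natural operation commutes with gluing. -/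
theorem nat_glue {μ : Type} {F' : CommRingCat.{u} ⥤ GrpCat.{u}} [PreservesFinPow F']
    (T : ∀ R : CommRingCat.{u}, (μ → F.obj R) → F'.obj R)
    (hT : ∀ (R R' : CommRingCat.{u}) (φ : R ⟶ R') (A : μ → F.obj R),
      F'.map φ (T R A) = T R' (fun k => F.map φ (A k)))
    (f : LocallyConstant X ι) (A : μ → ι → F.obj Γ(X, ⊤)) :
    T _ (fun k => glue F f (A k)) = glue F' f (fun i => T _ (fun k => A k i)) := by
  have h1 : piElem F' (fun i => T _ (fun k => A k i)) = T _ (fun k => piElem F (A k)) :=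
    pow_ext fun i => by
      rw [map_eval_piElem, hT]
      congr 1
      funext k
      rw [map_eval_piElem]
  rw [glue, h1, hT]
  rfl

end RingGroups

section Wreath

variable (F : CommRingCat.{u} ⥤ GrpCat.{u}) [PreservesFinPow F] (d : ℕ)

variable {F d} in
theorem glue_glue_perm {X : Scheme.{u}} (σ τ : LocallyConstant X (Equiv.Perm (Fin d)))
    (A : Equiv.Perm (Fin d) → F.obj Γ(X, ⊤)) :
    glue F σ (fun g => glue F τ (fun h => A (g * h))) = glue F (σ * τ) A := by
  let p : LocallyConstant X (Equiv.Perm (Fin d) × Equiv.Perm (Fin d)) :=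
    ⟨fun x => (σ x, τ x), σ.isLocallyConstant.prodMk τ.isLocallyConstant⟩
  exact (glue_pair p (fun g h => A (g * h))).trans (glue_map p (fun q => q.1 * q.2) A).symm

/-- The action of locally constant permutations of the indices on families: on the open and closed
subset where `σ` is equal to `g`, the component of `σ • A` at `i` is `A (g⁻¹ i)`. -/
def permAct (X : Scheme.{u}) :
    LocallyConstant X (Equiv.Perm (Fin d)) →* MulAut (Fin d → F.obj Γ(X, ⊤)) :=
  have h1 : ∀ A : Fin d → F.obj Γ(X, ⊤),
      (fun i => glue F (1 : LocallyConstant X (Equiv.Perm (Fin d))) (fun g => A (g⁻¹ i))) = A :=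
    fun A => funext fun i => glue_const (F := F) (1 : Equiv.Perm (Fin d)) (fun g => A (g⁻¹ i))
  have h2 : ∀ (σ τ : LocallyConstant X (Equiv.Perm (Fin d))) (A : Fin d → F.obj Γ(X, ⊤)),
      (fun i => glue F σ (fun g => glue F τ (fun h => A (h⁻¹ (g⁻¹ i))))) =
        fun i => glue F (σ * τ) (fun g => A (g⁻¹ i)) := fun σ τ A => funext fun i => by
    rw [← glue_glue_perm]
    simp only [mul_inv_rev, Equiv.Perm.mul_apply]
  { toFun := fun σ =>
      { toFun := fun A i => glue F σ (fun g => A (g⁻¹ i))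
        invFun := fun A i => glue F σ⁻¹ (fun g => A (g⁻¹ i))
        left_inv := fun A => (h2 σ⁻¹ σ A).trans (by rw [inv_mul_cancel, h1])
        right_inv := fun A => (h2 σ σ⁻¹ A).trans (by rw [mul_inv_cancel, h1])
        map_mul' := fun A B => funext fun i => glue_mul σ _ _ }
    map_one' := MulEquiv.ext h1
    map_mul' := fun σ τ => MulEquiv.ext fun A => (h2 σ τ A).symm }

theorem permAct_apply {X : Scheme.{u}} (σ : LocallyConstant X (Equiv.Perm (Fin d)))
    (A : Fin d → F.obj Γ(X, ⊤)) (i : Fin d) :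
    permAct F d X σ A i = glue F σ (fun g => A (g⁻¹ i)) := rfl

/-- The sections over `X` of the semidirect product of the `d`-th power of `F`, evaluated at global
functions, with the constant sheaf of permutations of `d` letters. -/
abbrev WreathSections (X : Scheme.{u}) : Type u :=
  (Fin d → F.obj Γ(X, ⊤)) ⋊[permAct F d X] LocallyConstant X (Equiv.Perm (Fin d))

/-- Restriction of sections of the semidirect product. -/
def wreathRes {X Y : Scheme.{u}} (h : Y ⟶ X) : WreathSections F d X →* WreathSections F d Y :=
  SemidirectProduct.map
    (MonoidHom.pi fun i => (F.map h.appTop).hom.comp (Pi.evalMonoidHom _ i))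
    (LocallyConstant.comapMonoidHom h.base.hom)
    (fun σ => MonoidHom.ext fun A => funext fun i => map_glue h σ fun g => A (g⁻¹ i))

/-- The presheaf of groups `F ^ d ⋊ 𝕊_d` on schemes over `S`. -/
def wreath (S : Scheme.{u}) : (Over S)ᵒᵖ ⥤ GrpCat.{u} where
  obj X := GrpCat.of (WreathSections F d X.unop.left)
  map f := GrpCat.ofHom (wreathRes F d f.unop.left)
  map_id X := by
    ext1
    refine MonoidHom.ext fun a => SemidirectProduct.ext (funext fun i => ?_) rfl
    change F.map (Scheme.Hom.appTop (𝟙 X.unop.left)) (a.left i) = a.left i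
    rw [Scheme.Hom.id_appTop, F.map_id]
    rfl
  map_comp f g := by
    ext1
    refine MonoidHom.ext fun a => SemidirectProduct.ext (funext fun i => ?_) rfl
    change F.map (Scheme.Hom.appTop (g.unop.left ≫ f.unop.left)) (a.left i) =
      F.map g.unop.left.appTop (F.map f.unop.left.appTop (a.left i))
    rw [Scheme.Hom.comp_appTop, map_map_apply]

/-- The presheaf of groups `X ↦ F Γ(X, ⊤)` on schemes over `S`. -/
def onSch (S : Scheme.{u}) : (Over S)ᵒᵖ ⥤ GrpCat.{u} :=
  (Over.forget S).op ⋙ Scheme.Γ ⋙ F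

end Wreath
/-! ## The group schemes `GL` and `PGL` -/

section LinearGroups

/-- `GL n`, as a functor from commutative rings to groups. -/
def GLFun (n : ℕ) : CommRingCat.{u} ⥤ GrpCat.{u} where
  obj R := GrpCat.of (GL (Fin n) R)
  map φ := GrpCat.ofHom (Matrix.GeneralLinearGroup.map φ.hom)
  map_id R := by
    ext1
    exact Matrix.GeneralLinearGroup.map_id
  map_comp f g := by
    ext1
    exact Matrix.GeneralLinearGroup.map_comp f.hom g.hom

instance (n : ℕ) : PreservesFinPow (GLFun.{u} n) where
  bijective ι _ R := by
    constructor
    · intro (a : GL (Fin n) (ι → R)) (b : GL (Fin n) (ι → R)) h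
      refine Units.ext (Matrix.ext fun i j => funext fun k => ?_)
      have h1 : Matrix.GeneralLinearGroup.map (Pi.evalRingHom (fun _ : ι => (R : Type u)) k) a =
        Matrix.GeneralLinearGroup.map (Pi.evalRingHom (fun _ : ι => (R : Type u)) k) b :=
        congrFun h k
      exact congrArg (fun g : GL (Fin n) R => g i j) h1
    · intro (A : ι → GL (Fin n) R)
      have hmul : ∀ M N : ι → Matrix (Fin n) (Fin n) R, (∀ k, M k * N k = 1) →
          (Matrix.of fun i j k => M k i j : Matrix (Fin n) (Fin n) (ι → R)) *
            (Matrix.of fun i j k => N k i j) = 1 := by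
        intro M N h
        refine Matrix.ext fun i j => funext fun k => ?_
        have := congrFun (congrFun (h k) i) j
        rw [Matrix.mul_apply] at this ⊢
        rw [Finset.sum_apply]
        refine Eq.trans this ?_
        simp only [Matrix.one_apply]
        split_ifs <;> rfl
      refine ⟨(⟨Matrix.of fun i j k => (A k).1 i j, Matrix.of fun i j k => (A k)⁻¹.1 i j,
        hmul _ _ fun k => (A k).mul_inv, hmul _ _ fun k => (A k).inv_mul⟩ :
          GL (Fin n) (ι → R)), ?_⟩
      funext k
      exact Units.ext (Matrix.ext fun i j => rfl)

/-- The linear automorphism given by an invertible matrix. -/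
def glEquiv {n : ℕ} {R : Type u} [CommRing R] (A : GL (Fin n) R) :
    (Fin n → R) ≃ₗ[R] (Fin n → R) :=
  LinearEquiv.ofLinearMap A.1.mulVecLin (A⁻¹).1.mulVecLin
    (by rw [← Matrix.mulVecLin_mul, Units.mul_inv, Matrix.mulVecLin_one])
    (by rw [← Matrix.mulVecLin_mul, Units.inv_mul, Matrix.mulVecLin_one])

/-- The automorphisms of the matrix algebra of degree `n` over `R`. -/
abbrev MatAut (n : ℕ) (R : Type u) [CommRing R] : Type u :=
  Matrix (Fin n) (Fin n) R ≃ₐ[R] Matrix (Fin n) (Fin n) R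

section BaseChange

variable {n m : ℕ} {R R' : Type u} [CommRing R] [CommRing R'] (φ : R →+* R')

/-- Base change of a linear map between matrix algebras along a ring homomorphism. -/
def baseLin (f : Matrix (Fin n) (Fin n) R →ₗ[R] Matrix (Fin m) (Fin m) R) :
    Matrix (Fin n) (Fin n) R' →ₗ[R'] Matrix (Fin m) (Fin m) R' where
  toFun X := ∑ i, ∑ j, X i j • (f (Matrix.single i j 1)).map φ
  map_add' X Y := by simp only [Matrix.add_apply, add_smul, Finset.sum_add_distrib]
  map_smul' c X := by
    simp only [Matrix.smul_apply, smul_assoc, Finset.smul_sum, RingHom.id_apply]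

theorem baseLin_map (f : Matrix (Fin n) (Fin n) R →ₗ[R] Matrix (Fin m) (Fin m) R)
    (X : Matrix (Fin n) (Fin n) R) : baseLin φ f (X.map φ) = (f X).map φ := by
  conv_rhs => rw [Matrix.matrix_eq_sum_single X]
  change ∑ i, ∑ j, φ (X i j) • (f (Matrix.single i j 1)).map φ = _
  have h : ∀ i j, Matrix.single i j (X i j) = X i j • Matrix.single i j (1 : R) := fun i j => by
    rw [Matrix.smul_single, smul_eq_mul, mul_one]
  simp only [h, map_sum, map_smul]
  refine Matrix.ext fun k l => ?_
  simp [Matrix.sum_apply]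

theorem lin_ext {f g : Matrix (Fin n) (Fin n) R' →ₗ[R'] Matrix (Fin m) (Fin m) R'}
    (h : ∀ X : Matrix (Fin n) (Fin n) R, f (X.map φ) = g (X.map φ)) : f = g := by
  refine Matrix.ext_linearMap _ fun i j => LinearMap.ext_ring ?_
  have := h (Matrix.single i j 1)
  rwa [Matrix.map_single _ _ _ φ, map_one] at this

theorem lin_mul {f : Matrix (Fin n) (Fin n) R' →ₗ[R'] Matrix (Fin m) (Fin m) R'}
    (h : ∀ X Y : Matrix (Fin n) (Fin n) R, f (X.map φ * Y.map φ) = f (X.map φ) * f (Y.map φ))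
    (X Y : Matrix (Fin n) (Fin n) R') : f (X * Y) = f X * f Y := by
  have h1 : ∀ X : Matrix (Fin n) (Fin n) R, f.comp (LinearMap.mulLeft R' (X.map φ)) =
      (LinearMap.mulLeft R' (f (X.map φ))).comp f := fun X => lin_ext φ fun Y => h X Y
  have h2 : f.comp (LinearMap.mulRight R' Y) = (LinearMap.mulRight R' (f Y)).comp f :=
    lin_ext φ fun X => LinearMap.congr_fun (h1 X) Y
  exact LinearMap.congr_fun h2 X

/-- Base change of an automorphism of the matrix algebra along a ring homomorphism. -/
def matAutMap : MatAut n R →* MatAut n R' where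
  toFun f := AlgEquiv.ofLinearEquiv
    (LinearEquiv.ofLinearMap (baseLin φ f.toLinearMap) (baseLin φ f.symm.toLinearMap)
      (lin_ext φ fun X => by
        rw [LinearMap.comp_apply, baseLin_map, baseLin_map]; simp)
      (lin_ext φ fun X => by
        rw [LinearMap.comp_apply, baseLin_map, baseLin_map]; simp))
    (by
      change baseLin φ f.toLinearMap 1 = 1
      rw [← Matrix.map_one φ (map_zero φ) (map_one φ), baseLin_map]
      simp)
    (lin_mul φ fun X Y => by
      change baseLin φ _ _ = baseLin φ _ _ * baseLin φ _ _
      rw [← Matrix.map_mul, baseLin_map, baseLin_map, baseLin_map]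
      simp [Matrix.map_mul])
  map_one' := AlgEquiv.ext fun X => by
    refine LinearMap.congr_fun (f := baseLin φ _) (g := LinearMap.id) (lin_ext φ fun Y => ?_) X
    rw [baseLin_map]; rfl
  map_mul' f g := AlgEquiv.ext fun X => by
    refine LinearMap.congr_fun (f := baseLin φ _)
      (g := (baseLin φ f.toLinearMap).comp (baseLin φ g.toLinearMap)) (lin_ext φ fun Y => ?_) X
    rw [LinearMap.comp_apply, baseLin_map, baseLin_map, baseLin_map]; rfl

theorem matAutMap_map (f : MatAut n R) (X : Matrix (Fin n) (Fin n) R) :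
    matAutMap φ f (X.map φ) = (f X).map φ := baseLin_map φ f.toLinearMap X

theorem matAut_ext {f g : MatAut n R'}
    (h : ∀ X : Matrix (Fin n) (Fin n) R, f (X.map φ) = g (X.map φ)) : f = g :=
  AlgEquiv.ext fun X =>
    LinearMap.congr_fun (f := f.toLinearMap) (g := g.toLinearMap) (lin_ext φ h) X

theorem matAutMap_comp {R'' : Type u} [CommRing R''] (φ : R →+* R') (ψ : R' →+* R'')
    (f : MatAut n R) : matAutMap (ψ.comp φ) f = matAutMap ψ (matAutMap φ f) := by
  refine matAut_ext (ψ.comp φ) fun X => ?_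
  refine (matAutMap_map (ψ.comp φ) f X).trans ?_
  have h := matAutMap_map ψ (matAutMap φ f) (X.map φ)
  exact (h.trans (congrArg (fun Z => Z.map ψ) (matAutMap_map φ f X))).symm

end BaseChange

/-- `PGL n`, the automorphism group of the matrix algebra of degree `n`, as a functor from
commutative rings to groups. -/
def PGLFun (n : ℕ) : CommRingCat.{u} ⥤ GrpCat.{u} where
  obj R := GrpCat.of (MatAut n R)
  map φ := GrpCat.ofHom (matAutMap φ.hom)
  map_id R := by
    ext1
    refine MonoidHom.ext fun f => matAut_ext (RingHom.id R) fun X => ?_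
    exact matAutMap_map (RingHom.id R) f X
  map_comp {R₁ R₂ R₃} f g := by
    ext1
    exact MonoidHom.ext fun a => matAutMap_comp f.hom g.hom a

instance (n : ℕ) : PreservesFinPow (PGLFun.{u} n) where
  bijective ι _ R := by
    constructor
    · intro (a : MatAut n (ι → R)) (b : MatAut n (ι → R)) h
      refine AlgEquiv.ext fun X => Matrix.ext fun i j => funext fun k => ?_
      have h1 : matAutMap (Pi.evalRingHom (fun _ : ι => (R : Type u)) k) a =
        matAutMap (Pi.evalRingHom (fun _ : ι => (R : Type u)) k) b := congrFun h k
      have h2 := matAutMap_map (Pi.evalRingHom (fun _ : ι => (R : Type u)) k) a X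
      rw [h1, matAutMap_map] at h2
      exact (congrFun (congrFun h2 i) j).symm
    · intro (A : ι → MatAut n R)
      let ev (k : ι) : (ι → R) →+* R := Pi.evalRingHom (fun _ : ι => (R : Type u)) k
      let F (B : ι → MatAut n R) (X : Matrix (Fin n) (Fin n) (ι → R)) :
        Matrix (Fin n) (Fin n) (ι → R) := Matrix.of fun i j k => B k (X.map (ev k)) i j
      have hF : ∀ B X k, (F B X).map (ev k) = B k (X.map (ev k)) := fun B X k => rfl
      have hext : ∀ X Y : Matrix (Fin n) (Fin n) (ι → R), (∀ k, X.map (ev k) = Y.map (ev k)) →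
        X = Y := fun X Y h => Matrix.ext fun i j => funext fun k =>
          congrFun (congrFun (h k) i) j
      have hinv : ∀ B B' : ι → MatAut n R, (∀ k Z, B k (B' k Z) = Z) → ∀ X, F B (F B' X) = X :=
        fun B B' h X => hext _ _ fun k => by rw [hF, hF, h]
      let f : MatAut n (ι → R) :=
        { toFun := F A
          invFun := F fun k => (A k).symm
          left_inv := hinv _ _ fun k Z => (A k).symm_apply_apply Z
          right_inv := hinv _ _ fun k Z => (A k).apply_symm_apply Z
          map_mul' := fun X Y => hext _ _ fun k => by
            rw [hF, Matrix.map_mul, map_mul, Matrix.map_mul, hF, hF]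
          map_add' := fun X Y => hext _ _ fun k => by
            rw [hF, Matrix.map_add _ (map_add (ev k)), map_add,
              Matrix.map_add _ (map_add (ev k)), hF, hF]
          commutes' := fun c => hext _ _ fun k => by
            have : ((algebraMap (ι → R) (Matrix (Fin n) (Fin n) (ι → R))) c).map (ev k) =
                algebraMap R (Matrix (Fin n) (Fin n) R) (c k) := by
              refine Matrix.ext fun i j => ?_
              simp only [Matrix.map_apply, Matrix.algebraMap_matrix_apply]
              split_ifs <;> rfl
            rw [hF, this, AlgEquiv.commutes] }
      refine ⟨f, funext fun k => ?_⟩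
      change matAutMap (ev k) f = A k
      refine AlgEquiv.ext fun Z => ?_
      have h1 : (Z.map (fun z (_ : ι) => z)).map (ev k) = Z := rfl
      have h2 := matAutMap_map (ev k) f (Z.map (fun z (_ : ι) => z))
      rw [h1] at h2
      rw [h2]
      exact hF A _ k

end LinearGroups
/-! ## The Segre homomorphisms -/

section SegreData

/-- A natural way to form, from a family of `d` elements of `F R`, an element of `F' R`, and a
natural way to form an element of `F' R` from a permutation, with the compatibility necessary to
define a homomorphism on the semidirect product. -/
structure SegreDatum (F F' : CommRingCat.{u} ⥤ GrpCat.{u}) (d : ℕ) where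
  /-- the homomorphism on families -/
  seg (R : CommRingCat.{u}) : (Fin d → F.obj R) →* F'.obj R
  /-- the homomorphism on permutations -/
  perm (R : CommRingCat.{u}) : Equiv.Perm (Fin d) →* F'.obj R
  map_seg {R R' : CommRingCat.{u}} (φ : R ⟶ R') (A : Fin d → F.obj R) :
    F'.map φ (seg R A) = seg R' (fun k => F.map φ (A k))
  map_perm {R R' : CommRingCat.{u}} (φ : R ⟶ R') (g : Equiv.Perm (Fin d)) :
    F'.map φ (perm R g) = perm R' g
  seg_perm {R : CommRingCat.{u}} (g : Equiv.Perm (Fin d)) (A : Fin d → F.obj R) :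
    seg R (fun i => A (g⁻¹ i)) = perm R g * seg R A * (perm R g)⁻¹

variable {F F' : CommRingCat.{u} ⥤ GrpCat.{u}} [PreservesFinPow F] [PreservesFinPow F'] {d : ℕ}
  (D : SegreDatum F F' d)

/-- The homomorphism `A * σ ↦ seg A * perm σ` on sections over `X`, where `perm σ` is equal to
`perm g` on the open and closed subset where `σ` is equal to `g`. -/
def SegreDatum.homSections (X : Scheme.{u}) : WreathSections F d X →* F'.obj Γ(X, ⊤) :=
  SemidirectProduct.lift (D.seg Γ(X, ⊤))
    { toFun := fun σ => glue F' σ (fun g => D.perm Γ(X, ⊤) g)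
      map_one' := (glue_const (F := F') (1 : Equiv.Perm (Fin d)) _).trans (map_one _)
      map_mul' := fun σ τ => by
        rw [← glue_glue_perm]
        have : ∀ g, glue F' τ (fun h => D.perm Γ(X, ⊤) (g * h)) =
            D.perm Γ(X, ⊤) g * glue F' τ (fun h => D.perm Γ(X, ⊤) h) := fun g => by
          conv_rhs => rw [← glue_const_fun (F := F') τ (D.perm Γ(X, ⊤) g), ← glue_mul]
          congr 1
          funext h
          exact map_mul _ g h
        simp only [this]
        conv_rhs => rw [← glue_const_fun (F := F') σ (glue F' τ fun h => D.perm Γ(X, ⊤) h),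
          ← glue_mul]
        rfl }
    (fun σ => MonoidHom.ext fun A => by
      change D.seg Γ(X, ⊤) (fun i => glue F σ (fun g => A (g⁻¹ i))) =
        glue F' σ (fun g => D.perm Γ(X, ⊤) g) * D.seg Γ(X, ⊤) A *
          (glue F' σ (fun g => D.perm Γ(X, ⊤) g))⁻¹
      rw [nat_glue (fun R => D.seg R) (fun _ _ φ A => D.map_seg φ A) σ
        (fun i g => A (g⁻¹ i)), eq_mul_inv_iff_mul_eq, ← glue_mul]
      conv_rhs => rw [← glue_const_fun (F := F') σ (D.seg Γ(X, ⊤) A), ← glue_mul]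
      congr 1
      funext g
      simp only [Pi.mul_apply]
      rw [D.seg_perm, inv_mul_cancel_right])

/-- The homomorphism `A * σ ↦ seg A * perm σ`. -/
def SegreDatum.hom (S : Scheme.{u}) : wreath F d S ⟶ onSch F' S where
  app X := GrpCat.ofHom (D.homSections X.unop.left)
  naturality X Y f := by
    ext1
    refine MonoidHom.ext fun a => ?_
    change D.seg _ (fun k => F.map f.unop.left.appTop (a.left k)) *
      glue F' (lcPull f.unop.left a.right) (fun g => D.perm _ g) =
      F'.map f.unop.left.appTop (D.seg _ a.left * glue F' a.right (fun g => D.perm _ g))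
    rw [map_mul, D.map_seg, map_glue]
    simp only [D.map_perm]

end SegreData

section Segre

variable (r d : ℕ) {R R' : Type u} [CommRing R] [CommRing R']

/-- The enumeration of the basis of a `d`-fold tensor power of a free module of rank `r`: the basis
vector `e (I 0) ⊗ ⋯ ⊗ e (I (d - 1))` has the number `tensorIdx r d I`. -/
def tensorIdx : (Fin d → Fin r) ≃ Fin (r ^ d) := finFunctionFinEquiv

variable {d} in
/-- The permutation of the tensor factors on the basis: the basis vector with multi-index `I` goes
to the basis vector with multi-index `I ∘ g⁻¹`. -/
def permIdx : Equiv.Perm (Fin d) →* Equiv.Perm (Fin (r ^ d)) where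
  toFun g := (tensorIdx r d).permCongr (g.arrowCongr (Equiv.refl (Fin r)))
  map_one' := by
    ext K
    exact congrArg Fin.val ((tensorIdx r d).apply_symm_apply K)
  map_mul' g h := by
    ext K
    simp only [Equiv.permCongr_apply, Equiv.Perm.mul_apply, Equiv.symm_apply_apply]
    rfl

variable {r d}

theorem permIdx_tensorIdx (g : Equiv.Perm (Fin d)) (I : Fin d → Fin r) :
    permIdx r g (tensorIdx r d I) = tensorIdx r d (fun k => I (g⁻¹ k)) := by
  change tensorIdx r d (g.arrowCongr (Equiv.refl (Fin r)) ((tensorIdx r d).symm _)) = _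
  rw [Equiv.symm_apply_apply]
  rfl

/-- The Kronecker product of `d` square matrices of size `r`, the matrix of the tensor product of
the corresponding endomorphisms. -/
def kron (A : Fin d → Matrix (Fin r) (Fin r) R) : Matrix (Fin (r ^ d)) (Fin (r ^ d)) R :=
  Matrix.of fun K L => ∏ k, A k ((tensorIdx r d).symm K k) ((tensorIdx r d).symm L k)

theorem kron_apply (A : Fin d → Matrix (Fin r) (Fin r) R) (I J : Fin d → Fin r) :
    kron A (tensorIdx r d I) (tensorIdx r d J) = ∏ k, A k (I k) (J k) := by
  simp [kron]

theorem tensorIdx_ext {M N : Matrix (Fin (r ^ d)) (Fin (r ^ d)) R}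
    (h : ∀ I J, M (tensorIdx r d I) (tensorIdx r d J) = N (tensorIdx r d I) (tensorIdx r d J)) :
    M = N := Matrix.ext fun K L => by
  have := h ((tensorIdx r d).symm K) ((tensorIdx r d).symm L)
  rwa [Equiv.apply_symm_apply, Equiv.apply_symm_apply] at this

theorem kron_mul (A B : Fin d → Matrix (Fin r) (Fin r) R) :
    kron (fun k => A k * B k) = kron A * kron B := tensorIdx_ext fun I J => by
  rw [kron_apply, Matrix.mul_apply, ← (tensorIdx r d).sum_comp]
  simp only [kron_apply, Matrix.mul_apply, ← Finset.prod_mul_distrib]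
  rw [Finset.prod_univ_sum]
  simp

theorem kron_one : kron (fun _ => 1 : Fin d → Matrix (Fin r) (Fin r) R) = 1 :=
  tensorIdx_ext fun I J => by
    rw [kron_apply, Matrix.one_apply]
    simp only [Matrix.one_apply]
    by_cases h : I = J
    · simp [h]
    · rw [if_neg (by simpa using h)]
      obtain ⟨k, hk⟩ := Function.ne_iff.1 h
      exact Finset.prod_eq_zero (Finset.mem_univ k) (if_neg hk)

theorem kron_map (φ : R →+* R') (A : Fin d → Matrix (Fin r) (Fin r) R) :
    (kron A).map φ = kron (fun k => (A k).map φ) := tensorIdx_ext fun I J => by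
  rw [Matrix.map_apply, kron_apply, kron_apply, map_prod]; rfl

theorem kron_submatrix (g : Equiv.Perm (Fin d)) (A : Fin d → Matrix (Fin r) (Fin r) R) :
    (kron A).submatrix (permIdx r g).symm (permIdx r g).symm = kron (fun k => A (g⁻¹ k)) := by
  refine tensorIdx_ext fun I J => ?_
  have h : ∀ I, (permIdx r g).symm (tensorIdx r d I) = tensorIdx r d (fun k => I (g k)) :=
    fun I => by
      rw [Equiv.symm_apply_eq, permIdx_tensorIdx]
      simp
  rw [Matrix.submatrix_apply, h, h, kron_apply, kron_apply]
  refine (Fintype.prod_equiv g _ _ fun k => ?_)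
  simp

theorem kron_single (I J : Fin d → Fin r) :
    kron (fun k => Matrix.single (I k) (J k) (1 : R)) =
      Matrix.single (tensorIdx r d I) (tensorIdx r d J) 1 := tensorIdx_ext fun I' J' => by
  rw [kron_apply, Matrix.single_apply]
  simp only [Matrix.single_apply, EmbeddingLike.apply_eq_iff_eq]
  by_cases h : I = I' ∧ J = J'
  · simp [h]
  · rw [if_neg h]
    have : ∃ k, ¬ (I k = I' k ∧ J k = J' k) := by
      by_contra hc
      push Not at hc
      exact h ⟨funext fun k => (hc k).1, funext fun k => (hc k).2⟩
    obtain ⟨k, hk⟩ := this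
    exact Finset.prod_eq_zero (Finset.mem_univ k) (if_neg hk)

/-- The Kronecker product as a multilinear map. -/
def kronMultilinear :
    MultilinearMap R (fun _ : Fin d => Matrix (Fin r) (Fin r) R)
      (Matrix (Fin (r ^ d)) (Fin (r ^ d)) R) where
  toFun := kron
  map_update_add' {_} A i x y := by
    refine tensorIdx_ext fun I J => ?_
    rw [Matrix.add_apply, kron_apply, kron_apply, kron_apply]
    rw [← Finset.mul_prod_erase _ _ (Finset.mem_univ i),
      ← Finset.mul_prod_erase _ _ (Finset.mem_univ i),
      ← Finset.mul_prod_erase _ _ (Finset.mem_univ i)]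
    have h : ∀ z : Matrix (Fin r) (Fin r) R,
        ∏ k ∈ Finset.univ.erase i, Function.update A i z k (I k) (J k) =
          ∏ k ∈ Finset.univ.erase i, A k (I k) (J k) := fun z =>
      Finset.prod_congr rfl fun k hk => by
        rw [Function.update_of_ne (Finset.ne_of_mem_erase hk)]
    have e : ‹DecidableEq (Fin d)› = instDecidableEqFin d := Subsingleton.elim _ _
    subst e
    simp only [h, Function.update_self, Matrix.add_apply, add_mul]
  map_update_smul' {_} A i c x := by
    refine tensorIdx_ext fun I J => ?_
    rw [Matrix.smul_apply, kron_apply, kron_apply]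
    rw [← Finset.mul_prod_erase _ _ (Finset.mem_univ i),
      ← Finset.mul_prod_erase _ _ (Finset.mem_univ i)]
    have h : ∀ z : Matrix (Fin r) (Fin r) R,
        ∏ k ∈ Finset.univ.erase i, Function.update A i z k (I k) (J k) =
          ∏ k ∈ Finset.univ.erase i, A k (I k) (J k) := fun z =>
      Finset.prod_congr rfl fun k hk => by
        rw [Function.update_of_ne (Finset.ne_of_mem_erase hk)]
    have e : ‹DecidableEq (Fin d)› = instDecidableEqFin d := Subsingleton.elim _ _
    subst e
    simp only [h, Function.update_self, Matrix.smul_apply, smul_eq_mul, mul_assoc]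

theorem kron_ext_map (φ : R →+* R') {m : ℕ}
    {f g : Matrix (Fin (r ^ d)) (Fin (r ^ d)) R' →ₗ[R'] Matrix (Fin m) (Fin m) R'}
    (h : ∀ X : Fin d → Matrix (Fin r) (Fin r) R, f ((kron X).map φ) = g ((kron X).map φ)) :
    f = g := by
  refine Matrix.ext_linearMap _ fun K L => LinearMap.ext_ring ?_
  have := h (fun k => Matrix.single ((tensorIdx r d).symm K k) ((tensorIdx r d).symm L k) 1)
  rw [kron_single, Matrix.map_single _ _ _ φ, map_one, Equiv.apply_symm_apply,
    Equiv.apply_symm_apply] at this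
  exact this

theorem kron_ext {m : ℕ}
    {f g : Matrix (Fin (r ^ d)) (Fin (r ^ d)) R →ₗ[R] Matrix (Fin m) (Fin m) R}
    (h : ∀ X : Fin d → Matrix (Fin r) (Fin r) R, f (kron X) = g (kron X)) : f = g :=
  kron_ext_map (RingHom.id R) h

/-- The tensor product of `d` endomorphisms `f k` of the module of square matrices of size `r`,
with the `d`-fold tensor power of this module identified by the Kronecker product with the module
of square matrices of size `r ^ d`. -/
def tensorLin (f : Fin d → (Matrix (Fin r) (Fin r) R →ₗ[R] Matrix (Fin r) (Fin r) R)) :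
    Matrix (Fin (r ^ d)) (Fin (r ^ d)) R →ₗ[R] Matrix (Fin (r ^ d)) (Fin (r ^ d)) R where
  toFun X := ∑ P : Fin d → Fin r × Fin r,
    X (tensorIdx r d fun k => (P k).1) (tensorIdx r d fun k => (P k).2) •
      kron (fun k => f k (Matrix.single (P k).1 (P k).2 1))
  map_add' X Y := by simp only [Matrix.add_apply, add_smul, Finset.sum_add_distrib]
  map_smul' c X := by
    simp only [Matrix.smul_apply, smul_assoc, Finset.smul_sum, RingHom.id_apply]

theorem tensorLin_kron (f : Fin d → (Matrix (Fin r) (Fin r) R →ₗ[R] Matrix (Fin r) (Fin r) R))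
    (X : Fin d → Matrix (Fin r) (Fin r) R) :
    tensorLin f (kron X) = kron (fun k => f k (X k)) := by
  have h : ∀ k, f k (X k) = ∑ p : Fin r × Fin r, X k p.1 p.2 • f k (Matrix.single p.1 p.2 1) := by
    intro k
    conv_lhs => rw [Matrix.matrix_eq_sum_single (X k)]
    simp only [map_sum, Fintype.sum_prod_type, ← map_smul, Matrix.smul_single, smul_eq_mul,
      mul_one]
  simp only [h]
  change _ = kronMultilinear _
  rw [MultilinearMap.map_sum]
  change ∑ P : Fin d → Fin r × Fin r, _ = _
  refine Finset.sum_congr rfl fun P _ => ?_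
  rw [MultilinearMap.map_smul_univ, kron_apply]
  rfl

/-- The tensor product of `d` automorphisms of the algebra of square matrices of size `r`, as an
automorphism of the algebra of square matrices of size `r ^ d`. -/
def tensorAut : (Fin d → MatAut r R) →* MatAut (r ^ d) R where
  toFun f := AlgEquiv.ofLinearEquiv
    (LinearEquiv.ofLinearMap (tensorLin fun k => (f k).toLinearMap)
      (tensorLin fun k => (f k).symm.toLinearMap)
      (kron_ext fun X => by
        rw [LinearMap.comp_apply, tensorLin_kron, tensorLin_kron]; simp)
      (kron_ext fun X => by
        rw [LinearMap.comp_apply, tensorLin_kron, tensorLin_kron]; simp))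
    (by
      change tensorLin _ 1 = 1
      rw [← kron_one, tensorLin_kron]
      simp)
    (by
      have h1 : ∀ X : Fin d → Matrix (Fin r) (Fin r) R,
          (tensorLin fun k => (f k).toLinearMap).comp (LinearMap.mulLeft R (kron X)) =
          (LinearMap.mulLeft R (tensorLin (fun k => (f k).toLinearMap) (kron X))).comp
            (tensorLin fun k => (f k).toLinearMap) := fun X => kron_ext fun Y => by
        simp only [LinearMap.comp_apply, LinearMap.mulLeft_apply]
        rw [← kron_mul, tensorLin_kron, tensorLin_kron, tensorLin_kron, ← kron_mul]
        simp
      intro X Y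
      have h2 : (tensorLin fun k => (f k).toLinearMap).comp (LinearMap.mulRight R Y) =
          (LinearMap.mulRight R (tensorLin (fun k => (f k).toLinearMap) Y)).comp
            (tensorLin fun k => (f k).toLinearMap) :=
        kron_ext fun X => LinearMap.congr_fun (h1 X) Y
      exact LinearMap.congr_fun h2 X)
  map_one' := AlgEquiv.ext fun X => by
    refine LinearMap.congr_fun (f := tensorLin _) (g := LinearMap.id) (kron_ext fun Y => ?_) X
    rw [tensorLin_kron]; rfl
  map_mul' f g := AlgEquiv.ext fun X => by
    refine LinearMap.congr_fun (f := tensorLin _)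
      (g := (tensorLin fun k => (f k).toLinearMap).comp (tensorLin fun k => (g k).toLinearMap))
      (kron_ext fun Y => ?_) X
    rw [LinearMap.comp_apply, tensorLin_kron, tensorLin_kron, tensorLin_kron]; rfl

theorem tensorAut_kron (f : Fin d → MatAut r R) (X : Fin d → Matrix (Fin r) (Fin r) R) :
    tensorAut f (kron X) = kron (fun k => f k (X k)) := tensorLin_kron _ X

theorem matAut_kron_ext_map (φ : R →+* R') {f g : MatAut (r ^ d) R'}
    (h : ∀ X : Fin d → Matrix (Fin r) (Fin r) R, f ((kron X).map φ) = g ((kron X).map φ)) :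
    f = g :=
  AlgEquiv.ext fun X =>
    LinearMap.congr_fun (f := f.toLinearMap) (g := g.toLinearMap) (kron_ext_map φ h) X

theorem matAut_kron_ext {f g : MatAut (r ^ d) R}
    (h : ∀ X : Fin d → Matrix (Fin r) (Fin r) R, f (kron X) = g (kron X)) : f = g :=
  matAut_kron_ext_map (RingHom.id R) h

variable (r R) in
/-- The permutation of the tensor factors, as an automorphism of the algebra of square matrices of
size `r ^ d`. -/
def permAut : Equiv.Perm (Fin d) →* MatAut (r ^ d) R where
  toFun g := Matrix.reindexAlgEquiv R R (permIdx r g)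
  map_one' := by rw [map_one]; rfl
  map_mul' g h := by rw [map_mul]; rfl

theorem permAut_kron (g : Equiv.Perm (Fin d)) (X : Fin d → Matrix (Fin r) (Fin r) R) :
    permAut r R g (kron X) = kron (fun k => X (g⁻¹ k)) := kron_submatrix g X

variable (r R) in
/-- The permutation of the tensor factors, as an invertible matrix of size `r ^ d`. -/
def permMat : Equiv.Perm (Fin d) →* GL (Fin (r ^ d)) R :=
  MonoidHom.toHomUnits
    { toFun := fun g => Matrix.of fun K L => if K = permIdx r g L then 1 else 0
      map_one' := by
        ext K L
        simp [Matrix.one_apply]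
      map_mul' := fun g h => by
        ext K L
        simp only [Matrix.mul_apply, Matrix.of_apply, mul_ite, mul_one, mul_zero,
          Finset.sum_ite_eq', Finset.mem_univ, if_true, map_mul, Equiv.Perm.mul_apply] }

theorem permMat_apply (g : Equiv.Perm (Fin d)) (K L : Fin (r ^ d)) :
    permMat r R g K L = if K = permIdx r g L then 1 else 0 := rfl

variable (R) in
/-- The tensor product `(A k) ↦ A 0 ⊗ ⋯ ⊗ A (d - 1)` of invertible matrices. -/
def tensorMat : (Fin d → GL (Fin r) R) →* GL (Fin (r ^ d)) R where
  toFun A := ⟨kron fun k => (A k).1, kron fun k => (A k)⁻¹.1,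
    by rw [← kron_mul]; simp only [Units.mul_inv, kron_one],
    by rw [← kron_mul]; simp only [Units.inv_mul, kron_one]⟩
  map_one' := Units.ext kron_one
  map_mul' A B := Units.ext (kron_mul _ _)

theorem mul_permMat (g : Equiv.Perm (Fin d)) (A : Fin d → Matrix (Fin r) (Fin r) R) :
    kron (fun k => A (g⁻¹ k)) * (permMat r R g).1 = (permMat r R g).1 * kron A := by
  rw [← kron_submatrix]
  refine Matrix.ext fun K L => ?_
  have h1 : ∀ K L, (permMat r R g).1 K L = if K = permIdx r g L then 1 else 0 := fun K L => rfl
  have h2 : ∀ K L, (permMat r R g).1 K L = if (permIdx r g).symm K = L then 1 else 0 :=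
    fun K L => by
      rw [h1]
      simp only [Equiv.symm_apply_eq]
  rw [Matrix.mul_apply, Matrix.mul_apply]
  conv_lhs => simp only [h1, mul_ite, mul_one, mul_zero]
  conv_rhs => simp only [h2, ite_mul, one_mul, zero_mul]
  rw [Finset.sum_ite_eq' , Finset.sum_ite_eq]
  simp

theorem matAutMap_tensorAut (φ : R →+* R') (A : Fin d → MatAut r R) :
    matAutMap φ (tensorAut A) = tensorAut fun k => matAutMap φ (A k) := by
  refine matAut_kron_ext_map φ fun X => ?_
  rw [matAutMap_map, tensorAut_kron, kron_map, kron_map, tensorAut_kron]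
  congr 1
  funext k
  exact (matAutMap_map φ (A k) (X k)).symm

theorem matAutMap_permAut (φ : R →+* R') (g : Equiv.Perm (Fin d)) :
    matAutMap φ (permAut r R g) = permAut r R' g := by
  refine matAut_kron_ext_map φ fun X => ?_
  rw [matAutMap_map, permAut_kron, kron_map, kron_map, permAut_kron]

theorem tensorAut_permAut (g : Equiv.Perm (Fin d)) (A : Fin d → MatAut r R) :
    tensorAut (fun i => A (g⁻¹ i)) = permAut r R g * tensorAut A * (permAut r R g)⁻¹ := by
  rw [eq_mul_inv_iff_mul_eq]
  refine matAut_kron_ext fun X => ?_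
  rw [AlgEquiv.mul_apply, AlgEquiv.mul_apply, permAut_kron, tensorAut_kron, tensorAut_kron,
    permAut_kron]

variable (r d)

/-- The data of the Segre homomorphism for `GL`. -/
def segreGL : SegreDatum (GLFun.{u} r) (GLFun.{u} (r ^ d)) d where
  seg R := tensorMat R
  perm R := permMat r R
  map_seg φ A := Units.ext (kron_map φ.hom fun k => (A k).1)
  map_perm φ g := Units.ext <| Matrix.ext fun K L => by
    change φ.hom (if K = permIdx r g L then 1 else 0) = if K = permIdx r g L then 1 else 0
    split_ifs <;> simp
  seg_perm {R} g A := by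
    rw [eq_mul_inv_iff_mul_eq]
    exact Units.ext (mul_permMat g fun k => (A k).1)

/-- The data of the Segre homomorphism for `PGL`. -/
def segrePGL : SegreDatum (PGLFun.{u} r) (PGLFun.{u} (r ^ d)) d where
  seg R := tensorAut
  perm R := permAut r R
  map_seg φ A := matAutMap_tensorAut φ.hom A
  map_perm φ g := matAutMap_permAut φ.hom g
  seg_perm g A := tensorAut_permAut g A

/-- The Segre homomorphism `GL_r ^ d ⋊ 𝕊_d ⟶ GL_{r ^ d}`. -/
def Seg (S : Scheme.{u}) : wreath (GLFun.{u} r) d S ⟶ onSch (GLFun.{u} (r ^ d)) S :=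
  (segreGL r d).hom S

/-- The projective Segre homomorphism `PGL_r ^ d ⋊ 𝕊_d ⟶ PGL_{r ^ d}`. -/
def PSeg (S : Scheme.{u}) : wreath (PGLFun.{u} r) d S ⟶ onSch (PGLFun.{u} (r ^ d)) S :=
  (segrePGL r d).hom S

end Segre
/-! ## `GL` and `PGL` are sheaves for the flat topology -/

section Sheaves

/-- The big fppf site of `S`: the category of schemes over `S` with the fppf topology. -/
abbrev fppf (S : Scheme.{u}) : GrothendieckTopology (Over S) :=
  Scheme.fppfTopology.over S

variable {S : Scheme.{u}}

/-- Global functions are represented by the affine line. -/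
def functionsIso (S : Scheme.{u}) :
    yoneda.obj (Over.mk (𝔸(PUnit.{u + 1}; S) ↘ S)) ≅
      (Over.forget S).op ⋙ Scheme.Γ ⋙ forget CommRingCat.{u} :=
  NatIso.ofComponents (fun X =>
    { hom := TypeCat.ofHom fun f => f.left.appTop (AffineSpace.coord S PUnit.unit)
      inv := TypeCat.ofHom fun s => Over.homMk (AffineSpace.homOfVector X.unop.hom fun _ => s)
        (AffineSpace.homOfVector_over _ _)
      hom_inv_id := by
        ext f
        refine Over.OverMorphism.ext ?_
        refine AffineSpace.hom_ext ?_ ?_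
        · exact (AffineSpace.homOfVector_over _ _).trans (Over.w f).symm
        · intro i
          exact AffineSpace.homOfVector_appTop_coord _ _ i
      inv_hom_id := by
        ext s
        exact AffineSpace.homOfVector_appTop_coord X.unop.hom (fun _ => s) PUnit.unit }) (by
    intro X Y f
    ext g
    change (f.unop.left ≫ g.left).appTop (AffineSpace.coord S PUnit.unit) = _
    rw [Scheme.Hom.comp_appTop]
    rfl)

theorem isSheaf_functions (S : Scheme.{u}) : Presieve.IsSheaf (fppf S)
    ((Over.forget S).op ⋙ Scheme.Γ ⋙ forget CommRingCat.{u}) :=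
  Presieve.isSheaf_iso _ (functionsIso S)
    (GrothendieckTopology.Subcanonical.isSheaf_of_isRepresentable _)

variable {X : Over S} {R : Sieve X}

theorem functions_ext (hR : R ∈ fppf S X) {a b : Γ(X.left, ⊤)}
    (h : ∀ (Y : Over S) (f : Y ⟶ X), R f → f.left.appTop a = f.left.appTop b) : a = b :=
  (isSheaf_functions S R hR).isSeparatedFor.ext (t₁ := a) (t₂ := b) fun Y f hf => h Y f hf

theorem exists_function (hR : R ∈ fppf S X)
    (x : ∀ (Y : Over S) (f : Y ⟶ X), R f → Γ(Y.left, ⊤))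
    (hx : ∀ (Y Z : Over S) (f : Y ⟶ X) (g : Z ⟶ Y) (hf : R f),
      x Z (g ≫ f) (R.downward_closed hf g) = g.left.appTop (x Y f hf)) :
    ∃ s : Γ(X.left, ⊤), ∀ (Y : Over S) (f : Y ⟶ X) (hf : R f), f.left.appTop s = x Y f hf := by
  let x' : Presieve.FamilyOfElements ((Over.forget S).op ⋙ Scheme.Γ ⋙ forget CommRingCat.{u})
    R.arrows := fun Y f hf => x Y f hf
  have hx' : x'.Compatible := by
    rw [Presieve.compatible_iff_sieveCompatible]
    intro Y Z f g hf
    exact hx Y Z f g hf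
  obtain ⟨t, ht, -⟩ := isSheaf_functions S R hR x' hx'
  exact ⟨t, fun Y f hf => ht f hf⟩

theorem matrix_ext (hR : R ∈ fppf S X) {n : ℕ} {a b : Matrix (Fin n) (Fin n) Γ(X.left, ⊤)}
    (h : ∀ (Y : Over S) (f : Y ⟶ X), R f → a.map f.left.appTop = b.map f.left.appTop) : a = b :=
  Matrix.ext fun i j => functions_ext hR fun Y f hf => congrFun (congrFun (h Y f hf) i) j

theorem exists_matrix (hR : R ∈ fppf S X) {n : ℕ}
    (x : ∀ (Y : Over S) (f : Y ⟶ X), R f → Matrix (Fin n) (Fin n) Γ(Y.left, ⊤))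
    (hx : ∀ (Y Z : Over S) (f : Y ⟶ X) (g : Z ⟶ Y) (hf : R f),
      x Z (g ≫ f) (R.downward_closed hf g) = (x Y f hf).map g.left.appTop) :
    ∃ s : Matrix (Fin n) (Fin n) Γ(X.left, ⊤),
      ∀ (Y : Over S) (f : Y ⟶ X) (hf : R f), s.map f.left.appTop = x Y f hf := by
  choose s hs using fun i j => exists_function hR (fun Y f hf => x Y f hf i j)
    fun Y Z f g hf => congrFun (congrFun (hx Y Z f g hf) i) j
  exact ⟨Matrix.of s, fun Y f hf => Matrix.ext fun i j => hs i j Y f hf⟩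

theorem isSheaf_GL (n : ℕ) (S : Scheme.{u}) :
    Presieve.IsSheaf (fppf S) (onSch (GLFun.{u} n) S ⋙ forget GrpCat) := by
  intro X R hR x hx
  rw [Presieve.compatible_iff_sieveCompatible] at hx
  let x' : ∀ (Y : Over S) (f : Y ⟶ X), R f → GL (Fin n) Γ(Y.left, ⊤) := fun Y f hf => x f hf
  have hx' : ∀ (Y Z : Over S) (f : Y ⟶ X) (g : Z ⟶ Y) (hf : R f),
      x' Z (g ≫ f) (R.downward_closed hf g) =
        Matrix.GeneralLinearGroup.map g.left.appTop.hom (x' Y f hf) :=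
    fun Y Z f g hf => hx f g hf
  obtain ⟨s, hs⟩ := exists_matrix hR (fun Y f hf => (x' Y f hf).1)
    fun Y Z f g hf => congrArg Units.val (hx' Y Z f g hf)
  obtain ⟨t, ht⟩ := exists_matrix hR (fun Y f hf => (x' Y f hf)⁻¹.1)
    fun Y Z f g hf => congrArg (fun u => (u⁻¹).1) (hx' Y Z f g hf)
  have map_one' : ∀ (Y : Over S) (f : Y ⟶ X),
      (1 : Matrix (Fin n) (Fin n) Γ(X.left, ⊤)).map f.left.appTop = 1 := fun Y f =>
    Matrix.map_one f.left.appTop.hom (map_zero _) (map_one _)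
  have map_mul' : ∀ (Y : Over S) (f : Y ⟶ X) (a b : Matrix (Fin n) (Fin n) Γ(X.left, ⊤)),
      (a * b).map f.left.appTop = a.map f.left.appTop * b.map f.left.appTop := fun Y f a b =>
    Matrix.map_mul (f := f.left.appTop.hom)
  have hst : s * t = 1 := matrix_ext hR fun Y f hf => by
    rw [map_one', map_mul', hs Y f hf, ht Y f hf]
    exact (x' Y f hf).mul_inv
  have hts : t * s = 1 := matrix_ext hR fun Y f hf => by
    rw [map_one', map_mul', hs Y f hf, ht Y f hf]
    exact (x' Y f hf).inv_mul
  refine ⟨(⟨s, t, hst, hts⟩ : GL (Fin n) Γ(X.left, ⊤)), ?_, ?_⟩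
  · intro Y f hf
    exact Units.ext (hs Y f hf)
  · intro (y : GL (Fin n) Γ(X.left, ⊤)) hy
    refine Units.ext (matrix_ext hR fun Y f hf => ?_)
    exact (congrArg Units.val (hy f hf)).trans (hs Y f hf).symm

theorem isSheaf_PGL (n : ℕ) (S : Scheme.{u}) :
    Presieve.IsSheaf (fppf S) (onSch (PGLFun.{u} n) S ⋙ forget GrpCat) := by
  intro X R hR x hx
  rw [Presieve.compatible_iff_sieveCompatible] at hx
  let x' : ∀ (Y : Over S) (f : Y ⟶ X), R f → MatAut n Γ(Y.left, ⊤) := fun Y f hf => x f hf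
  have hx' : ∀ (Y Z : Over S) (f : Y ⟶ X) (g : Z ⟶ Y) (hf : R f),
      x' Z (g ≫ f) (R.downward_closed hf g) = matAutMap g.left.appTop.hom (x' Y f hf) :=
    fun Y Z f g hf => hx f g hf
  have hmap : ∀ (Y Z : Over S) (f : Y ⟶ X) (g : Z ⟶ Y) (M : Matrix (Fin n) (Fin n) Γ(X.left, ⊤)),
      M.map (g ≫ f).left.appTop = (M.map f.left.appTop).map g.left.appTop := fun Y Z f g M => by
    rw [Over.comp_left, Scheme.Hom.comp_appTop]
    rfl
  obtain ⟨F, hF⟩ : ∃ F : Matrix (Fin n) (Fin n) Γ(X.left, ⊤) → Matrix (Fin n) (Fin n) Γ(X.left, ⊤),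
      ∀ M (Y : Over S) (f : Y ⟶ X) (hf : R f),
        (F M).map f.left.appTop = x' Y f hf (M.map f.left.appTop) := by
    choose F hF using fun M : Matrix (Fin n) (Fin n) Γ(X.left, ⊤) => exists_matrix hR
      (fun Y f hf => x' Y f hf (M.map f.left.appTop)) fun Y Z f g hf => by
        rw [hx', hmap]
        exact matAutMap_map g.left.appTop.hom _ _
    exact ⟨F, hF⟩
  obtain ⟨F', hF'⟩ : ∃ F : Matrix (Fin n) (Fin n) Γ(X.left, ⊤) → Matrix (Fin n) (Fin n) Γ(X.left, ⊤),
      ∀ M (Y : Over S) (f : Y ⟶ X) (hf : R f),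
        (F M).map f.left.appTop = (x' Y f hf).symm (M.map f.left.appTop) := by
    choose F hF using fun M : Matrix (Fin n) (Fin n) Γ(X.left, ⊤) => exists_matrix hR
      (fun Y f hf => (x' Y f hf).symm (M.map f.left.appTop)) fun Y Z f g hf => by
        rw [hx', hmap, AlgEquiv.symm_apply_eq]
        refine Eq.trans ?_ (matAutMap_map g.left.appTop.hom _ _).symm
        rw [AlgEquiv.apply_symm_apply]
        exact hf
    exact ⟨F, hF⟩
  let a : MatAut n Γ(X.left, ⊤) :=
    { toFun := F
      invFun := F'
      left_inv := fun M => matrix_ext hR fun Y f hf => by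
        rw [hF' _ Y f hf, hF _ Y f hf, AlgEquiv.symm_apply_apply]
      right_inv := fun M => matrix_ext hR fun Y f hf => by
        rw [hF _ Y f hf, hF' _ Y f hf, AlgEquiv.apply_symm_apply]
      map_mul' := fun M N => matrix_ext hR fun Y f hf => by
        have h : ∀ M N : Matrix (Fin n) (Fin n) Γ(X.left, ⊤), (M * N).map f.left.appTop =
            M.map f.left.appTop * N.map f.left.appTop := fun M N =>
          Matrix.map_mul (f := f.left.appTop.hom)
        rw [hF _ Y f hf, h, h, map_mul, hF _ Y f hf, hF _ Y f hf]
      map_add' := fun M N => matrix_ext hR fun Y f hf => by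
        have h : ∀ M N : Matrix (Fin n) (Fin n) Γ(X.left, ⊤), (M + N).map f.left.appTop =
            M.map f.left.appTop + N.map f.left.appTop := fun M N =>
          Matrix.map_add f.left.appTop.hom (map_add _) M N
        rw [hF _ Y f hf, h, h, map_add, hF _ Y f hf, hF _ Y f hf]
      commutes' := fun c => matrix_ext hR fun Y f hf => by
        have h : (algebraMap Γ(X.left, ⊤) (Matrix (Fin n) (Fin n) Γ(X.left, ⊤)) c).map
            f.left.appTop = algebraMap Γ(Y.left, ⊤) _ (f.left.appTop c) := by
          refine Matrix.ext fun i j => ?_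
          rw [Matrix.map_apply, Matrix.algebraMap_matrix_apply, Matrix.algebraMap_matrix_apply]
          split_ifs
          · rfl
          · exact map_zero f.left.appTop.hom
        rw [hF _ Y f hf, h, AlgEquiv.commutes] }
  have ha : ∀ (Y : Over S) (f : Y ⟶ X) (hf : R f),
      matAutMap f.left.appTop.hom a = x' Y f hf := fun Y f hf =>
    matAut_ext f.left.appTop.hom fun M =>
      (matAutMap_map f.left.appTop.hom a M).trans (hF M Y f hf)
  refine ⟨a, fun Y f hf => ha Y f hf, ?_⟩
  intro (y : MatAut n Γ(X.left, ⊤)) hy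
  refine AlgEquiv.ext fun M => matrix_ext hR fun Y f hf => ?_
  have h1 : matAutMap f.left.appTop.hom y = x' Y f hf := hy f hf
  rw [← ha Y f hf] at h1
  have h2 := matAutMap_map f.left.appTop.hom y M
  rw [h1, matAutMap_map] at h2
  exact h2.symm

end Sheaves
/-! ## Modules, algebras and their frames -/

section Modules

/-- The presheaf of rings `Y ↦ Γ(Y, ⊤)` on schemes over `X`. -/
abbrev functions (X : Scheme.{u}) : (Over X)ᵒᵖ ⥤ CommRingCat.{u} :=
  (Over.forget X).op ⋙ Scheme.Γ

/-- Presheaves of `𝒪`-modules on the category of schemes over `X`. -/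
abbrev OMod (X : Scheme.{u}) : Type (u + 2) :=
  PresheafOfModules.{u + 1} (functions X ⋙ forget₂ CommRingCat.{u} RingCat.{u})

variable {X : Scheme.{u}}

/-- The sections of a module over an object of the site. -/
def Sec (M : OMod X) (Y : Over X) : Type (u + 1) := M.obj (op Y)

instance (M : OMod X) (Y : Over X) : AddCommGroup (Sec M Y) :=
  inferInstanceAs (AddCommGroup (M.obj (op Y)))

instance (M : OMod X) (Y : Over X) : Module Γ(Y.left, ⊤) (Sec M Y) :=
  inferInstanceAs (Module ((functions X ⋙ forget₂ CommRingCat.{u} RingCat.{u}).obj (op Y))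
    (M.obj (op Y)))

/-- Restriction of sections of a module. -/
def res (M : OMod X) {Y Z : Over X} (f : Z ⟶ Y) : Sec M Y →ₛₗ[f.left.appTop.hom] Sec M Z where
  toFun m := M.map f.op m
  map_add' m n := map_add (M.map f.op).hom m n
  map_smul' a m := M.map_smul f.op a m

theorem res_id (M : OMod X) {Y : Over X} (m : Sec M Y) : res M (𝟙 Y) m = m := by
  change M.map (𝟙 (op Y)) m = m
  rw [M.map_id]
  rfl

theorem res_comp (M : OMod X) {Y Z W : Over X} (f : Z ⟶ Y) (g : W ⟶ Z) (m : Sec M Y) :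
    res M (g ≫ f) m = res M g (res M f m) :=
  M.map_comp_apply f.op g.op m

/-- An isomorphism of `𝒪 ^ n` with the restriction of `M` to the schemes over `Y`. -/
@[ext]
structure FrameSec (M : OMod X) (n : ℕ) (Y : Over X) : Type (u + 1) where
  /-- the isomorphism on sections -/
  app (Z : Over X) (z : Z ⟶ Y) : (Fin n → Γ(Z.left, ⊤)) ≃ₗ[Γ(Z.left, ⊤)] Sec M Z
  app_map (Z W : Over X) (z : Z ⟶ Y) (w : W ⟶ Z) (v : Fin n → Γ(Z.left, ⊤)) :
    res M w (app Z z v) = app W (w ≫ z) (fun i => w.left.appTop (v i))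

namespace FrameSec

variable {M : OMod X} {n : ℕ}

/-- Restriction of isomorphisms. -/
def res {Y Y' : Over X} (f : Y' ⟶ Y) (e : FrameSec M n Y) : FrameSec M n Y' where
  app Z z := e.app Z (z ≫ f)
  app_map Z W z w v := by rw [e.app_map, Category.assoc]

/-- Precomposition of an isomorphism with an automorphism of `𝒪 ^ n`. -/
def act {Y : Over X} (e : FrameSec M n Y) (A : GL (Fin n) Γ(Y.left, ⊤)) : FrameSec M n Y where
  app Z z :=
    (glEquiv (Matrix.GeneralLinearGroup.map z.left.appTop.hom A)).trans (e.app Z z)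
  app_map Z W z w v := by
    change SegreNorm.res M w (e.app Z z
      ((Matrix.GeneralLinearGroup.map z.left.appTop.hom A).1.mulVec v)) = e.app W (w ≫ z)
        ((Matrix.GeneralLinearGroup.map (w ≫ z).left.appTop.hom A).1.mulVec
          fun i => w.left.appTop (v i))
    rw [e.app_map]
    congr 1
    funext i
    rw [Over.comp_left, Scheme.Hom.comp_appTop]
    exact RingHom.map_mulVec w.left.appTop.hom _ v i

end FrameSec

/-- The sheaf of isomorphisms `Isom(𝒪 ^ n, M)`, with `GL n` acting by precomposition. -/
def frames (M : OMod X) (n : ℕ) : RightGSet (onSch (GLFun.{u} n) X) where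
  F :=
    { obj := fun Y => FrameSec M n Y.unop
      map := fun f => TypeCat.ofHom (FrameSec.res f.unop)
      map_id := fun Y => by
        refine ConcreteCategory.hom_ext _ _ fun e => ?_
        refine FrameSec.ext (funext fun Z => funext fun z => ?_)
        exact congrArg (FrameSec.app e Z) (Category.comp_id z)
      map_comp := fun f g => by
        refine ConcreteCategory.hom_ext _ _ fun e => ?_
        refine FrameSec.ext (funext fun Z => funext fun z => ?_)
        exact congrArg (FrameSec.app e Z) (Category.assoc z _ _).symm }
  act {Y} e A := FrameSec.act e A
  act_map {Y Y'} f e A := by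
    apply FrameSec.ext
    funext Z z
    apply LinearEquiv.ext
    intro v
    change FrameSec.app e Z (z ≫ f.unop) ((Matrix.GeneralLinearGroup.map
      (z ≫ f.unop).left.appTop.hom A).1.mulVec v) = FrameSec.app e Z (z ≫ f.unop)
      ((Matrix.GeneralLinearGroup.map z.left.appTop.hom
        (Matrix.GeneralLinearGroup.map f.unop.left.appTop.hom A)).1.mulVec v)
    rw [Over.comp_left, Scheme.Hom.comp_appTop]
    rfl

/-- Locally free `𝒪`-modules of constant rank `n`: sheaves of modules which are isomorphic to
`𝒪 ^ n` locally for the fppf topology. -/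
structure IsLocFree (M : OMod X) (n : ℕ) : Prop where
  isSheaf : Presheaf.IsSheaf (fppf X) M.presheaf
  locally_free : ∃ R ∈ fppf X (Over.mk (𝟙 X)), ∀ (Y : Over X) (f : Y ⟶ Over.mk (𝟙 X)), R f →
    Nonempty (FrameSec M n Y)

/-- The structure of an associative unital `𝒪`-algebra on a module. -/
@[ext]
structure AlgStr (M : OMod X) : Type (u + 1) where
  /-- the multiplication -/
  mul (Y : Over X) : Sec M Y →ₗ[Γ(Y.left, ⊤)] Sec M Y →ₗ[Γ(Y.left, ⊤)] Sec M Y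
  /-- the unit -/
  one (Y : Over X) : Sec M Y
  one_mul (Y : Over X) (a : Sec M Y) : mul Y (one Y) a = a
  mul_one (Y : Over X) (a : Sec M Y) : mul Y a (one Y) = a
  mul_assoc (Y : Over X) (a b c : Sec M Y) : mul Y (mul Y a b) c = mul Y a (mul Y b c)
  res_mul {Y Z : Over X} (f : Z ⟶ Y) (a b : Sec M Y) :
    res M f (mul Y a b) = mul Z (res M f a) (res M f b)
  res_one {Y Z : Over X} (f : Z ⟶ Y) : res M f (one Y) = one Z

/-- An isomorphism of the matrix algebra of degree `n` with the restriction of the algebra `M` to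
the schemes over `Y`. -/
@[ext]
structure AlgFrameSec {M : OMod X} (A : AlgStr M) (n : ℕ) (Y : Over X) : Type (u + 1) where
  /-- the isomorphism on sections -/
  app (Z : Over X) (z : Z ⟶ Y) : Matrix (Fin n) (Fin n) Γ(Z.left, ⊤) ≃ₗ[Γ(Z.left, ⊤)] Sec M Z
  app_one (Z : Over X) (z : Z ⟶ Y) : app Z z 1 = A.one Z
  app_mul (Z : Over X) (z : Z ⟶ Y) (a b : Matrix (Fin n) (Fin n) Γ(Z.left, ⊤)) :
    app Z z (a * b) = A.mul Z (app Z z a) (app Z z b)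
  app_map (Z W : Over X) (z : Z ⟶ Y) (w : W ⟶ Z) (a : Matrix (Fin n) (Fin n) Γ(Z.left, ⊤)) :
    res M w (app Z z a) = app W (w ≫ z) (a.map w.left.appTop)

namespace AlgFrameSec

variable {M : OMod X} {A : AlgStr M} {n : ℕ}

/-- Restriction of isomorphisms. -/
def res {Y Y' : Over X} (f : Y' ⟶ Y) (e : AlgFrameSec A n Y) : AlgFrameSec A n Y' where
  app Z z := e.app Z (z ≫ f)
  app_one Z z := e.app_one Z _
  app_mul Z z := e.app_mul Z _
  app_map Z W z w v := by rw [e.app_map, Category.assoc]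

/-- Precomposition of an isomorphism with an automorphism of the matrix algebra. -/
def act {Y : Over X} (e : AlgFrameSec A n Y) (φ : MatAut n Γ(Y.left, ⊤)) :
    AlgFrameSec A n Y where
  app Z z := (matAutMap z.left.appTop.hom φ).toLinearEquiv.trans (e.app Z z)
  app_one Z z := by
    change e.app Z z (matAutMap z.left.appTop.hom φ 1) = _
    rw [map_one, e.app_one]
  app_mul Z z a b := by
    change e.app Z z (matAutMap z.left.appTop.hom φ (a * b)) = _
    rw [map_mul, e.app_mul]
    rfl
  app_map Z W z w a := by
    change SegreNorm.res M w (e.app Z z (matAutMap z.left.appTop.hom φ a)) =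
      e.app W (w ≫ z) (matAutMap (w ≫ z).left.appTop.hom φ (a.map w.left.appTop))
    rw [e.app_map]
    congr 1
    have h : matAutMap (w ≫ z).left.appTop.hom φ =
        matAutMap w.left.appTop.hom (matAutMap z.left.appTop.hom φ) := by
      rw [Over.comp_left, Scheme.Hom.comp_appTop]
      exact matAutMap_comp _ _ φ
    exact ((congrArg (fun ψ : MatAut n Γ(W.left, ⊤) => ψ (a.map w.left.appTop)) h).trans
      (matAutMap_map w.left.appTop.hom _ a)).symm

end AlgFrameSec

/-- The sheaf of algebra isomorphisms `Isom(Mₙ(𝒪), A)`, with `PGL n` acting by precomposition. -/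
def algFrames {M : OMod X} (A : AlgStr M) (n : ℕ) : RightGSet (onSch (PGLFun.{u} n) X) where
  F :=
    { obj := fun Y => AlgFrameSec A n Y.unop
      map := fun f => TypeCat.ofHom (AlgFrameSec.res f.unop)
      map_id := fun Y => by
        refine ConcreteCategory.hom_ext _ _ fun e => ?_
        refine AlgFrameSec.ext (funext fun Z => funext fun z => ?_)
        exact congrArg (AlgFrameSec.app e Z) (Category.comp_id z)
      map_comp := fun f g => by
        refine ConcreteCategory.hom_ext _ _ fun e => ?_
        refine AlgFrameSec.ext (funext fun Z => funext fun z => ?_)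
        exact congrArg (AlgFrameSec.app e Z) (Category.assoc z _ _).symm }
  act {Y} e φ := AlgFrameSec.act e φ
  act_map {Y Y'} f e φ := by
    apply AlgFrameSec.ext
    funext Z z
    apply LinearEquiv.ext
    intro a
    change AlgFrameSec.app e Z (z ≫ f.unop) (matAutMap (z ≫ f.unop).left.appTop.hom φ a) =
      AlgFrameSec.app e Z (z ≫ f.unop)
        (matAutMap z.left.appTop.hom (matAutMap f.unop.left.appTop.hom φ) a)
    have h : matAutMap (z ≫ f.unop).left.appTop.hom φ =
        matAutMap z.left.appTop.hom (matAutMap f.unop.left.appTop.hom φ) := by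
      rw [Over.comp_left, Scheme.Hom.comp_appTop]
      exact matAutMap_comp _ _ φ
    exact congrArg (fun ψ : MatAut n Γ(Z.left, ⊤) => AlgFrameSec.app e Z (z ≫ f.unop) (ψ a)) h

/-- Azumaya `𝒪`-algebras of constant degree `n`: sheaves of algebras which are isomorphic to the
matrix algebra of degree `n` locally for the fppf topology. -/
structure IsAzumaya {M : OMod X} (A : AlgStr M) (n : ℕ) : Prop where
  isSheaf : Presheaf.IsSheaf (fppf X) M.presheaf
  locally_matrix : ∃ R ∈ fppf X (Over.mk (𝟙 X)), ∀ (Y : Over X) (f : Y ⟶ Over.mk (𝟙 X)), R f →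
    Nonempty (AlgFrameSec A n Y)

end Modules
/-! ## The torsor of isomorphisms from the split pair -/

section SplitPair

variable {S T : Scheme.{u}} (f : T ⟶ S) {F : CommRingCat.{u} ⥤ GrpCat.{u}} [PreservesFinPow F]
  (P : RightGSet (onSch F T)) (d : ℕ)

/-- An isomorphism over `X` from the pair consisting of the `d`-fold disjoint union of `X` with the
trivial object to the pair consisting of `T` and the object whose sheaf of trivializations is `P`.
A point with values in `W` of the disjoint union of `d` copies of `X` is a point `w` of `X` with
values in `W`, together with a locally constant function `i : W → Fin d`. An isomorphism of schemes
over `X` from the disjoint union to `T ×[S] X` is thus a natural family of bijections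
`pt W w` from such functions `i` to the points of `T` over `S` with values in `W`. The
isomorphism of the trivial object with the pullback of the given object is a natural family of
sections of `P` over these points. -/
@[ext]
structure SplitIso (X : Over S) : Type (u + 1) where
  /-- the isomorphism of schemes, on points -/
  pt (W : Over S) (w : W ⟶ X) (i : LocallyConstant W.left (Fin d)) : W ⟶ Over.mk f
  /-- the trivialization -/
  triv (W : Over S) (w : W ⟶ X) (i : LocallyConstant W.left (Fin d)) :
    P.F.obj (op (Over.mk (pt W w i).left))
  pt_map (V W : Over S) (w : W ⟶ X) (v : V ⟶ W) (i : LocallyConstant W.left (Fin d)) :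
    v ≫ pt W w i = pt V (v ≫ w) (lcPull v.left i)
  pt_bijective (W : Over S) (w : W ⟶ X) : Function.Bijective (pt W w)
  triv_map (V W : Over S) (w : W ⟶ X) (v : V ⟶ W) (i : LocallyConstant W.left (Fin d)) :
    P.F.map (Quiver.Hom.op (Over.homMk v.left (congrArg Over.Hom.left (pt_map V W w v i)) :
      Over.mk (pt V (v ≫ w) (lcPull v.left i)).left ⟶ Over.mk (pt W w i).left)) (triv W w i) =
      triv V (v ≫ w) (lcPull v.left i)

/-- The pointwise application of a locally constant permutation. -/
def lcApply {d : ℕ} {W : Scheme.{u}} (σ : LocallyConstant W (Equiv.Perm (Fin d)))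
    (i : LocallyConstant W (Fin d)) : LocallyConstant W (Fin d) where
  toFun x := σ x (i x)
  isLocallyConstant := (σ.isLocallyConstant.prodMk i.isLocallyConstant).comp fun q => q.1 q.2

namespace SplitIso

variable {f P d}

theorem ext_heq {X : Over S} {p q : SplitIso f P d X} (h : ∀ W w i, p.pt W w i = q.pt W w i)
    (h' : ∀ W w i, HEq (p.triv W w i) (q.triv W w i)) : p = q := by
  obtain ⟨pt, triv, _, _, _⟩ := p
  obtain ⟨pt', triv', _, _, _⟩ := q
  obtain rfl : pt = pt' := funext fun W => funext fun w => funext fun i => h W w i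
  obtain rfl : triv = triv' := funext fun W => funext fun w => funext fun i => eq_of_heq (h' W w i)
  rfl

theorem map_triv {X : Over S} (p : SplitIso f P d X) {V W : Over S} (w : W ⟶ X) (v : V ⟶ W)
    (w' : V ⟶ X) (e : v ≫ w = w') (i : LocallyConstant W.left (Fin d))
    (g : Over.mk (p.pt V w' (lcPull v.left i)).left ⟶ Over.mk (p.pt W w i).left)
    (hg : g.left = v.left) :
    P.F.map g.op (p.triv W w i) = p.triv V w' (lcPull v.left i) := by
  subst e
  have : g = (Over.homMk v.left (congrArg Over.Hom.left (p.pt_map V W w v i)) :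
      Over.mk (p.pt V (v ≫ w) (lcPull v.left i)).left ⟶ Over.mk (p.pt W w i).left) :=
    Over.OverMorphism.ext hg
  rw [this]
  exact p.triv_map V W w v i

/-- Restriction of isomorphisms. -/
def res {X X' : Over S} (h : X' ⟶ X) (p : SplitIso f P d X) : SplitIso f P d X' where
  pt W w i := p.pt W (w ≫ h) i
  triv W w i := p.triv W (w ≫ h) i
  pt_map V W w v i := by rw [p.pt_map, Category.assoc]
  pt_bijective W w := p.pt_bijective W _
  triv_map V W w v i := by
    exact p.map_triv (w ≫ h) v _ (Category.assoc v w h).symm i _ rfl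

/-- Precomposition with the automorphism of the split pair given by a family `A` of elements of `F`
and a locally constant permutation `σ`: the copy with index `i` of the disjoint union is sent to
the copy with index `σ i`, with the automorphism `A (σ i)` of the trivial object. -/
def act {X : Over S} (p : SplitIso f P d X) (a : WreathSections F d X.left) :
    SplitIso f P d X where
  pt W w i := p.pt W w (lcApply (lcPull w.left a.right) i)
  triv W w i := P.act (p.triv W w (lcApply (lcPull w.left a.right) i))
    (glue F (lcApply (lcPull w.left a.right) i) fun k => F.map w.left.appTop (a.left k))
  pt_map V W w v i := p.pt_map V W w v _
  pt_bijective W w := by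
    refine (p.pt_bijective W w).comp (Function.bijective_iff_has_inverse.2
      ⟨lcApply (lcPull w.left a.right⁻¹), fun i => ?_, fun i => ?_⟩)
    · ext x
      simp [lcApply]
    · ext x
      simp [lcApply]
  triv_map V W w v i := by
    have h1 := p.triv_map V W w v (lcApply (lcPull w.left a.right) i)
    have h2 : F.map v.left.appTop
        (glue F (lcApply (lcPull w.left a.right) i) fun k => F.map w.left.appTop (a.left k)) =
        glue F (lcApply (lcPull (v ≫ w).left a.right) (lcPull v.left i))
          fun k => F.map (v ≫ w).left.appTop (a.left k) := by
      rw [map_glue, Over.comp_left, Scheme.Hom.comp_appTop]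
      simp only [map_map_apply]
      rfl
    exact (P.act_map _ _ _).trans (congrArg₂ P.act h1 h2)

end SplitIso

/-- The sheaf of isomorphisms from the split pair, with the automorphisms of the split pair acting
by precomposition. -/
def splitIsos : RightGSet (wreath F d S) where
  F :=
    { obj := fun X => SplitIso f P d X.unop
      map := fun h => TypeCat.ofHom (SplitIso.res h.unop)
      map_id := fun X => by
        refine ConcreteCategory.hom_ext _ _ fun p => SplitIso.ext_heq ?_ ?_
        · intro W w i
          exact congrArg (fun t => SplitIso.pt (X := X.unop) p W t i) (Category.comp_id w)
        · intro W w i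
          change HEq (SplitIso.triv (X := X.unop) p W (w ≫ 𝟙 _) i) _
          rw [Category.comp_id]
          rfl
      map_comp := fun g h => by
        refine ConcreteCategory.hom_ext _ _ fun p => SplitIso.ext_heq ?_ ?_
        · intro W w i
          exact congrArg (fun t => SplitIso.pt p W t i) (Category.assoc w _ _).symm
        · intro W w i
          change HEq (SplitIso.triv p W (w ≫ h.unop ≫ g.unop) i)
            (SplitIso.triv p W ((w ≫ h.unop) ≫ g.unop) i)
          rw [Category.assoc] }
  act {X} p a := SplitIso.act p a
  act_map {X X'} h p a := by
    refine SplitIso.ext_heq (fun W w i => rfl) fun W w i => heq_of_eq ?_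
    have h2 : (glue F (lcApply (lcPull (w ≫ h.unop).left a.right) i)
        fun k => F.map (w ≫ h.unop).left.appTop (a.left k)) =
        glue F (lcApply (lcPull w.left (lcPull h.unop.left a.right)) i)
          fun k => F.map w.left.appTop (F.map h.unop.left.appTop (a.left k)) := by
      rw [Over.comp_left, Scheme.Hom.comp_appTop]
      simp only [map_map_apply]
      rfl
    exact congrArg (P.act _) h2

end SplitPair
/-! ## The norm of a module over a finite projective algebra -/

section FerrandNorm

/-- A finite family of elements `x j` of an algebra `φ : R → A` and of `R`-linear forms `f j` on `A`
with `p = ∑ j, f j p * x j` for all `p` in `A`. Such families exist exactly if `A` is a finitely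
generated projective `R`-module. -/
structure DualBasis {R A : Type u} [CommRing R] [CommRing A] (φ : R →+* A) (n : ℕ) where
  /-- the elements -/
  x : Fin n → A
  /-- the linear forms -/
  f : Fin n → A →+ R
  f_smul (j : Fin n) (r : R) (a : A) : f j (φ r * a) = r * f j a
  sum_eq (p : A) : ∑ j, φ (f j p) * x j = p

/-- The polynomial law given by the norm from `A` to `R`, on a family `r` of elements of `A`: the
norm from `A[X]` to `R[X]` of `∑ t, X t * r t`. The projective module `A` is a direct summand of
`R ^ n` by `p ↦ (f i p)` and `e j ↦ x j`, and the determinant of an endomorphism of `A` is the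
determinant of its extension by the identity of the complement. -/
def normPoly {R A : Type u} [CommRing R] [CommRing A] {φ : R →+* A} {n k : ℕ} (D : DualBasis φ n)
    (r : Fin k → A) : MvPolynomial (Fin k) R :=
  Matrix.det (Matrix.of fun i j : Fin n =>
    ∑ t, MvPolynomial.X t * MvPolynomial.C (D.f i (r t * D.x j)) +
      MvPolynomial.C ((if i = j then 1 else 0) - D.f i (D.x j)))

/-- The coefficient of `∏ t, X t ^ a t` in `normPoly`. -/
def normCoeff {R A : Type u} [CommRing R] [CommRing A] {φ : R →+* A} {n k : ℕ} (D : DualBasis φ n)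
    (r : Fin k → A) (a : Fin k → ℕ) : R :=
  MvPolynomial.coeff (Finsupp.equivFunOnFinite.symm a) (normPoly D r)

/-- An `A`-module regarded as an `R`-module along `φ : R → A`. -/
def ModOver {R A : Type u} [CommRing R] [CommRing A] (_φ : R →+* A) (M : Type (u + 1)) :
    Type (u + 1) := M

variable {R A S B : Type u} [CommRing R] [CommRing A] [CommRing S] [CommRing B]
  (φ : R →+* A) (ψ : S →+* B) (d : ℕ)
  (M : Type (u + 1)) [AddCommGroup M] [Module A M] (N : Type (u + 1)) [AddCommGroup N] [Module B N]

instance : AddCommGroup (ModOver φ M) := inferInstanceAs (AddCommGroup M)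

instance : Module R (ModOver φ M) := Module.compHom M φ

/-- The divided power algebra of `M` over `R`. -/
def Gam : Type (u + 1) := DividedPowerAlgebra R (ModOver φ M)

instance : CommRing (Gam φ M) :=
  inferInstanceAs (CommRing (DividedPowerAlgebra R (ModOver φ M)))

instance : Algebra R (Gam φ M) :=
  inferInstanceAs (Algebra R (DividedPowerAlgebra R (ModOver φ M)))

/-- The divided power `γ_n(m)`. -/
def gam {M : Type (u + 1)} [AddCommGroup M] [Module A M] (n : ℕ) (m : M) : Gam φ M :=
  DividedPowerAlgebra.dp R n (show ModOver φ M from m)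

/-- The product `∏ j, γ_{b j}(m j)`. -/
def gamProd {M : Type (u + 1)} [AddCommGroup M] [Module A M] {l : ℕ} (b : Fin l → ℕ)
    (m : Fin l → M) : Gam φ M :=
  ∏ j, gam φ (b j) (m j)

/-- The `d`-th divided power `Γ^d_R(M)`: the part of degree `d` of the divided power algebra,
generated by the products `∏ j, γ_{b j}(m j)` with `∑ j, b j = d`. -/
def gamDeg : Submodule R (Gam φ M) :=
  Submodule.span R {z | ∃ (l : ℕ) (b : Fin l → ℕ) (m : Fin l → M), ∑ j, b j = d ∧ z = gamProd φ b m}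

/-- The action of `∏ i, γ_{a i}(r i)`, an element of the algebra `Γ^d_R(A)`, on `∏ j, γ_{b j}(m j)`.
As `γ_d(r)` sends `γ_d(m)` to `γ_d(r • m)`, also after extension of scalars, it is the sum of
the products `∏ i, ∏ j, γ_{C i j}(r i • m j)` over the matrices `C` of natural numbers with row
sums `a i` and column sums `b j`. -/
def gamAct {M : Type (u + 1)} [AddCommGroup M] [Module A M] {k l : ℕ} (a : Fin k → ℕ)
    (r : Fin k → A) (b : Fin l → ℕ) (m : Fin l → M) : Gam φ M :=
  ∑ C : Fin k → Fin l → Fin (d + 1) with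
    (∀ i, ∑ j, (C i j : ℕ) = a i) ∧ ∀ j, ∑ i, (C i j : ℕ) = b j,
    ∏ i, ∏ j, gam φ (C i j) (r i • m j)

/-- The relations `c • z = π(c) • z` in `Γ^d_R(M)`, for `c` in the algebra `Γ^d_R(A)`, where
`π : Γ^d_R(A) → R` is the homomorphism corresponding to the norm: it sends `γ_d(r)` to the norm of
`r`, also after extension of scalars, and therefore `∏ i, γ_{a i}(r i)` to the coefficient of
`∏ i, X i ^ a i` in the norm of `∑ i, X i * r i`. -/
def normRel : Submodule R (Gam φ M) :=
  Submodule.span R {z | ∃ (n k l : ℕ) (D : DualBasis φ n) (a : Fin k → ℕ) (r : Fin k → A)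
    (b : Fin l → ℕ) (m : Fin l → M), ∑ i, a i = d ∧ ∑ j, b j = d ∧
      z = gamAct φ d a r b m - normCoeff D r a • gamProd φ b m}

/-- Ferrand's norm of the `A`-module `M`, for an algebra `φ : R → A` which is a projective module
of rank `d`: the tensor product of `Γ^d_R(M)` and `R` over the algebra `Γ^d_R(A)`. -/
abbrev NormMod : Type (u + 1) :=
  gamDeg φ d M ⧸ (normRel φ d M).comap (gamDeg φ d M).subtype

theorem gam_mem {M : Type (u + 1)} [AddCommGroup M] [Module A M] (m : M) :
    gam φ d m ∈ gamDeg φ d M :=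
  Submodule.subset_span ⟨1, fun _ => d, fun _ => m, by simp, by simp [gamProd]⟩

/-- The universal norm `m ↦ γ_d(m) ⊗ 1`. -/
def normMk {M : Type (u + 1)} [AddCommGroup M] [Module A M] (m : M) : NormMod φ d M :=
  Submodule.Quotient.mk ⟨gam φ d m, gam_mem φ d m⟩

/-! ### Change of rings -/

section BaseChange

variable {φ ψ} {M N} {ρ : R →+* S} {τ : A →+* B}

theorem gam_smul (n : ℕ) (s : S) (m : N) : gam ψ n (ψ s • m) = s ^ n • gam ψ n m :=
  DividedPowerAlgebra.dp_smul (R := S) (M := ModOver ψ N)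

theorem gam_map_smul (comm : τ.comp φ = ψ.comp ρ) (g : M →ₛₗ[τ] N) (n : ℕ) (r : R) (m : M) :
    gam ψ n (g (φ r • m)) = algebraMap S _ (ρ r) ^ n * gam ψ n (g m) := by
  have h : τ (φ r) = ψ (ρ r) := RingHom.congr_fun comm r
  rw [map_smulₛₗ, h, gam_smul, Algebra.smul_def, map_pow]

variable (comm : τ.comp φ = ψ.comp ρ) (g : M →ₛₗ[τ] N)

/-- The homomorphism of divided power algebras with `γ_n(m) ↦ γ_n(g m)`. -/
def gamMap : Gam φ M →+* Gam ψ N :=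
  letI : Algebra R (Gam ψ N) := ((algebraMap S (Gam ψ N)).comp ρ).toAlgebra
  (DividedPowerAlgebra.lift' (R := R) (M := ModOver φ M) (A := Gam ψ N)
    (f := fun q => gam ψ q.1 (g q.2))
    (fun m => DividedPowerAlgebra.dp_zero (R := S) (M := ModOver ψ N))
    (fun n r m => by
      rw [Algebra.smul_def, map_pow]
      exact gam_map_smul comm g n r m)
    (fun n p m => DividedPowerAlgebra.dp_mul (R := S) (M := ModOver ψ N))
    (fun n u v => by
      change gam ψ n (g ((show M from u) + (show M from v))) = _
      rw [map_add]
      exact DividedPowerAlgebra.dp_add (R := S) (M := ModOver ψ N))).toRingHom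

theorem gamMap_gam (n : ℕ) (m : M) : gamMap comm g (gam φ n m) = gam ψ n (g m) := by
  let : Algebra R (Gam ψ N) := ((algebraMap S (Gam ψ N)).comp ρ).toAlgebra
  exact DividedPowerAlgebra.lift'_apply_dp (R := R) (M := ModOver φ M) (A := Gam ψ N) _ _ _ _ n m

theorem gamMap_algebraMap (r : R) :
    gamMap comm g (algebraMap R _ r) = algebraMap S _ (ρ r) := by
  let : Algebra R (Gam ψ N) := ((algebraMap S (Gam ψ N)).comp ρ).toAlgebra
  exact AlgHom.commutes (DividedPowerAlgebra.lift' (R := R) (M := ModOver φ M) (A := Gam ψ N) _ _ _ _) r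

theorem gamMap_smul (r : R) (z : Gam φ M) : gamMap comm g (r • z) = ρ r • gamMap comm g z := by
  rw [Algebra.smul_def, Algebra.smul_def, map_mul, gamMap_algebraMap]

/-- `gamMap` as a semilinear map. -/
def gamMapLin : Gam φ M →ₛₗ[ρ] Gam ψ N where
  toFun := gamMap comm g
  map_add' := map_add _
  map_smul' := gamMap_smul comm g

theorem gamMap_gamProd {l : ℕ} (b : Fin l → ℕ) (m : Fin l → M) :
    gamMap comm g (gamProd φ b m) = gamProd ψ b (fun j => g (m j)) := by
  rw [gamProd, map_prod]
  simp only [gamMap_gam]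
  rfl

theorem gamMap_gamAct {k l : ℕ} (a : Fin k → ℕ)
    (r : Fin k → A) (b : Fin l → ℕ) (m : Fin l → M) :
    gamMap comm g (gamAct φ d a r b m) =
      gamAct ψ d a (fun i => τ (r i)) b (fun j => g (m j)) := by
  rw [gamAct, map_sum]
  simp only [map_prod, gamMap_gam, map_smulₛₗ]
  rfl

/-- Base change of linear forms. -/
theorem DualBasis.exists_baseChange {R A S B : CommRingCat.{u}} {φ : R ⟶ A} {ψ : S ⟶ B}
    {ρ : R ⟶ S} {τ : A ⟶ B} (sq : IsPushout ρ φ ψ τ) {n : ℕ} (D : DualBasis φ.hom n) :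
    ∃ D' : DualBasis ψ.hom n, (∀ j, D'.x j = τ (D.x j)) ∧
      ∀ j a, D'.f j (τ a) = ρ (D.f j a) := by
  algebraize [φ.hom, ψ.hom, ρ.hom, τ.hom, τ.hom.comp φ.hom]
  have hc : τ.hom.comp φ.hom = ψ.hom.comp ρ.hom :=
    (congrArg CommRingCat.Hom.hom sq.w).symm
  have t1 : IsScalarTower R S B := .of_algebraMap_eq' hc
  have t2 : IsScalarTower R A B := .of_algebraMap_eq' rfl
  have hp : Algebra.IsPushout R S A B := CommRingCat.isPushout_iff_isPushout.1 sq
  have hb : IsBaseChange S (IsScalarTower.toAlgHom R A B).toLinearMap := hp.out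
  let F (j : Fin n) : A →ₗ[R] S :=
    { toFun := fun a => ρ (D.f j a)
      map_add' := fun a b => by rw [map_add, map_add]
      map_smul' := fun r a => by
        rw [Algebra.smul_def, RingHom.id_apply, Algebra.smul_def]
        exact (congrArg ρ (D.f_smul j r a)).trans (map_mul ρ.hom r _) }
  have hF : ∀ j a, hb.lift (F j) (τ a) = ρ (D.f j a) := fun j a => hb.lift_eq (F j) a
  have hs : ∀ j s b, hb.lift (F j) (ψ s * b) = s * hb.lift (F j) b := fun j s b =>
    (hb.lift (F j)).map_smul s b
  refine ⟨⟨fun j => τ (D.x j), fun j => (hb.lift (F j)).toAddMonoidHom, hs, fun p => ?_⟩,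
    fun _ => rfl, hF⟩
  change ∑ j, ψ (hb.lift (F j) p) * τ (D.x j) = p
  refine hb.inductionOn p (fun p => ∑ j, ψ (hb.lift (F j) p) * τ (D.x j) = p) ?_ ?_ ?_ ?_
  · simp
  · intro a
    change ∑ j, ψ (hb.lift (F j) (τ a)) * τ (D.x j) = τ a
    conv_rhs => rw [← D.sum_eq a, map_sum]
    refine Finset.sum_congr rfl fun j _ => ?_
    rw [hF, map_mul]
    congr 1
    exact (RingHom.congr_fun hc (D.f j a)).symm
  · intro s b hb'
    conv_rhs => rw [← hb', Finset.smul_sum]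
    refine Finset.sum_congr rfl fun j _ => ?_
    rw [map_smul, smul_eq_mul, map_mul, mul_assoc]
    rfl
  · intro b b' h h'
    conv_rhs => rw [← h, ← h', ← Finset.sum_add_distrib]
    refine Finset.sum_congr rfl fun j _ => ?_
    rw [map_add, map_add, add_mul]

theorem normPoly_baseChange {n k : ℕ} (D : DualBasis φ n) (D' : DualBasis ψ n)
    (hx : ∀ j, D'.x j = τ (D.x j)) (hf : ∀ j a, D'.f j (τ a) = ρ (D.f j a)) (r : Fin k → A) :
    normPoly D' (fun i => τ (r i)) = MvPolynomial.map ρ (normPoly D r) := by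
  rw [normPoly, normPoly, RingHom.map_det]
  congr 1
  ext1 i j
  simp only [Matrix.of_apply, RingHom.mapMatrix_apply, Matrix.map_apply, map_add, map_sum, map_mul,
    MvPolynomial.map_X, MvPolynomial.map_C, map_sub, hx, ← hf]
  congr 3
  split_ifs <;> simp

theorem normCoeff_baseChange {n k : ℕ} (D : DualBasis φ n) (D' : DualBasis ψ n)
    (hx : ∀ j, D'.x j = τ (D.x j)) (hf : ∀ j a, D'.f j (τ a) = ρ (D.f j a)) (r : Fin k → A)
    (a : Fin k → ℕ) : normCoeff D' (fun i => τ (r i)) a = ρ (normCoeff D r a) := by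
  rw [normCoeff, normPoly_baseChange D D' hx hf, MvPolynomial.coeff_map]
  rfl

theorem gamMap_mem_gamDeg {z : Gam φ M} (hz : z ∈ gamDeg φ d M) :
    gamMap comm g z ∈ gamDeg ψ d N := by
  have : gamDeg φ d M ≤ (gamDeg ψ d N).comap (gamMapLin comm g) := by
    refine Submodule.span_le.2 ?_
    rintro _ ⟨l, b, m, hb, rfl⟩
    exact Submodule.subset_span ⟨l, b, _, hb, gamMap_gamProd comm g b m⟩
  exact this hz

theorem gamMap_mem_normRel
    (hD : ∀ (n : ℕ) (D : DualBasis φ n), ∃ D' : DualBasis ψ n, (∀ j, D'.x j = τ (D.x j)) ∧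
      ∀ j a, D'.f j (τ a) = ρ (D.f j a))
    {z : Gam φ M} (hz : z ∈ normRel φ d M) : gamMap comm g z ∈ normRel ψ d N := by
  have : normRel φ d M ≤ (normRel ψ d N).comap (gamMapLin comm g) := by
    refine Submodule.span_le.2 ?_
    rintro _ ⟨n, k, l, D, a, r, b, m, ha, hb, rfl⟩
    obtain ⟨D', hx, hf⟩ := hD n D
    refine Submodule.subset_span ⟨n, k, l, D', a, fun i => τ (r i), b, fun j => g (m j), ha, hb, ?_⟩
    change gamMap comm g _ = _
    rw [map_sub, gamMap_gamAct, gamMap_smul, gamMap_gamProd, normCoeff_baseChange D D' hx hf]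
  exact this hz

/-- The map of norms with `γ_d(m) ⊗ 1 ↦ γ_d(g m) ⊗ 1`, for a change of rings by which dual bases
are carried to dual bases. -/
def normMap
    (hD : ∀ (n : ℕ) (D : DualBasis φ n), ∃ D' : DualBasis ψ n, (∀ j, D'.x j = τ (D.x j)) ∧
      ∀ j a, D'.f j (τ a) = ρ (D.f j a)) : NormMod φ d M →ₛₗ[ρ] NormMod ψ d N :=
  Submodule.mapQ _ _
    (((gamMapLin comm g).comp (gamDeg φ d M).subtype).codRestrict (gamDeg ψ d N)
      fun z => gamMap_mem_gamDeg d comm g z.2)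
    fun _ hz => gamMap_mem_normRel d comm g hD hz

theorem normMap_normMk
    (hD : ∀ (n : ℕ) (D : DualBasis φ n), ∃ D' : DualBasis ψ n, (∀ j, D'.x j = τ (D.x j)) ∧
      ∀ j a, D'.f j (τ a) = ρ (D.f j a)) (m : M) :
    normMap d comm g hD (normMk φ d m) = normMk ψ d (g m) := by
  refine (Submodule.mapQ_apply _ _ _ _).trans ?_
  exact congrArg Submodule.Quotient.mk (Subtype.ext (gamMap_gam comm g d m))

end BaseChange

end FerrandNorm
/-! ## The norm of a module along a finite morphism -/

section NormSheaf

variable {S T : Scheme.{u}} (f : T ⟶ S)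

/-- The homomorphism from the functions on `U` to the functions on `U ×[S] T`. -/
abbrev phi (U : Over S) : Γ(U.left, ⊤) ⟶ Γ(((Over.pullback f).obj U).left, ⊤) :=
  (Limits.pullback.fst U.hom f).appTop

theorem isPullback_pullback {U V : Over S} (v : V ⟶ U) :
    IsPullback (Limits.pullback.fst V.hom f) ((Over.pullback f).map v).left v.left
      (Limits.pullback.fst U.hom f) := by
  have h : IsPullback (Limits.pullback.snd V.hom f) (Limits.pullback.fst V.hom f) f
      (v.left ≫ U.hom) := by
    rw [Over.w v]
    exact (IsPullback.of_hasPullback V.hom f).flip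
  refine IsPullback.flip (IsPullback.of_right (h₁₂ := Limits.pullback.snd U.hom f) (v₁₃ := f)
    (h₂₂ := U.hom) ?_ ?_ (IsPullback.of_hasPullback U.hom f).flip)
  · convert h using 1
    exact Limits.pullback.lift_snd _ _ _
  · exact Limits.pullback.lift_fst _ _ _

theorem phi_comp {U V : Over S} (v : V ⟶ U) :
    ((Over.pullback f).map v).left.appTop.hom.comp (phi f U).hom =
      (phi f V).hom.comp v.left.appTop.hom := by
  have h := congrArg Scheme.Hom.appTop (isPullback_pullback f v).w
  rw [Scheme.Hom.comp_appTop, Scheme.Hom.comp_appTop] at h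
  exact (congrArg CommRingCat.Hom.hom h).symm

theorem phi_dualBasis {U V : Over S} [IsAffine U.left] [IsAffine V.left] [IsAffineHom f]
    (v : V ⟶ U) (n : ℕ) (D : DualBasis (phi f U).hom n) :
    ∃ D' : DualBasis (phi f V).hom n,
      (∀ j, D'.x j = ((Over.pullback f).map v).left.appTop.hom (D.x j)) ∧
      ∀ j a, D'.f j (((Over.pullback f).map v).left.appTop.hom a) =
        v.left.appTop.hom (D.f j a) := by
  have : IsAffine ((Over.pullback f).obj U).left := by
    change IsAffine (Limits.pullback U.hom f)
    exact isAffine_of_isAffineHom (Limits.pullback.fst U.hom f)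
  exact DualBasis.exists_baseChange (isPushout_appTop_of_isPullback (isPullback_pullback f v)) D

variable [IsAffineHom f] (d : ℕ) (M : OMod T)

/-- The norm of `M` over an affine scheme `U` over `S`: the norm of the module of sections of `M`
over `U ×[S] T`. -/
abbrev NormOn (U : Over S) : Type (u + 1) :=
  NormMod (phi f U).hom d (Sec M ((Over.pullback f).obj U))

/-- The restriction of norms between affine schemes. -/
def normOnRes {U V : Over S} [IsAffine U.left] [IsAffine V.left] (v : V ⟶ U) :
    NormOn f d M U →ₛₗ[v.left.appTop.hom] NormOn f d M V :=
  normMap d (phi_comp f v) (res M ((Over.pullback f).map v)) (phi_dualBasis f v)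

/-- A section over `X` of the norm of `M`: a compatible family of elements of the norms over the
affine schemes over `X`. -/
@[ext]
structure NormSec (X : Over S) : Type (u + 1) where
  /-- the family -/
  app (U : Over S) [IsAffine U.left] (x : U ⟶ X) : NormOn f d M U
  app_map (U V : Over S) [IsAffine U.left] [IsAffine V.left] (x : U ⟶ X) (v : V ⟶ U) :
    normOnRes f d M v (app U x) = app V (v ≫ x)

namespace NormSec

variable {f d M} {X : Over S}

instance : Zero (NormSec f d M X) := ⟨⟨fun _ _ _ => 0, fun _ _ _ _ _ _ => map_zero _⟩⟩

instance : Add (NormSec f d M X) :=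
  ⟨fun s t => ⟨fun U _ x => s.app U x + t.app U x, fun U V _ _ x v => by
    rw [map_add, s.app_map, t.app_map]⟩⟩

instance : Neg (NormSec f d M X) :=
  ⟨fun s => ⟨fun U _ x => -s.app U x, fun U V _ _ x v => by
    rw [map_neg, s.app_map]⟩⟩

instance : SMul Γ(X.left, ⊤) (NormSec f d M X) :=
  ⟨fun a s => ⟨fun U _ x => x.left.appTop a • s.app U x, fun U V _ _ x v => by
    rw [map_smulₛₗ, s.app_map, Over.comp_left, Scheme.Hom.comp_appTop]
    rfl⟩⟩

theorem ext_app {s t : NormSec f d M X}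
    (h : ∀ (U : Over S) [IsAffine U.left] (x : U ⟶ X), s.app U x = t.app U x) : s = t :=
  NormSec.ext (funext fun U => funext fun i => funext fun x => @h U i x)

instance : AddCommGroup (NormSec f d M X) where
  add_assoc s t w := ext_app fun U _ x => add_assoc (s.app U x) (t.app U x) (w.app U x)
  zero_add s := ext_app fun U _ x => zero_add (s.app U x)
  add_zero s := ext_app fun U _ x => add_zero (s.app U x)
  add_comm s t := ext_app fun U _ x => add_comm (s.app U x) (t.app U x)
  neg_add_cancel s := ext_app fun U _ x => neg_add_cancel (s.app U x)
  nsmul := nsmulRec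
  zsmul := zsmulRec

instance : Module Γ(X.left, ⊤) (NormSec f d M X) where
  one_smul s := ext_app fun U _ x =>
    (congrArg (· • s.app U x) (map_one x.left.appTop.hom)).trans (one_smul _ _)
  mul_smul a b s := ext_app fun U _ x =>
    (congrArg (· • s.app U x) (map_mul x.left.appTop.hom a b)).trans (mul_smul _ _ _)
  smul_zero a := ext_app fun U _ x => smul_zero _
  smul_add a s t := ext_app fun U _ x => smul_add _ _ _
  add_smul a b s := ext_app fun U _ x =>
    (congrArg (· • s.app U x) (map_add x.left.appTop.hom a b)).trans (add_smul _ _ _)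
  zero_smul s := ext_app fun U _ x =>
    (congrArg (· • s.app U x) (map_zero x.left.appTop.hom)).trans (zero_smul _ _)

/-- Restriction of sections. -/
def res {X' : Over S} (h : X' ⟶ X) : NormSec f d M X →+ NormSec f d M X' where
  toFun s := ⟨fun U _ x => s.app U (x ≫ h), fun U V _ _ x v => by rw [s.app_map, Category.assoc]⟩
  map_zero' := rfl
  map_add' _ _ := rfl

end NormSec

instance (X : (Over S)ᵒᵖ) :
    Module ((functions S ⋙ forget₂ CommRingCat.{u} RingCat.{u}).obj X) (NormSec f d M X.unop) :=
  inferInstanceAs (Module Γ(X.unop.left, ⊤) (NormSec f d M X.unop))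

/-- The norm of the `𝒪`-module `M` along `f`. -/
def normMod : OMod S where
  obj X := ModuleCat.of _ (NormSec f d M X.unop)
  map {X Y} h := ModuleCat.ofHom
    (Y := (ModuleCat.restrictScalars ((functions S ⋙ forget₂ CommRingCat.{u} RingCat.{u}).map
      h).hom).obj (ModuleCat.of _ (NormSec f d M Y.unop)))
    { toFun := NormSec.res h.unop
      map_add' := map_add _
      map_smul' := fun (a : Γ(X.unop.left, ⊤)) (s : NormSec f d M X.unop) => by
        refine NormSec.ext_app fun U _ x => ?_
        change (x ≫ h.unop).left.appTop a • s.app U (x ≫ h.unop) =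
          x.left.appTop (h.unop.left.appTop a) • s.app U (x ≫ h.unop)
        rw [Over.comp_left, Scheme.Hom.comp_appTop]
        rfl }
  map_id X := by
    refine ModuleCat.hom_ext (LinearMap.ext fun (s : NormSec f d M X.unop) => ?_)
    refine NormSec.ext_app fun U _ x => ?_
    exact congrArg (fun y => s.app U y) (Category.comp_id x)
  map_comp h k := by
    refine ModuleCat.hom_ext (LinearMap.ext fun (s : NormSec f d M _) => ?_)
    refine NormSec.ext_app fun U _ x => ?_
    exact congrArg (fun y => s.app U y) (Category.assoc x _ _).symm

/-- The universal norm, from the sections of `M` over `X ×[S] T` to the sections over `X` of the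
norm of `M`. -/
def nu (X : Over S) (m : Sec M ((Over.pullback f).obj X)) : Sec (normMod f d M) X :=
  (⟨fun U _ x => normMk (phi f U).hom d (res M ((Over.pullback f).map x) m),
    fun U V _ _ x v => by
      refine (normMap_normMk d (phi_comp f v) (SegreNorm.res M ((Over.pullback f).map v))
        (phi_dualBasis f v) _).trans ?_
      rw [← res_comp, ← Functor.map_comp]⟩ : NormSec f d M X)

end NormSheaf
/-! ## Modules and Azumaya algebras over étale covers -/

section Pairs

/-- An isomorphism of `M` with the pullback of `M'` along `g`. -/
structure ModIso {T T' : Scheme.{u}} (g : T ⟶ T') (M : OMod T) (M' : OMod T') :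
    Type (u + 1) where
  /-- the isomorphism on sections -/
  app (Y : Over T) : Sec M Y ≃+ Sec M' (Over.mk (Y.hom ≫ g))
  app_smul (Y : Over T) (a : Γ(Y.left, ⊤)) (m : Sec M Y) :
    app Y (a • m) = (show Γ((Over.mk (Y.hom ≫ g)).left, ⊤) from a) • app Y m
  app_res {Y Z : Over T} (h : Z ⟶ Y) (m : Sec M Y) :
    app Z (res M h m) =
      res M' (Over.homMk h.left (by simp) : Over.mk (Z.hom ≫ g) ⟶ Over.mk (Y.hom ≫ g)) (app Y m)

variable (S : Scheme.{u}) (d r : ℕ)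

/-- Pairs consisting of a finite étale cover `T` of `S` of degree `d` and a locally free module of
constant rank `r` on `T`. -/
structure ModEt : Type (u + 2) where
  /-- the cover -/
  T : Scheme.{u}
  /-- the structure morphism -/
  f : T ⟶ S
  [isFinite : IsFinite f]
  [etale : Etale f]
  finrank_eq : ∀ s : S, f.finrank s = d
  /-- the module -/
  M : OMod T
  isLocFree : IsLocFree M r

/-- Pairs consisting of a finite étale cover `T` of `S` of degree `d` and an Azumaya algebra of
constant degree `r` on `T`. -/
structure AzuEt : Type (u + 2) where
  /-- the cover -/
  T : Scheme.{u}
  /-- the structure morphism -/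
  f : T ⟶ S
  [isFinite : IsFinite f]
  [etale : Etale f]
  finrank_eq : ∀ s : S, f.finrank s = d
  /-- the underlying module of the algebra -/
  M : OMod T
  /-- the algebra structure -/
  A : AlgStr M
  isAzumaya : IsAzumaya A r

attribute [instance] ModEt.isFinite ModEt.etale AzuEt.isFinite AzuEt.etale

variable {S d r}

namespace ModEt

/-- The sheaf of isomorphisms from the split pair. -/
def isom (x : ModEt S d r) : RightGSet (wreath (GLFun.{u} r) d S) :=
  splitIsos x.f (frames x.M r) d

/-- The norm of the module. -/
def norm (x : ModEt S d r) : OMod S := normMod x.f d x.M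

/-- Isomorphism of pairs. -/
def Iso (x y : ModEt S d r) : Prop :=
  ∃ g : x.T ≅ y.T, g.hom ≫ y.f = x.f ∧ Nonempty (ModIso g.hom x.M y.M)

end ModEt

namespace AzuEt

/-- The sheaf of isomorphisms from the split pair. -/
def isom (x : AzuEt S d r) : RightGSet (wreath (PGLFun.{u} r) d S) :=
  splitIsos x.f (algFrames x.A r) d

/-- The norm of the underlying module of the algebra. -/
def norm (x : AzuEt S d r) : OMod S := normMod x.f d x.M

/-- The condition that an algebra structure on the norm is the norm of the given algebra: the
universal norm is multiplicative and preserves the unit. -/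
structure IsNormAlg (x : AzuEt S d r) (B : AlgStr x.norm) : Prop where
  one_eq (X : Over S) : B.one X = nu x.f d x.M X (x.A.one ((Over.pullback x.f).obj X))
  mul_nu (X : Over S) (a b : Sec x.M ((Over.pullback x.f).obj X)) :
    B.mul X (nu x.f d x.M X a) (nu x.f d x.M X b) =
      nu x.f d x.M X (x.A.mul ((Over.pullback x.f).obj X) a b)

/-- Isomorphism of pairs. -/
def Iso (x y : AzuEt S d r) : Prop :=
  ∃ g : x.T ≅ y.T, g.hom ≫ y.f = x.f ∧ ∃ e : ModIso g.hom x.M y.M,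
    ∀ Y : Over x.T, e.app Y (x.A.one Y) = y.A.one (Over.mk (Y.hom ≫ g.hom)) ∧
      ∀ a b : Sec x.M Y, e.app Y (x.A.mul Y a b) =
        y.A.mul (Over.mk (Y.hom ≫ g.hom)) (e.app Y a) (e.app Y b)

end AzuEt

end Pairs

end

end SegreNorm

/-!
# The norm along a finite étale morphism and the Segre homomorphisms

A torsor `P` under a sheaf of groups `G` twists every sheaf `E` with an action of `G`: the sections
of the twist over `X` are the equivariant families `P(Y) → E(Y)` for `Y` over `X` (`EqvSec`).
Conversely, a family of bijections `E(X) ≃ B(X)`, natural and equivariant in the point of `P(X)` by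
which it is indexed, exhibits `B` as that twist (`Framing`, and `ModFraming` for modules). A point
of `P` thus acts as a system of coordinates on `B`, and each identification needed for the theorem
is made by writing down such coordinates. In particular, if a module is framed by `P` through a
homomorphism from `G` to a general linear group, then it is locally free, and its torsor of frames
is the contracted product of `P` along that homomorphism (`ModFraming.isom_push_frames`); the same
holds for Azumaya algebras and automorphisms of matrix algebras (`IsAlg.isom_push_frames`).

*The class of a pair.* A finite étale morphism of degree `d` is locally the projection from `d`
copies of the base (`exists_split_cover`, `exists_isSplitting`), and a torsor on its source has
local sections over all `d` copies at once. So the isomorphisms from the split pair form a torsor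
under the semidirect product (`isTorsor_splitIsos`). The scheme `T` is the twist of the constant
scheme of indices, and the total space of the torsor on `T` is the twist of the sheaf of pairs of an
index and an element of the group; hence an isomorphism between the torsors of two pairs induces an
isomorphism of the pairs (`exists_torsorMap`). Given a torsor under the semidirect product, `T` is
the relative spectrum of the twist of the algebra of functions on the indices (`exists_idxSpec`,
`IdxSpec.framing`). The equivariant families of pairs whose index is that of the tautological point
form a torsor on `T` (`isTorsor_baseTorsor`), and the resulting pair has the given class
(`isom_splitIsos_baseTorsor`).

*The norm.* Let the algebra `A` be split over `R`, and let `M` be the product of free components. The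
norm of `A` is the product of the components (`normPoly_split`), and successive contraction with
coordinate forms of the `d` components defines functionals on `Γ^d(M)` which are compatible with
the relations of the norm (`gamEval_gamAct`). They identify the norm of `M` with the tensor product
of the components. This is proved in the stronger form that, for an algebra which splits after a
base change, the map from the norm to that tensor product is itself a base change (`isBC_normEval`).
Sheaves of modules that are locally free are quasi-coherent (`isBC_res`), so faithfully flat descent
applies (`IsBC.of_comp`): the norm of `M`, which over any isomorphism with the split pair has
the coordinates given by tensor products, is the module associated with the torsor of the pair by
way of the Segre homomorphism (`normFraming`, `NormSec.bijective_toAssocLin`). Together with the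
description of frames this gives the map induced by the Segre homomorphism.

*Algebras.* In the coordinates given by a point of the torsor, the universal norm of a section is
the Kronecker product of the matrices of its components. Such products span the matrix algebra and
multiply factor by factor. Hence an algebra structure on the norm for which the universal norm is
multiplicative and unital is the one for which the coordinates are isomorphisms of algebras
(`isAlg_algNormFraming_iff`), which gives both its existence and its uniqueness.
-/

universe w w' w''

set_option linter.unusedSectionVars false

namespace SegreNorm

noncomputable section

/-! ### Sheaves on a site -/

section Sheaf

variable {C : Type w''} [Category.{w'} C] {J : GrothendieckTopology C} {F : Cᵒᵖ ⥤ Type w}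
  (hF : Presieve.IsSheaf J F)
include hF

theorem sheaf_ext {X : C} {R : Sieve X} (hR : R ∈ J X) {a b : F.obj (op X)}
    (h : ∀ (Y : C) (f : Y ⟶ X), R f → F.map f.op a = F.map f.op b) : a = b :=
  (hF R hR).isSeparatedFor.ext fun Y f hf => h Y f hf

theorem sheaf_glue {X : C} {R : Sieve X} (hR : R ∈ J X)
    (x : ∀ (Y : C) (f : Y ⟶ X), R f → F.obj (op Y))
    (hx : ∀ (Y Z : C) (f : Y ⟶ X) (g : Z ⟶ Y) (hf : R f),
      x Z (g ≫ f) (R.downward_closed hf g) = F.map g.op (x Y f hf)) :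
    ∃ t : F.obj (op X), ∀ (Y : C) (f : Y ⟶ X) (hf : R f), F.map f.op t = x Y f hf := by
  let x' : Presieve.FamilyOfElements F R.arrows := fun Y f hf => x Y f hf
  have hx' : x'.Compatible := by
    rw [Presieve.compatible_iff_sieveCompatible]
    exact fun Y Z f g hf => hx Y Z f g hf
  obtain ⟨t, ht, -⟩ := hF R hR x' hx'
  exact ⟨t, fun Y f hf => ht f hf⟩

end Sheaf

/-! ### The fppf site -/

section Site

theorem isZariskiLocalAtSource_of_ringHom (P : MorphismProperty Scheme.{u})
    {Q : ∀ {R S : Type u} [CommRing R] [CommRing S], (R →+* S) → Prop}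
    [HasRingHomProperty P Q] : IsZariskiLocalAtSource P := inferInstance

variable {S : Scheme.{u}}

theorem fppf_ofArrows {ι : Type w} {X : Over S} (Y : ι → Over S) (f : ∀ i, Y i ⟶ X)
    (h1 : ∀ i, Flat (f i).left) (h2 : ∀ i, LocallyOfFinitePresentation (f i).left)
    (h3 : ∀ x : X.left, ∃ i, ∃ y, (f i).left y = x) : Sieve.ofArrows Y f ∈ fppf S X := by
  rw [GrothendieckTopology.mem_over_iff, Sieve.overEquiv_ofArrows]
  refine Precoverage.generate_mem_toGrothendieck ?_
  rw [Scheme.fppfPrecoverage, Scheme.ofArrows_mem_precoverage_iff]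
  exact ⟨fun x => h3 x, fun i => ⟨h1 i, h2 i⟩⟩

theorem fppf_singleton {X Y : Over S} (f : Y ⟶ X) [Flat f.left] [Surjective f.left]
    [LocallyOfFinitePresentation f.left] : Sieve.generate (Presieve.singleton f) ∈ fppf S X := by
  rw [← Presieve.ofArrows_pUnit.{0}]
  refine fppf_ofArrows (fun _ : PUnit => Y) (fun _ => f) (fun _ => inferInstance)
    (fun _ => inferInstance) fun x => ?_
  obtain ⟨y, hy⟩ := f.left.surjective x
  exact ⟨⟨⟩, y, hy⟩

theorem fppf_of_isEmpty {X : Over S} [IsEmpty X.left] (R : Sieve X) : R ∈ fppf S X := by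
  have := fppf_ofArrows (S := S) (X := X) (ι := PEmpty.{1}) (fun i => i.elim) (fun i => i.elim)
    (fun i => i.elim) (fun i => i.elim) (fun x => isEmptyElim x)
  refine (fppf S).superset_covering ?_ this
  rw [Sieve.ofArrows, Sieve.generate_le_iff, Presieve.ofArrows_le_iff]
  exact fun i => i.elim

/-- A sieve containing all morphisms from affine schemes that lie over open subsets of a given
open cover is covering. -/
theorem fppf_of_affine {X : Over S} (R : Sieve X) {ι : Type w} (O : ι → X.left.Opens)
    (hO : ∀ x, ∃ i, x ∈ O i)
    (h : ∀ (i : ι) (U : Over S) (u : U ⟶ X), IsAffine U.left → IsOpenImmersion u.left →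
      (∀ y, u.left y ∈ O i) → R u) : R ∈ fppf S X := by
  have key : ∀ x : X.left, ∃ V : X.left.Opens, ∃ i, IsAffineOpen V ∧ x ∈ V ∧ V ≤ O i := by
    intro x
    obtain ⟨i, hi⟩ := hO x
    obtain ⟨_, ⟨V, hV, rfl⟩, hx, hVO⟩ :=
      X.left.isBasis_affineOpens.exists_subset_of_mem_open hi (O i).2
    exact ⟨V, i, hV, hx, hVO⟩
  choose V i hV hx hVO using key
  refine (fppf S).superset_covering ?_ (fppf_ofArrows (S := S) (X := X) (ι := X.left)
    (fun x => Over.mk ((V x).ι ≫ X.hom)) (fun x => Over.homMk (V x).ι)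
    (fun x => show Flat (V x).ι from inferInstance)
    (fun x => show LocallyOfFinitePresentation (V x).ι from inferInstance)
    (fun x => ⟨x, ⟨x, hx x⟩, rfl⟩))
  rw [Sieve.ofArrows, Sieve.generate_le_iff, Presieve.ofArrows_le_iff]
  intro x
  refine h (i x) _ _ (hV x) (inferInstanceAs (IsOpenImmersion (V x).ι)) fun y => hVO x ?_
  exact y.2

theorem fppf_of_forall_affine {X : Over S} (R : Sieve X)
    (h : ∀ (U : Over S) (u : U ⟶ X), IsAffine U.left → R u) : R ∈ fppf S X :=
  fppf_of_affine R (ι := PUnit.{1}) (fun _ => ⊤) (fun _ => ⟨⟨⟩, trivial⟩) fun _ U u hU _ _ => h U u hU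

variable {F : (Over S)ᵒᵖ ⥤ Type w} (hF : Presieve.IsSheaf (fppf S) F)
include hF

theorem sheaf_subsingleton {X : Over S} [IsEmpty X.left] (a b : F.obj (op X)) : a = b :=
  sheaf_ext hF (fppf_of_isEmpty ⊥) fun _ _ h => h.elim

theorem sheaf_ext_affine {X : Over S} {a b : F.obj (op X)}
    (h : ∀ (U : Over S) (u : U ⟶ X), IsAffine U.left → F.map u.op a = F.map u.op b) : a = b :=
  sheaf_ext hF (R := Sieve.generate fun U _ => IsAffine U.left)
    (fppf_of_forall_affine _ fun _ u hU => Sieve.le_generate _ _ _ hU) (by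
    rintro Y _ ⟨U, g, u, hU, rfl⟩
    rw [op_comp, F.map_comp, types_comp_apply, types_comp_apply, h U u hU])

/-- A sheaf is determined by its sections over affine schemes. -/
theorem sheaf_glue_affine {X : Over S}
    (x : ∀ (U : Over S) (_ : U ⟶ X), IsAffine U.left → F.obj (op U))
    (hx : ∀ (U V : Over S) (u : U ⟶ X) (v : V ⟶ U) (hU : IsAffine U.left) (hV : IsAffine V.left),
      F.map v.op (x U u hU) = x V (v ≫ u) hV) :
    ∃ t : F.obj (op X), ∀ (U : Over S) (u : U ⟶ X) (hU : IsAffine U.left),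
      F.map u.op t = x U u hU := by
  let R : Presieve X := fun U _ => IsAffine U.left
  have hR : Presieve.IsSheafFor F R := by
    rw [Presieve.isSheafFor_iff_generate]
    exact hF _ (fppf_of_forall_affine _ fun _ u hU => Sieve.le_generate _ _ _ hU)
  obtain ⟨t, ht, -⟩ := hR (fun U u hU => x U u hU) (by
    intro Y₁ Y₂ Z g₁ g₂ f₁ f₂ h₁ h₂ e
    refine sheaf_ext_affine hF fun W w hW => ?_
    have h3 : ∀ (u u' : W ⟶ X) (_ : u = u'), x W u hW = x W u' hW := by rintro u _ rfl; rfl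
    change F.map w.op (F.map g₁.op (x Y₁ f₁ h₁)) = F.map w.op (F.map g₂.op (x Y₂ f₂ h₂))
    rw [← types_comp_apply (F.map g₁.op), ← F.map_comp, ← op_comp, hx _ _ _ _ h₁ hW,
      ← types_comp_apply (F.map g₂.op), ← F.map_comp, ← op_comp, hx _ _ _ _ h₂ hW]
    exact h3 _ _ (by rw [Category.assoc, Category.assoc, e]))
  exact ⟨t, fun U u hU => ht u hU⟩

/-- The sections of a sheaf over a disjoint union are the families of sections over its parts. -/
theorem sheaf_disjoint {ι : Type w'} {X : Over S} (V : ι → Over S) (s : ∀ i, V i ⟶ X)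
    (hs : Sieve.ofArrows V s ∈ fppf S X) [∀ i, Mono (s i)]
    (hd : ∀ i j, i ≠ j → ∀ (v : (V i).left) (w : (V j).left), (s i).left v ≠ (s j).left w)
    (x : ∀ i, F.obj (op (V i))) : ∃! t : F.obj (op X), ∀ i, F.map (s i).op t = x i := by
  have h : Presieve.IsSheafFor F (Presieve.ofArrows V s) := by
    rw [Presieve.isSheafFor_iff_generate]; exact hF _ hs
  rw [Presieve.isSheafFor_arrows_iff] at h
  refine h x fun i j Z g g' e => ?_
  by_cases hij : i = j
  · subst hij
    rw [cancel_mono] at e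
    rw [e]
  · have : IsEmpty Z.left := ⟨fun z => hd i j hij (g.left z) (g'.left z) (by
      rw [← Scheme.Hom.comp_apply, ← Scheme.Hom.comp_apply]
      exact congrArg (fun k : Z ⟶ X => k.left z) e)⟩
    exact sheaf_subsingleton hF _ _

/-- A sheaf which has sections locally on an affine scheme has one over a single affine fppf cover
of it: by quasi-compactness finitely many affine schemes suffice to cover, and their disjoint union
is affine. -/
theorem exists_affine_cover {X : Over S} [IsAffine X.left] {R : Sieve X} (hR : R ∈ fppf S X)
    (hne : ∀ (Y : Over S) (f : Y ⟶ X), R f → Nonempty (F.obj (op Y))) :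
    ∃ (V : Over S) (v : V ⟶ X), IsAffine V.left ∧ Flat v.left ∧ Surjective v.left ∧
      LocallyOfFinitePresentation v.left ∧ Nonempty (F.obj (op V)) := by
  rw [GrothendieckTopology.mem_over_iff] at hR
  have h0 : Scheme.fppfPrecoverage.HasIsos := by
    have : (@Flat ⊓ @LocallyOfFinitePresentation : MorphismProperty Scheme.{u}).RespectsIso :=
      { precomp := by
          rintro X Y Z i (hi : IsIso i) f ⟨_, _⟩
          exact ⟨inferInstance, inferInstance⟩
        postcomp := by
          rintro X Y Z i (hi : IsIso i) f ⟨_, _⟩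
          exact ⟨inferInstance, inferInstance⟩ }
    have : (@Flat ⊓ @LocallyOfFinitePresentation :
        MorphismProperty Scheme.{u}).ContainsIdentities :=
      ⟨fun X => ⟨inferInstance, inferInstance⟩⟩
    exact inferInstanceAs (Scheme.precoverage (@Flat ⊓ @LocallyOfFinitePresentation)).HasIsos
  have h1 : Scheme.fppfPrecoverage.HasPullbacks := inferInstance
  obtain ⟨R', hR', hle⟩ :=
    Precoverage.mem_toGrothendieck_iff_of_isStableUnderComposition.1 hR
  rw [Precoverage.mem_iff_exists_zeroHypercover] at hR'
  obtain ⟨E, rfl⟩ := hR'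
  let E' : X.left.Cover (Scheme.precoverage (@Flat ⊓ @LocallyOfFinitePresentation)) := E
  have hE : ∀ i, (@Flat ⊓ @LocallyOfFinitePresentation : MorphismProperty Scheme) (E'.f i) :=
    fun i => E'.map_prop i
  have : QuasiCompactCover E'.toPreZeroHypercover :=
    QuasiCompactCover.of_isOpenMap fun i =>
      have := (hE i).1; have := (hE i).2; (E'.f i).isOpenMap
  have : MorphismProperty.RespectsLeft (@Flat ⊓ @LocallyOfFinitePresentation)
      (@IsOpenImmersion : MorphismProperty Scheme.{u}) :=
    ⟨by rintro X Y Z i hi f ⟨_, _⟩; exact ⟨inferInstance, inferInstance⟩⟩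
  -- the maps of the cover are open, so finitely many affine opens of its members suffice
  obtain ⟨𝒱, a, hfin, -⟩ := QuasiCompactCover.exists_hom E'
  have hle' : ∀ i, R (Over.homMk (E.f i) : Over.mk (E.f i ≫ X.hom) ⟶ X) := fun i =>
    (Sieve.overEquiv_iff R (E.f i)).1 (hle _ _ ⟨i⟩)
  have ha : ∀ j, a.h₀ j ≫ E.f (a.s₀ j) = 𝒱.f j := fun j => a.w₀ j
  have hflat : ∀ j, Flat (𝒱.f j) := fun j => (𝒱.map_prop j).1
  have hlfp : ∀ j, LocallyOfFinitePresentation (𝒱.f j) := fun j => (𝒱.map_prop j).2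
  -- the disjoint union of the finitely many affine schemes, over which sections are families
  let v : ∐ (fun j => Spec (𝒱.X j)) ⟶ X.left := Limits.Sigma.desc 𝒱.f
  let V : Over S := Over.mk (v ≫ X.hom)
  let W (j) : Over S := Over.mk (Limits.Sigma.ι (fun j => Spec (𝒱.X j)) j ≫ V.hom)
  let s (j) : W j ⟶ V := Over.homMk (Limits.Sigma.ι (fun j => Spec (𝒱.X j)) j)
  have hs : Sieve.ofArrows W s ∈ fppf S V := by
    refine fppf_ofArrows W s
      (fun j => inferInstanceAs (Flat (Limits.Sigma.ι (fun j => Spec (𝒱.X j)) j)))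
      (fun j => inferInstanceAs (LocallyOfFinitePresentation
        (Limits.Sigma.ι (fun j => Spec (𝒱.X j)) j))) fun x => ?_
    obtain ⟨y, hy⟩ := (sigmaOpenCover fun j => Spec (𝒱.X j)).covers x
    exact ⟨_, y, hy⟩
  have hmono : ∀ j, Mono (s j) := fun j =>
    have : Mono (s j).left := inferInstanceAs (Mono (Limits.Sigma.ι (fun j => Spec (𝒱.X j)) j))
    Over.mono_of_mono_left (s j)
  have hW : ∀ j, Nonempty (F.obj (op (W j))) := fun j => by
    obtain ⟨y⟩ := hne _ _ (hle' (a.s₀ j))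
    refine ⟨F.map (Quiver.Hom.op (Over.homMk (a.h₀ j) ?_)) y⟩
    change a.h₀ j ≫ E.f (a.s₀ j) ≫ X.hom = Limits.Sigma.ι (fun j => Spec (𝒱.X j)) j ≫ v ≫ X.hom
    rw [reassoc_of% (ha j), Limits.Sigma.ι_desc_assoc]
    rfl
  obtain ⟨t, -⟩ := sheaf_disjoint hF W s hs (fun i j hij x y h => hij
    (congrArg Sigma.fst ((sigmaι_eq_iff (fun j => Spec (𝒱.X j)) i j x y).1 h)))
    fun j => (hW j).some
  refine ⟨V, Over.homMk v, ?_, ?_, ?_, ?_, ⟨t⟩⟩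
  · exact inferInstanceAs (IsAffine (∐ (fun j => Spec (𝒱.X j))))
  · have := isZariskiLocalAtSource_of_ringHom @Flat.{u}
    exact IsZariskiLocalAtSource.sigmaDesc hflat
  · refine Surjective.sigmaDesc_of_union_range_eq_univ (Set.eq_univ_of_forall fun x => ?_)
    exact Set.mem_iUnion.2 ⟨𝒱.idx x, 𝒱.covers x⟩
  · have := isZariskiLocalAtSource_of_ringHom @LocallyOfFinitePresentation.{u}
    exact IsZariskiLocalAtSource.sigmaDesc hlfp

end Site

/-! ### Maps of torsors and equivariant families -/

section TorsorMaps

variable {C : Type (u + 1)} [Category.{u} C] {J : GrothendieckTopology C}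
  {G H : Cᵒᵖ ⥤ GrpCat.{u}} {P : RightGSet G}

theorem RightGSet.map_comp_apply (P : RightGSet G) {X Y Z : Cᵒᵖ} (f : X ⟶ Y) (g : Y ⟶ Z)
    (p : P.F.obj X) : P.F.map (f ≫ g) p = P.F.map g (P.F.map f p) := by
  rw [P.F.map_comp]; rfl

theorem RightGSet.map_id_apply (P : RightGSet G) {X : Cᵒᵖ} (p : P.F.obj X) :
    P.F.map (𝟙 X) p = p := by
  rw [P.F.map_id]; rfl

namespace IsTorsor

variable (hP : IsTorsor J P)

/-- The unique section `g` with `p · g = q`. -/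
def diff {X : Cᵒᵖ} (p q : P.F.obj X) : G.obj X := (hP.simply_transitive p q).choose

@[simp]
theorem act_diff {X : Cᵒᵖ} (p q : P.F.obj X) : P.act p (hP.diff p q) = q :=
  (hP.simply_transitive p q).choose_spec.1

theorem diff_eq {X : Cᵒᵖ} {p q : P.F.obj X} {g : G.obj X} (h : P.act p g = q) :
    hP.diff p q = g :=
  ((hP.simply_transitive p q).choose_spec.2 g h).symm

include hP in
theorem act_injective {X : Cᵒᵖ} (p : P.F.obj X) {g g' : G.obj X} (h : P.act p g = P.act p g') :
    g = g' := (hP.diff_eq h).symm.trans (hP.diff_eq rfl)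

theorem map_diff {X Y : Cᵒᵖ} (f : X ⟶ Y) (p q : P.F.obj X) :
    G.map f (hP.diff p q) = hP.diff (P.F.map f p) (P.F.map f q) :=
  (hP.diff_eq (by rw [← P.act_map, hP.act_diff])).symm

theorem diff_act_right {X : Cᵒᵖ} (p q : P.F.obj X) (g : G.obj X) :
    hP.diff p (P.act q g) = hP.diff p q * g :=
  hP.diff_eq (by rw [hP.act_mul, hP.act_diff])

theorem diff_act_left {X : Cᵒᵖ} (p q : P.F.obj X) (g : G.obj X) :
    hP.diff (P.act p g) q = g⁻¹ * hP.diff p q :=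
  hP.diff_eq (by rw [← hP.act_mul, mul_inv_cancel_left, hP.act_diff])

/-- The sieve of the objects over `X` on which `P` has a section. -/
def sieve (P : RightGSet G) (X : C) : Sieve X where
  arrows Y _ := Nonempty (P.F.obj (op Y))
  downward_closed := fun ⟨p⟩ g => ⟨P.F.map g.op p⟩

include hP in
theorem sieve_mem (X : C) : sieve P X ∈ J X := by
  obtain ⟨R, hR, h⟩ := hP.locally_nonempty X
  exact J.superset_covering (fun Y f hf => h Y f hf) hR

end IsTorsor

/-- A natural equivariant map between torsors is an isomorphism. -/
theorem isom_of_map {Q : RightGSet G} (hP : IsTorsor J P) (hQ : IsTorsor J Q)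
    (f : ∀ X, P.F.obj X → Q.F.obj X)
    (hf : ∀ (X Y : Cᵒᵖ) (u : X ⟶ Y) (p : P.F.obj X), f Y (P.F.map u p) = Q.F.map u (f X p))
    (hf' : ∀ (X : Cᵒᵖ) (p : P.F.obj X) (g : G.obj X), f X (P.act p g) = Q.act (f X p) g) :
    P.Isom Q := by
  have hinj : ∀ X, Function.Injective (f X) := fun X p q h => by
    rw [← hP.act_diff p q, hf'] at h
    have := hQ.act_injective (f X p) ((hQ.act_one _).trans h)
    rw [← hP.act_diff p q, ← this, hP.act_one]
  have hsurj : ∀ X, Function.Surjective (f X) := by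
    rintro ⟨X⟩ q
    have key : ∀ (Y : C) (y : Y ⟶ X), IsTorsor.sieve P X y →
        ∃ p, f (op Y) p = Q.F.map y.op q := by
      rintro Y y ⟨p⟩
      exact ⟨P.act p (hQ.diff (f _ p) (Q.F.map y.op q)), by rw [hf', hQ.act_diff]⟩
    choose p hp using key
    obtain ⟨t, ht⟩ := sheaf_glue hP.isSheaf (hP.sieve_mem X) p (by
      intro Y Z y z hy
      apply hinj
      rw [hp, hf, hp, op_comp, Q.map_comp_apply])
    refine ⟨t, sheaf_ext hQ.isSheaf (hP.sieve_mem X) fun Y y hy => ?_⟩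
    rw [← hf, ht _ _ hy, hp]
  refine ⟨NatIso.ofComponents (fun X => (Equiv.ofBijective (f X) ⟨hinj X, hsurj X⟩).toIso)
    fun {X Y} u => ?_, hf'⟩
  ext p
  exact hf X Y u p

/-- A torsor receiving a map from `P` that is equivariant along `φ` is the contracted product. -/
theorem isom_push_of_map {φ : G ⟶ H} {Q : RightGSet H} (hH : Presieve.IsSheaf J (H ⋙ forget GrpCat))
    (hP : IsTorsor J P) (hQ : IsTorsor J Q) (f : ∀ X, P.F.obj X → Q.F.obj X)
    (hf : ∀ (X Y : Cᵒᵖ) (u : X ⟶ Y) (p : P.F.obj X), f Y (P.F.map u p) = Q.F.map u (f X p))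
    (hf' : ∀ (X : Cᵒᵖ) (p : P.F.obj X) (g : G.obj X),
      f X (P.act p g) = Q.act (f X p) (φ.app X g)) :
    (P.push φ).Isom Q := by
  refine (torsorSetoid J H).symm (a := ⟨Q, hQ⟩) (b := ⟨P.push φ, isTorsor_push hH hP⟩)
    (isom_of_map hQ (isTorsor_push hH hP) (fun X q => (
      { app := fun Y y p => hQ.diff (f _ p) (Q.F.map y.op q)
        app_map := fun Y Z y z p => by
          rw [hQ.map_diff, hf, op_comp, Q.map_comp_apply]
        app_act := fun Y y p g => by
          rw [hf', hQ.diff_act_left] } : PushSection φ P X.unop)) ?_ ?_)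
  · intro X Y u q
    apply PushSection.ext
    funext Z z p
    change hQ.diff _ _ = hQ.diff _ _
    rw [op_comp, Q.map_comp_apply]
    rfl
  · intro X q g
    apply PushSection.ext
    funext Z z p
    change hQ.diff _ _ = hQ.diff _ _ * _
    rw [Q.act_map, hQ.diff_act_right]

/-- A presheaf of sets with a right action of a presheaf of groups. -/
structure GSet (G : Cᵒᵖ ⥤ GrpCat.{u}) where
  /-- the underlying presheaf -/
  F : Cᵒᵖ ⥤ Type w
  /-- the action -/
  act {X : Cᵒᵖ} : F.obj X → G.obj X → F.obj X
  act_map {X Y : Cᵒᵖ} (f : X ⟶ Y) (p : F.obj X) (g : G.obj X) :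
    F.map f (act p g) = act (F.map f p) (G.map f g)
  act_one {X : Cᵒᵖ} (p : F.obj X) : act p 1 = p
  act_mul {X : Cᵒᵖ} (p : F.obj X) (g h : G.obj X) : act p (g * h) = act (act p g) h

/-- Sections over `X` of the twist of `E` by the torsor `P`: natural equivariant families of maps
`P(Y) → E(Y)`, for `Y ⟶ X`. -/
@[ext]
structure EqvSec (P : RightGSet G) (E : GSet.{u, w} G) (X : C) : Type (max (u + 1) w) where
  /-- the family of maps -/
  app (Y : C) (y : Y ⟶ X) (p : P.F.obj (op Y)) : E.F.obj (op Y)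
  app_map (Y Z : C) (y : Y ⟶ X) (z : Z ⟶ Y) (p : P.F.obj (op Y)) :
    app Z (z ≫ y) (P.F.map z.op p) = E.F.map z.op (app Y y p)
  app_act (Y : C) (y : Y ⟶ X) (p : P.F.obj (op Y)) (g : G.obj (op Y)) :
    app Y y (P.act p g) = E.act (app Y y p) g

namespace EqvSec

variable {E : GSet.{u, w} G}

/-- Restriction of sections. -/
def res {X X' : C} (f : X' ⟶ X) (s : EqvSec P E X) : EqvSec P E X' where
  app Y y p := s.app Y (y ≫ f) p
  app_map Y Z y z p := by rw [Category.assoc, s.app_map]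
  app_act Y y p g := s.app_act Y _ p g

theorem app_congr {X Y : C} (s : EqvSec P E X) {y y' : Y ⟶ X} (h : y = y')
    (p : P.F.obj (op Y)) : s.app Y y p = s.app Y y' p := by rw [h]

variable (P E) in
/-- The twist of `E` by `P`, as a presheaf. -/
def presheaf : Cᵒᵖ ⥤ Type (max (u + 1) w) where
  obj X := EqvSec P E X.unop
  map f := TypeCat.ofHom (res f.unop)
  map_id X := by
    ext s Y y p
    exact s.app_congr (Category.comp_id y) p
  map_comp f g := by
    ext s Y y p
    exact s.app_congr (Category.assoc y _ _).symm p

theorem ext_of_locally (hE : Presieve.IsSheaf J E.F) {X : C} {R : Sieve X} (hR : R ∈ J X)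
    {s t : EqvSec P E X} (h : ∀ (Y : C) (f : Y ⟶ X) (p : P.F.obj (op Y)), R f →
      s.app Y f p = t.app Y f p) : s = t := by
  refine EqvSec.ext (funext fun Y => funext fun y => funext fun p =>
    sheaf_ext hE (J.pullback_stable y hR) fun Z z hz => ?_)
  rw [← s.app_map, ← t.app_map]
  exact h _ _ _ hz

theorem ext_of_point (hP : IsTorsor J P) {X : C} {s t : EqvSec P E X} (p : P.F.obj (op X))
    (h : s.app X (𝟙 X) p = t.app X (𝟙 X) p) : s = t := by
  refine EqvSec.ext (funext fun Y => funext fun y => funext fun q => ?_)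
  rw [← hP.act_diff (P.F.map y.op p) q, s.app_act, t.app_act,
    ← s.app_congr (Category.comp_id y), ← t.app_congr (Category.comp_id y), s.app_map, t.app_map, h]

/-- The section with a given value at a given point of the torsor. -/
def ofPoint (hP : IsTorsor J P) {X : C} (p : P.F.obj (op X)) (e : E.F.obj (op X)) :
    EqvSec P E X where
  app Y y q := E.act (E.F.map y.op e) (hP.diff (P.F.map y.op p) q)
  app_map Y Z y z q := by
    rw [E.act_map, hP.map_diff, op_comp, P.map_comp_apply, E.F.map_comp]
    rfl
  app_act Y y q g := by rw [hP.diff_act_right, E.act_mul]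

theorem ofPoint_app (hP : IsTorsor J P) {X : C} (p : P.F.obj (op X)) (e : E.F.obj (op X))
    (Y : C) (y : Y ⟶ X) : (ofPoint hP p e).app Y y (P.F.map y.op p) = E.F.map y.op e := by
  change E.act _ _ = _
  rw [hP.diff_eq (hP.act_one _), E.act_one]

theorem ofPoint_app_self (hP : IsTorsor J P) {X : C} (p : P.F.obj (op X)) (e : E.F.obj (op X)) :
    (ofPoint hP p e).app X (𝟙 X) p = e := by
  have := ofPoint_app hP p e X (𝟙 X)
  rwa [op_id, P.map_id_apply, E.F.map_id] at this

/-- The twist of a sheaf by a torsor is a sheaf. The value of the glued family at a point of the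
torsor is obtained by gluing the given values at the restrictions of that point. -/
theorem isSheaf_presheaf (hE : Presieve.IsSheaf J E.F) : Presieve.IsSheaf J (presheaf P E) := by
  intro X R hR x hx
  rw [Presieve.compatible_iff_sieveCompatible] at hx
  let x' : ∀ (Y : C) (f : Y ⟶ X), R f → EqvSec P E Y := fun Y f hf => x f hf
  have h3 : ∀ (Y W : C) (f f' : Y ⟶ X) (_ : f = f') (hf : R f) (hf' : R f') (w : W ⟶ Y)
      (p : P.F.obj (op W)), (x' Y f hf).app W w p = (x' Y f' hf').app W w p := by
    rintro Y W f _ rfl _ _ w p; rfl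
  have hx' : ∀ (Y Z W : C) (f : Y ⟶ X) (g : Z ⟶ Y) (hf : R f) (hg : R (g ≫ f)) (w : W ⟶ Z)
      (p : P.F.obj (op W)), (x' Z (g ≫ f) hg).app W w p = (x' Y f hf).app W (w ≫ g) p :=
    fun Y Z W f g hf hg w p => congrArg (fun s : EqvSec P E Z => s.app W w p) (hx f g hf)
  -- the value at a point, glued from the values of the local families at its restrictions
  have key : ∀ (Y : C) (y : Y ⟶ X) (p : P.F.obj (op Y)), ∃ h : E.F.obj (op Y),
      ∀ (Z : C) (z : Z ⟶ Y) (hz : R (z ≫ y)),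
        E.F.map z.op h = (x' Z (z ≫ y) hz).app Z (𝟙 Z) (P.F.map z.op p) := by
    intro Y y p
    refine sheaf_glue hE (J.pullback_stable y hR)
      (fun Z z hz => (x' Z (z ≫ y) hz).app Z (𝟙 Z) (P.F.map z.op p)) ?_
    intro Z W z w hz
    have hz' : R (z ≫ y) := hz
    have hw : R ((w ≫ z) ≫ y) := by
      rw [Category.assoc]; exact R.downward_closed hz' w
    have e1 := h3 W W _ _ (Category.assoc w z y) hw (R.downward_closed hz' w) (𝟙 W)
      (P.F.map (w ≫ z).op p)
    have e2 := hx' Z W W (z ≫ y) w hz' (R.downward_closed hz' w) (𝟙 W) (P.F.map (w ≫ z).op p)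
    have e3 := app_congr (x' Z (z ≫ y) hz') (show 𝟙 W ≫ w = w ≫ 𝟙 Z by simp)
      (P.F.map (w ≫ z).op p)
    have e4 := (x' Z (z ≫ y) hz').app_map Z W (𝟙 Z) w (P.F.map z.op p)
    rw [← P.map_comp_apply, ← op_comp] at e4
    exact e1.trans (e2.trans (e3.trans e4))
  choose h hh using key
  let s : EqvSec P E X :=
    { app := h
      app_map := by
        intro Y Z y z p
        refine sheaf_ext hE (J.pullback_stable (z ≫ y) hR) fun W w hw => ?_
        have hw' : R ((w ≫ z) ≫ y) := by rw [Category.assoc]; exact hw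
        have := hh Y y p W (w ≫ z) hw'
        rw [op_comp, E.F.map_comp] at this
        refine (hh _ _ _ _ _ hw).trans (Eq.trans ?_ this.symm)
        rw [h3 W W _ _ (Category.assoc w z y) hw' hw, P.map_comp_apply]
      app_act := by
        intro Y y p g
        refine sheaf_ext hE (J.pullback_stable y hR) fun W w hw => ?_
        rw [hh _ _ _ _ _ hw, E.act_map, hh _ _ _ _ _ hw, P.act_map, EqvSec.app_act] }
  have hs : ∀ (Y Z : C) (f : Y ⟶ X) (hf : R f) (y : Z ⟶ Y) (p : P.F.obj (op Z)),
      s.app Z (y ≫ f) p = (x' Y f hf).app Z y p := by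
    intro Y Z f hf y p
    have hz : R (𝟙 Z ≫ y ≫ f) := by
      rw [Category.id_comp]; exact R.downward_closed hf y
    have := hh Z (y ≫ f) p Z (𝟙 Z) hz
    rw [op_id, E.F.map_id, P.map_id_apply] at this
    refine Eq.trans this ?_
    rw [h3 Z Z _ _ (Category.id_comp _) hz (R.downward_closed hf y), hx' _ _ _ _ _ hf]
    exact app_congr _ (Category.id_comp y) _
  refine ⟨s, fun Y f hf => ?_, fun t ht => ?_⟩
  · exact EqvSec.ext (funext fun Z => funext fun y => funext fun p => hs Y Z f hf y p)
  · refine ext_of_locally (s := t) (t := s) hE hR fun Y f p hf => ?_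
    have h5 := hs Y Y f hf (𝟙 Y) p
    rw [s.app_congr (Category.id_comp f)] at h5
    rw [h5]
    have h6 : x' Y f hf = res f t := (ht _ hf).symm
    rw [h6]
    exact (app_congr (X := X) t (Category.id_comp f) p).symm

end EqvSec

end TorsorMaps

/-! ### Gluing morphisms of sheaves -/

section GlueHom

variable {C : Type (u + 1)} [Category.{u} C] {J : GrothendieckTopology C}
  {A : Cᵒᵖ ⥤ Type w} {B : Cᵒᵖ ⥤ Type w'}

theorem map_comp_apply' (A : Cᵒᵖ ⥤ Type w) {X Y Z : Cᵒᵖ} (f : X ⟶ Y) (g : Y ⟶ Z) (a : A.obj X) :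
    A.map (f ≫ g) a = A.map g (A.map f a) := by
  rw [A.map_comp]; rfl

theorem map_id_apply' (A : Cᵒᵖ ⥤ Type w) {X : Cᵒᵖ} (a : A.obj X) : A.map (𝟙 X) a = a := by
  rw [A.map_id]; rfl

/-- A morphism to a sheaf can be given on a covering sieve. -/
theorem glue_hom (hB : Presieve.IsSheaf J B) {X : C} {R : Sieve X} (hR : R ∈ J X)
    (e : ∀ (Y : C) (f : Y ⟶ X), R f → A.obj (op Y) → B.obj (op Y))
    (he : ∀ (Y Z : C) (f : Y ⟶ X) (g : Z ⟶ Y) (hf : R f) (a : A.obj (op Y)),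
      B.map g.op (e Y f hf a) = e Z (g ≫ f) (R.downward_closed hf g) (A.map g.op a)) :
    ∃ E : ∀ (Y : C) (_ : Y ⟶ X), A.obj (op Y) → B.obj (op Y),
      (∀ (Y Z : C) (f : Y ⟶ X) (g : Z ⟶ Y) (a : A.obj (op Y)),
        B.map g.op (E Y f a) = E Z (g ≫ f) (A.map g.op a)) ∧
      ∀ (Y : C) (f : Y ⟶ X) (hf : R f), E Y f = e Y f hf := by
  have e_congr : ∀ (Y : C) (f f' : Y ⟶ X) (_ : f = f') (hf : R f) (hf' : R f') (a : A.obj (op Y)),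
      e Y f hf a = e Y f' hf' a := by
    rintro Y f _ rfl _ _ a; rfl
  have key : ∀ (Y : C) (f : Y ⟶ X) (a : A.obj (op Y)), ∃ b : B.obj (op Y),
      ∀ (Z : C) (g : Z ⟶ Y) (hg : R (g ≫ f)), B.map g.op b = e Z (g ≫ f) hg (A.map g.op a) := by
    intro Y f a
    refine sheaf_glue hB (J.pullback_stable f hR)
      (fun Z g hg => e Z (g ≫ f) hg (A.map g.op a)) ?_
    intro Z W g k hg
    have hg' : R (g ≫ f) := hg
    have h1 : R ((k ≫ g) ≫ f) := by rw [Category.assoc]; exact R.downward_closed hg' k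
    have e1 := e_congr W _ _ (Category.assoc k g f) h1 (R.downward_closed hg' k)
      (A.map (k ≫ g).op a)
    refine e1.trans (Eq.trans ?_ (he Z W (g ≫ f) k hg' (A.map g.op a)).symm)
    rw [op_comp, map_comp_apply']
  choose E hE using key
  refine ⟨E, fun Y Z f g a => ?_, fun Y f hf => funext fun a => ?_⟩
  · refine sheaf_ext hB (J.pullback_stable (g ≫ f) hR) fun W k hk => ?_
    have hk' : R ((k ≫ g) ≫ f) := by rw [Category.assoc]; exact hk
    have h1 := hE Y f a W (k ≫ g) hk'
    rw [op_comp, map_comp_apply', map_comp_apply'] at h1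
    exact h1.trans ((e_congr W _ _ (Category.assoc k g f) hk' hk _).trans
      (hE Z (g ≫ f) (A.map g.op a) W k hk).symm)
  · have hf' : R (𝟙 Y ≫ f) := by rw [Category.id_comp]; exact hf
    have h1 := hE Y f a Y (𝟙 Y) hf'
    rw [op_id, map_id_apply', map_id_apply'] at h1
    exact h1.trans (e_congr Y _ _ (Category.id_comp f) hf' hf a)

/-- An isomorphism of sheaves can be given on a covering sieve. -/
theorem glue_iso (hA : Presieve.IsSheaf J A) (hB : Presieve.IsSheaf J B) {X : C} {R : Sieve X}
    (hR : R ∈ J X) (e : ∀ (Y : C) (f : Y ⟶ X), R f → A.obj (op Y) ≃ B.obj (op Y))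
    (he : ∀ (Y Z : C) (f : Y ⟶ X) (g : Z ⟶ Y) (hf : R f) (a : A.obj (op Y)),
      B.map g.op (e Y f hf a) = e Z (g ≫ f) (R.downward_closed hf g) (A.map g.op a)) :
    ∃ E : ∀ (Y : C) (_ : Y ⟶ X), A.obj (op Y) ≃ B.obj (op Y),
      (∀ (Y Z : C) (f : Y ⟶ X) (g : Z ⟶ Y) (a : A.obj (op Y)),
        B.map g.op (E Y f a) = E Z (g ≫ f) (A.map g.op a)) ∧
      ∀ (Y : C) (f : Y ⟶ X) (hf : R f), E Y f = e Y f hf := by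
  obtain ⟨E, h1, h2⟩ := glue_hom hB hR (fun Y f hf => e Y f hf) he
  obtain ⟨E', h1', h2'⟩ := glue_hom hA hR (fun Y f hf => (e Y f hf).symm) (by
    intro Y Z f g hf b
    rw [Equiv.eq_symm_apply, ← he _ _ _ _ hf, Equiv.apply_symm_apply])
  refine ⟨fun Y f => ⟨E Y f, E' Y f, fun a => ?_, fun b => ?_⟩, h1,
    fun Y f hf => Equiv.ext fun a => congrFun (h2 Y f hf) a⟩
  · refine sheaf_ext hA (J.pullback_stable f hR) fun Z g hg => ?_
    rw [h1', h1, h2 _ _ hg, h2' _ _ hg, Equiv.symm_apply_apply]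
  · refine sheaf_ext hB (J.pullback_stable f hR) fun Z g hg => ?_
    rw [h1, h1', h2 _ _ hg, h2' _ _ hg, Equiv.apply_symm_apply]

/-- A natural family of maps of sheaves which is bijective locally is bijective. -/
theorem bijective_of_locally (hA : Presieve.IsSheaf J A) (hB : Presieve.IsSheaf J B) {X : C}
    (E : ∀ (Y : C) (_ : Y ⟶ X), A.obj (op Y) → B.obj (op Y))
    (hE : ∀ (Y Z : C) (f : Y ⟶ X) (g : Z ⟶ Y) (a : A.obj (op Y)),
        B.map g.op (E Y f a) = E Z (g ≫ f) (A.map g.op a))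
    {R : Sieve X} (hR : R ∈ J X)
    (h : ∀ (Y : C) (f : Y ⟶ X), R f → Function.Bijective (E Y f)) (Y : C) (f : Y ⟶ X) :
    Function.Bijective (E Y f) := by
  have hinj : ∀ (Y : C) (f : Y ⟶ X), Function.Injective (E Y f) := fun Y f a b hab =>
    sheaf_ext hA (J.pullback_stable f hR) fun Z g hg => (h _ _ hg).1 (by rw [← hE, ← hE, hab])
  refine ⟨hinj Y f, fun b => ?_⟩
  choose a ha using fun (Z : C) (g : Z ⟶ Y) (hg : R (g ≫ f)) => (h _ _ hg).2 (B.map g.op b)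
  obtain ⟨t, ht⟩ := sheaf_glue hA (J.pullback_stable f hR) a (by
    intro Z W g k hg
    have hg' : R (g ≫ f) := hg
    have h1 : R ((k ≫ g) ≫ f) := by rw [Category.assoc]; exact R.downward_closed hg' k
    apply hinj _ ((k ≫ g) ≫ f)
    refine (ha W (k ≫ g) h1).trans ?_
    rw [op_comp, map_comp_apply', ← ha Z g hg', hE]
    simp only [Category.assoc])
  refine ⟨t, sheaf_ext hB (J.pullback_stable f hR) fun Z g hg => ?_⟩
  rw [hE, ht _ _ hg]
  exact ha Z g hg

end GlueHom

/-! ### Sheaves which are twists by a torsor -/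

section Framings

variable {C : Type (u + 1)} [Category.{u} C] {J : GrothendieckTopology C}
  {G : Cᵒᵖ ⥤ GrpCat.{u}}

/-- A presentation of the presheaf `B` as the twist of `E` by `P`: every section of `P` gives an
isomorphism of `E` with `B`, compatibly with restriction and with the action of `G`. -/
structure Framing (P : RightGSet G) (E : GSet.{u, w} G) (B : Cᵒᵖ ⥤ Type w') where
  /-- the isomorphism given by a section of `P` -/
  app {Y : C} (p : P.F.obj (op Y)) : E.F.obj (op Y) ≃ B.obj (op Y)
  app_map {Y Z : C} (g : Z ⟶ Y) (p : P.F.obj (op Y)) (v : E.F.obj (op Y)) :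
    B.map g.op (app p v) = app (P.F.map g.op p) (E.F.map g.op v)
  app_act {Y : C} (p : P.F.obj (op Y)) (g : G.obj (op Y)) (v : E.F.obj (op Y)) :
    app (P.act p g) (E.act v g) = app p v

namespace Framing

variable {P : RightGSet G} {E : GSet.{u, w} G} {B : Cᵒᵖ ⥤ Type w'} {B' : Cᵒᵖ ⥤ Type w''}

theorem app_symm_act (e : Framing P E B) {Y : C} (p : P.F.obj (op Y)) (g : G.obj (op Y))
    (b : B.obj (op Y)) : (e.app (P.act p g)).symm b = E.act ((e.app p).symm b) g := by
  rw [Equiv.symm_apply_eq, e.app_act, Equiv.apply_symm_apply]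

theorem app_symm_map (e : Framing P E B) {Y Z : C} (g : Z ⟶ Y) (p : P.F.obj (op Y))
    (b : B.obj (op Y)) :
    (e.app (P.F.map g.op p)).symm (B.map g.op b) = E.F.map g.op ((e.app p).symm b) := by
  rw [Equiv.symm_apply_eq, ← e.app_map, Equiv.apply_symm_apply]

/-- The equivariant family given by a section of a framed presheaf. -/
def toEqv (e : Framing P E B) {X : C} (b : B.obj (op X)) : EqvSec P E X where
  app Y y p := (e.app p).symm (B.map y.op b)
  app_map Y Z y z p := by rw [op_comp, map_comp_apply', e.app_symm_map]
  app_act Y y p g := e.app_symm_act p g _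

variable (hP : IsTorsor J P) (hB : Presieve.IsSheaf J B) (hB' : Presieve.IsSheaf J B')

include hP hB in
/-- A sheaf which is a twist of `E` by `P` is the sheaf of equivariant families: the values of a
family at local points of `P` glue, as they do not depend on the point. -/
theorem toEqv_bijective (e : Framing P E B) (X : C) :
    Function.Bijective (e.toEqv : B.obj (op X) → EqvSec P E X) := by
  constructor
  · intro b b' h
    refine sheaf_ext hB (hP.sieve_mem X) fun Y y hy => ?_
    obtain ⟨p⟩ := hy
    exact (e.app p).symm.injective (congrArg (fun s : EqvSec P E X => s.app Y y p) h)
  · intro s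
    have key : ∀ (Y : C) (y : Y ⟶ X) (p q : P.F.obj (op Y)),
        e.app p (s.app Y y p) = e.app q (s.app Y y q) := by
      intro Y y p q
      rw [← hP.act_diff p q, s.app_act, e.app_act]
    obtain ⟨b, hb⟩ := sheaf_glue hB (hP.sieve_mem X)
      (fun Y y hy => e.app hy.some (s.app Y y hy.some)) (by
        intro Y Z y z hy
        rw [e.app_map, ← s.app_map]
        exact key _ _ _ _)
    refine ⟨b, EqvSec.ext (funext fun Y => funext fun y => funext fun p => ?_)⟩
    change (e.app p).symm (B.map y.op b) = _
    rw [Equiv.symm_apply_eq, hb Y y ⟨p⟩]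
    exact key _ _ _ _

/-- Two sheaves framed by the same torsor are isomorphic. -/
def equiv (e : Framing P E B) (e' : Framing P E B') (X : C) : B.obj (op X) ≃ B'.obj (op X) :=
  (Equiv.ofBijective _ (e.toEqv_bijective hP hB X)).trans
    (Equiv.ofBijective _ (e'.toEqv_bijective hP hB' X)).symm

theorem equiv_spec (e : Framing P E B) (e' : Framing P E B') {X Y : C} (y : Y ⟶ X)
    (p : P.F.obj (op Y)) (b : B.obj (op X)) :
    (e'.app p).symm (B'.map y.op (equiv hP hB hB' e e' X b)) = (e.app p).symm (B.map y.op b) := by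
  have h : e'.toEqv (equiv hP hB hB' e e' X b) = e.toEqv b :=
    (Equiv.ofBijective _ (e'.toEqv_bijective hP hB' X)).apply_symm_apply _
  exact congrArg (fun s : EqvSec P E X => s.app Y y p) h

theorem equiv_app (e : Framing P E B) (e' : Framing P E B') {X : C}
    (p : P.F.obj (op X)) (v : E.F.obj (op X)) :
    equiv hP hB hB' e e' X (e.app p v) = e'.app p v := by
  have := equiv_spec hP hB hB' e e' (𝟙 X) p (e.app p v)
  rw [op_id, map_id_apply', map_id_apply', Equiv.symm_apply_apply, Equiv.symm_apply_eq] at this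
  exact this

theorem map_equiv (e : Framing P E B) (e' : Framing P E B') {X Y : C} (y : Y ⟶ X)
    (b : B.obj (op X)) :
    B'.map y.op (equiv hP hB hB' e e' X b) = equiv hP hB hB' e e' Y (B.map y.op b) := by
  refine sheaf_ext hB' (hP.sieve_mem Y) fun Z z ⟨p⟩ => (e'.app p).symm.injective ?_
  rw [equiv_spec hP hB hB' e e' z p, ← map_comp_apply', ← op_comp,
    equiv_spec hP hB hB' e e' (z ≫ y) p, op_comp, map_comp_apply']

end Framing

/-- The twist of a sheaf by a torsor is framed by the torsor. -/
def EqvSec.framing {P : RightGSet G} (E : GSet.{u, w} G) (hP : IsTorsor J P) :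
    Framing P E (EqvSec.presheaf P E) where
  app {Y} p :=
    { toFun := EqvSec.ofPoint hP p
      invFun := fun s => EqvSec.app (X := Y) s Y (𝟙 Y) p
      left_inv := EqvSec.ofPoint_app_self hP p
      right_inv := fun s => EqvSec.ext_of_point hP p (EqvSec.ofPoint_app_self hP p _) }
  app_map {Y Z} g p v := by
    refine EqvSec.ext_of_point (X := Z) (E := E) hP (P.F.map g.op p) ?_
    refine Eq.trans ?_ (EqvSec.ofPoint_app_self hP (P.F.map g.op p) _).symm
    refine Eq.trans ?_ (EqvSec.ofPoint_app hP p v Z g)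
    exact EqvSec.app_congr (EqvSec.ofPoint hP p v) (Category.id_comp g) _
  app_act {Y} p g v := by
    refine EqvSec.ext_of_point (X := Y) (E := E) hP (P.act p g) ?_
    refine (EqvSec.ofPoint_app_self hP (P.act p g) _).trans ?_
    refine Eq.trans ?_ (EqvSec.app_act _ _ _ _ _).symm
    congr 1
    exact (EqvSec.ofPoint_app_self hP p v).symm

end Framings

/-! ### Frames of modules and of algebras -/

section Frames

variable {X : Scheme.{u}}

/-- The sections of a module, as a presheaf of sets. -/
def secF (M : OMod X) : (Over X)ᵒᵖ ⥤ Type (u + 1) := M.presheaf ⋙ forget Ab.{u + 1}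

theorem isSheaf_secF_iff (M : OMod X) :
    Presieve.IsSheaf (fppf X) (secF M) ↔ Presheaf.IsSheaf (fppf X) M.presheaf := by
  rw [Presheaf.isSheaf_iff_isSheaf_forget (fppf X) M.presheaf (forget Ab.{u + 1}),
    isSheaf_iff_isSheaf_of_type]
  rfl

/-- The presheaf of sets `𝒪 ^ ι`. -/
def powF (X : Scheme.{u}) (ι : Type) : (Over X)ᵒᵖ ⥤ Type u where
  obj Y := ι → Γ(Y.unop.left, ⊤)
  map f := TypeCat.ofHom fun v i => f.unop.left.appTop (v i)
  map_id Y := by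
    ext v i
    change Scheme.Hom.appTop (𝟙 Y.unop.left) (v i) = v i
    rw [Scheme.Hom.id_appTop]; rfl
  map_comp f g := by
    ext v i
    change Scheme.Hom.appTop (g.unop.left ≫ f.unop.left) (v i) = _
    rw [Scheme.Hom.comp_appTop]; rfl

theorem isSheaf_powF (ι : Type) : Presieve.IsSheaf (fppf X) (powF X ι) := by
  intro Y R hR x hx
  rw [Presieve.compatible_iff_sieveCompatible] at hx
  choose s hs using fun i : ι => exists_function hR (fun Z f hf => (x f hf : ι → Γ(Z.left, ⊤)) i)
    fun Z W f g hf => congrFun (hx f g hf) i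
  refine ⟨s, fun Z f hf => funext fun i => hs i Z f hf, fun t ht => funext fun i => ?_⟩
  exact functions_ext hR fun Z f hf => (congrFun (ht f hf) i).trans (hs i Z f hf).symm

section

variable {M : OMod X} (hM : Presieve.IsSheaf (fppf X) (secF M))
include hM

theorem sec_ext {Y : Over X} {R : Sieve Y} (hR : R ∈ fppf X Y) {a b : Sec M Y}
    (h : ∀ (Z : Over X) (f : Z ⟶ Y), R f → res M f a = res M f b) : a = b :=
  sheaf_ext hM hR h

/-- Frames can be glued. -/
theorem glue_lin {ι : Type} {Y : Over X} {R : Sieve Y} (hR : R ∈ fppf X Y)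
    (e : ∀ (Z : Over X) (f : Z ⟶ Y), R f → (ι → Γ(Z.left, ⊤)) ≃ₗ[Γ(Z.left, ⊤)] Sec M Z)
    (he : ∀ (Z W : Over X) (f : Z ⟶ Y) (g : W ⟶ Z) (hf : R f) (v : ι → Γ(Z.left, ⊤)),
      res M g (e Z f hf v) = e W (g ≫ f) (R.downward_closed hf g) fun i => g.left.appTop (v i)) :
    ∃ E : ∀ (Z : Over X) (_ : Z ⟶ Y), (ι → Γ(Z.left, ⊤)) ≃ₗ[Γ(Z.left, ⊤)] Sec M Z,
      (∀ (Z W : Over X) (f : Z ⟶ Y) (g : W ⟶ Z) (v : ι → Γ(Z.left, ⊤)),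
        res M g (E Z f v) = E W (g ≫ f) fun i => g.left.appTop (v i)) ∧
      ∀ (Z : Over X) (f : Z ⟶ Y) (hf : R f), E Z f = e Z f hf := by
  obtain ⟨E, h1, h2⟩ := glue_iso (isSheaf_powF ι) hM hR (fun Z f hf => (e Z f hf).toEquiv) he
  let E' (Z : Over X) (f : Z ⟶ Y) : (ι → Γ(Z.left, ⊤)) → Sec M Z := E Z f
  have h1' : ∀ (Z W : Over X) (f : Z ⟶ Y) (g : W ⟶ Z) (v : ι → Γ(Z.left, ⊤)),
        res M g (E' Z f v) = E' W (g ≫ f) fun i => g.left.appTop (v i) := h1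
  have h2' : ∀ (Z : Over X) (f : Z ⟶ Y) (hf : R f) (v : ι → Γ(Z.left, ⊤)),
      E' Z f v = e Z f hf v := fun Z f hf v => congrArg (fun k => k.toFun v) (h2 Z f hf)
  let L (Z : Over X) (f : Z ⟶ Y) : (ι → Γ(Z.left, ⊤)) →ₗ[Γ(Z.left, ⊤)] Sec M Z :=
    { toFun := E' Z f
      map_add' := fun v v' => sec_ext hM ((fppf X).pullback_stable f hR) fun W g hg => by
        rw [map_add, h1', h1', h1', h2' _ _ hg, h2' _ _ hg, h2' _ _ hg, ← map_add]
        congr 1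
        funext i
        exact map_add g.left.appTop.hom _ _
      map_smul' := fun a v => sec_ext hM ((fppf X).pullback_stable f hR) fun W g hg => by
        rw [RingHom.id_apply, map_smulₛₗ, h1', h1', h2' _ _ hg, h2' _ _ hg, ← map_smul]
        congr 1
        funext i
        exact map_mul g.left.appTop.hom _ _ }
  exact ⟨fun Z f => LinearEquiv.ofBijective (L Z f) (E Z f).bijective, h1',
    fun Z f hf => LinearEquiv.ext fun v => h2' Z f hf v⟩

end

theorem FrameSec.app_eq {M : OMod X} {n : ℕ} {Y Z : Over X} (e : FrameSec M n Y) (z : Z ⟶ Y)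
    (v : Fin n → Γ(Y.left, ⊤)) :
    e.app Z z (fun i => z.left.appTop (v i)) = SegreNorm.res M z (e.app Y (𝟙 Y) v) := by
  rw [e.app_map, Category.comp_id]

theorem FrameSec.ext_self {M : OMod X} {n : ℕ} {Y : Over X} {e e' : FrameSec M n Y}
    (h : ∀ v, e.app Y (𝟙 Y) v = e'.app Y (𝟙 Y) v) : e = e' := by
  refine FrameSec.ext (funext fun Z => funext fun z => LinearEquiv.toLinearMap_injective
    (LinearMap.pi_ext' fun i => LinearMap.ext_ring ?_))
  have h1 : ∀ e : FrameSec M n Y, e.app Z z (Pi.single i 1) =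
      SegreNorm.res M z (e.app Y (𝟙 Y) (Pi.single i 1)) := fun e => by
    rw [← e.app_eq]
    congr 1
    funext j
    by_cases hj : j = i
    · subst hj; simp
    · simp [hj]
  exact (h1 e).trans ((congrArg _ (h _)).trans (h1 e').symm)

theorem FrameSec.act_one {M : OMod X} {n : ℕ} {Y : Over X} (e : FrameSec M n Y) : e.act 1 = e := by
  refine FrameSec.ext_self fun v => ?_
  change e.app _ _ (Matrix.mulVec (Matrix.GeneralLinearGroup.map _ 1).1 v) = _
  rw [map_one, Units.val_one, Matrix.one_mulVec]

theorem FrameSec.act_mul {M : OMod X} {n : ℕ} {Y : Over X} (e : FrameSec M n Y)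
    (A B : GL (Fin n) Γ(Y.left, ⊤)) : e.act (A * B) = (e.act A).act B := by
  refine FrameSec.ext_self fun v => ?_
  change e.app _ _ (Matrix.mulVec (Matrix.GeneralLinearGroup.map _ (A * B)).1 v) =
    e.app _ _ (Matrix.mulVec (Matrix.GeneralLinearGroup.map _ A).1
      (Matrix.mulVec (Matrix.GeneralLinearGroup.map _ B).1 v))
  rw [map_mul, Units.val_mul, Matrix.mulVec_mulVec]

theorem appTop_id_hom (Y : Over X) : (𝟙 Y : Y ⟶ Y).left.appTop.hom = RingHom.id _ := by
  rw [Over.id_left, Scheme.Hom.id_appTop]; rfl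

theorem FrameSec.act_app_self {M : OMod X} {n : ℕ} {Y : Over X} (e : FrameSec M n Y)
    (A : GL (Fin n) Γ(Y.left, ⊤)) (v : Fin n → Γ(Y.left, ⊤)) :
    (e.act A).app Y (𝟙 Y) v = e.app Y (𝟙 Y) (A.1.mulVec v) := by
  change e.app _ _ (Matrix.mulVec (Matrix.GeneralLinearGroup.map _ A).1 v) = _
  rw [appTop_id_hom, Matrix.GeneralLinearGroup.map_id]
  rfl

/-- Two frames differ by the matrix of the automorphism of the free module which compares them. -/
theorem FrameSec.existsUnique_act {M : OMod X} {n : ℕ} {Y : Over X} (e f : FrameSec M n Y) :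
    ∃! A : GL (Fin n) Γ(Y.left, ⊤), e.act A = f := by
  let φ := (f.app Y (𝟙 Y)).trans (e.app Y (𝟙 Y)).symm
  let A : GL (Fin n) Γ(Y.left, ⊤) := Matrix.GeneralLinearGroup.toLin.symm
    (LinearMap.GeneralLinearGroup.ofLinearEquiv φ)
  have hA : ∀ v, Matrix.mulVec A.1 v = φ v := fun v => by
    have : Matrix.toLin' A.1 = φ.toLinearMap := by
      exact congrArg Units.val (Matrix.GeneralLinearGroup.toLin.apply_symm_apply
        (LinearMap.GeneralLinearGroup.ofLinearEquiv φ))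
    exact LinearMap.congr_fun this v
  refine ⟨A, FrameSec.ext_self fun v => ?_, fun B hB => ?_⟩
  · rw [act_app_self, hA]
    exact (e.app Y (𝟙 Y)).apply_symm_apply _
  · refine Units.ext (Matrix.ext_of_mulVec_single fun i => ?_)
    rw [hA]
    refine (LinearEquiv.eq_symm_apply _).2 ?_
    rw [← act_app_self, hB]
    rfl

theorem isTorsor_frames {M : OMod X} {n : ℕ} (hM : IsLocFree M n) :
    IsTorsor (fppf X) (frames M n) where
  isSheaf := by
    have hs := (isSheaf_secF_iff M).2 hM.isSheaf
    intro Y R hR x hx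
    rw [Presieve.compatible_iff_sieveCompatible] at hx
    let x' : ∀ (Z : Over X) (f : Z ⟶ Y), R f → FrameSec M n Z := fun Z f hf => x f hf
    have hx' : ∀ (Z W : Over X) (f : Z ⟶ Y) (g : W ⟶ Z) (hf : R f),
      x' W (g ≫ f) (R.downward_closed hf g) = (x' Z f hf).res g := fun Z W f g hf => hx f g hf
    obtain ⟨E, h1, h2⟩ := glue_lin hs hR (fun Z f hf => (x' Z f hf).app Z (𝟙 Z)) (by
      intro Z W f g hf v
      rw [(x' Z f hf).app_map, hx']
      change (x' Z f hf).app W (g ≫ 𝟙 Z) _ = (x' Z f hf).app W (𝟙 W ≫ g) _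
      rw [Category.comp_id, Category.id_comp])
    refine ⟨(⟨E, fun Z W z w v => h1 Z W z w v⟩ : FrameSec M n Y), fun Z f hf => ?_,
      fun t ht => ?_⟩
    · refine FrameSec.ext_self (M := M) (Y := Z) fun v => ?_
      change E Z (𝟙 Z ≫ f) v = (x' Z f hf).app Z (𝟙 Z) v
      rw [Category.id_comp, h2 Z f hf]
    · let t' : FrameSec M n Y := t
      refine FrameSec.ext (M := M) (Y := Y) (funext fun Z => funext fun z =>
        LinearEquiv.ext fun v => sec_ext hs ((fppf X).pullback_stable z hR) fun W w hw => ?_)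
      change SegreNorm.res M w (t'.app Z z v) = SegreNorm.res M w (E Z z v)
      rw [h1, h2 _ _ hw, t'.app_map]
      have h3 : x' W (w ≫ z) hw = t'.res (w ≫ z) := (ht _ hw).symm
      rw [h3]
      change _ = t'.app W (𝟙 W ≫ w ≫ z) _
      rw [Category.id_comp]
  act_one {Y} e := FrameSec.act_one (Y := Y.unop) e
  act_mul {Y} e A B := FrameSec.act_mul (Y := Y.unop) e A B
  simply_transitive {Y} e f := FrameSec.existsUnique_act (Y := Y.unop) e f
  locally_nonempty Y := by
    obtain ⟨R, hR, h⟩ := hM.locally_free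
    exact ⟨_, (fppf X).pullback_stable (Over.mkIdTerminal.from Y) hR, fun Z z hz => h _ _ hz⟩

theorem AlgFrameSec.app_eq {M : OMod X} {A : AlgStr M} {n : ℕ} {Y Z : Over X}
    (e : AlgFrameSec A n Y) (z : Z ⟶ Y) (v : Matrix (Fin n) (Fin n) Γ(Y.left, ⊤)) :
    e.app Z z (v.map z.left.appTop) = SegreNorm.res M z (e.app Y (𝟙 Y) v) := by
  rw [e.app_map, Category.comp_id]

theorem AlgFrameSec.ext_self {M : OMod X} {A : AlgStr M} {n : ℕ} {Y : Over X}
    {e e' : AlgFrameSec A n Y} (h : ∀ v, e.app Y (𝟙 Y) v = e'.app Y (𝟙 Y) v) : e = e' := by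
  refine AlgFrameSec.ext (funext fun Z => funext fun z => LinearEquiv.toLinearMap_injective
    (Matrix.ext_linearMap _ fun i j => LinearMap.ext_ring ?_))
  have h1 : ∀ e : AlgFrameSec A n Y, e.app Z z (Matrix.single i j 1) =
      SegreNorm.res M z (e.app Y (𝟙 Y) (Matrix.single i j 1)) := fun e => by
    rw [← e.app_eq]
    congr 1
    exact ((Matrix.map_single i j 1 z.left.appTop.hom).trans (by rw [map_one])).symm
  exact (h1 e).trans ((congrArg _ (h _)).trans (h1 e').symm)

theorem AlgFrameSec.act_one {M : OMod X} {A : AlgStr M} {n : ℕ} {Y : Over X}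
    (e : AlgFrameSec A n Y) : e.act 1 = e := by
  refine AlgFrameSec.ext_self fun v => ?_
  change e.app _ _ (matAutMap _ 1 v) = _
  rw [map_one, AlgEquiv.one_apply]

theorem AlgFrameSec.act_mul {M : OMod X} {A : AlgStr M} {n : ℕ} {Y : Over X}
    (e : AlgFrameSec A n Y) (f g : MatAut n Γ(Y.left, ⊤)) : e.act (f * g) = (e.act f).act g := by
  refine AlgFrameSec.ext_self fun v => ?_
  change e.app _ _ (matAutMap _ (f * g) v) = e.app _ _ (matAutMap _ f (matAutMap _ g v))
  rw [map_mul, AlgEquiv.mul_apply]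

theorem AlgFrameSec.act_app_self {M : OMod X} {A : AlgStr M} {n : ℕ} {Y : Over X}
    (e : AlgFrameSec A n Y) (f : MatAut n Γ(Y.left, ⊤)) (v : Matrix (Fin n) (Fin n) Γ(Y.left, ⊤)) :
    (e.act f).app Y (𝟙 Y) v = e.app Y (𝟙 Y) (f v) := by
  change e.app _ _ (matAutMap _ f v) = _
  rw [appTop_id_hom]
  congr 1
  exact matAutMap_map (RingHom.id _) f v

theorem AlgFrameSec.existsUnique_act {M : OMod X} {A : AlgStr M} {n : ℕ} {Y : Over X}
    (e f : AlgFrameSec A n Y) : ∃! a : MatAut n Γ(Y.left, ⊤), e.act a = f := by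
  let a : MatAut n Γ(Y.left, ⊤) := AlgEquiv.ofLinearEquiv
    ((f.app Y (𝟙 Y)).trans (e.app Y (𝟙 Y)).symm)
    (by
      rw [LinearEquiv.trans_apply, LinearEquiv.symm_apply_eq, f.app_one, e.app_one])
    (fun v w => by
      simp only [LinearEquiv.trans_apply]
      rw [LinearEquiv.symm_apply_eq, f.app_mul, e.app_mul, LinearEquiv.apply_symm_apply,
        LinearEquiv.apply_symm_apply])
  refine ⟨a, AlgFrameSec.ext_self fun v => ?_, fun b hb => ?_⟩
  · rw [act_app_self]
    exact (e.app Y (𝟙 Y)).apply_symm_apply _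
  · refine AlgEquiv.ext fun v => ?_
    refine (LinearEquiv.eq_symm_apply _).2 ?_
    rw [← act_app_self, hb]
    rfl

/-- Matrices as vectors indexed by pairs. -/
def matVec (n : ℕ) (R : Type u) [CommRing R] :
    (Fin n × Fin n → R) ≃ₗ[R] Matrix (Fin n) (Fin n) R :=
  (LinearEquiv.curry R R (Fin n) (Fin n)).trans (Matrix.ofLinearEquiv R)

theorem matVec_symm_map {n : ℕ} {R R' : Type u} [CommRing R] [CommRing R'] (f : R →+* R')
    (v : Matrix (Fin n) (Fin n) R) :
    (matVec n R').symm (v.map f) = fun i => f ((matVec n R).symm v i) := rfl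

theorem isTorsor_algFrames {M : OMod X} {A : AlgStr M} {n : ℕ} (hM : IsAzumaya A n) :
    IsTorsor (fppf X) (algFrames A n) where
  isSheaf := by
    have hs := (isSheaf_secF_iff M).2 hM.isSheaf
    intro Y R hR x hx
    rw [Presieve.compatible_iff_sieveCompatible] at hx
    let x' : ∀ (Z : Over X) (f : Z ⟶ Y), R f → AlgFrameSec A n Z := fun Z f hf => x f hf
    have hx' : ∀ (Z W : Over X) (f : Z ⟶ Y) (g : W ⟶ Z) (hf : R f),
      x' W (g ≫ f) (R.downward_closed hf g) = (x' Z f hf).res g := fun Z W f g hf => hx f g hf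
    obtain ⟨E, h1, h2⟩ := glue_lin hs hR
      (fun Z f hf => (matVec n _).trans ((x' Z f hf).app Z (𝟙 Z))) (by
      intro Z W f g hf v
      rw [LinearEquiv.trans_apply, LinearEquiv.trans_apply, (x' Z f hf).app_map, hx']
      change (x' Z f hf).app W (g ≫ 𝟙 Z) _ = (x' Z f hf).app W (𝟙 W ≫ g) _
      rw [Category.comp_id, Category.id_comp]
      rfl)
    let E' (Z : Over X) (z : Z ⟶ Y) := (matVec n _).symm.trans (E Z z)
    have h1' : ∀ (Z W : Over X) (z : Z ⟶ Y) (w : W ⟶ Z) (v : Matrix (Fin n) (Fin n) Γ(Z.left, ⊤)),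
        SegreNorm.res M w (E' Z z v) = E' W (w ≫ z) (v.map w.left.appTop) :=
      fun Z W z w v => h1 Z W z w _
    have h2' : ∀ (Z : Over X) (f : Z ⟶ Y) (hf : R f), E' Z f = (x' Z f hf).app Z (𝟙 Z) := by
      intro Z f hf
      refine LinearEquiv.ext fun v => ?_
      change E Z f _ = _
      rw [h2 Z f hf, LinearEquiv.trans_apply]
      exact congrArg _ ((matVec n _).apply_symm_apply v)
    refine ⟨(⟨E', fun Z z => ?_, fun Z z a b => ?_, h1'⟩ : AlgFrameSec A n Y), fun Z f hf => ?_,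
      fun t ht => ?_⟩
    · refine sec_ext hs ((fppf X).pullback_stable z hR) fun W w hw => ?_
      rw [h1', h2' _ _ hw, A.res_one, ← (x' W (w ≫ z) hw).app_one W (𝟙 W)]
      congr 1
      exact Matrix.map_one w.left.appTop.hom (map_zero _) (map_one _)
    · refine sec_ext hs ((fppf X).pullback_stable z hR) fun W w hw => ?_
      rw [h1', h2' _ _ hw, A.res_mul, h1', h1', h2' _ _ hw, ← (x' W (w ≫ z) hw).app_mul W (𝟙 W)]
      congr 1
      exact Matrix.map_mul (f := w.left.appTop.hom)
    · refine AlgFrameSec.ext_self (A := A) (Y := Z) fun v => ?_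
      change E' Z (𝟙 Z ≫ f) v = (x' Z f hf).app Z (𝟙 Z) v
      rw [Category.id_comp, h2' Z f hf]
    · let t' : AlgFrameSec A n Y := t
      refine AlgFrameSec.ext (A := A) (Y := Y) (funext fun Z => funext fun z =>
        LinearEquiv.ext fun v => sec_ext hs ((fppf X).pullback_stable z hR) fun W w hw => ?_)
      change SegreNorm.res M w (t'.app Z z v) = SegreNorm.res M w (E' Z z v)
      rw [h1', h2' _ _ hw, t'.app_map]
      have h3 : x' W (w ≫ z) hw = t'.res (w ≫ z) := (ht _ hw).symm
      rw [h3]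
      change _ = t'.app W (𝟙 W ≫ w ≫ z) _
      rw [Category.id_comp]
  act_one {Y} e := AlgFrameSec.act_one (Y := Y.unop) e
  act_mul {Y} e f g := AlgFrameSec.act_mul (Y := Y.unop) e f g
  simply_transitive {Y} e f := AlgFrameSec.existsUnique_act (Y := Y.unop) e f
  locally_nonempty Y := by
    obtain ⟨R, hR, h⟩ := hM.locally_matrix
    exact ⟨_, (fppf X).pullback_stable (Over.mkIdTerminal.from Y) hR, fun Z z hz => h _ _ hz⟩

end Frames

/-! ### Modules associated with torsors -/

section Assoc

variable {X : Scheme.{u}} {G H : (Over X)ᵒᵖ ⥤ GrpCat.{u}} {ι : Type}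

/-- A linear action on the left of a presheaf of groups on `𝒪 ^ ι`. -/
structure LinAct (G : (Over X)ᵒᵖ ⥤ GrpCat.{u}) (ι : Type) where
  /-- the action on sections -/
  act {Y : Over X} : G.obj (op Y) →* ((ι → Γ(Y.left, ⊤)) ≃ₗ[Γ(Y.left, ⊤)] (ι → Γ(Y.left, ⊤)))
  act_map {Y Z : Over X} (z : Z ⟶ Y) (g : G.obj (op Y)) (v : ι → Γ(Y.left, ⊤)) :
    (fun i => z.left.appTop (act g v i)) = act (G.map z.op g) (fun i => z.left.appTop (v i))

namespace LinAct

/-- Restriction of a linear action along a homomorphism. -/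
def comp (L : LinAct H ι) (φ : G ⟶ H) : LinAct G ι where
  act {Y} := L.act.comp (φ.app (op Y)).hom
  act_map {Y Z} z g v := by
    refine (L.act_map z _ v).trans ?_
    have h : H.map z.op (φ.app (op Y) g) = φ.app (op Z) (G.map z.op g) :=
      (ConcreteCategory.congr_hom (φ.naturality z.op) g).symm
    rw [h]; rfl

theorem act_inv_act (L : LinAct G ι) {Y : Over X} (g : G.obj (op Y)) (v : ι → Γ(Y.left, ⊤)) :
    L.act g (L.act g⁻¹ v) = v := by
  rw [map_inv]; exact (L.act g).apply_symm_apply v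

/-- The sheaf `𝒪 ^ ι` with the inverse action on the right. -/
def gset (L : LinAct G ι) : GSet.{u, u} G where
  F := powF X ι
  act {Y} v g := L.act (Y := Y.unop) g⁻¹ v
  act_map {Y Z} f v g := (L.act_map f.unop _ v).trans (by rw [← map_inv]; rfl)
  act_one {Y} v := by
    rw [inv_one, map_one]; rfl
  act_mul {Y} v g h := by
    rw [mul_inv_rev, map_mul]; rfl

end LinAct

variable (P : RightGSet G) (L : LinAct G ι)

/-- The sections of the module associated with a torsor and a linear action. -/
abbrev AssocSec (Y : Over X) : Type (u + 1) := EqvSec P L.gset Y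

namespace AssocSec

variable {P L} {Y : Over X}

/-- The values of a section, as vectors. -/
def val (s : AssocSec P L Y) {Z : Over X} (z : Z ⟶ Y) (p : P.F.obj (op Z)) : ι → Γ(Z.left, ⊤) :=
  s.app Z z p

theorem ext_val {s t : AssocSec P L Y}
    (h : ∀ (Z : Over X) (z : Z ⟶ Y) (p : P.F.obj (op Z)), s.val z p = t.val z p) : s = t :=
  EqvSec.ext (funext fun Z => funext fun z => funext fun p => h Z z p)

/-- A section with given values. -/
def mk' (f : ∀ (Z : Over X) (_ : Z ⟶ Y) (_ : P.F.obj (op Z)), ι → Γ(Z.left, ⊤))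
    (h1 : ∀ (Z W : Over X) (z : Z ⟶ Y) (w : W ⟶ Z) (p : P.F.obj (op Z)),
      f W (w ≫ z) (P.F.map w.op p) = fun i => w.left.appTop (f Z z p i))
    (h2 : ∀ (Z : Over X) (z : Z ⟶ Y) (p : P.F.obj (op Z)) (g : G.obj (op Z)),
      f Z z (P.act p g) = L.act g⁻¹ (f Z z p)) : AssocSec P L Y where
  app := f
  app_map := h1
  app_act := h2

theorem val_map (s : AssocSec P L Y) {Z W : Over X} (z : Z ⟶ Y) (w : W ⟶ Z)
    (p : P.F.obj (op Z)) :
    s.val (w ≫ z) (P.F.map w.op p) = fun i => w.left.appTop (s.val z p i) :=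
  s.app_map Z W z w p

theorem val_act (s : AssocSec P L Y) {Z : Over X} (z : Z ⟶ Y) (p : P.F.obj (op Z))
    (g : G.obj (op Z)) : s.val z (P.act p g) = L.act g⁻¹ (s.val z p) := s.app_act Z z p g

instance : Zero (AssocSec P L Y) := ⟨mk' (fun _ _ _ => 0)
  (fun _ _ _ w _ => funext fun _ => (map_zero w.left.appTop.hom).symm)
  (fun _ _ _ _ => (map_zero _).symm)⟩

instance : Add (AssocSec P L Y) := ⟨fun s t => mk' (fun _ z p => s.val z p + t.val z p)
  (fun _ _ z w p => by
    rw [val_map, val_map]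
    exact funext fun _ => (map_add w.left.appTop.hom _ _).symm)
  (fun _ z p g => by rw [val_act, val_act, map_add])⟩

instance : Neg (AssocSec P L Y) := ⟨fun s => mk' (fun _ z p => -s.val z p)
  (fun _ _ z w p => by
    rw [val_map]
    exact funext fun _ => (map_neg w.left.appTop.hom _).symm)
  (fun _ z p g => by rw [val_act, map_neg])⟩

instance : SMul Γ(Y.left, ⊤) (AssocSec P L Y) := ⟨fun a s =>
  mk' (fun _ z p => z.left.appTop a • s.val z p)
  (fun _ _ z w p => by
    rw [val_map, Over.comp_left, Scheme.Hom.comp_appTop]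
    exact funext fun _ => (map_mul w.left.appTop.hom _ _).symm)
  (fun _ z p g => by rw [val_act, map_smul])⟩

theorem smul_val (a : Γ(Y.left, ⊤)) (s : AssocSec P L Y) {Z : Over X} (z : Z ⟶ Y)
    (p : P.F.obj (op Z)) : (a • s).val z p = z.left.appTop a • s.val z p := rfl

instance : AddCommGroup (AssocSec P L Y) where
  add_assoc s t w := ext_val fun Z z p => add_assoc (s.val z p) (t.val z p) (w.val z p)
  zero_add s := ext_val fun Z z p => zero_add (s.val z p)
  add_zero s := ext_val fun Z z p => add_zero (s.val z p)
  add_comm s t := ext_val fun Z z p => add_comm (s.val z p) (t.val z p)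
  neg_add_cancel s := ext_val fun Z z p => neg_add_cancel (s.val z p)
  nsmul := nsmulRec
  zsmul := zsmulRec

instance : Module Γ(Y.left, ⊤) (AssocSec P L Y) where
  one_smul s := ext_val fun Z z p =>
    (congrArg (· • s.val z p) (map_one z.left.appTop.hom)).trans (one_smul _ _)
  mul_smul a b s := ext_val fun Z z p =>
    (congrArg (· • s.val z p) (map_mul z.left.appTop.hom a b)).trans (mul_smul _ _ _)
  smul_zero a := ext_val fun Z z p => smul_zero _
  smul_add a s t := ext_val fun Z z p => smul_add _ _ _
  add_smul a b s := ext_val fun Z z p =>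
    (congrArg (· • s.val z p) (map_add z.left.appTop.hom a b)).trans (add_smul _ _ _)
  zero_smul s := ext_val fun Z z p =>
    (congrArg (· • s.val z p) (map_zero z.left.appTop.hom)).trans (zero_smul _ _)

end AssocSec

instance (Y : (Over X)ᵒᵖ) :
    Module ((functions X ⋙ forget₂ CommRingCat.{u} RingCat.{u}).obj Y) (AssocSec P L Y.unop) :=
  inferInstanceAs (Module Γ(Y.unop.left, ⊤) (AssocSec P L Y.unop))

/-- The module associated with a torsor and a linear action on `𝒪 ^ ι`. -/
def assocMod : OMod X where
  obj Y := ModuleCat.of _ (AssocSec P L Y.unop)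
  map {Y Z} h := ModuleCat.ofHom
    (Y := (ModuleCat.restrictScalars ((functions X ⋙ forget₂ CommRingCat.{u} RingCat.{u}).map
      h).hom).obj (ModuleCat.of _ (AssocSec P L Z.unop)))
    { toFun := EqvSec.res h.unop
      map_add' := fun _ _ => rfl
      map_smul' := fun (a : Γ(Y.unop.left, ⊤)) (s : AssocSec P L Y.unop) => by
        refine AssocSec.ext_val (Y := Z.unop) fun U x p => ?_
        change (x ≫ h.unop).left.appTop a • s.val (x ≫ h.unop) p =
          x.left.appTop (h.unop.left.appTop a) • s.val (x ≫ h.unop) p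
        rw [Over.comp_left, Scheme.Hom.comp_appTop]
        rfl }
  map_id Y := by
    refine ModuleCat.hom_ext (LinearMap.ext fun (s : AssocSec P L Y.unop) => ?_)
    exact AssocSec.ext_val (Y := Y.unop) fun U x p => s.app_congr (Category.comp_id x) p
  map_comp {Y Z W} h k := by
    refine ModuleCat.hom_ext (LinearMap.ext fun (s : AssocSec P L _) => ?_)
    exact AssocSec.ext_val (Y := W.unop) fun U x p => s.app_congr (Category.assoc x _ _).symm p

theorem isSheaf_assocMod : Presieve.IsSheaf (fppf X) (secF (assocMod P L)) :=
  EqvSec.isSheaf_presheaf (P := P) (E := L.gset) (isSheaf_powF ι)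

variable {P L}

/-- A presentation of a module as the module associated with a torsor: a framing by linear
isomorphisms. -/
structure ModFraming (P : RightGSet G) (L : LinAct G ι) (M : OMod X) where
  /-- the isomorphism given by a section of the torsor -/
  app {Y : Over X} (p : P.F.obj (op Y)) : (ι → Γ(Y.left, ⊤)) ≃ₗ[Γ(Y.left, ⊤)] Sec M Y
  app_map {Y Z : Over X} (z : Z ⟶ Y) (p : P.F.obj (op Y)) (v : ι → Γ(Y.left, ⊤)) :
    res M z (app p v) = app (P.F.map z.op p) (fun i => z.left.appTop (v i))
  app_act {Y : Over X} (p : P.F.obj (op Y)) (g : G.obj (op Y)) (v : ι → Γ(Y.left, ⊤)) :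
    app (P.act p g) v = app p (L.act g v)

namespace ModFraming

variable {M N : OMod X}

/-- The underlying framing of the presheaf of sets. -/
def toFraming (e : ModFraming P L M) : Framing P L.gset (secF M) where
  app p := (e.app p).toEquiv
  app_map z p v := e.app_map z p v
  app_act {Y} p g v := (e.app_act p g (L.act g⁻¹ v)).trans (congrArg _ (L.act_inv_act g v))

theorem app_symm_map (e : ModFraming P L M) {Y Z : Over X} (z : Z ⟶ Y) (p : P.F.obj (op Y))
    (m : Sec M Y) : (e.app (P.F.map z.op p)).symm (res M z m) =
      fun i => z.left.appTop ((e.app p).symm m i) := e.toFraming.app_symm_map z p m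

variable (hP : IsTorsor (fppf X) P) (hM : Presieve.IsSheaf (fppf X) (secF M))
  (hN : Presieve.IsSheaf (fppf X) (secF N)) (e : ModFraming P L M) (e' : ModFraming P L N)

/-- Two sheaves of modules with framings by the same torsor are isomorphic. -/
def linEquiv (Y : Over X) : Sec M Y ≃ₗ[Γ(Y.left, ⊤)] Sec N Y :=
  have h1 : ∀ {Y Z : Over X} (z : Z ⟶ Y) (p : P.F.obj (op Z)) (m : Sec M Y),
      (e'.app p).symm (res N z (Framing.equiv hP hM hN e.toFraming e'.toFraming Y m)) =
        (e.app p).symm (res M z m) :=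
    fun z p m => Framing.equiv_spec hP hM hN e.toFraming e'.toFraming z p m
  let f : Sec M Y → Sec N Y := Framing.equiv hP hM hN e.toFraming e'.toFraming Y
  have h2 : ∀ {Z : Over X} (z : Z ⟶ Y) (p : P.F.obj (op Z)) (m : Sec M Y),
      (e'.app p).symm (res N z (f m)) = (e.app p).symm (res M z m) := h1
  { toFun := f
    invFun := (Framing.equiv hP hM hN e.toFraming e'.toFraming Y).symm
    left_inv := (Framing.equiv hP hM hN e.toFraming e'.toFraming Y).left_inv
    right_inv := (Framing.equiv hP hM hN e.toFraming e'.toFraming Y).right_inv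
    map_add' := fun a b => sec_ext hN (hP.sieve_mem Y) fun Z z ⟨p⟩ =>
      (e'.app p).symm.injective (by
        rw [h2, map_add, map_add, map_add, map_add, h2, h2])
    map_smul' := fun c a => sec_ext hN (hP.sieve_mem Y) fun Z z ⟨p⟩ =>
      (e'.app p).symm.injective (by
        rw [h2, map_smulₛₗ, map_smul, RingHom.id_apply, map_smulₛₗ, map_smul, h2]) }

theorem linEquiv_app {Y : Over X} (p : P.F.obj (op Y)) (v : ι → Γ(Y.left, ⊤)) :
    linEquiv hP hM hN e e' Y (e.app p v) = e'.app p v :=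
  Framing.equiv_app hP hM hN e.toFraming e'.toFraming p v

theorem res_linEquiv {Y Z : Over X} (z : Z ⟶ Y) (m : Sec M Y) :
    res N z (linEquiv hP hM hN e e' Y m) = linEquiv hP hM hN e e' Z (res M z m) :=
  Framing.map_equiv hP hM hN e.toFraming e'.toFraming z m

/-- The transport of a framing along an isomorphism of modules. -/
def trans (e : ModFraming P L M) (f : ∀ Y : Over X, Sec M Y ≃ₗ[Γ(Y.left, ⊤)] Sec N Y)
    (hf : ∀ {Y Z : Over X} (z : Z ⟶ Y) (m : Sec M Y), res N z (f Y m) = f Z (res M z m)) :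
    ModFraming P L N where
  app {Y} p := (e.app p).trans (f Y)
  app_map z p v := by
    rw [LinearEquiv.trans_apply, LinearEquiv.trans_apply, hf, e.app_map]
  app_act p g v := by
    rw [LinearEquiv.trans_apply, LinearEquiv.trans_apply, e.app_act]

end ModFraming

/-- The associated module is framed by the torsor. -/
def assocFraming (hP : IsTorsor (fppf X) P) (L : LinAct G ι) : ModFraming P L (assocMod P L) :=
  let e := EqvSec.framing L.gset hP
  have hs : ∀ {Y : Over X} (p : P.F.obj (op Y)) (s : AssocSec P L Y),
      (e.app p).symm s = s.val (𝟙 Y) p := fun p s => rfl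
  { app := fun {Y} p => LinearEquiv.symm
      { (e.app p).symm with
        map_add' := fun s t => rfl
        map_smul' := fun a s => by
          change Scheme.Hom.appTop (𝟙 Y : Y ⟶ Y).left a • AssocSec.val (Y := Y) s (𝟙 Y) p = _
          rw [Over.id_left, Scheme.Hom.id_appTop]
          rfl }
    app_map := fun z p v => e.app_map z p v
    app_act := fun {Y} p g v => by
      have h := e.app_act p g (L.act g v)
      have h2 : L.act (Y := Y) g⁻¹ (L.act g v) = v := by
        have := L.act_inv_act (Y := Y) g⁻¹ v
        rwa [inv_inv] at this
      refine Eq.trans ?_ h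
      exact congrArg (e.app (P.act p g)) h2.symm }

end Assoc

/-! ### Modules and Azumaya algebras as associated modules -/

section Linear

/-- A natural linear action of `F R` on `R ^ ι`. -/
structure LinRep (F : CommRingCat.{u} ⥤ GrpCat.{u}) (ι : Type) where
  /-- the action over a ring -/
  act {R : CommRingCat.{u}} : F.obj R →* ((ι → R) ≃ₗ[R] (ι → R))
  act_map {R R' : CommRingCat.{u}} (φ : R ⟶ R') (g : F.obj R) (v : ι → R) :
    (fun i => φ (act g v i)) = act (F.map φ g) (fun i => φ (v i))

/-- The action on `𝒪 ^ ι` of the presheaf of groups on schemes over `X`. -/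
def LinRep.lin {F : CommRingCat.{u} ⥤ GrpCat.{u}} {ι : Type} (ρ : LinRep F ι) (X : Scheme.{u}) :
    LinAct (onSch F X) ι where
  act := ρ.act
  act_map z g v := ρ.act_map z.left.appTop g v

/-- The standard representation of `GL n`. -/
def glRep (n : ℕ) : LinRep (GLFun.{u} n) (Fin n) where
  act {R} :=
    { toFun := fun g => glEquiv g
      map_one' := LinearEquiv.ext fun v => Matrix.one_mulVec v
      map_mul' := fun A B => LinearEquiv.ext fun v => (Matrix.mulVec_mulVec v A.1 B.1).symm }
  act_map {R R'} φ g v := funext fun i => RingHom.map_mulVec φ.hom _ v i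

/-- The representation of `PGL n` on the matrix algebra. -/
def pglRep (n : ℕ) : LinRep (PGLFun.{u} n) (Fin n × Fin n) where
  act {R} :=
    { toFun := fun g => ((matVec n R).trans (AlgEquiv.toLinearEquiv g)).trans (matVec n R).symm
      map_one' := LinearEquiv.ext fun v => rfl
      map_mul' := fun A B => LinearEquiv.ext fun v => rfl }
  act_map {R R'} φ g v := congrArg (matVec n R').symm (matAutMap_map φ.hom g (matVec n R v)).symm

variable {X : Scheme.{u}} {G : (Over X)ᵒᵖ ⥤ GrpCat.{u}} {P : RightGSet G} {M N : OMod X} {n : ℕ}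

/-- A module is framed by its frames. -/
def framesFraming (M : OMod X) (n : ℕ) : ModFraming (frames M n) ((glRep n).lin X) M where
  app {Y} e := FrameSec.app (Y := Y) e Y (𝟙 Y)
  app_map {Y Z} z e v := by
    refine (FrameSec.app_map (Y := Y) e Y Z (𝟙 Y) z v).trans ?_
    change FrameSec.app (Y := Y) e Z (z ≫ 𝟙 Y) _ = FrameSec.app (Y := Y) e Z (𝟙 Z ≫ z) _
    rw [Category.comp_id, Category.id_comp]
  app_act {Y} e g v := FrameSec.act_app_self (Y := Y) e g v

/-- The frame of a framed module given by a section of the torsor. -/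
def ModFraming.frame {L : LinAct G (Fin n)} (e : ModFraming P L M) {Y : Over X}
    (p : P.F.obj (op Y)) : FrameSec M n Y where
  app Z z := e.app (P.F.map z.op p)
  app_map Z W z w v := by rw [e.app_map, op_comp, P.map_comp_apply]

theorem ModFraming.frame_app_self {L : LinAct G (Fin n)} (e : ModFraming P L M) {Y : Over X}
    (p : P.F.obj (op Y)) (v : Fin n → Γ(Y.left, ⊤)) :
    (e.frame p).app Y (𝟙 Y) v = e.app p v := by
  change e.app (P.F.map (𝟙 (op Y)) p) v = _
  rw [P.map_id_apply]

theorem ModFraming.isLocFree {L : LinAct G (Fin n)} (hP : IsTorsor (fppf X) P)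
    (hM : Presieve.IsSheaf (fppf X) (secF M)) (e : ModFraming P L M) : IsLocFree M n where
  isSheaf := (isSheaf_secF_iff M).1 hM
  locally_free := ⟨_, hP.sieve_mem _, fun Y f ⟨p⟩ => ⟨e.frame p⟩⟩

/-- The contracted product along a homomorphism to `GL n` is the torsor of frames of the associated
module. -/
theorem ModFraming.isom_push_frames {φ : G ⟶ onSch (GLFun.{u} n) X} (hP : IsTorsor (fppf X) P)
    (hM : IsLocFree M n) (e : ModFraming P (((glRep n).lin X).comp φ) M) :
    (P.push φ).Isom (frames M n) := by
  refine isom_push_of_map (isSheaf_GL n X) hP (isTorsor_frames hM) (fun Y p => e.frame p) ?_ ?_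
  · intro Y Z u p
    refine FrameSec.ext (M := M) (Y := Z.unop) (funext fun W => funext fun w => ?_)
    change e.app (P.F.map w.op (P.F.map u p)) = e.app (P.F.map (w ≫ u.unop).op p)
    rw [op_comp, P.map_comp_apply]
    rfl
  · intro Y p g
    refine FrameSec.ext_self (M := M) (Y := Y.unop) fun v => ?_
    refine (e.frame_app_self (P.act p g) v).trans (Eq.trans ?_
      (FrameSec.act_app_self (Y := Y.unop) (e.frame p) (φ.app Y g) v).symm)
    rw [e.frame_app_self]
    exact e.app_act p g v

/-- A framing by isomorphisms of algebras. -/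
structure ModFraming.IsAlg {L : LinAct G (Fin n × Fin n)} (e : ModFraming P L M) (A : AlgStr M) :
    Prop where
  app_one {Y : Over X} (p : P.F.obj (op Y)) : e.app p ((matVec n _).symm 1) = A.one Y
  app_mul {Y : Over X} (p : P.F.obj (op Y)) (a b : Matrix (Fin n) (Fin n) Γ(Y.left, ⊤)) :
    e.app p ((matVec n _).symm (a * b)) =
      A.mul Y (e.app p ((matVec n _).symm a)) (e.app p ((matVec n _).symm b))

/-- An algebra is framed by its frames. -/
def algFramesFraming (A : AlgStr M) (n : ℕ) :
    ModFraming (algFrames A n) ((pglRep n).lin X) M where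
  app {Y} e := (matVec n _).trans (AlgFrameSec.app (Y := Y) e Y (𝟙 Y))
  app_map {Y Z} z e v := by
    refine (AlgFrameSec.app_map (Y := Y) e Y Z (𝟙 Y) z _).trans ?_
    change AlgFrameSec.app (Y := Y) e Z (z ≫ 𝟙 Y) _ = AlgFrameSec.app (Y := Y) e Z (𝟙 Z ≫ z) _
    rw [Category.comp_id, Category.id_comp]
    rfl
  app_act {Y} e g v := AlgFrameSec.act_app_self (Y := Y) e g _

theorem isAlg_algFramesFraming (A : AlgStr M) (n : ℕ) : (algFramesFraming A n).IsAlg A where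
  app_one {Y} e := AlgFrameSec.app_one (Y := Y) e Y (𝟙 Y)
  app_mul {Y} e a b := AlgFrameSec.app_mul (Y := Y) e Y (𝟙 Y) a b

namespace ModFraming.IsAlg

variable {L : LinAct G (Fin n × Fin n)} {e : ModFraming P L M} {A : AlgStr M}

/-- The frame of a framed algebra given by a section of the torsor. -/
def frame (h : e.IsAlg A) {Y : Over X} (p : P.F.obj (op Y)) : AlgFrameSec A n Y where
  app Z z := (matVec n _).symm.trans (e.app (P.F.map z.op p))
  app_one Z z := h.app_one _
  app_mul Z z := h.app_mul _
  app_map Z W z w v := by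
    rw [LinearEquiv.trans_apply, LinearEquiv.trans_apply, e.app_map, op_comp, P.map_comp_apply]
    rfl

theorem frame_app_self (h : e.IsAlg A) {Y : Over X} (p : P.F.obj (op Y))
    (v : Matrix (Fin n) (Fin n) Γ(Y.left, ⊤)) :
    (h.frame p).app Y (𝟙 Y) v = e.app p ((matVec n _).symm v) := by
  change e.app (P.F.map (𝟙 (op Y)) p) _ = _
  rw [P.map_id_apply]
  rfl

theorem isAzumaya (h : e.IsAlg A) (hP : IsTorsor (fppf X) P)
    (hM : Presieve.IsSheaf (fppf X) (secF M)) : IsAzumaya A n where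
  isSheaf := (isSheaf_secF_iff M).1 hM
  locally_matrix := ⟨_, hP.sieve_mem _, fun Y f ⟨p⟩ => ⟨h.frame p⟩⟩

/-- The contracted product along a homomorphism to `PGL n` is the torsor of frames of the
associated algebra. -/
theorem isom_push_frames {φ : G ⟶ onSch (PGLFun.{u} n) X} (hP : IsTorsor (fppf X) P)
    {e : ModFraming P (((pglRep n).lin X).comp φ) M} (h : e.IsAlg A)
    (hM : IsAzumaya A n) : (P.push φ).Isom (algFrames A n) := by
  refine isom_push_of_map (isSheaf_PGL n X) hP (isTorsor_algFrames hM)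
    (fun Y p => h.frame p) ?_ ?_
  · intro Y Z u p
    refine AlgFrameSec.ext (A := A) (Y := Z.unop) (funext fun W => funext fun w => ?_)
    change (matVec n _).symm.trans (e.app (P.F.map w.op (P.F.map u p))) =
      (matVec n _).symm.trans (e.app (P.F.map (w ≫ u.unop).op p))
    rw [op_comp, P.map_comp_apply]
    rfl
  · intro Y p g
    refine AlgFrameSec.ext_self (A := A) (Y := Y.unop) fun v => ?_
    refine (h.frame_app_self (P.act p g) v).trans (Eq.trans ?_
      (AlgFrameSec.act_app_self (Y := Y.unop) (h.frame p) (φ.app Y g) v).symm)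
    rw [h.frame_app_self]
    exact e.app_act p g _

/-- The algebra structure on a sheaf is determined by a framing. -/
theorem ext {A' : AlgStr M} (hP : IsTorsor (fppf X) P)
    (hM : Presieve.IsSheaf (fppf X) (secF M)) (h : e.IsAlg A) (h' : e.IsAlg A') : A = A' := by
  have h1 : ∀ Y, A.one Y = A'.one Y := fun Y =>
    sec_ext hM (hP.sieve_mem Y) fun Z z ⟨p⟩ => by
      rw [A.res_one, A'.res_one, ← h.app_one p, ← h'.app_one p]
  have h2 : ∀ Y a b, A.mul Y a b = A'.mul Y a b := fun Y a b =>
    sec_ext hM (hP.sieve_mem Y) fun Z z ⟨p⟩ => by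
      rw [A.res_mul, A'.res_mul]
      obtain ⟨v, hv⟩ := ((matVec n _).symm.trans (e.app p)).surjective (res M z a)
      obtain ⟨w, hw⟩ := ((matVec n _).symm.trans (e.app p)).surjective (res M z b)
      rw [← hv, ← hw]
      exact (h.app_mul p v w).symm.trans (h'.app_mul p v w)
  exact AlgStr.ext (funext fun Y => LinearMap.ext fun a => LinearMap.ext fun b => h2 Y a b)
    (funext h1)

end ModFraming.IsAlg

/-- The transport of an algebra structure along an isomorphism of modules. -/
def AlgStr.transport (A : AlgStr M) (f : ∀ Y : Over X, Sec M Y ≃ₗ[Γ(Y.left, ⊤)] Sec N Y)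
    (hf : ∀ {Y Z : Over X} (z : Z ⟶ Y) (m : Sec M Y), res N z (f Y m) = f Z (res M z m)) :
    AlgStr N where
  mul Y := ((A.mul Y).compl₁₂ (f Y).symm.toLinearMap (f Y).symm.toLinearMap).compr₂
    (f Y).toLinearMap
  one Y := f Y (A.one Y)
  one_mul Y a := by simp [A.one_mul]
  mul_one Y a := by simp [A.mul_one]
  mul_assoc Y a b c := by simp [A.mul_assoc]
  res_mul {Y Z} z a b := by
    have h : ∀ a, (f Z).symm (res N z a) = res M z ((f Y).symm a) := fun a => by
      rw [LinearEquiv.symm_apply_eq, ← hf, LinearEquiv.apply_symm_apply]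
    simp [hf, A.res_mul, h]
  res_one {Y Z} z := by rw [hf, A.res_one]

theorem AlgStr.transport_mul (A : AlgStr M) (f : ∀ Y : Over X, Sec M Y ≃ₗ[Γ(Y.left, ⊤)] Sec N Y)
    (hf : ∀ {Y Z : Over X} (z : Z ⟶ Y) (m : Sec M Y), res N z (f Y m) = f Z (res M z m))
    (Y : Over X) (a b : Sec M Y) :
    (A.transport f hf).mul Y (f Y a) (f Y b) = f Y (A.mul Y a b) := by
  simp [AlgStr.transport]

theorem ModFraming.IsAlg.trans {L : LinAct G (Fin n × Fin n)} {e : ModFraming P L M}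
    {A : AlgStr M} (h : e.IsAlg A) (f : ∀ Y : Over X, Sec M Y ≃ₗ[Γ(Y.left, ⊤)] Sec N Y)
    (hf : ∀ {Y Z : Over X} (z : Z ⟶ Y) (m : Sec M Y), res N z (f Y m) = f Z (res M z m)) :
    (e.trans f hf).IsAlg (A.transport f hf) where
  app_one p := congrArg (f _) (h.app_one p)
  app_mul p a b := (congrArg (f _) (h.app_mul p a b)).trans (A.transport_mul f hf _ _ _).symm

/-- The algebra structure on the module associated with a torsor and an action by automorphisms of
the matrix algebra. -/
def assocAlg (P : RightGSet G) (φ : G ⟶ onSch (PGLFun.{u} n) X) :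
    AlgStr (assocMod P (((pglRep n).lin X).comp φ)) :=
  let L := ((pglRep n).lin X).comp φ
  have hL : ∀ {Y : Over X} (g : G.obj (op Y)) (v : Fin n × Fin n → Γ(Y.left, ⊤)),
      matVec n _ (L.act g v) = (show MatAut n Γ(Y.left, ⊤) from φ.app (op Y) g) (matVec n _ v) :=
    fun g v => rfl
  -- products are formed at each point; equivariance holds as the group acts by algebra maps
  let mul (Y : Over X) (s t : AssocSec P L Y) : AssocSec P L Y :=
    AssocSec.mk' (fun Z z p => (matVec n _).symm (matVec n _ (s.val z p) * matVec n _ (t.val z p)))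
      (fun Z W z w p => by
        rw [s.val_map, t.val_map]
        refine Eq.trans ?_ (matVec_symm_map w.left.appTop.hom _)
        congr 1
        exact (Matrix.map_mul (f := w.left.appTop.hom)).symm)
      (fun Z z p g => by
        refine (matVec n _).injective ?_
        rw [hL, s.val_act, t.val_act, hL, hL, LinearEquiv.apply_symm_apply,
          LinearEquiv.apply_symm_apply, map_mul])
  let one (Y : Over X) : AssocSec P L Y :=
    AssocSec.mk' (fun Z z p => (matVec n _).symm 1)
      (fun Z W z w p => by
        refine Eq.trans ?_ (matVec_symm_map w.left.appTop.hom _)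
        congr 1
        exact (Matrix.map_one w.left.appTop.hom (map_zero _) (map_one _)).symm)
      (fun Z z p g => by
        refine (matVec n _).injective ?_
        rw [hL, LinearEquiv.apply_symm_apply, map_one])
  { mul := fun Y => LinearMap.mk₂ Γ(Y.left, ⊤) (mul Y)
      (fun s s' t => AssocSec.ext_val fun Z z p => by
        change (matVec n _).symm (matVec n _ (s.val z p + s'.val z p) * matVec n _ (t.val z p)) =
          (matVec n _).symm _ + (matVec n _).symm _
        rw [map_add, add_mul, map_add])
      (fun c s t => AssocSec.ext_val fun Z z p => by
        change (matVec n _).symm (matVec n _ (z.left.appTop c • s.val z p) *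
          matVec n _ (t.val z p)) = z.left.appTop c • (matVec n _).symm _
        rw [map_smul, smul_mul_assoc, map_smul])
      (fun s t t' => AssocSec.ext_val fun Z z p => by
        change (matVec n _).symm (matVec n _ (s.val z p) * matVec n _ (t.val z p + t'.val z p)) =
          (matVec n _).symm _ + (matVec n _).symm _
        rw [map_add, mul_add, map_add])
      (fun c s t => AssocSec.ext_val fun Z z p => by
        change (matVec n _).symm (matVec n _ (s.val z p) *
          matVec n _ (z.left.appTop c • t.val z p)) = z.left.appTop c • (matVec n _).symm _
        rw [map_smul, mul_smul_comm, map_smul])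
    one := one
    one_mul := fun Y s => AssocSec.ext_val (Y := Y) fun Z z p => by
      refine (matVec n _).injective (Eq.trans (LinearEquiv.apply_symm_apply _ _) ?_)
      exact one_mul _
    mul_one := fun Y s => AssocSec.ext_val (Y := Y) fun Z z p => by
      refine (matVec n _).injective (Eq.trans (LinearEquiv.apply_symm_apply _ _) ?_)
      exact mul_one _
    mul_assoc := fun Y a b c => AssocSec.ext_val (Y := Y) fun Z z p => by
      refine congrArg (matVec n _).symm ?_
      exact mul_assoc _ _ _
    res_mul := fun f a b => rfl
    res_one := fun f => rfl }

theorem assocFraming_symm_apply (hP : IsTorsor (fppf X) P) {ι : Type} (L : LinAct G ι) {Y : Over X}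
    (p : P.F.obj (op Y)) (s : AssocSec P L Y) :
    ((assocFraming hP L).app p).symm s = s.val (𝟙 Y) p := rfl

theorem assocAlg_one_val (φ : G ⟶ onSch (PGLFun.{u} n) X) {Y : Over X} {Z : Over X} (z : Z ⟶ Y)
    (p : P.F.obj (op Z)) :
    AssocSec.val (Y := Y) ((assocAlg P φ).one Y) z p = (matVec n _).symm 1 := rfl

theorem assocAlg_mul_val (φ : G ⟶ onSch (PGLFun.{u} n) X) {Y : Over X}
    (s t : AssocSec P (((pglRep n).lin X).comp φ) Y) {Z : Over X} (z : Z ⟶ Y)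
    (p : P.F.obj (op Z)) :
    AssocSec.val (Y := Y) ((assocAlg P φ).mul Y s t) z p =
      (matVec n _).symm (matVec n _ (s.val z p) * matVec n _ (t.val z p)) := rfl

theorem isAlg_assocFraming (hP : IsTorsor (fppf X) P) (φ : G ⟶ onSch (PGLFun.{u} n) X) :
    (assocFraming hP (((pglRep n).lin X).comp φ)).IsAlg (assocAlg P φ) where
  app_one {Y} p := by
    refine ((assocFraming hP _).app p).symm.injective ((LinearEquiv.symm_apply_apply _ _).trans ?_)
    exact ((assocFraming_symm_apply hP _ p _).trans (assocAlg_one_val φ _ p)).symm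
  app_mul {Y} p a b := by
    let e := (assocFraming hP (((pglRep n).lin X).comp φ)).app p
    have h : ∀ v, AssocSec.val (Y := Y) (e v) (𝟙 Y) p = v := fun v => e.symm_apply_apply v
    refine e.symm.injective ((e.symm_apply_apply _).trans ?_)
    refine Eq.trans ?_ ((assocFraming_symm_apply hP _ p _).trans
      (assocAlg_mul_val φ (Y := Y) _ _ _ p)).symm
    rw [h, h, LinearEquiv.apply_symm_apply, LinearEquiv.apply_symm_apply]

end Linear

/-! ### Isomorphisms of modules over different schemes -/

section Pull

variable {T T' : Scheme.{u}} (g : T ⟶ T')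

/-- The morphism of schemes over `T'` given by a morphism of schemes over `T`. -/
abbrev mapHom {Y Z : Over T} (h : Z ⟶ Y) : Over.mk (Z.hom ≫ g) ⟶ Over.mk (Y.hom ≫ g) :=
  Over.homMk h.left (by simp)

theorem isSheaf_over_map {F : (Over T')ᵒᵖ ⥤ Type w} (hF : Presieve.IsSheaf (fppf T') F) :
    Presieve.IsSheaf (fppf T) ((Over.map g).op ⋙ F) :=
  (Over.map g).op_comp_isSheaf_of_types (fppf T) (fppf T') ⟨F, (isSheaf_iff_isSheaf_of_type _ _).2 hF⟩

instance (M' : OMod T') (Y : (Over T)ᵒᵖ) : Module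
    ((functions T ⋙ forget₂ CommRingCat.{u} RingCat.{u}).obj Y)
    (Sec M' (Over.mk (Y.unop.hom ≫ g))) :=
  inferInstanceAs (Module Γ((Over.mk (Y.unop.hom ≫ g)).left, ⊤) (Sec M' (Over.mk (Y.unop.hom ≫ g))))

/-- The pullback of a module along a morphism. -/
def pullMod (M' : OMod T') : OMod T where
  obj Y := ModuleCat.of _ (Sec M' (Over.mk (Y.unop.hom ≫ g)))
  map {Y Z} h := ModuleCat.ofHom
    (Y := (ModuleCat.restrictScalars ((functions T ⋙ forget₂ CommRingCat.{u} RingCat.{u}).map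
      h).hom).obj (ModuleCat.of _ (Sec M' (Over.mk (Z.unop.hom ≫ g)))))
    { toFun := res M' (mapHom g h.unop)
      map_add' := map_add _
      map_smul' := fun a m => (res M' (mapHom g h.unop)).map_smul' a m }
  map_id Y := by
    refine ModuleCat.hom_ext (LinearMap.ext fun (m : Sec M' (Over.mk (Y.unop.hom ≫ g))) => ?_)
    exact (congrArg (fun k => res M' k m) (Over.OverMorphism.ext rfl)).trans (res_id M' m)
  map_comp {Y Z W} h k := by
    refine ModuleCat.hom_ext (LinearMap.ext fun (m : Sec M' (Over.mk (Y.unop.hom ≫ g))) => ?_)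
    refine Eq.trans ?_ (res_comp M' (mapHom g h.unop) (mapHom g k.unop) m)
    exact congrArg (fun k => res M' k m) (Over.OverMorphism.ext rfl)

theorem isSheaf_pullMod {M' : OMod T'} (hM : Presieve.IsSheaf (fppf T') (secF M')) :
    Presieve.IsSheaf (fppf T) (secF (pullMod g M')) :=
  isSheaf_over_map g hM

variable {F : CommRingCat.{u} ⥤ GrpCat.{u}}

/-- A map from a torsor on `T` to the pullback along `g` of a torsor on `T'`. -/
structure TorsorMap (P : RightGSet (onSch F T)) (P' : RightGSet (onSch F T')) : Type (u + 1) where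
  /-- the map on sections -/
  app {Y : Over T} (p : P.F.obj (op Y)) : P'.F.obj (op (Over.mk (Y.hom ≫ g)))
  app_map {Y Z : Over T} (h : Z ⟶ Y) (p : P.F.obj (op Y)) :
    app (P.F.map h.op p) = P'.F.map (mapHom g h).op (app p)
  app_act {Y : Over T} (p : P.F.obj (op Y)) (a : (onSch F T).obj (op Y)) :
    app (P.act p a) = P'.act (app p) a

variable {g} {P : RightGSet (onSch F T)} {P' : RightGSet (onSch F T')} {ι : Type} {ρ : LinRep F ι}
  {M : OMod T} {M' : OMod T'}

/-- The framing of the pullback of a module given by a map of torsors. -/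
def TorsorMap.framing (θ : TorsorMap g P P') (e : ModFraming P' (ρ.lin T') M') :
    ModFraming P (ρ.lin T) (pullMod g M') where
  app p := e.app (θ.app p)
  app_map z p v := (e.app_map (mapHom g z) (θ.app p) v).trans (congrArg (fun k => e.app k _) (θ.app_map z p).symm)
  app_act p a v := by
    rw [θ.app_act]
    exact e.app_act (θ.app p) a v

/-- An isomorphism of modules given by a linear isomorphism with the pullback. -/
def ModIso.ofLinear (f : ∀ Y : Over T, Sec M Y ≃ₗ[Γ(Y.left, ⊤)] Sec (pullMod g M') Y)
    (hf : ∀ {Y Z : Over T} (z : Z ⟶ Y) (m : Sec M Y),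
      SegreNorm.res (pullMod g M') z (f Y m) = f Z (SegreNorm.res M z m)) : ModIso g M M' where
  app Y := (f Y).toAddEquiv
  app_smul Y a m := (f Y).map_smul a m
  app_res h m := (hf h m).symm

instance (M : OMod T) {Y : Scheme.{u}} (y : Y ⟶ T) : Module Γ(Y, ⊤) (Sec M (Over.mk y)) :=
  inferInstanceAs (Module Γ((Over.mk y).left, ⊤) (Sec M (Over.mk y)))

namespace ModIso

/-- The value of an isomorphism on the sections over a scheme `Z` over `T'`, with a given
factorization of the structure morphism through `T`. -/
def secAt (e : ModIso g M M') (Z : Over T') (y : Z.left ⟶ T) (hy : y ≫ g = Z.hom) :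
    Sec M (Over.mk y) ≃ₗ[Γ(Z.left, ⊤)] Sec M' Z :=
  let i : Z ⟶ Over.mk ((Over.mk y).hom ≫ g) := Over.homMk (𝟙 _) (by simpa using hy)
  let j : Over.mk ((Over.mk y).hom ≫ g) ⟶ Z := Over.homMk (𝟙 _) (by simpa using hy.symm)
  have hij : ∀ m, SegreNorm.res M' i (SegreNorm.res M' j m) = m := fun m => by
    rw [← res_comp]
    exact (congrArg (fun k => SegreNorm.res M' k m) (Over.OverMorphism.ext
      (Category.comp_id _))).trans (res_id M' m)
  have hji : ∀ m, SegreNorm.res M' j (SegreNorm.res M' i m) = m := fun m => by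
    rw [← res_comp]
    exact (congrArg (fun k => SegreNorm.res M' k m) (Over.OverMorphism.ext
      (Category.comp_id _))).trans (res_id M' m)
  { toFun := fun m => SegreNorm.res M' i (e.app (Over.mk y) m)
    invFun := fun m => (e.app (Over.mk y)).symm (SegreNorm.res M' j m)
    left_inv := fun m => by beta_reduce; rw [hji, AddEquiv.symm_apply_apply]
    right_inv := fun m => by beta_reduce; rw [AddEquiv.apply_symm_apply, hij]
    map_add' := fun a b => by rw [map_add, map_add]
    map_smul' := fun (a : Γ(Z.left, ⊤)) b => by
      have h1 := e.app_smul (Over.mk y) a b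
      have h2 : i.left.appTop.hom a = a := by
        change (Scheme.Hom.appTop (𝟙 Z.left)).hom a = a
        rw [Scheme.Hom.id_appTop]; rfl
      refine (congrArg (SegreNorm.res M' i) h1).trans (((SegreNorm.res M' i).map_smulₛₗ _ _).trans ?_)
      exact congrArg (· • _) h2 }

theorem res_secAt (e : ModIso g M M') {Z W : Over T'} (w : W ⟶ Z) (y : Z.left ⟶ T)
    (hy : y ≫ g = Z.hom) (y' : W.left ⟶ T) (hy' : y' ≫ g = W.hom) (h : w.left ≫ y = y')
    (m : Sec M (Over.mk y)) :
    SegreNorm.res M' w (e.secAt Z y hy m) =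
      e.secAt W y' hy' (SegreNorm.res M (Over.homMk w.left h : Over.mk y' ⟶ Over.mk y) m) := by
  change SegreNorm.res M' w (SegreNorm.res M' _ _) = SegreNorm.res M' _ (e.app _ _)
  rw [e.app_res, ← res_comp, ← res_comp]
  refine congrArg (fun k => SegreNorm.res M' k _) (Over.OverMorphism.ext ?_)
  exact (Category.comp_id _).trans (Category.id_comp _).symm

theorem secAt_self (e : ModIso g M M') (Y : Over T) (m : Sec M Y) :
    e.secAt (Over.mk (Y.hom ≫ g)) Y.hom rfl m = e.app Y m :=
  (congrArg (fun k => SegreNorm.res M' k (e.app Y m)) (Over.OverMorphism.ext rfl)).trans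
    (res_id M' _)

/-- The frame of `M'` given by an isomorphism and a frame of `M`. -/
def frame (e : ModIso g M M') {n : ℕ} {Y : Over T} (p : FrameSec M n Y) :
    FrameSec M' n (Over.mk (Y.hom ≫ g)) where
  app Z z := (show (Fin n → Γ(Z.left, ⊤)) ≃ₗ[Γ(Z.left, ⊤)] Sec M (Over.mk (z.left ≫ Y.hom)) from
    p.app (Over.mk (z.left ≫ Y.hom)) (Over.homMk z.left rfl)).trans
    (e.secAt Z (z.left ≫ Y.hom) (by rw [Category.assoc]; exact Over.w z))
  app_map Z W z w v := by
    rw [LinearEquiv.trans_apply, LinearEquiv.trans_apply, e.res_secAt w _ _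
      ((w ≫ z).left ≫ Y.hom) (by rw [Category.assoc]; exact Over.w (w ≫ z))
      (by rw [Over.comp_left, Category.assoc])]
    congr 1
    refine (p.app_map _ (Over.mk ((w ≫ z).left ≫ Y.hom)) _ _ _).trans ?_
    congr 1

theorem frame_app (e : ModIso g M M') {n : ℕ} {Y Z : Over T} (p : FrameSec M n Y) (h : Z ⟶ Y)
    (v : Fin n → Γ(Z.left, ⊤)) :
    (e.frame p).app (Over.mk (Z.hom ≫ g)) (mapHom g h) v = e.app Z (p.app Z h v) := by
  let k : Z ⟶ Over.mk (h.left ≫ Y.hom) := Over.homMk (𝟙 _) (by simp)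
  let q : Over.mk (h.left ≫ Y.hom) ⟶ Y := Over.homMk h.left rfl
  have hv : (fun i => k.left.appTop (v i)) = v := funext fun i => by
    change Scheme.Hom.appTop (𝟙 Z.left) (v i) = _
    rw [Scheme.Hom.id_appTop]; rfl
  have h1 : SegreNorm.res M k (p.app _ q v) = p.app Z h v := by
    refine (p.app_map _ Z q k v).trans ?_
    have hk : k ≫ q = h := Over.OverMorphism.ext (Category.id_comp _)
    rw [hv, hk]
  have h2 := e.res_secAt (𝟙 (Over.mk (Z.hom ≫ g))) (h.left ≫ Y.hom) (by simp) Z.hom rfl (by simp)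
    (p.app _ q v)
  rw [res_id] at h2
  rw [← h1, ← secAt_self]
  exact h2

/-- The map of torsors of frames given by an isomorphism of modules. -/
def torsorMap (e : ModIso g M M') (n : ℕ) : TorsorMap g (frames M n) (frames M' n) where
  app {Y} p := e.frame (Y := Y) p
  app_map {Y Z} h p := by
    refine FrameSec.ext_self (Y := Over.mk (Z.hom ≫ g)) fun v => ?_
    let p' : FrameSec M n Y := p
    have e1 := e.frame_app (p'.res h) (𝟙 Z) v
    have e2 := e.frame_app p' h v
    have hid : mapHom g (𝟙 Z) = 𝟙 _ := Over.OverMorphism.ext rfl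
    rw [hid] at e1
    refine e1.trans (Eq.trans ?_ (e2.symm.trans ?_))
    · change e.app Z (p'.app Z (𝟙 Z ≫ h) v) = _
      rw [Category.id_comp]
    · change (e.frame p').app _ _ v = (e.frame p').app _ (𝟙 _ ≫ mapHom g h) v
      rw [Category.id_comp]
  app_act {Y} p a := by
    refine FrameSec.ext_self (Y := Over.mk (Y.hom ≫ g)) fun v => ?_
    let p' : FrameSec M n Y := p
    have hid : mapHom g (𝟙 Y) = 𝟙 _ := Over.OverMorphism.ext rfl
    have e1 := e.frame_app (p'.act a) (𝟙 Y) v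
    have e2 := e.frame_app p' (𝟙 Y) (Matrix.mulVec (Units.val (show GL (Fin n) Γ(Y.left, ⊤) from a)) v)
    rw [hid] at e1 e2
    refine e1.trans (Eq.trans ?_ (e2.symm.trans ?_))
    · exact congrArg (e.app Y) (p'.act_app_self a v)
    · exact (FrameSec.act_app_self (e.frame p') a v).symm

/-- The frame of an algebra on `T'` given by an isomorphism and a frame of an algebra on `T`. -/
def algFrame (e : ModIso g M M') {A : AlgStr M} {A' : AlgStr M'}
    (he : ∀ Y : Over T, e.app Y (A.one Y) = A'.one (Over.mk (Y.hom ≫ g)) ∧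
      ∀ a b : Sec M Y, e.app Y (A.mul Y a b) =
        A'.mul (Over.mk (Y.hom ≫ g)) (e.app Y a) (e.app Y b)) {n : ℕ} {Y : Over T}
    (p : AlgFrameSec A n Y) :
    AlgFrameSec A' n (Over.mk (Y.hom ≫ g)) where
  app Z z := (show Matrix (Fin n) (Fin n) Γ(Z.left, ⊤) ≃ₗ[Γ(Z.left, ⊤)] Sec M (Over.mk (z.left ≫ Y.hom)) from
    p.app (Over.mk (z.left ≫ Y.hom)) (Over.homMk z.left rfl)).trans
    (e.secAt Z (z.left ≫ Y.hom) (by rw [Category.assoc]; exact Over.w z))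
  app_one Z z := by
    rw [LinearEquiv.trans_apply, p.app_one]
    refine (congrArg (SegreNorm.res M' _) (he _).1).trans ?_
    rw [A'.res_one]
  app_mul Z z a b := by
    rw [LinearEquiv.trans_apply, p.app_mul]
    refine (congrArg (SegreNorm.res M' _) ((he _).2 _ _)).trans ?_
    rw [A'.res_mul]
    rfl
  app_map Z W z w v := by
    rw [LinearEquiv.trans_apply, LinearEquiv.trans_apply, e.res_secAt w _ _
      ((w ≫ z).left ≫ Y.hom) (by rw [Category.assoc]; exact Over.w (w ≫ z))
      (by rw [Over.comp_left, Category.assoc])]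
    congr 1
    refine (p.app_map _ (Over.mk ((w ≫ z).left ≫ Y.hom)) _ _ _).trans ?_
    congr 1

theorem algFrame_app (e : ModIso g M M') {A : AlgStr M} {A' : AlgStr M'}
    (he : ∀ Y : Over T, e.app Y (A.one Y) = A'.one (Over.mk (Y.hom ≫ g)) ∧
      ∀ a b : Sec M Y, e.app Y (A.mul Y a b) =
        A'.mul (Over.mk (Y.hom ≫ g)) (e.app Y a) (e.app Y b)) {n : ℕ} {Y Z : Over T}
    (p : AlgFrameSec A n Y) (h : Z ⟶ Y) (v : Matrix (Fin n) (Fin n) Γ(Z.left, ⊤)) :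
    (e.algFrame he p).app (Over.mk (Z.hom ≫ g)) (mapHom g h) v = e.app Z (p.app Z h v) := by
  let k : Z ⟶ Over.mk (h.left ≫ Y.hom) := Over.homMk (𝟙 _) (by simp)
  let q : Over.mk (h.left ≫ Y.hom) ⟶ Y := Over.homMk h.left rfl
  have hv : v.map k.left.appTop = v := Matrix.ext fun i j => by
    change Scheme.Hom.appTop (𝟙 Z.left) (v i j) = _
    rw [Scheme.Hom.id_appTop]; rfl
  have h1 : SegreNorm.res M k (p.app _ q v) = p.app Z h v := by
    refine (p.app_map _ Z q k v).trans ?_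
    have hk : k ≫ q = h := Over.OverMorphism.ext (Category.id_comp _)
    rw [hv, hk]
  have h2 := e.res_secAt (𝟙 (Over.mk (Z.hom ≫ g))) (h.left ≫ Y.hom) (by simp) Z.hom rfl (by simp)
    (p.app _ q v)
  rw [res_id] at h2
  rw [← h1, ← secAt_self]
  exact h2

/-- The map of torsors of frames given by an isomorphism of algebras. -/
def algTorsorMap (e : ModIso g M M') {A : AlgStr M} {A' : AlgStr M'}
    (he : ∀ Y : Over T, e.app Y (A.one Y) = A'.one (Over.mk (Y.hom ≫ g)) ∧
      ∀ a b : Sec M Y, e.app Y (A.mul Y a b) =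
        A'.mul (Over.mk (Y.hom ≫ g)) (e.app Y a) (e.app Y b)) (n : ℕ) :
    TorsorMap g (algFrames A n) (algFrames A' n) where
  app {Y} p := e.algFrame he (Y := Y) p
  app_map {Y Z} h p := by
    refine AlgFrameSec.ext_self (Y := Over.mk (Z.hom ≫ g)) fun v => ?_
    let p' : AlgFrameSec A n Y := p
    have e1 := e.algFrame_app he (p'.res h) (𝟙 Z) v
    have e2 := e.algFrame_app he p' h v
    have hid : mapHom g (𝟙 Z) = 𝟙 _ := Over.OverMorphism.ext rfl
    rw [hid] at e1
    refine e1.trans (Eq.trans ?_ (e2.symm.trans ?_))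
    · change e.app Z (p'.app Z (𝟙 Z ≫ h) v) = _
      rw [Category.id_comp]
    · change (e.algFrame he p').app _ _ v = (e.algFrame he p').app _ (𝟙 _ ≫ mapHom g h) v
      rw [Category.id_comp]
  app_act {Y} p a := by
    refine AlgFrameSec.ext_self (Y := Over.mk (Y.hom ≫ g)) fun v => ?_
    let p' : AlgFrameSec A n Y := p
    have hid : mapHom g (𝟙 Y) = 𝟙 _ := Over.OverMorphism.ext rfl
    have e1 := e.algFrame_app he (p'.act a) (𝟙 Y) v
    have e2 := e.algFrame_app he p' (𝟙 Y) ((show MatAut n Γ(Y.left, ⊤) from a) v)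
    rw [hid] at e1 e2
    refine e1.trans (Eq.trans ?_ (e2.symm.trans ?_))
    · exact congrArg (e.app Y) (p'.act_app_self a v)
    · exact (AlgFrameSec.act_app_self (e.algFrame he p') a v).symm

end ModIso

/-- A map of the torsors of frames gives an isomorphism of modules. -/
theorem TorsorMap.nonempty_modIso {n : ℕ} (hM : IsLocFree M n) (hM' : IsLocFree M' n)
    (θ : TorsorMap g (frames M n) (frames M' n)) : Nonempty (ModIso g M M') :=
  ⟨ModIso.ofLinear (ModFraming.linEquiv (isTorsor_frames hM) ((isSheaf_secF_iff M).2 hM.isSheaf)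
    (isSheaf_pullMod g ((isSheaf_secF_iff M').2 hM'.isSheaf)) (framesFraming M n)
    (θ.framing (framesFraming M' n))) (ModFraming.res_linEquiv _ _ _ _ _)⟩

/-- A map of the torsors of frames gives an isomorphism of algebras. -/
theorem TorsorMap.exists_algIso {n : ℕ} {A : AlgStr M} {A' : AlgStr M'} (hM : IsAzumaya A n)
    (hM' : IsAzumaya A' n) (θ : TorsorMap g (algFrames A n) (algFrames A' n)) :
    ∃ e : ModIso g M M', ∀ Y : Over T, e.app Y (A.one Y) = A'.one (Over.mk (Y.hom ≫ g)) ∧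
      ∀ a b : Sec M Y, e.app Y (A.mul Y a b) =
        A'.mul (Over.mk (Y.hom ≫ g)) (e.app Y a) (e.app Y b) := by
  have hP := isTorsor_algFrames hM
  have hs := (isSheaf_secF_iff M).2 hM.isSheaf
  have hs' := isSheaf_pullMod g ((isSheaf_secF_iff M').2 hM'.isSheaf)
  let e0 := algFramesFraming A n
  let e1 := θ.framing (algFramesFraming A' n)
  let f := ModFraming.linEquiv hP hs hs' e0 e1
  have hf : ∀ {Y Z : Over T} (z : Z ⟶ Y) (m : Sec M Y),
      SegreNorm.res (pullMod g M') z (f Y m) = f Z (SegreNorm.res M z m) :=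
    fun z m => ModFraming.res_linEquiv hP hs hs' e0 e1 z m
  -- the algebra structure of the pullback of `M'`
  let B : AlgStr (pullMod g M') :=
    { mul := fun Y => A'.mul (Over.mk (Y.hom ≫ g))
      one := fun Y => A'.one (Over.mk (Y.hom ≫ g))
      one_mul := fun Y => A'.one_mul (Over.mk (Y.hom ≫ g))
      mul_one := fun Y => A'.mul_one (Over.mk (Y.hom ≫ g))
      mul_assoc := fun Y => A'.mul_assoc (Over.mk (Y.hom ≫ g))
      res_mul := fun h => A'.res_mul (mapHom g h)
      res_one := fun h => A'.res_one (mapHom g h) }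
  have hB : e1.IsAlg B :=
    ⟨fun p => (isAlg_algFramesFraming A' n).app_one (θ.app p),
      fun p => (isAlg_algFramesFraming A' n).app_mul (θ.app p)⟩
  have hB' : e1.IsAlg (A.transport f hf) := by
    have h1 : e0.trans f hf = e1 := by
      have : ∀ {Y : Over T} (p : (algFrames A n).F.obj (op Y)),
          (e0.app p).trans (f Y) = e1.app p := fun p =>
        LinearEquiv.ext fun v => ModFraming.linEquiv_app hP hs hs' e0 e1 p v
      obtain ⟨app1, _, _⟩ := e1
      change ModFraming.mk _ _ _ = _
      congr 1
      funext Y p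
      exact this p
    have h2 := (isAlg_algFramesFraming A n).trans f hf
    rwa [← h1]
  have hAB : A.transport f hf = B := ModFraming.IsAlg.ext hP hs' hB' hB
  refine ⟨ModIso.ofLinear f hf, fun Y => ⟨?_, fun a b => ?_⟩⟩
  · exact congrArg (fun C : AlgStr (pullMod g M') => C.one Y) hAB
  · refine (A.transport_mul f hf Y a b).symm.trans ?_
    rw [hAB]
    rfl

end Pull

/-! ### Locally constant functions -/

section LocallyConstantFunctions

variable {X Y : Scheme.{u}} {ι : Type} [DecidableEq ι]

/-- The indicator function of a fibre of a locally constant function. -/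
def lcInd (f : LocallyConstant X ι) (j : ι) : Γ(X, ⊤) := lcEval f (Pi.single j 1)

theorem germ_lcInd (f : LocallyConstant X ι) (j : ι) (x : X) :
    X.presheaf.germ ⊤ x trivial (lcInd f j) = if f x = j then 1 else 0 := by
  rw [lcInd, germ_lcEval, Pi.single_apply]
  split_ifs
  · exact map_one (X.presheaf.germ ⊤ x trivial).hom
  · exact map_zero (X.presheaf.germ ⊤ x trivial).hom

theorem lc_ext {f g : LocallyConstant X ι} (h : ∀ j, lcInd f j = lcInd g j) : f = g := by
  ext x
  have h1 := congrArg (X.presheaf.germ ⊤ x trivial) (h (f x))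
  rw [germ_lcInd, germ_lcInd, if_pos rfl] at h1
  by_contra hne
  rw [if_neg (Ne.symm hne)] at h1
  exact one_ne_zero h1

theorem appTop_lcInd (h : Y ⟶ X) (f : LocallyConstant X ι) (j : ι) :
    h.appTop (lcInd f j) = lcInd (lcPull h f) j := by
  rw [lcInd, appTop_lcEval, lcInd]
  congr 1
  funext k
  rw [Pi.single_apply, Pi.single_apply]
  split_ifs
  · exact map_one h.appTop.hom
  · exact map_zero h.appTop.hom

theorem lcInd_mul (f : LocallyConstant X ι) {i j : ι} (h : i ≠ j) : lcInd f i * lcInd f j = 0 := by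
  rw [lcInd, lcInd, ← map_mul, ← Pi.single_mul_left, Pi.single_apply, if_neg h, mul_zero,
    Pi.single_zero, map_zero]

theorem sum_lcInd [Fintype ι] (f : LocallyConstant X ι) : ∑ j, lcInd f j = 1 := by
  simp only [lcInd]
  rw [← map_sum]
  have : ∑ j : ι, (Pi.single j 1 : ι → Γ(X, ⊤)) = 1 := by
    funext i
    simp [Finset.sum_apply, Pi.single_apply]
  rw [this, map_one]

theorem lcEval_eq_sum [Fintype ι] (f : LocallyConstant X ι) (a : ι → Γ(X, ⊤)) :
    lcEval f a = ∑ j, a j * lcInd f j := by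
  refine eq_of_germ_eq fun x => ?_
  rw [germ_lcEval, map_sum]
  simp only [map_mul, germ_lcInd]
  simp

/-- A finite complete system of orthogonal idempotents is the system of indicator functions of the
fibres of a locally constant function. -/
theorem exists_lc [Fintype ι] (e : ι → Γ(X, ⊤)) (he : ∀ i j, i ≠ j → e i * e j = 0)
    (he' : ∑ j, e j = 1) : ∃ f : LocallyConstant X ι, ∀ j, lcInd f j = e j := by
  have hsq : ∀ i, e i * e i = e i := fun i => by
    conv_rhs => rw [← mul_one (e i), ← he', Finset.mul_sum]
    rw [Finset.sum_eq_single i (fun j _ hj => he i j hj.symm) (fun h => (h (Finset.mem_univ i)).elim)]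
  let g (x : X) (i : ι) := X.presheaf.germ ⊤ x trivial (e i)
  -- an idempotent of a local ring is zero or one
  have hg : ∀ x i, g x i = 1 ∨ g x i = 0 := fun x i => by
    have h1 : g x i * (1 - g x i) = 0 := by
      rw [mul_sub, mul_one, ← map_mul, hsq, sub_self]
    rcases IsLocalRing.isUnit_or_isUnit_one_sub_self (g x i) with h | h
    · left
      have := h.mul_right_eq_zero.1 h1
      exact (sub_eq_zero.1 this).symm
    · right
      exact h.mul_left_eq_zero.1 h1
  have hsum : ∀ x, ∑ i, g x i = 1 := fun x => by
    rw [← map_sum, he', map_one]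
  have hex : ∀ x, ∃ i, g x i = 1 := fun x => by
    by_contra hc
    push Not at hc
    have := hsum x
    rw [Finset.sum_eq_zero fun i _ => (hg x i).resolve_left (hc i)] at this
    exact zero_ne_one this
  choose f hf using hex
  have hf' : ∀ x i, g x i = 1 → f x = i := fun x i hi => by
    by_contra hc
    have h1 : g x (f x) * g x i = 0 := by
      rw [← map_mul, he _ _ hc, map_zero]
    rw [hf, hi, mul_one] at h1
    exact one_ne_zero h1
  -- the fibres are the basic open sets of the idempotents
  have hopen : ∀ i, IsOpen (f ⁻¹' {i}) := fun i => by
    have : f ⁻¹' {i} = X.basicOpen (e i) := by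
      ext x
      rw [Set.mem_preimage, Set.mem_singleton_iff]
      refine Iff.trans ?_ (Scheme.mem_basicOpen_top X (e i) x).symm
      constructor
      · rintro rfl
        change IsUnit (g x (f x))
        rw [hf]
        exact isUnit_one
      · intro hu
        rcases hg x i with h | h
        · exact hf' x i h
        · change IsUnit (g x i) at hu
          rw [h] at hu
          exact (not_isUnit_zero hu).elim
    rw [this]
    exact (X.basicOpen (e i)).isOpen
  let f' : LocallyConstant X ι := ⟨f, (IsLocallyConstant.iff_isOpen_fiber).2 hopen⟩
  refine ⟨f', fun j => eq_of_germ_eq fun x => ?_⟩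
  rw [germ_lcInd]
  change (if f x = j then 1 else 0) = g x j
  split_ifs with h
  · rw [← h, hf]
  · exact ((hg x j).resolve_left fun h' => h (hf' x j h')).symm

/-- Homomorphisms from a power of a ring to the ring of global functions are given by locally
constant functions. -/
theorem exists_lc_of_ringHom [Fintype ι] {R : Type w} [CommRing R] (χ : (ι → R) →+* Γ(X, ⊤)) :
    ∃ f : LocallyConstant X ι, ∀ a, χ a = lcEval f (fun j => χ (fun _ => a j)) := by
  obtain ⟨f, hf⟩ := exists_lc (fun j => χ (Pi.single j 1)) (fun i j h => by
      rw [← map_mul, ← Pi.single_mul_left, Pi.single_apply, if_neg h, mul_zero,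
        Pi.single_zero, map_zero]) (by
      rw [← map_sum]
      have : ∑ j : ι, (Pi.single j 1 : ι → R) = 1 := by
        funext i
        simp [Finset.sum_apply, Pi.single_apply]
      rw [this, map_one])
  refine ⟨f, fun a => ?_⟩
  rw [lcEval_eq_sum]
  simp only [hf, ← map_mul, ← map_sum]
  congr 1
  funext i
  simp [Finset.sum_apply, Pi.single_apply]

end LocallyConstantFunctions

section LocallyConstantSheaf

variable {S : Scheme.{u}}

/-- The constant sheaf: the presheaf of locally constant functions. -/
def lcF (S : Scheme.{u}) (κ : Type) : (Over S)ᵒᵖ ⥤ Type u where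
  obj W := LocallyConstant W.unop.left κ
  map v := TypeCat.ofHom fun i => lcPull v.unop.left i
  map_id W := by
    ext i x
    rfl
  map_comp v w := by
    ext i x
    rfl

/-- The locally constant functions form a sheaf: they are the partitions of unity into orthogonal
idempotents of the ring of functions, and these glue since functions form a sheaf. -/
theorem isSheaf_lcF (κ : Type) [Fintype κ] [DecidableEq κ] :
    Presieve.IsSheaf (fppf S) (lcF S κ) := by
  intro W R hR x hx
  rw [Presieve.compatible_iff_sieveCompatible] at hx
  let x' (Y : Over S) (f : Y ⟶ W) (hf : R f) : LocallyConstant Y.left κ := x f hf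
  have hx' : ∀ (Y Z : Over S) (f : Y ⟶ W) (g : Z ⟶ Y) (hf : R f),
    x' Z (g ≫ f) (R.downward_closed hf g) = lcPull g.left (x' Y f hf) := fun Y Z f g hf => hx f g hf
  choose e he using fun j : κ => exists_function hR (fun Y f hf => lcInd (x' Y f hf) j)
    (fun Y Z f g hf => by rw [appTop_lcInd, hx'])
  obtain ⟨t, ht⟩ := exists_lc e
    (fun i j hij => functions_ext hR fun Y f hf => by
      rw [map_mul, he _ _ _ hf, he _ _ _ hf, map_zero, lcInd_mul _ hij])
    (functions_ext hR fun Y f hf => by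
      rw [map_sum, map_one, ← sum_lcInd (x' Y f hf)]
      exact Finset.sum_congr rfl fun j _ => he j _ _ hf)
  refine ⟨t, fun Y f hf => ?_, fun s hs => ?_⟩
  · refine lc_ext (X := Y.left) fun j => ?_
    change lcInd (lcPull f.left t) j = lcInd (x' Y f hf) j
    rw [← appTop_lcInd, ht, he j _ _ hf]
  · refine lc_ext (X := W.left) fun j => functions_ext hR fun Y f hf => ?_
    rw [ht, he j _ _ hf]
    exact (appTop_lcInd f.left (show LocallyConstant W.left κ from s) j).trans
      (congrArg (fun k => lcInd k j) (hs f hf))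

/-- The fibres of a locally constant function form a covering. -/
theorem fppf_fibres {W : Over S} {κ : Type} (i : LocallyConstant W.left κ) (R : Sieve W)
    (h : ∀ (V : Over S) (v : V ⟶ W) (k : κ), lcPull v.left i = LocallyConstant.const V.left k → R v) :
    R ∈ fppf S W :=
  fppf_of_affine R (fiberOpen i) (fun x => ⟨i x, rfl⟩) fun k U u _ _ hu => h U u k (by
    ext y
    exact hu y)

end LocallyConstantSheaf

/-! ### The total space of a torsor on a scheme over `S` -/

section Total

variable {S T : Scheme.{u}} {f : T ⟶ S} {F : CommRingCat.{u} ⥤ GrpCat.{u}}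
  {P : RightGSet (onSch F T)}

/-- The morphism over `S` with a given underlying morphism to `W`. -/
def pullHom {W : Over S} (t : W ⟶ Over.mk f) {Z : Over T} (h : Z ⟶ Over.mk t.left) :
    Over.mk (Z.hom ≫ f) ⟶ W :=
  Over.homMk h.left (by
    have h1 : h.left ≫ t.left = Z.hom := Over.w h
    have h2 : t.left ≫ f = W.hom := Over.w t
    rw [← h2, ← Category.assoc, h1]; rfl)

/-- The sieve on a scheme over `T` given by a sieve on a scheme over `S`. -/
def pullSieve {W : Over S} (t : W ⟶ Over.mk f) (R : Sieve W) : Sieve (Over.mk t.left : Over T) where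
  arrows _ h := R (pullHom t h)
  downward_closed {Y Z h} hh k := by
    have : pullHom t (k ≫ h) = mapHom f k ≫ pullHom t h := Over.OverMorphism.ext rfl
    rw [this]
    exact R.downward_closed hh _

theorem pullSieve_mem {W : Over S} (t : W ⟶ Over.mk f) {R : Sieve W} (hR : R ∈ fppf S W) :
    pullSieve t R ∈ fppf T (Over.mk t.left) := by
  rw [GrothendieckTopology.mem_over_iff] at hR ⊢
  refine (Scheme.fppfTopology).superset_covering ?_ hR
  intro Z z hz
  rw [Sieve.overEquiv_iff] at hz ⊢
  have h2 : t.left ≫ f = W.hom := Over.w t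
  let i : Over.mk ((z ≫ t.left) ≫ f) ⟶ Over.mk (z ≫ W.hom) := Over.homMk (𝟙 _) (by
    rw [← h2]; simp)
  have e : pullHom t (Over.homMk z rfl : (Over.mk (z ≫ t.left) : Over T) ⟶ Over.mk t.left) =
      i ≫ Over.homMk z rfl := Over.OverMorphism.ext (Category.id_comp _).symm
  have := R.downward_closed hz i
  rw [← e] at this
  exact this

variable (f P) in
/-- Pairs of a point `t` of `T` with values in `W` and a section of `P` over `t`. -/
abbrev TotSec (W : Over S) : Type (u + 1) :=
  Σ t : W ⟶ Over.mk f, P.F.obj (op (Over.mk t.left))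

namespace TotSec

variable {V W : Over S}

theorem map_congr {a b : TotSec f P W} (e : a = b) {Z : Over T} (g : Z ⟶ Over.mk a.1.left)
    (g' : Z ⟶ Over.mk b.1.left) (h : g.left = g'.left) : P.F.map g.op a.2 = P.F.map g'.op b.2 := by
  subst e
  rw [Over.OverMorphism.ext h]

theorem ext' {a b : TotSec f P W} (h : a.1 = b.1)
    (h' : ∀ g : Over.mk b.1.left ⟶ Over.mk a.1.left, g.left = 𝟙 _ → P.F.map g.op a.2 = b.2) :
    a = b := by
  obtain ⟨t, x⟩ := a
  obtain ⟨t', x'⟩ := b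
  obtain rfl : t = t' := h
  have := h' (𝟙 _) rfl
  rw [op_id, P.map_id_apply] at this
  exact congrArg _ this

/-- Restriction. -/
def res (v : V ⟶ W) (a : TotSec f P W) : TotSec f P V :=
  ⟨v ≫ a.1, P.F.map (Over.homMk v.left rfl : Over.mk (v ≫ a.1).left ⟶ Over.mk a.1.left).op a.2⟩

theorem res_id (a : TotSec f P W) : res (𝟙 W) a = a := by
  refine ext' (Category.id_comp _) fun g hg => ?_
  refine (P.map_comp_apply _ _ _).symm.trans ?_
  have h : P.F.map (𝟙 (Over.mk a.1.left : Over T)).op a.2 = a.2 := by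
    rw [op_id, P.map_id_apply]
  refine Eq.trans (map_congr rfl (g ≫ _) _ ?_) h
  refine (congrArg (· ≫ _) hg).trans ?_
  exact Category.id_comp _

theorem res_comp {U : Over S} (u : U ⟶ V) (v : V ⟶ W) (a : TotSec f P W) :
    res (u ≫ v) a = res u (res v a) := by
  refine ext' (Category.assoc _ _ _) fun g hg => ?_
  refine (P.map_comp_apply _ _ _).symm.trans (Eq.trans ?_ (P.map_comp_apply _ _ _))
  refine map_congr rfl (g ≫ _) (_ ≫ _) ?_
  refine (congrArg (· ≫ _) hg).trans ?_
  exact Category.id_comp _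

/-- The operation of `F` on the second component. -/
def act (a : TotSec f P W) (x : F.obj Γ(W.left, ⊤)) : TotSec f P W := ⟨a.1, P.act a.2 x⟩

theorem res_act (v : V ⟶ W) (a : TotSec f P W) (x : F.obj Γ(W.left, ⊤)) :
    res v (a.act x) = (res v a).act (F.map v.left.appTop x) :=
  congrArg (Sigma.mk (v ≫ a.1)) (P.act_map _ _ _)

theorem act_one (hP : IsTorsor (fppf T) P) (a : TotSec f P W) : a.act 1 = a :=
  congrArg (Sigma.mk a.1) (hP.act_one a.2)

theorem act_mul (hP : IsTorsor (fppf T) P) (a : TotSec f P W) (x y : F.obj Γ(W.left, ⊤)) :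
    a.act (x * y) = (a.act x).act y :=
  congrArg (Sigma.mk a.1) (hP.act_mul a.2 x y)

theorem existsUnique_act (hP : IsTorsor (fppf T) P) (a b : TotSec f P W) (h : a.1 = b.1) :
    ∃! x : F.obj Γ(W.left, ⊤), a.act x = b := by
  obtain ⟨t, p⟩ := a
  obtain ⟨t', q⟩ := b
  obtain rfl : t = t' := h
  obtain ⟨x, hx, hx'⟩ := hP.simply_transitive p q
  exact ⟨x, congrArg (Sigma.mk t) hx, fun y hy => hx' y (eq_of_heq (Sigma.mk.inj hy).2)⟩

theorem act_injective (hP : IsTorsor (fppf T) P) (a : TotSec f P W) {x y : F.obj Γ(W.left, ⊤)}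
    (h : a.act x = a.act y) : x = y :=
  (existsUnique_act hP a (a.act y) rfl).unique h rfl

/-- The value of a section at a scheme over `T` which is mapped to `W`. -/
def eval (a : TotSec f P W) (Z : Over T) (g : Z.left ⟶ W.left) (h : g ≫ a.1.left = Z.hom) :
    P.F.obj (op Z) :=
  P.F.map (Over.homMk g h : Z ⟶ Over.mk a.1.left).op a.2

theorem eval_congr {a b : TotSec f P W} (e : a = b) (Z : Over T) {g g' : Z.left ⟶ W.left}
    (e' : g = g') (h : g ≫ a.1.left = Z.hom) (h' : g' ≫ b.1.left = Z.hom) :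
    a.eval Z g h = b.eval Z g' h' := by
  subst e e'
  rfl

theorem eval_res (v : V ⟶ W) (a : TotSec f P W) (Z : Over T) (g : Z.left ⟶ V.left)
    (h : g ≫ (a.res v).1.left = Z.hom) (h' : (g ≫ v.left) ≫ a.1.left = Z.hom) :
    (a.res v).eval Z g h = a.eval Z (g ≫ v.left) h' :=
  (P.map_comp_apply _ _ _).symm.trans (map_congr rfl (_ ≫ _) _ rfl)

theorem map_eval (a : TotSec f P W) {Y Z : Over T} (k : Y ⟶ Z) (g : Z.left ⟶ W.left)
    (h : g ≫ a.1.left = Z.hom) (h' : (k.left ≫ g) ≫ a.1.left = Y.hom) :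
    P.F.map k.op (a.eval Z g h) = a.eval Y (k.left ≫ g) h' :=
  (P.map_comp_apply _ _ _).symm.trans (map_congr rfl (_ ≫ _) _ rfl)

theorem eval_self (a : TotSec f P W) (h : 𝟙 _ ≫ a.1.left = a.1.left) :
    a.eval (Over.mk a.1.left) (𝟙 _) h = a.2 := by
  refine (map_congr rfl _ (𝟙 _) rfl).trans ?_
  rw [op_id, P.map_id_apply]

theorem ext_eval {a b : TotSec f P W} (h : a.1 = b.1)
    (h' : ∀ e : 𝟙 _ ≫ a.1.left = (Over.mk b.1.left).hom,
      a.eval (Over.mk b.1.left) (𝟙 _) e = b.2) : a = b := by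
  obtain ⟨t, x⟩ := a
  obtain ⟨t', x'⟩ := b
  obtain rfl : t = t' := h
  have := h' (Category.id_comp _)
  rw [eval_self] at this
  exact congrArg _ this

end TotSec

variable (f P) in
/-- The total space, as a presheaf on schemes over `S`. -/
def totF : (Over S)ᵒᵖ ⥤ Type (u + 1) where
  obj W := TotSec f P W.unop
  map v := TypeCat.ofHom (TotSec.res v.unop)
  map_id W := ConcreteCategory.hom_ext _ _ fun a => TotSec.res_id (W := W.unop) a
  map_comp v w := ConcreteCategory.hom_ext _ _ fun a => TotSec.res_comp _ _ a

theorem isSheaf_yoneda (X : Over S) : Presieve.IsSheaf (fppf S) (yoneda.obj X) :=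
  GrothendieckTopology.Subcanonical.isSheaf_of_isRepresentable _

theorem TotSec.eval_mapHom {Z Y : Over T} {a : TotSec f P (Over.mk (Z.hom ≫ f))}
    {b : TotSec f P (Over.mk (Y.hom ≫ f))} (k : Y ⟶ Z) (h1 : b = a.res (mapHom f k))
    (e : 𝟙 Z.left ≫ a.1.left = Z.hom) (e' : 𝟙 Y.left ≫ b.1.left = Y.hom) :
    b.eval Y (𝟙 Y.left) e' = P.F.map k.op (a.eval Z (𝟙 Z.left) e) := by
  subst h1
  have h2 : k.left ≫ a.1.left = Y.hom :=
    (congrArg (k.left ≫ ·) ((Category.id_comp _).symm.trans e)).trans (Over.w k)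
  refine (P.map_comp_apply _ _ _).symm.trans (Eq.trans ?_ (P.map_comp_apply _ _ _))
  refine TotSec.map_congr rfl (_ ≫ _) (_ ≫ _) ?_
  exact (Category.id_comp k.left).trans (Category.comp_id k.left).symm

/-- The total space of a sheaf on `T`, seen as a sheaf on `S`: points of `T` glue because the fppf
topology is subcanonical, and the sections over the glued point glue because `P` is a sheaf. -/
theorem isSheaf_totF (hP : Presieve.IsSheaf (fppf T) P.F) :
    Presieve.IsSheaf (fppf S) (totF f P) := by
  intro W R hR x hx
  rw [Presieve.compatible_iff_sieveCompatible] at hx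
  let x' (Y : Over S) (g : Y ⟶ W) (hg : R g) : TotSec f P Y := x g hg
  have hx' : ∀ (Y Z : Over S) (g : Y ⟶ W) (k : Z ⟶ Y) (hg : R g) (g' : Z ⟶ W) (hg' : R g'),
      g' = k ≫ g → x' Z g' hg' = (x' Y g hg).res k := by
    rintro Y Z g k hg _ hg' rfl
    exact hx g k hg
  obtain ⟨t, ht⟩ := sheaf_glue (isSheaf_yoneda (Over.mk f)) hR (fun Y g hg => (x' Y g hg).1)
    fun Y Z g k hg => congrArg Sigma.fst (hx' _ _ g k hg _ (R.downward_closed hg k) rfl)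
  have ht' : ∀ (Y : Over S) (g : Y ⟶ W) (hg : R g), g ≫ t = (x' Y g hg).1 := ht
  have e (Z : Over T) (h : Z ⟶ Over.mk t.left) (hh : pullSieve t R h) :
      𝟙 _ ≫ (x' _ (pullHom t h) hh).1.left = Z.hom := by
    rw [← ht' _ _ hh]
    exact (Category.id_comp _).trans (Over.w h)
  obtain ⟨s, hs⟩ := sheaf_glue hP (pullSieve_mem t hR)
    (fun Z h hh => (x' _ (pullHom t h) hh).eval Z (𝟙 _) (e Z h hh))
    fun Y Z h k hh => TotSec.eval_mapHom k (hx' _ _ _ _ hh _ _ (Over.OverMorphism.ext rfl)) _ _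
  refine ⟨(⟨t, s⟩ : TotSec f P W), fun Y g hg => ?_, fun b hb => ?_⟩
  · refine TotSec.ext_eval (a := TotSec.res g ⟨t, s⟩) (b := x' Y g hg) (ht' Y g hg) fun e1 => ?_
    let i : Over.mk ((x' Y g hg).1.left ≫ f) ⟶ Y := Over.homMk (𝟙 _) (by
      refine (Category.id_comp _).trans ?_
      exact (Over.w (x' Y g hg).1).symm)
    let h : Over.mk (x' Y g hg).1.left ⟶ Over.mk t.left :=
      Over.homMk g.left (congrArg CommaMorphism.left (ht' Y g hg))
    have hi : pullHom t h = i ≫ g := Over.OverMorphism.ext (Category.id_comp _).symm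
    have hh : pullSieve t R h := by
      change R (pullHom t h)
      rw [hi]
      exact R.downward_closed hg i
    refine (TotSec.eval_res g ⟨t, s⟩ _ _ e1 (by
      refine Eq.trans ?_ e1
      exact Category.assoc _ _ _)).trans ?_
    refine (congrArg (fun k => P.F.map (Quiver.Hom.op k) s) ?_).trans ((hs _ h hh).trans ?_)
    · exact Over.OverMorphism.ext (Category.id_comp _)
    refine (TotSec.eval_congr (hx' _ _ g i hg _ hh hi) _ rfl _ ?_).trans
      ((TotSec.eval_res i (x' Y g hg) _ _ ?_ ?_).trans ?_)
    · exact (Category.id_comp _).trans (Category.id_comp _)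
    · exact (Category.id_comp _).trans (Category.id_comp _)
    · exact (congrArg (· ≫ _) (Category.id_comp (𝟙 _))).trans (Category.id_comp _)
    · exact (TotSec.eval_congr rfl _ (Category.id_comp _) _ (Category.id_comp _)).trans
        (TotSec.eval_self _ _)
  · let b' : TotSec f P W := b
    have hb' : ∀ (Y : Over S) (g : Y ⟶ W) (hg : R g), b'.res g = x' Y g hg := fun Y g hg => hb g hg
    have h1 : b'.1 = t := sheaf_ext (isSheaf_yoneda (Over.mk f)) hR fun Y g hg => by
      refine Eq.trans ?_ (ht' Y g hg).symm
      exact congrArg Sigma.fst (hb' Y g hg)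
    refine TotSec.ext_eval (a := b') (b := ⟨t, s⟩) h1 fun e1 => ?_
    refine sheaf_ext hP (pullSieve_mem t hR) fun Z h hh => ?_
    refine Eq.trans ?_ (hs Z h hh).symm
    have e2 : (h.left ≫ 𝟙 _) ≫ b'.1.left = Z.hom := by
      rw [h1]
      exact (congrArg (· ≫ _) (Category.comp_id _)).trans (Over.w h)
    have e3 : (𝟙 _ ≫ h.left) ≫ b'.1.left = Z.hom := by
      rw [h1]
      exact (congrArg (· ≫ _) (Category.id_comp _)).trans (Over.w h)
    refine (TotSec.map_eval b' h _ e1 e2).trans ?_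
    refine Eq.trans ?_ (TotSec.eval_congr (hb' _ _ hh) Z rfl ?_ _)
    · exact (TotSec.eval_congr rfl Z ((Category.comp_id _).trans (Category.id_comp _).symm)
        _ e3).trans (TotSec.eval_res (pullHom t h) b' Z (𝟙 _) _ _).symm
    · exact (Category.assoc _ _ _).symm.trans e3

end Total

/-! ### The torsor of isomorphisms from the split pair -/

section Select

variable {S : Scheme.{u}} {B : (Over S)ᵒᵖ ⥤ Type w} {κ : Type} {W : Over S}

/-- Sections of a sheaf which agree on the fibres of a locally constant function are equal. -/
theorem sheaf_ext_fibres (hB : Presieve.IsSheaf (fppf S) B) (i : LocallyConstant W.left κ)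
    {a b : B.obj (op W)}
    (h : ∀ (V : Over S) (v : V ⟶ W) (k : κ), lcPull v.left i = LocallyConstant.const V.left k →
      B.map v.op a = B.map v.op b) : a = b := by
  let R : Sieve W := Sieve.generate fun V v => ∃ k, lcPull v.left i = LocallyConstant.const V.left k
  refine sheaf_ext hB (R := R) (fppf_fibres i R fun V v k hk => Sieve.le_generate _ _ _ ⟨k, hk⟩) ?_
  rintro Y _ ⟨V, g, v, ⟨k, hk⟩, rfl⟩
  rw [op_comp, map_comp_apply', map_comp_apply', h V v k hk]

/-- Sections of a sheaf which are indexed by the values of a locally constant function can be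
glued. -/
theorem sheaf_select (hB : Presieve.IsSheaf (fppf S) B) (i : LocallyConstant W.left κ)
    (x : κ → B.obj (op W)) : ∃ t : B.obj (op W), ∀ (V : Over S) (v : V ⟶ W) (k : κ),
      lcPull v.left i = LocallyConstant.const V.left k → B.map v.op t = B.map v.op (x k) := by
  let R : Sieve W :=
    { arrows := fun V v => ∃ k, lcPull v.left i = LocallyConstant.const V.left k
      downward_closed := by
        rintro V U v ⟨k, hk⟩ u
        refine ⟨k, ?_⟩
        ext y
        exact LocallyConstant.congr_fun hk (u.left y) }
  have hx : ∀ (V : Over S) (v : V ⟶ W) (k l : κ), lcPull v.left i = LocallyConstant.const V.left k →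
      lcPull v.left i = LocallyConstant.const V.left l → B.map v.op (x k) = B.map v.op (x l) := by
    intro V v k l hk hl
    by_cases h : IsEmpty V.left
    · exact sheaf_subsingleton hB _ _
    · obtain ⟨y⟩ := not_isEmpty_iff.1 h
      have h1 := LocallyConstant.congr_fun (hk.symm.trans hl) y
      have h2 : k = l := h1
      rw [h2]
  obtain ⟨t, ht⟩ := sheaf_glue hB (R := R) (fppf_fibres i R fun V v k hk => ⟨k, hk⟩)
    (fun V v hv => B.map v.op (x hv.choose)) (fun V U v u hv => by
      dsimp only
      rw [← map_comp_apply', ← op_comp]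
      refine hx _ _ _ _ (Exists.choose_spec (R.downward_closed hv u)) ?_
      ext y
      exact LocallyConstant.congr_fun hv.choose_spec (u.left y))
  refine ⟨t, fun V v k hk => ?_⟩
  have hv : R v := ⟨k, hk⟩
  exact (ht V v hv).trans (hx _ _ _ _ hv.choose_spec hk)

end Select

section SplitTorsor

variable {S T : Scheme.{u}} {f : T ⟶ S} {F : CommRingCat.{u} ⥤ GrpCat.{u}} [PreservesFinPow F]
  {P : RightGSet (onSch F T)} {d : ℕ}

theorem lcPull_const {X Y : Scheme.{u}} (h : Y ⟶ X) {κ : Type w} (k : κ) :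
    lcPull h (LocallyConstant.const X k) = LocallyConstant.const Y k := rfl

theorem lcPull_lcApply {X Y : Scheme.{u}} (h : Y ⟶ X) (σ : LocallyConstant X (Equiv.Perm (Fin d)))
    (i : LocallyConstant X (Fin d)) : lcPull h (lcApply σ i) = lcApply (lcPull h σ) (lcPull h i) :=
  rfl

namespace SplitIso

variable {X : Over S}

/-- The isomorphism on points, together with the trivialization. -/
def tot (p : SplitIso f P d X) (W : Over S) (w : W ⟶ X) (i : LocallyConstant W.left (Fin d)) :
    TotSec f P W :=
  ⟨p.pt W w i, p.triv W w i⟩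

theorem res_tot (p : SplitIso f P d X) {V W : Over S} (w : W ⟶ X) (v : V ⟶ W)
    (i : LocallyConstant W.left (Fin d)) :
    (p.tot W w i).res v = p.tot V (v ≫ w) (lcPull v.left i) := by
  refine TotSec.ext_eval (p.pt_map V W w v i) fun e => ?_
  refine (P.map_comp_apply _ _ _).symm.trans ?_
  exact p.map_triv w v (v ≫ w) rfl i (_ ≫ _) (Category.id_comp _)

theorem tot_injective {p q : SplitIso f P d X} (h : ∀ W w i, p.tot W w i = q.tot W w i) : p = q :=
  SplitIso.ext_heq (fun W w i => congrArg Sigma.fst (h W w i)) fun W w i =>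
    (Sigma.mk.inj (h W w i)).2

/-- An isomorphism from the split pair is a natural family of sections of the total space for
which the first components are bijective. -/
def ofTot (A : ∀ (W : Over S) (_ : W ⟶ X), LocallyConstant W.left (Fin d) → TotSec f P W)
    (hA : ∀ (V W : Over S) (w : W ⟶ X) (v : V ⟶ W) (i : LocallyConstant W.left (Fin d)),
      (A W w i).res v = A V (v ≫ w) (lcPull v.left i))
    (hb : ∀ (W : Over S) (w : W ⟶ X), Function.Bijective fun i => (A W w i).1) :
    SplitIso f P d X where
  pt W w i := (A W w i).1
  triv W w i := (A W w i).2
  pt_map V W w v i := congrArg Sigma.fst (hA V W w v i)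
  pt_bijective := hb
  triv_map V W w v i := by
    have h := hA V W w v i
    refine Eq.trans ?_ (TotSec.eval_self _ (Category.id_comp _))
    refine Eq.trans ?_ (TotSec.eval_congr h (Over.mk (A V (v ≫ w) (lcPull v.left i)).1.left) rfl
      ((Category.id_comp _).trans (congrArg (fun a => Over.Hom.left a) (congrArg Sigma.fst h))) _)
    refine Eq.trans ?_ (P.map_comp_apply _ _ _)
    exact TotSec.map_congr rfl _ (_ ≫ _) (Category.id_comp _).symm

theorem tot_act (p : SplitIso f P d X) (a : WreathSections F d X.left) (W : Over S) (w : W ⟶ X)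
    (i : LocallyConstant W.left (Fin d)) :
    (p.act a).tot W w i = (p.tot W w (lcApply (lcPull w.left a.right) i)).act
      (glue F (lcApply (lcPull w.left a.right) i) fun k => F.map w.left.appTop (a.left k)) := rfl

theorem tot_congr (p : SplitIso f P d X) (W : Over S) {w w' : W ⟶ X} (h : w = w')
    (i : LocallyConstant W.left (Fin d)) : p.tot W w i = p.tot W w' i := by rw [h]

theorem act_one (hP : IsTorsor (fppf T) P) (p : SplitIso f P d X) :
    p.act (1 : WreathSections F d X.left) = p := by
  refine tot_injective fun W w i => ?_
  rw [tot_act]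
  have h1 : lcApply (lcPull w.left (1 : WreathSections F d X.left).right) i = i := rfl
  have h2 : (fun k => F.map w.left.appTop ((1 : WreathSections F d X.left).left k)) = 1 :=
    funext fun k => map_one _
  rw [h1, h2, glue_one, TotSec.act_one hP]

theorem act_mul (hP : IsTorsor (fppf T) P) (p : SplitIso f P d X)
    (a b : WreathSections F d X.left) : p.act (a * b) = (p.act a).act b := by
  refine tot_injective fun W w i => ?_
  rw [tot_act, tot_act, tot_act]
  have h1 : lcApply (lcPull w.left (a * b).right) i =
      lcApply (lcPull w.left a.right) (lcApply (lcPull w.left b.right) i) := rfl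
  rw [h1, ← TotSec.act_mul hP]
  congr 1
  set j := lcApply (lcPull w.left b.right) i
  set σ := lcPull w.left a.right
  have h2 : (fun k => F.map w.left.appTop ((a * b).left k)) =
      (fun k => F.map w.left.appTop (a.left k)) *
        fun k => glue F σ fun g => F.map w.left.appTop (b.left (g⁻¹ k)) := by
    funext k
    rw [SemidirectProduct.mul_left, Pi.mul_apply, Pi.mul_apply, map_mul, permAct_apply, map_glue]
  rw [h2, glue_mul]
  congr 1
  let q : LocallyConstant W.left (Fin d × Equiv.Perm (Fin d)) :=
    ⟨fun x => (lcApply σ j x, σ x),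
      (lcApply σ j).isLocallyConstant.prodMk σ.isLocallyConstant⟩
  have h3 : q.map (fun r => r.2⁻¹ r.1) = j := by
    ext x
    change Fin.val ((σ x)⁻¹ (σ x (j x))) = _
    exact congrArg Fin.val (Equiv.symm_apply_apply (σ x) (j x))
  refine (glue_pair q (fun k g => F.map w.left.appTop (b.left (g⁻¹ k)))).trans ?_
  rw [← h3]
  exact (glue_map q _ fun k => F.map w.left.appTop (b.left k)).symm

/-- Two isomorphisms from the split pair differ, on the underlying schemes, by a locally constant
permutation. -/
theorem exists_index (p q : SplitIso f P d X) :
    ∃ σ : LocallyConstant X.left (Equiv.Perm (Fin d)), ∀ k, p.pt X (𝟙 X)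
      (lcApply σ (LocallyConstant.const X.left k)) = q.pt X (𝟙 X) (LocallyConstant.const X.left k) := by
  -- `j k` is the index for `p` of the point that has the index `k` for `q`
  choose j hj using fun k => (p.pt_bijective X (𝟙 X)).2 (q.pt X (𝟙 X) (LocallyConstant.const X.left k))
  -- injectivity at a point is tested over its residue field
  have hinj : ∀ x : X.left, Function.Injective fun k => j k x := by
    intro x k l hkl
    let V : Over S := Over.mk (X.left.fromSpecResidueField x ≫ X.hom)
    let v : V ⟶ X := Over.homMk (X.left.fromSpecResidueField x)
    have h1 : ∀ k, lcPull v.left (j k) = LocallyConstant.const V.left (j k x) := by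
      intro k
      ext y
      refine congrArg (fun x => Fin.val (j k x)) ?_
      have : v.left y ∈ Set.range (X.left.fromSpecResidueField x) := ⟨y, rfl⟩
      rw [Scheme.range_fromSpecResidueField] at this
      exact this
    have h2 : ∀ k, q.pt V (v ≫ 𝟙 X) (LocallyConstant.const V.left k) =
        p.pt V (v ≫ 𝟙 X) (LocallyConstant.const V.left (j k x)) := by
      intro k
      have e1 := q.pt_map V X (𝟙 X) v (LocallyConstant.const X.left k)
      have e2 := p.pt_map V X (𝟙 X) v (j k)
      rw [h1, hj] at e2
      exact e1.symm.trans e2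
    have h3 := (h2 k).trans ((congrArg (fun n => p.pt V (v ≫ 𝟙 X) (LocallyConstant.const V.left n))
      hkl).trans (h2 l).symm)
    obtain ⟨y⟩ : Nonempty V.left := inferInstanceAs (Nonempty (Spec (X.left.residueField x)))
    exact LocallyConstant.congr_fun ((q.pt_bijective V (v ≫ 𝟙 X)).1 h3) y
  classical
  let τ : (Fin d → Fin d) → Equiv.Perm (Fin d) := fun g =>
    if h : Function.Injective g then Equiv.ofBijective g (Finite.injective_iff_bijective.1 h) else 1
  refine ⟨(LocallyConstant.unflip j).map τ, fun k => ?_⟩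
  rw [← hj k]
  congr 1
  ext x
  have h : Function.Injective fun k => j k x := hinj x
  change Fin.val (τ (fun k => j k x) k) = _
  simp only [τ, dif_pos h]
  rfl

/-- The semidirect product acts transitively on the isomorphisms from the split pair: after a
locally constant permutation the points agree, and then sections of `P` over the `d` constant
points are compared. -/
theorem exists_act (hP : IsTorsor (fppf T) P) (p q : SplitIso f P d X) :
    ∃ a : WreathSections F d X.left, p.act a = q := by
  obtain ⟨σ, hσ⟩ := exists_index p q
  -- the permutation compares the points of all indices, since an index is locally constant
  have hσ' : ∀ (W : Over S) (w : W ⟶ X) (i : LocallyConstant W.left (Fin d)),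
      p.pt W w (lcApply (lcPull w.left σ) i) = q.pt W w i := by
    intro W w i
    refine sheaf_ext_fibres (isSheaf_yoneda (Over.mk f)) i fun V v k hk => ?_
    refine (p.pt_map V W w v _).trans (Eq.trans ?_ (q.pt_map V W w v _).symm)
    rw [lcPull_lcApply, hk]
    have e1 := p.pt_map V X (𝟙 X) (v ≫ w) (lcApply σ (LocallyConstant.const X.left k))
    have e2 := q.pt_map V X (𝟙 X) (v ≫ w) (LocallyConstant.const X.left k)
    rw [hσ, Category.comp_id] at e1
    rw [Category.comp_id] at e2
    exact e1.symm.trans e2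
  have hinv : ∀ (W : Over S) (w : W ⟶ X) (i : LocallyConstant W.left (Fin d)),
      lcApply (lcPull w.left σ) (lcApply (lcPull w.left σ⁻¹) i) = i := by
    intro W w i
    ext x
    change Fin.val (σ (w.left x) ((σ (w.left x))⁻¹ (i x))) = _
    exact congrArg Fin.val (Equiv.apply_symm_apply (σ (w.left x)) (i x))
  -- with the points matched, the sections of `P` over them differ by sections of the group
  choose A hA _ using fun k => TotSec.existsUnique_act hP
    (p.tot X (𝟙 X) (LocallyConstant.const X.left k))
    (q.tot X (𝟙 X) (lcApply σ⁻¹ (LocallyConstant.const X.left k)))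
    ((congrArg (p.pt X (𝟙 X)) (hinv X (𝟙 X) _)).symm.trans (hσ' X (𝟙 X) _))
  refine ⟨⟨A, σ⟩, tot_injective fun W w i => ?_⟩
  rw [tot_act]
  refine sheaf_ext_fibres (isSheaf_totF hP.isSheaf) (lcApply (lcPull w.left σ) i) fun V v k hk => ?_
  change TotSec.res v _ = TotSec.res v _
  rw [TotSec.res_act, res_tot, res_tot, map_glue]
  change (p.tot V (v ≫ w) (lcPull v.left (lcApply (lcPull w.left σ) i))).act (glue F
    (lcPull v.left (lcApply (lcPull w.left σ) i)) _) = _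
  rw [hk, glue_const]
  have h1 : lcPull v.left i = lcPull (v ≫ w).left (lcApply σ⁻¹ (LocallyConstant.const X.left k)) := by
    ext x
    have := LocallyConstant.congr_fun hk x
    change σ (w.left (v.left x)) (i (v.left x)) = k at this
    change Fin.val (i (v.left x)) = Fin.val ((σ (w.left (v.left x)))⁻¹ k)
    rw [← this]
    exact congrArg Fin.val (Equiv.symm_apply_apply (σ (w.left (v.left x))) _).symm
  have h2 := congrArg (TotSec.res (v ≫ w)) (hA k)
  rw [TotSec.res_act, res_tot, res_tot, ← h1, lcPull_const,
    tot_congr p V (Category.comp_id (v ≫ w)), tot_congr q V (Category.comp_id (v ≫ w))] at h2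
  refine Eq.trans ?_ h2
  congr 1
  rw [map_map_apply, ← Scheme.Hom.comp_appTop]
  rfl

/-- The permutation is recovered from the points and the sections of the group from the sections of
`P`, so the semidirect product acts freely. -/
theorem act_injective (hP : IsTorsor (fppf T) P) (p : SplitIso f P d X)
    {a b : WreathSections F d X.left} (h : p.act a = p.act b) : a = b := by
  have h1 : a.right = b.right := by
    ext x k
    have h2 := congrArg (fun q : SplitIso f P d X => q.pt X (𝟙 X) (LocallyConstant.const X.left k)) h
    exact congrArg Fin.val (LocallyConstant.congr_fun ((p.pt_bijective X (𝟙 X)).1 h2) x)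
  refine SemidirectProduct.ext (funext fun k => ?_) h1
  have h2 := congrArg (fun q : SplitIso f P d X => q.tot X (𝟙 X)
    (lcApply a.right⁻¹ (LocallyConstant.const X.left k))) h
  have h3 : lcApply (lcPull (𝟙 X : X ⟶ X).left a.right)
      (lcApply a.right⁻¹ (LocallyConstant.const X.left k)) = LocallyConstant.const X.left k := by
    ext x
    change Fin.val (a.right x ((a.right x)⁻¹ k)) = _
    exact congrArg Fin.val (Equiv.apply_symm_apply (a.right x) k)
  have h5 : ∀ z : F.obj Γ(X.left, ⊤), F.map (𝟙 X : X ⟶ X).left.appTop z = z := fun z => by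
    rw [Over.id_left, Scheme.Hom.id_appTop, F.map_id]
    rfl
  simp only [tot_act] at h2
  rw [← h1, h3, glue_const, glue_const, h5, h5] at h2
  exact TotSec.act_injective hP _ h2

end SplitIso

/-- The isomorphisms from the split pair form a sheaf: they are the maps from the sheaf of indices
to the total space which are bijective on the underlying points, and bijectivity is local. -/
theorem isSheaf_splitIsos (hP : Presieve.IsSheaf (fppf T) P.F) :
    Presieve.IsSheaf (fppf S) (splitIsos f P d).F := by
  intro X R hR x hx
  rw [Presieve.compatible_iff_sieveCompatible] at hx
  let x' (Y : Over S) (g : Y ⟶ X) (hg : R g) : SplitIso f P d Y := x g hg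
  have hx' : ∀ (Y Z : Over S) (g : Y ⟶ X) (k : Z ⟶ Y) (hg : R g),
      x' Z (k ≫ g) (R.downward_closed hg k) = (x' Y g hg).res k := fun Y Z g k hg => hx g k hg
  obtain ⟨E, hE, hE'⟩ := glue_hom (A := lcF S (Fin d)) (B := totF f P) (isSheaf_totF hP) hR
    (fun Y g hg i => (x' Y g hg).tot Y (𝟙 Y) i) (fun Y Z g k hg i => by
      refine ((x' Y g hg).res_tot (𝟙 Y) k i).trans ?_
      rw [hx']
      exact SplitIso.tot_congr (x' Y g hg) Z ((Category.comp_id k).trans (Category.id_comp k).symm) _)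
  have hE1 : ∀ (Y Z : Over S) (g : Y ⟶ X) (k : Z ⟶ Y) (i : LocallyConstant Y.left (Fin d)),
      TotSec.res k (E Y g i) = E Z (k ≫ g) (lcPull k.left i) := hE
  refine ⟨SplitIso.ofTot E (fun V W w v i => hE W V w v i) ?_, fun Y g hg => ?_, fun t ht => ?_⟩
  · refine bijective_of_locally (A := lcF S (Fin d)) (B := yoneda.obj (Over.mk f))
      (isSheaf_lcF (Fin d)) (isSheaf_yoneda _) (fun Y g i => (E Y g i).1)
      (fun Y Z g k i => congrArg Sigma.fst (hE Y Z g k i)) hR (fun Y g hg => ?_)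
    rw [hE' Y g hg]
    exact (x' Y g hg).pt_bijective Y (𝟙 Y)
  · refine SplitIso.tot_injective fun W w i => ?_
    change E W (w ≫ g) i = (x' Y g hg).tot W w i
    rw [hE' W (w ≫ g) (R.downward_closed hg w), hx']
    exact SplitIso.tot_congr (x' Y g hg) W (Category.id_comp w) i
  · refine SplitIso.tot_injective fun W w i => ?_
    let t' : SplitIso f P d X := t
    refine sheaf_ext (isSheaf_totF hP) (GrothendieckTopology.pullback_stable _ w hR) fun V v hv => ?_
    refine (t'.res_tot w v i).trans (Eq.trans ?_ (hE1 W V w v i).symm)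
    have hv' : R (v ≫ w) := hv
    rw [hE' V (v ≫ w) hv']
    change _ = (x' V (v ≫ w) hv').tot V (𝟙 V) (lcPull v.left i)
    have h1 : t'.res (v ≫ w) = x' V (v ≫ w) hv' := ht (v ≫ w) hv'
    rw [← h1]
    exact (SplitIso.tot_congr t' V (Category.id_comp (v ≫ w)) _).symm

end SplitTorsor

/-! ### Finite étale morphisms are locally split -/

section SplitAlgebra

open TensorProduct

/-- Algebras over the zero ring are isomorphic. -/
def algEquivOfSubsingleton (C D E : Type w) [CommRing C] [Subsingleton C] [CommRing D] [Algebra C D]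
    [CommRing E] [Algebra C E] : D ≃ₐ[C] E :=
  have h1 : Subsingleton D := RingHom.codomain_trivial (algebraMap C D)
  have h2 : Subsingleton E := RingHom.codomain_trivial (algebraMap C E)
  { toFun := fun _ => 0
    invFun := fun _ => 0
    left_inv := fun _ => Subsingleton.elim _ _
    right_inv := fun _ => Subsingleton.elim _ _
    map_mul' := fun _ _ => Subsingleton.elim _ _
    map_add' := fun _ _ => Subsingleton.elim _ _
    commutes' := fun _ => Subsingleton.elim _ _ }

/-- A finite étale algebra of constant rank `d` becomes a power of the base ring after a faithfully
flat base change of finite presentation. -/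
theorem exists_split_baseChange {A B : Type u} [CommRing A] [CommRing B] [Algebra A B]
    [Algebra.Etale A B] [Module.Finite A B] {d : ℕ}
    (h : ∀ p : PrimeSpectrum A, Module.rankAtStalk B p = d) :
    ∃ (C : Type u) (_ : CommRing C) (_ : Algebra A C) (_ : Module.FaithfullyFlat A C)
      (_ : Algebra.FinitePresentation A C), Nonempty (C ⊗[A] B ≃ₐ[C] (Fin d → C)) := by
  obtain ⟨C, _, _, _, _, _, h1⟩ := Algebra.IsFiniteSplit.exists_tensorProduct_of_etale
    (R := A) (S := B) (n := d) (funext h)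
  obtain ⟨n, ⟨e⟩⟩ := Algebra.IsFiniteSplit.nonempty_algEquiv_fun C (C ⊗[A] B)
  refine ⟨C, inferInstance, inferInstance, inferInstance, inferInstance, ?_⟩
  -- the rank of the split algebra is read off at a point, so the zero ring is set apart
  by_cases hC : Subsingleton C
  · exact ⟨algEquivOfSubsingleton C _ _⟩
  · have : Nontrivial C := not_subsingleton_iff_nontrivial.1 hC
    obtain ⟨p⟩ : Nonempty (PrimeSpectrum C) := inferInstance
    have h2 : Module.rankAtStalk (R := C) (C ⊗[A] B) p = n := by
      rw [Module.rankAtStalk_eq_of_equiv e.toLinearEquiv, Module.rankAtStalk_eq_finrank_of_free]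
      simp
    rw [Module.rankAtStalk_baseChange, h] at h2
    have h3 : d = n := by exact_mod_cast h2
    subst h3
    exact ⟨e⟩

/-- A base change which is isomorphic to one that splits is split. -/
theorem split_of_isPushout {A B D E : CommRingCat.{u}} {φ : A ⟶ B} {ρ : A ⟶ D}
    {ψ : D ⟶ E} {τ : B ⟶ E} (sq : IsPushout ρ φ ψ τ) {C : Type u} [CommRing C] [Algebra A C]
    (e : CommRingCat.of C ≅ D) (he : CommRingCat.ofHom (algebraMap A C) ≫ e.hom = ρ)
    {d : ℕ} (h : letI := φ.hom.toAlgebra; Nonempty (C ⊗[A] B ≃ₐ[C] (Fin d → C))) :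
    ∃ ε : E ≃+* (Fin d → D), ∀ a, ε (ψ a) = fun _ => a := by
  subst he
  algebraize [φ.hom, ψ.hom, τ.hom, e.hom.hom]
  let γ : A ⟶ CommRingCat.of C := CommRingCat.ofHom (algebraMap A C)
  let : Algebra A D := (γ ≫ e.hom).hom.toAlgebra
  have t0 : IsScalarTower A C D := .of_algebraMap_eq' rfl
  let : Algebra A E := (τ.hom.comp φ.hom).toAlgebra
  have hc : τ.hom.comp φ.hom = ψ.hom.comp (γ ≫ e.hom).hom :=
    (congrArg CommRingCat.Hom.hom sq.w).symm
  have t1 : IsScalarTower A D E := .of_algebraMap_eq' hc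
  have t2 : IsScalarTower A B E := .of_algebraMap_eq' rfl
  have hp : Algebra.IsPushout A D B E := CommRingCat.isPushout_iff_isPushout.1 sq
  obtain ⟨s⟩ := h
  let e1 : D ⊗[A] B ≃ₐ[D] E := Algebra.IsPushout.equiv A D B E
  let e2 : D ⊗[C] (C ⊗[A] B) ≃ₐ[D] D ⊗[A] B := Algebra.TensorProduct.cancelBaseChange A C D D B
  let e3 : D ⊗[C] (C ⊗[A] B) ≃ₐ[D] D ⊗[C] (Fin d → C) := Algebra.TensorProduct.congr AlgEquiv.refl s
  let e4 : D ⊗[C] (Fin d → C) ≃ₐ[D] (Fin d → D) :=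
    (Algebra.TensorProduct.piRight C D D fun _ : Fin d => C).trans
      (AlgEquiv.piCongrRight fun _ => Algebra.TensorProduct.rid C D D)
  let e5 : E ≃ₐ[D] (Fin d → D) := e1.symm.trans (e2.symm.trans (e3.trans e4))
  exact ⟨e5.toRingEquiv, fun a => e5.commutes a⟩

end SplitAlgebra

section SplitCover

theorem appTop_isoSpec_inv (Z : Scheme.{u}) [IsAffine Z] :
    Z.isoSpec.inv.appTop = (Scheme.ΓSpecIso Γ(Z, ⊤)).inv := by
  have h := congrArg Scheme.Hom.appTop Z.isoSpec.inv_hom_id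
  rw [Scheme.Hom.comp_appTop, Scheme.Hom.id_appTop] at h
  change Z.toSpecΓ.appTop ≫ _ = _ at h
  rw [Scheme.toSpecΓ_appTop] at h
  rw [← Iso.inv_hom_id_assoc (Scheme.ΓSpecIso Γ(Z, ⊤)) Z.isoSpec.inv.appTop, h]
  exact Category.comp_id _

variable {S T : Scheme.{u}} (f : T ⟶ S)

/-- A splitting of the algebra of functions on the pullback of `T`. -/
def IsSplitOver (d : ℕ) (V : Over S) : Prop :=
  ∃ ε : Γ(((Over.pullback f).obj V).left, ⊤) ≃+* (Fin d → Γ(V.left, ⊤)),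
    ∀ a, ε (phi f V a) = fun _ => a

variable [IsFinite f] [Etale f] {d : ℕ} (hd : ∀ s, f.finrank s = d)

include hd in
/-- A finite étale morphism of constant degree splits after an affine fppf cover of an affine
scheme. -/
theorem exists_split_cover (X : Over S) [IsAffine X.left] :
    ∃ (V : Over S) (v : V ⟶ X), IsAffine V.left ∧ Flat v.left ∧ Surjective v.left ∧
      LocallyOfFinitePresentation v.left ∧ IsSplitOver f d V := by
  let g := Limits.pullback.fst X.hom f
  have hf : Flat f := inferInstance
  have : IsAffine (Limits.pullback X.hom f) := isAffine_of_isAffineHom g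
  let A := Γ(X.left, ⊤)
  let B := Γ(Limits.pullback X.hom f, ⊤)
  let φ : A ⟶ B := g.appTop
  algebraize [φ.hom]
  have hfin : Module.Finite A B := g.finite_appTop
  have het : Algebra.Etale A B := HasRingHomProperty.appTop (P := @Etale) (Q := RingHom.Etale) g
    inferInstance
  have hr : ∀ p : PrimeSpectrum A, Module.rankAtStalk B p = d := by
    intro p
    have h1 := Scheme.Hom.finrank_SpecMap_algebraMap A B p
    have h2 := Scheme.Hom.finrank_of_isPullback (Limits.pullback X.hom f).isoSpec.inv
      (Spec.map φ) g X.left.isoSpec.inv (IsPullback.of_horiz_isIso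
        ⟨(Scheme.isoSpec_inv_naturality g).symm⟩) p
    rw [← h1]
    exact h2.trans ((Scheme.Hom.finrank_pullback_fst f X.hom _).trans (hd _))
  obtain ⟨C, _, _, _, _, hC⟩ := exists_split_baseChange hr
  let γ : A ⟶ CommRingCat.of C := CommRingCat.ofHom (algebraMap A C)
  obtain ⟨hv1, hv2⟩ := (flat_and_surjective_SpecMap_iff γ).2
    (RingHom.faithfullyFlat_algebraMap_iff.2 inferInstance)
  have hv3 := (LocallyOfFinitePresentation.SpecMap_iff γ).2
    ((RingHom.finitePresentation_algebraMap).2 inferInstance)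
  let v0 : Spec (CommRingCat.of C) ⟶ X.left := Spec.map γ ≫ X.left.isoSpec.inv
  let V : Over S := Over.mk (v0 ≫ X.hom)
  let v : V ⟶ X := Over.homMk v0
  have hV : IsAffine V.left := inferInstanceAs (IsAffine (Spec (CommRingCat.of C)))
  refine ⟨V, v, hV, ?_, ?_, ?_, ?_⟩
  · exact (inferInstance : Flat v0)
  · exact (inferInstance : Surjective v0)
  · exact (inferInstance : LocallyOfFinitePresentation v0)
  · have : IsAffine ((Over.pullback f).obj X).left :=
      inferInstanceAs (IsAffine (Limits.pullback X.hom f))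
    refine split_of_isPushout (isPushout_appTop_of_isPullback (isPullback_pullback f v))
      (Scheme.ΓSpecIso (CommRingCat.of C)).symm ?_ ?_
    · change γ ≫ (Scheme.ΓSpecIso (CommRingCat.of C)).inv = (Spec.map γ ≫ X.left.isoSpec.inv).appTop
      rw [Scheme.Hom.comp_appTop, Scheme.ΓSpecIso_inv_naturality]
      rw [appTop_isoSpec_inv]
    · exact hC

end SplitCover

section Splitting

variable {S T : Scheme.{u}} {f : T ⟶ S} {d : ℕ} {V : Over S}

/-- The point of the pullback given by a point of `V` and a point of `T`. -/
def toPullback {W : Over S} (w : W ⟶ V) (u : W ⟶ Over.mk f) :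
    W.left ⟶ Limits.pullback V.hom f :=
  Limits.pullback.lift w.left u.left ((Over.w w).trans (Over.w u).symm)

theorem toPullback_fst {W : Over S} (w : W ⟶ V) (u : W ⟶ Over.mk f) :
    toPullback w u ≫ Limits.pullback.fst V.hom f = w.left := Limits.pullback.lift_fst _ _ _

theorem toPullback_snd {W : Over S} (w : W ⟶ V) (u : W ⟶ Over.mk f) :
    toPullback w u ≫ Limits.pullback.snd V.hom f = u.left := Limits.pullback.lift_snd _ _ _

theorem comp_toPullback {U W : Over S} (v : U ⟶ W) (w : W ⟶ V) (u : W ⟶ Over.mk f) :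
    v.left ≫ toPullback w u = toPullback (v ≫ w) (v ≫ u) := by
  refine Limits.pullback.hom_ext ?_ ?_
  · rw [Category.assoc, toPullback_fst, toPullback_fst]
    rfl
  · rw [Category.assoc, toPullback_snd, toPullback_snd]
    rfl

theorem toPullback_injective {W : Over S} {w w' : W ⟶ V} {u u' : W ⟶ Over.mk f}
    (h : toPullback w u = toPullback w' u') : u = u' := by
  refine Over.OverMorphism.ext ?_
  refine (toPullback_snd w u).symm.trans (Eq.trans ?_ (toPullback_snd w' u'))
  rw [h]

/-- A family of `d` points of `T` with values in `V` for which `T ×[S] V` is the disjoint union of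
the `d` copies of `V` which are embedded by these points. -/
def IsSplitting (t : Fin d → (V ⟶ Over.mk f)) : Prop :=
  ∀ (W : Over S) (w : W ⟶ V) (u : W ⟶ Over.mk f), ∃! i : LocallyConstant W.left (Fin d),
    ∀ (U : Over S) (v : U ⟶ W) (k : Fin d), lcPull v.left i = LocallyConstant.const U.left k →
      v ≫ u = (v ≫ w) ≫ t k

theorem IsSplitting.comp {t : Fin d → (V ⟶ Over.mk f)} (ht : IsSplitting t) {W : Over S} (w : W ⟶ V) :
    IsSplitting fun k => w ≫ t k := fun U u x => by
  obtain ⟨i, hi, hi'⟩ := ht U (u ≫ w) x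
  refine ⟨i, fun U v k hk => ?_, fun j hj => hi' j fun U v k hk => ?_⟩
  · refine (hi U v k hk).trans ?_
    simp only [Category.assoc]
  · refine (hj U v k hk).trans ?_
    simp only [Category.assoc]

variable {F : CommRingCat.{u} ⥤ GrpCat.{u}} [PreservesFinPow F] {P : RightGSet (onSch F T)}

/-- An isomorphism from the split pair can be given by a splitting and a section of the torsor over
each of its points. -/
theorem IsSplitting.nonempty_splitIso {t : Fin d → (V ⟶ Over.mk f)} (ht : IsSplitting t)
    (hP : IsTorsor (fppf T) P) (a : Fin d → TotSec f P V) (ha : ∀ k, (a k).1 = t k) :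
    Nonempty (SplitIso f P d V) := by
  have hS := isSheaf_totF (f := f) hP.isSheaf
  choose A hA using fun (W : Over S) (w : W ⟶ V) (i : LocallyConstant W.left (Fin d)) =>
    sheaf_select hS i fun k => TotSec.res w (a k)
  have hA' : ∀ (W : Over S) (w : W ⟶ V) (i : LocallyConstant W.left (Fin d)) (U : Over S) (u : U ⟶ W)
      (k : Fin d), lcPull u.left i = LocallyConstant.const U.left k →
      TotSec.res u (A W w i) = TotSec.res (u ≫ w) (a k) := fun W w i U u k hk =>
    (hA W w i U u k hk).trans (TotSec.res_comp u w (a k)).symm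
  refine ⟨SplitIso.ofTot A (fun U W w v i => ?_) fun W w => ⟨fun i j hij => ?_, fun u => ?_⟩⟩
  · refine sheaf_ext_fibres hS (lcPull v.left i) fun U' u k hk => ?_
    refine Eq.trans ?_ (hA' U (v ≫ w) _ U' u k hk).symm
    refine (TotSec.res_comp u v _).symm.trans ?_
    refine (hA' W w i U' (u ≫ v) k hk).trans ?_
    rw [Category.assoc]
  · obtain ⟨l, -, hl⟩ := ht W w (A W w i).1
    refine (hl i fun U u k hk => ?_).trans (hl j fun U u k hk => ?_).symm
    · refine (congrArg Sigma.fst (hA' W w i U u k hk)).trans ?_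
      exact congrArg ((u ≫ w) ≫ ·) (ha k)
    · refine (congrArg (u ≫ ·) hij).trans ?_
      refine (congrArg Sigma.fst (hA' W w j U u k hk)).trans ?_
      exact congrArg ((u ≫ w) ≫ ·) (ha k)
  · obtain ⟨i, hi, -⟩ := ht W w u
    refine ⟨i, sheaf_ext_fibres (isSheaf_yoneda (Over.mk f)) i fun U v k hk => ?_⟩
    refine (congrArg Sigma.fst (hA' W w i U v k hk)).trans (Eq.trans ?_ (hi U v k hk).symm)
    exact congrArg ((v ≫ w) ≫ ·) (ha k)

theorem exists_appTop_eq {W Z : Scheme.{u}} [IsAffine Z] (χ : Γ(Z, ⊤) ⟶ Γ(W, ⊤)) :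
    ∃ g : W ⟶ Z, g.appTop = χ := by
  refine ⟨W.toSpecΓ ≫ Spec.map χ ≫ Z.isoSpec.inv, ?_⟩
  rw [Scheme.Hom.comp_appTop, Scheme.Hom.comp_appTop, appTop_isoSpec_inv, Scheme.toSpecΓ_appTop,
    ← Scheme.ΓSpecIso_inv_naturality, Category.assoc, Iso.inv_hom_id, Category.comp_id]

/-- If the algebra of functions on the pullback of `T` is a power of the base ring, the pullback
itself is a disjoint union of `d` copies of the base, also as regards its points over arbitrary
schemes. A point is a homomorphism from a power of a ring to the ring of functions, thus given by a
locally constant index. -/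
theorem exists_isSplitting [IsAffineHom f] [IsAffine V.left] (h : IsSplitOver f d V) :
    ∃ t : Fin d → (V ⟶ Over.mk f), IsSplitting t := by
  let Z : Scheme.{u} := Limits.pullback V.hom f
  have hZ : IsAffine Z := isAffine_of_isAffineHom (Limits.pullback.fst V.hom f)
  obtain ⟨ε, hε⟩ : ∃ ε : Γ(Z, ⊤) ≃+* (Fin d → Γ(V.left, ⊤)),
    ∀ a, ε ((Limits.pullback.fst V.hom f).appTop a) = fun _ => a := h
  -- the `d` sections of the pullback given by the components of the algebra
  choose s hs using fun k : Fin d => exists_appTop_eq (W := V.left) (Z := Z)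
    (CommRingCat.ofHom ((Pi.evalRingHom (fun _ : Fin d => (Γ(V.left, ⊤) : Type u)) k).comp
      ε.toRingHom))
  have hs' : ∀ k a, (s k).appTop a = ε a k := fun k a => by rw [hs]; rfl
  have hs1 : ∀ k, s k ≫ Limits.pullback.fst V.hom f = 𝟙 _ := fun k => by
    refine ext_of_isAffine ?_
    ext a
    rw [Scheme.Hom.comp_appTop, CommRingCat.comp_apply, hs', hε, Scheme.Hom.id_appTop]
    rfl
  let t (k : Fin d) : V ⟶ Over.mk f := Over.homMk (s k ≫ Limits.pullback.snd V.hom f) (by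
    change (s k ≫ Limits.pullback.snd V.hom f) ≫ f = V.hom
    rw [Category.assoc, ← Limits.pullback.condition, ← Category.assoc, hs1, Category.id_comp])
  have ht : ∀ (W : Over S) (w : W ⟶ V) (k : Fin d), toPullback w (w ≫ t k) = w.left ≫ s k := by
    intro W w k
    refine Limits.pullback.hom_ext ?_ ?_
    · rw [toPullback_fst, Category.assoc, hs1, Category.comp_id]
    · rw [toPullback_snd, Category.assoc]
      rfl
  have key : ∀ (W : Over S) (w : W ⟶ V) (u : W ⟶ Over.mk f) (k : Fin d),
      u = w ≫ t k ↔ ∀ b : Γ(Z, ⊤), (toPullback w u).appTop b = w.left.appTop (ε b k) := by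
    intro W w u k
    constructor
    · rintro rfl b
      rw [ht, Scheme.Hom.comp_appTop, CommRingCat.comp_apply, hs']
    · intro h
      refine toPullback_injective (w := w) (w' := w) (ext_of_isAffine (Y := Z) ?_)
      ext b
      rw [ht, h, Scheme.Hom.comp_appTop, CommRingCat.comp_apply, hs']
  refine ⟨t, fun W w u => ?_⟩
  let u' : W.left ⟶ Z := toPullback w u
  have hu' : ∀ a, u'.appTop (ε.symm fun _ => a) = w.left.appTop a := fun a => by
    rw [← hε a, RingEquiv.symm_apply_apply, ← CommRingCat.comp_apply, ← Scheme.Hom.comp_appTop]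
    exact congrArg (fun g : W.left ⟶ V.left => g.appTop a) (toPullback_fst w u)
  have key' : ∀ (U : Over S) (v : U ⟶ W) (k : Fin d), v ≫ u = (v ≫ w) ≫ t k ↔
      ∀ b : Γ(Z, ⊤), v.left.appTop (u'.appTop b) = v.left.appTop (w.left.appTop (ε b k)) := by
    intro U v k
    rw [key, ← comp_toPullback]
    simp only [Scheme.Hom.comp_appTop, CommRingCat.comp_apply, Over.comp_left]
    rfl
  -- on the function side, the index of a point is the decomposition of the idempotents
  have char : ∀ i : LocallyConstant W.left (Fin d), (∀ (U : Over S) (v : U ⟶ W) (k : Fin d),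
      lcPull v.left i = LocallyConstant.const U.left k → v ≫ u = (v ≫ w) ≫ t k) →
      ∀ b : Γ(Z, ⊤), u'.appTop b = lcEval i fun k => w.left.appTop (ε b k) := by
    intro i hi b
    refine sheaf_ext_fibres (isSheaf_functions S) i fun U v k hk => ?_
    change v.left.appTop (u'.appTop b) = v.left.appTop (lcEval i fun k => w.left.appTop (ε b k))
    rw [appTop_lcEval, hk, lcEval_const]
    exact (key' U v k).1 (hi U v k hk) b
  -- a point composed with the splitting is a homomorphism from a power of a ring
  obtain ⟨i, hi⟩ := exists_lc_of_ringHom ((u'.appTop.hom).comp ε.symm.toRingHom)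
  have hi' : ∀ b, u'.appTop b = lcEval i fun k => w.left.appTop (ε b k) := fun b => by
    have := hi (ε b)
    change u'.appTop (ε.symm (ε b)) = lcEval i fun k => u'.appTop (ε.symm fun _ => ε b k) at this
    rw [RingEquiv.symm_apply_apply] at this
    simpa only [hu'] using this
  refine ⟨i, fun U v k hk => ?_, fun j hj => ?_⟩
  · rw [key']
    intro b
    rw [hi', appTop_lcEval, hk, lcEval_const]
  · refine lc_ext (X := W.left) fun k => ?_
    have e1 : (fun l => w.left.appTop (ε (ε.symm (Pi.single k 1)) l)) = Pi.single k 1 := by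
      funext l
      rw [RingEquiv.apply_symm_apply, Pi.single_apply, Pi.single_apply]
      split_ifs
      · exact map_one _
      · exact map_zero _
    have h1 := char j hj (ε.symm (Pi.single k 1))
    rw [hi', e1] at h1
    exact h1.symm

end Splitting

/-! ### Pairs and torsors under the semidirect product -/

section LocallySplit

variable {S T : Scheme.{u}} {f : T ⟶ S} {F : CommRingCat.{u} ⥤ GrpCat.{u}}
  {P : RightGSet (onSch F T)} {d : ℕ}

/-- The sieve of all morphisms over which `P` has a section above a given point. -/
def totSieve (P : RightGSet (onSch F T)) {V : Over S} (t : V ⟶ Over.mk f) : Sieve V where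
  arrows W w := ∃ a : TotSec f P W, a.1 = w ≫ t
  downward_closed := by
    rintro W U w ⟨a, ha⟩ v
    exact ⟨a.res v, (congrArg (v ≫ ·) ha).trans (Category.assoc _ _ _).symm⟩

theorem totSieve_mem (hP : IsTorsor (fppf T) P) {V : Over S} (t : V ⟶ Over.mk f) :
    totSieve P t ∈ fppf S V := by
  obtain ⟨R, hR, h⟩ := hP.locally_nonempty (Over.mk t.left)
  rw [GrothendieckTopology.mem_over_iff] at hR ⊢
  refine (Scheme.fppfTopology).superset_covering ?_ hR
  intro Z z hz
  rw [Sieve.overEquiv_iff] at hz ⊢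
  obtain ⟨p⟩ := h _ _ hz
  exact ⟨⟨Over.homMk z ≫ t, p⟩, rfl⟩

theorem sieve_forall_mem {C : Type w} [Category.{w'} C] (J : GrothendieckTopology C) {X : C}
    {ι : Type w''} [Finite ι] (R : ι → Sieve X) (hR : ∀ i, R i ∈ J X) : (⨅ i, R i) ∈ J X := by
  classical
  have := Fintype.ofFinite ι
  have key : ∀ s : Finset ι, (⨅ i ∈ s, R i) ∈ J X := fun s => by
    induction s using Finset.induction_on with
    | empty => simp
    | insert a s ha ih =>
      rw [Finset.iInf_insert]
      exact J.intersection_covering (hR a) ih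
  simpa using key Finset.univ

variable [PreservesFinPow F]

/-- The isomorphisms from the split pair form a torsor. -/
theorem isTorsor_splitIsos [IsFinite f] [Etale f] (hd : ∀ s, f.finrank s = d)
    (hP : IsTorsor (fppf T) P) : IsTorsor (fppf S) (splitIsos f P d) where
  isSheaf := isSheaf_splitIsos hP.isSheaf
  act_one {X} p := SplitIso.act_one (X := X.unop) hP p
  act_mul {X} p a b := SplitIso.act_mul (X := X.unop) hP p a b
  simply_transitive {X} p q := by
    obtain ⟨a, ha⟩ := SplitIso.exists_act (X := X.unop) hP p q
    exact ⟨a, ha, fun b hb => SplitIso.act_injective (X := X.unop) hP p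
      (Eq.trans (show SplitIso.act (X := X.unop) p b = q from hb) ha.symm)⟩
  locally_nonempty X := by
    let R : Sieve X :=
      { arrows := fun Y _ => Nonempty (SplitIso f P d Y)
        downward_closed := fun ⟨p⟩ g => ⟨p.res g⟩ }
    suffices h : R ∈ fppf S X from ⟨R, h, fun Y g hg => hg⟩
    -- affine schemes cover, and each of them has a cover over which `T` is split
    refine (fppf S).transitive (fppf_of_forall_affine (Sieve.generate fun U _ => IsAffine U.left)
      fun U u hU => Sieve.le_generate _ _ _ hU) R ?_
    rintro Y _ ⟨U, y, u, hU, rfl⟩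
    suffices h : R.pullback u ∈ fppf S U by
      rw [Sieve.pullback_comp]
      exact (fppf S).pullback_stable y h
    have : IsAffine U.left := hU
    obtain ⟨V, v, hV, hv1, hv2, hv3, hs⟩ := exists_split_cover f hd U
    refine (fppf S).transitive (fppf_singleton v) _ ?_
    rintro Y' _ ⟨_, y', _, ⟨⟩, rfl⟩
    suffices h : (R.pullback u).pullback v ∈ fppf S V by
      rw [Sieve.pullback_comp]
      exact (fppf S).pullback_stable y' h
    -- it remains to find sections of `P` locally over the `d` points simultaneously
    obtain ⟨t, ht⟩ := exists_isSplitting hs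
    refine (fppf S).superset_covering ?_ (sieve_forall_mem (fppf S) (fun k => totSieve P (t k))
      fun k => totSieve_mem hP (t k))
    intro W w hw
    choose a ha using fun k => iInf_le (fun k => totSieve P (t k)) k w hw
    exact (ht.comp w).nonempty_splitIso hP a ha

end LocallySplit

section SplitFramings

variable {S T : Scheme.{u}} {f : T ⟶ S} {F : CommRingCat.{u} ⥤ GrpCat.{u}} [PreservesFinPow F]
  {P : RightGSet (onSch F T)} {d : ℕ}

theorem glue_permAct {X : Scheme.{u}} (σ : LocallyConstant X (Equiv.Perm (Fin d)))
    (j : LocallyConstant X (Fin d)) (B : Fin d → F.obj Γ(X, ⊤)) :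
    glue F j (permAct F d X σ B) = glue F (lcApply σ⁻¹ j) B := by
  let q : LocallyConstant X (Fin d × Equiv.Perm (Fin d)) :=
    ⟨fun x => (j x, σ x), j.isLocallyConstant.prodMk σ.isLocallyConstant⟩
  exact (glue_pair q (fun k g => B (g⁻¹ k))).trans (glue_map q (fun r => r.2⁻¹ r.1) B).symm

theorem lcApply_inv_lcApply {X : Scheme.{u}} (σ : LocallyConstant X (Equiv.Perm (Fin d)))
    (j : LocallyConstant X (Fin d)) : lcApply σ (lcApply σ⁻¹ j) = j := by
  ext x
  exact congrArg Fin.val (Equiv.apply_symm_apply (σ x) (j x))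

variable (F d S) in
/-- The action of the semidirect product on the constant sheaf of indices. -/
def lcSet : GSet.{u, u} (wreath F d S) where
  F := lcF S (Fin d)
  act {X} i a := lcApply (show WreathSections F d X.unop.left from a).right⁻¹ i
  act_map h i a := rfl
  act_one i := rfl
  act_mul i a b := by
    refine LocallyConstant.ext fun x => ?_
    rfl

/-- The action of the semidirect product on pairs of an index and an element of the group. -/
def pairAct {X : Scheme.{u}} (v : LocallyConstant X (Fin d) × F.obj Γ(X, ⊤))
    (a : WreathSections F d X) : LocallyConstant X (Fin d) × F.obj Γ(X, ⊤) :=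
  (lcApply a.right⁻¹ v.1, (glue F v.1 a.left)⁻¹ * v.2)

theorem pairAct_one {X : Scheme.{u}} (v : LocallyConstant X (Fin d) × F.obj Γ(X, ⊤)) :
    pairAct v (1 : WreathSections F d X) = v := by
  refine Prod.ext rfl ?_
  change (glue F v.1 1)⁻¹ * v.2 = v.2
  rw [glue_one, inv_one, one_mul]

theorem pairAct_mul {X : Scheme.{u}} (v : LocallyConstant X (Fin d) × F.obj Γ(X, ⊤))
    (a b : WreathSections F d X) : pairAct v (a * b) = pairAct (pairAct v a) b := by
  refine Prod.ext (LocallyConstant.ext fun x => rfl) ?_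
  change (glue F v.1 (a * b).left)⁻¹ * v.2 =
    (glue F (lcApply a.right⁻¹ v.1) b.left)⁻¹ * ((glue F v.1 a.left)⁻¹ * v.2)
  rw [SemidirectProduct.mul_left, glue_mul, glue_permAct, mul_inv_rev, mul_assoc]

/-- Restriction of pairs. -/
def pairRes {X Y : Scheme.{u}} (h : Y ⟶ X) (v : LocallyConstant X (Fin d) × F.obj Γ(X, ⊤)) :
    LocallyConstant Y (Fin d) × F.obj Γ(Y, ⊤) :=
  (lcPull h v.1, F.map h.appTop v.2)

theorem pairRes_pairAct {X Y : Scheme.{u}} (h : Y ⟶ X)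
    (v : LocallyConstant X (Fin d) × F.obj Γ(X, ⊤)) (a : WreathSections F d X) :
    pairRes h (pairAct v a) = pairAct (pairRes h v) (wreathRes F d h a) := by
  refine Prod.ext rfl ?_
  change F.map h.appTop ((glue F v.1 a.left)⁻¹ * v.2) =
    (glue F (lcPull h v.1) fun k => F.map h.appTop (a.left k))⁻¹ * F.map h.appTop v.2
  rw [map_mul, map_inv, map_glue]

variable (F d S) in
/-- The sheaf of pairs of an index and an element of the group, with the action of the semidirect
product. -/
def pairSet : GSet.{u, u} (wreath F d S) where
  F :=
    { obj := fun X => LocallyConstant X.unop.left (Fin d) × F.obj Γ(X.unop.left, ⊤)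
      map := fun h => TypeCat.ofHom (pairRes h.unop.left)
      map_id := fun X => by
        refine ConcreteCategory.hom_ext _ _ fun v => ?_
        refine Prod.ext rfl ?_
        change F.map (𝟙 X.unop : X.unop ⟶ X.unop).left.appTop v.2 = v.2
        rw [Over.id_left, Scheme.Hom.id_appTop, F.map_id]
        rfl
      map_comp := fun g h => by
        refine ConcreteCategory.hom_ext _ _ fun v => ?_
        refine Prod.ext rfl ?_
        change F.map (h.unop ≫ g.unop).left.appTop v.2 =
          F.map h.unop.left.appTop (F.map g.unop.left.appTop v.2)
        rw [Over.comp_left, Scheme.Hom.comp_appTop, map_map_apply] }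
  act {X} v a := pairAct (X := X.unop.left) v a
  act_map {X Y} h v a := pairRes_pairAct h.unop.left v a
  act_one {X} v := pairAct_one (X := X.unop.left) v
  act_mul {X} v a b := pairAct_mul (X := X.unop.left) v a b

theorem map_appTop_id {X : Over S} (x : F.obj Γ(X.left, ⊤)) :
    F.map (𝟙 X : X ⟶ X).left.appTop x = x := by
  rw [Over.id_left, Scheme.Hom.id_appTop, F.map_id]
  rfl

theorem SplitIso.tot_act_id {X : Over S} (p : SplitIso f P d X) (a : WreathSections F d X.left)
    (i : LocallyConstant X.left (Fin d)) :
    (p.act a).tot X (𝟙 X) i = (p.tot X (𝟙 X) (lcApply a.right i)).act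
      (glue F (lcApply a.right i) a.left) := by
  rw [tot_act]
  simp only [map_appTop_id]
  rfl

/-- The sections of the total space given by an isomorphism from the split pair, as a bijection. -/
def SplitIso.totEquiv (hP : IsTorsor (fppf T) P) {X : Over S} (p : SplitIso f P d X) :
    LocallyConstant X.left (Fin d) × F.obj Γ(X.left, ⊤) ≃ TotSec f P X :=
  Equiv.ofBijective (fun v => (p.tot X (𝟙 X) v.1).act v.2) (by
    constructor
    · intro v v' h
      have h1 : v.1 = v'.1 := (p.pt_bijective X (𝟙 X)).1 (congrArg Sigma.fst h)
      obtain ⟨i, x⟩ := v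
      obtain ⟨i', x'⟩ := v'
      obtain rfl : i = i' := h1
      exact Prod.ext rfl (TotSec.act_injective hP _ h)
    · intro a
      obtain ⟨i, hi⟩ := (p.pt_bijective X (𝟙 X)).2 a.1
      obtain ⟨x, hx, -⟩ := TotSec.existsUnique_act hP (p.tot X (𝟙 X) i) a hi
      exact ⟨(i, x), hx⟩)

/-- The scheme `T` is the twist of the constant sheaf of indices. -/
def ptFraming : Framing (splitIsos f P d) (lcSet S F d) (yoneda.obj (Over.mk f)) where
  app {Y} p := Equiv.ofBijective (SplitIso.pt (X := Y) p Y (𝟙 Y)) (SplitIso.pt_bijective (X := Y) p Y _)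
  app_map {Y Z} g p i := by
    refine (SplitIso.pt_map (X := Y) p Z Y (𝟙 Y) g i).trans ?_
    exact congrArg (fun y => SplitIso.pt (X := Y) p Z y (lcPull g.left i))
      ((Category.comp_id g).trans (Category.id_comp g).symm)
  app_act {Y} p a i := congrArg (SplitIso.pt (X := Y) p Y (𝟙 Y))
    (lcApply_inv_lcApply (X := Y.left) (show WreathSections F d Y.left from a).right i)

/-- The total space of the torsor is the twist of the sheaf of pairs. -/
def totFraming (hP : IsTorsor (fppf T) P) :
    Framing (splitIsos f P d) (pairSet S F d) (totF f P) where
  app {Y} p := SplitIso.totEquiv (X := Y) hP p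
  app_map {Y Z} g p v := by
    refine (TotSec.res_act g _ _).trans ?_
    refine congrArg (fun a => TotSec.act a _) ((SplitIso.res_tot (X := Y) p (𝟙 Y) g _).trans ?_)
    exact SplitIso.tot_congr (X := Y) p Z ((Category.comp_id g).trans (Category.id_comp g).symm) _
  app_act {Y} p' a v := by
    let p : SplitIso f P d Y := p'
    let a' : WreathSections F d Y.left := a
    obtain ⟨i, x⟩ : LocallyConstant Y.left (Fin d) × F.obj Γ(Y.left, ⊤) := v
    change ((p.act a').tot Y (𝟙 Y) (lcApply a'.right⁻¹ i)).act ((glue F i a'.left)⁻¹ * x) =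
      (p.tot Y (𝟙 Y) i).act x
    rw [SplitIso.tot_act_id, lcApply_inv_lcApply, ← TotSec.act_mul hP, mul_inv_cancel_left]

end SplitFramings

section IsoOfTorsors

variable {S T T' : Scheme.{u}} {f : T ⟶ S} {f' : T' ⟶ S} {F : CommRingCat.{u} ⥤ GrpCat.{u}}
  [PreservesFinPow F] {P : RightGSet (onSch F T)} {P' : RightGSet (onSch F T')} {d : ℕ}

/-- The map of total spaces given by a map of torsors. -/
def TorsorMap.tot {g : T ⟶ T'} (hg : g ≫ f' = f) (θ : TorsorMap g P P') {W : Over S}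
    (a : TotSec f P W) : TotSec f' P' W :=
  ⟨a.1 ≫ Over.homMk g hg, θ.app a.2⟩

theorem TorsorMap.res_tot {g : T ⟶ T'} (hg : g ≫ f' = f) (θ : TorsorMap g P P') {V W : Over S}
    (v : V ⟶ W) (a : TotSec f P W) : (θ.tot hg a).res v = θ.tot hg (a.res v) := by
  refine TotSec.ext_eval (Category.assoc v a.1 _).symm fun e => ?_
  refine (P'.map_comp_apply _ _ _).symm.trans (Eq.trans ?_
    (θ.app_map (Over.homMk v.left rfl : Over.mk (v ≫ a.1).left ⟶ Over.mk a.1.left) a.2).symm)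
  exact TotSec.map_congr (a := θ.tot hg a) rfl (_ ≫ _) _ (Category.id_comp _)

theorem isom_splitIsos (hT : IsTorsor (fppf S) (splitIsos f P d))
    (hT' : IsTorsor (fppf S) (splitIsos f' P' d)) (g : T ≅ T') (hg : g.hom ≫ f' = f)
    (θ : TorsorMap g.hom P P') : (splitIsos f P d).Isom (splitIsos f' P' d) := by
  have hb : ∀ W : Over S, Function.Bijective fun u : W ⟶ Over.mk f =>
      u ≫ (Over.homMk g.hom hg : Over.mk f ⟶ Over.mk f') := by
    intro W
    have : IsIso (Over.homMk g.hom hg : Over.mk f ⟶ Over.mk f') := by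
      have : IsIso ((Over.forget S).map (Over.homMk g.hom hg : Over.mk f ⟶ Over.mk f')) :=
        inferInstanceAs (IsIso g.hom)
      exact isIso_of_reflects_iso _ (Over.forget S)
    exact ⟨fun a b h => (cancel_mono _).1 h, fun b => ⟨b ≫ inv (Over.homMk g.hom hg : Over.mk f ⟶ Over.mk f'), by simp⟩⟩
  refine isom_of_map hT hT' (fun X p => SplitIso.ofTot (X := X.unop)
    (fun W w i => θ.tot hg (SplitIso.tot (X := X.unop) p W w i)) (fun V W w v i => ?_)
    fun W w => (hb W).comp (SplitIso.pt_bijective (X := X.unop) p W w)) ?_ ?_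
  · exact (θ.res_tot hg v _).trans (congrArg (θ.tot hg) (SplitIso.res_tot (X := X.unop) p w v i))
  · intro X Y h p
    rfl
  · intro X p a
    refine SplitIso.tot_injective (X := X.unop) fun W w i => ?_
    exact congrArg (Sigma.mk _) (θ.app_act _ _)

theorem TotSec.eval_act {W : Over S} (a : TotSec f P W) (x : F.obj Γ(W.left, ⊤)) (Z : Over T)
    (g : Z.left ⟶ W.left) (h : g ≫ a.1.left = Z.hom) :
    (a.act x).eval Z g h = P.act (a.eval Z g h) (F.map g.appTop x) :=
  P.act_map _ _ _

theorem TotSec.eval_of_res_eq {V W : Over S} {a : TotSec f P W} {b : TotSec f P V} {v : V ⟶ W}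
    (hb : a.res v = b) {Y Z : Over T} (k : Y ⟶ Z) (g : Z.left ⟶ W.left) (g' : Y.left ⟶ V.left)
    (e : k.left ≫ g = g' ≫ v.left) (h : g ≫ a.1.left = Z.hom) (h' : g' ≫ b.1.left = Y.hom) :
    b.eval Y g' h' = P.F.map k.op (a.eval Z g h) := by
  subst hb
  have h1 : (k.left ≫ g) ≫ a.1.left = Y.hom := by rw [Category.assoc, h, Over.w]
  rw [TotSec.eval_res v a Y g' h' (by rw [← e, h1]), TotSec.map_eval a k g h h1]
  exact TotSec.eval_congr rfl Y e.symm _ _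

/-- An isomorphism of the torsors of isomorphisms from the split pair comes from an isomorphism of
pairs: the scheme and the total space of its torsor are twists of sheaves which do not depend on the
pair. -/
theorem exists_torsorMap (hP : IsTorsor (fppf T) P) (hP' : IsTorsor (fppf T') P')
    (hT : IsTorsor (fppf S) (splitIsos f P d))
    (h : (splitIsos f P d).Isom (splitIsos f' P' d)) :
    ∃ g : T ≅ T', g.hom ≫ f' = f ∧ Nonempty (TorsorMap g.hom P P') := by
  obtain ⟨e, he⟩ := h
  have he1 : ∀ {X Y : Over S} (y : Y ⟶ X) (p : SplitIso f P d X),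
      e.hom.app (op Y) (p.res y) = SplitIso.res y (e.hom.app (op X) p) :=
    fun y p => ConcreteCategory.congr_hom (e.hom.naturality y.op) p
  let fp : Framing (splitIsos f P d) (lcSet S F d) (yoneda.obj (Over.mk f')) :=
    { app := fun {Y} p => ptFraming.app (e.hom.app (op Y) p)
      app_map := fun {Y Z} g p v => by
        refine ((ptFraming (P := P')).app_map g (e.hom.app (op Y) p) v).trans ?_
        exact congrArg (fun q => (ptFraming (P := P')).app q ((lcSet S F d).F.map g.op v))
          (he1 g p).symm
      app_act := fun {Y} p a v => by
        refine Eq.trans ?_ ((ptFraming (P := P')).app_act (e.hom.app (op Y) p) a v)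
        exact congrArg (fun q => (ptFraming (P := P')).app q ((lcSet S F d).act v a)) (he (op Y) p a) }
  let ft : Framing (splitIsos f P d) (pairSet S F d) (totF f' P') :=
    { app := fun {Y} p => (totFraming hP').app (e.hom.app (op Y) p)
      app_map := fun {Y Z} g p v => by
        refine ((totFraming hP').app_map g (e.hom.app (op Y) p) v).trans ?_
        exact congrArg (fun q => (totFraming hP').app q ((pairSet S F d).F.map g.op v))
          (he1 g p).symm
      app_act := fun {Y} p a v => by
        refine Eq.trans ?_ ((totFraming hP').app_act (e.hom.app (op Y) p) a v)
        exact congrArg (fun q => (totFraming hP').app q ((pairSet S F d).act v a))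
          (he (op Y) p a) }
  let E (Y : Over S) : (Y ⟶ Over.mk f) ≃ (Y ⟶ Over.mk f') :=
    Framing.equiv hT (isSheaf_yoneda _) (isSheaf_yoneda _) ptFraming fp Y
  have hE : ∀ {X Y : Over S} (y : Y ⟶ X) (t : X ⟶ Over.mk f), y ≫ E X t = E Y (y ≫ t) :=
    fun y t => Framing.map_equiv hT (isSheaf_yoneda _) (isSheaf_yoneda _) ptFraming fp y t
  have hE' : ∀ {X : Over S} (p : SplitIso f P d X) (i : LocallyConstant X.left (Fin d)),
      E X (p.pt X (𝟙 X) i) = SplitIso.pt (X := X) (e.hom.app (op X) p) X (𝟙 X) i :=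
    fun p i => Framing.equiv_app hT (isSheaf_yoneda _) (isSheaf_yoneda _) ptFraming fp p i
  let D (Y : Over S) : TotSec f P Y ≃ TotSec f' P' Y :=
    Framing.equiv hT (isSheaf_totF hP.isSheaf) (isSheaf_totF hP'.isSheaf) (totFraming hP) ft Y
  have hD : ∀ {X Y : Over S} (y : Y ⟶ X) (t : TotSec f P X), (D X t).res y = D Y (t.res y) :=
    fun y t => Framing.map_equiv hT (isSheaf_totF hP.isSheaf) (isSheaf_totF hP'.isSheaf)
      (totFraming hP) ft y t
  have hD' : ∀ {X : Over S} (p : SplitIso f P d X) (i : LocallyConstant X.left (Fin d))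
      (x : F.obj Γ(X.left, ⊤)), D X ((p.tot X (𝟙 X) i).act x) =
        (SplitIso.tot (X := X) (e.hom.app (op X) p) X (𝟙 X) i).act x :=
    fun p i x => Framing.equiv_app hT (isSheaf_totF hP.isSheaf) (isSheaf_totF hP'.isSheaf)
      (totFraming hP) ft p (i, x)
  -- locally, every section of the total space is given by a section of the torsor
  have hloc : ∀ {X : Over S} (a : TotSec f P X), ∃ R ∈ fppf S X, ∀ (Y : Over S) (y : Y ⟶ X), R y →
      ∃ (p : SplitIso f P d Y) (i : LocallyConstant Y.left (Fin d)) (x : F.obj Γ(Y.left, ⊤)),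
        a.res y = (p.tot Y (𝟙 Y) i).act x := by
    intro X a
    refine ⟨_, hT.sieve_mem X, fun Y y ⟨p⟩ => ?_⟩
    obtain ⟨⟨i, x⟩, h⟩ := ((totFraming hP).app p).surjective (a.res y)
    exact ⟨p, i, x, h.symm⟩
  have hD1 : ∀ {X : Over S} (a : TotSec f P X), (D X a).1 = E X a.1 := by
    intro X a
    obtain ⟨R, hR, h⟩ := hloc a
    refine sheaf_ext (isSheaf_yoneda (Over.mk f')) hR fun Y y hy => ?_
    obtain ⟨p, i, x, hp⟩ := h Y y hy
    refine (congrArg Sigma.fst (hD y a)).trans (Eq.trans ?_ (hE y a.1).symm)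
    refine Eq.trans ?_ (congrArg (fun b => E Y (Sigma.fst b)) hp).symm
    refine (congrArg (fun b => Sigma.fst (D Y b)) hp).trans ?_
    exact (congrArg Sigma.fst (hD' p i x)).trans (hE' p i).symm
  have hD2 : ∀ {X : Over S} (a : TotSec f P X) (x : F.obj Γ(X.left, ⊤)),
      D X (a.act x) = (D X a).act x := by
    intro X a x
    obtain ⟨R, hR, h⟩ := hloc a
    refine sheaf_ext (isSheaf_totF hP'.isSheaf) hR fun Y y hy => ?_
    obtain ⟨p, i, z, hp⟩ := h Y y hy
    refine (hD y _).trans (Eq.trans ?_ (TotSec.res_act y _ x).symm)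
    rw [hD, TotSec.res_act, hp, hD', ← TotSec.act_mul hP, hD', TotSec.act_mul hP']
  let G : Over.mk f ≅ Over.mk f' :=
    { hom := E _ (𝟙 _)
      inv := (E _).symm (𝟙 _)
      hom_inv_id := (E _).injective (by rw [← hE, Equiv.apply_symm_apply, Category.comp_id])
      inv_hom_id := by rw [hE, Category.comp_id, Equiv.apply_symm_apply] }
  have hG : ∀ {X : Over S} (t : X ⟶ Over.mk f), t ≫ G.hom = E X t := fun {X} t =>
    (hE t (𝟙 _)).trans (congrArg (E X) (Category.comp_id t))
  have hg : G.hom.left ≫ f' = f := Over.w G.hom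
  let pr (Y : Over T) : Over.mk (Y.hom ≫ f) ⟶ Over.mk f := Over.homMk Y.hom
  have hpr : ∀ {Y : Over T} (p : P.F.obj (op Y)), 𝟙 Y.left ≫
      (D (Over.mk (Y.hom ≫ f)) ⟨pr Y, p⟩).1.left = (Over.mk (Y.hom ≫ G.hom.left)).hom := by
    intro Y p
    rw [hD1, ← hG]
    exact Category.id_comp _
  refine ⟨(Over.forget S).mapIso G, hg, ⟨{
    app := fun {Y} p => (D (Over.mk (Y.hom ≫ f)) ⟨pr Y, p⟩).eval (Over.mk (Y.hom ≫ G.hom.left))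
      (𝟙 Y.left) (hpr p)
    app_map := ?_
    app_act := ?_ }⟩⟩
  · intro Y Z h p
    have h1 : (⟨pr Z, P.F.map h.op p⟩ : TotSec f P (Over.mk (Z.hom ≫ f))) =
        TotSec.res (mapHom f h) ⟨pr Y, p⟩ := by
      refine TotSec.ext_eval (Over.OverMorphism.ext (Over.w h).symm) fun e => ?_
      refine (P.map_comp_apply _ _ _).symm.trans ?_
      exact TotSec.map_congr (a := ⟨pr Y, p⟩) (b := ⟨pr Y, p⟩) rfl (_ ≫ _) _ (Category.id_comp _)
    have h2 := congrArg (D (Over.mk (Z.hom ≫ f))) h1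
    rw [← hD] at h2
    have h5 : 𝟙 Z.left ≫ _ = (Over.mk (Z.hom ≫ G.hom.left)).hom := hpr (P.F.map h.op p)
    exact TotSec.eval_of_res_eq (Y := Over.mk (Z.hom ≫ G.hom.left)) (Z := Over.mk (Y.hom ≫ G.hom.left)) h2.symm (mapHom G.hom.left h) (𝟙 Y.left) (𝟙 Z.left)
      ((Category.comp_id _).trans (Category.id_comp _).symm) (hpr p) h5
  · intro Y p a
    have h2 := hD2 ⟨pr Y, p⟩ a
    refine (TotSec.eval_congr h2 _ rfl _ (by exact hpr p)).trans ?_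
    refine (TotSec.eval_act _ _ _ _ _).trans ?_
    exact congrArg (P'.act _) (map_appTop_id (X := Over.mk (Y.hom ≫ f)) _)

end IsoOfTorsors

/-! ### Linear functionals on divided powers -/

section Contraction

variable {R : Type w} {M : Type w'} [CommRing R] [AddCommGroup M] [Module R M]

local notation "Γᴿ" => DividedPowerAlgebra R M

/-- The divided power with the exponent lowered by one. -/
def dpPred (n : ℕ) (m : M) : Γᴿ :=
  match n with
  | 0 => 0
  | n + 1 => DividedPowerAlgebra.dp R n m

theorem dpPred_zero (m : M) : (dpPred 0 m : Γᴿ) = 0 := rfl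

theorem dpPred_succ (n : ℕ) (m : M) : dpPred (n + 1) m = DividedPowerAlgebra.dp R n m := rfl

/-- The homomorphism `x ↦ x + ∂x ε` to the dual numbers, for the derivation `∂` which is the
contraction by the linear form `f`. -/
def contractAlg (f : M →ₗ[R] R) : Γᴿ →ₐ[R] TrivSqZeroExt Γᴿ Γᴿ :=
  DividedPowerAlgebra.lift' (f := fun q : ℕ × M =>
      (TrivSqZeroExt.inl (DividedPowerAlgebra.dp R q.1 q.2) +
        TrivSqZeroExt.inr (f q.2 • dpPred q.1 q.2) : TrivSqZeroExt Γᴿ Γᴿ))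
    (fun m => by
      refine TrivSqZeroExt.ext ?_ ?_
      · simp [DividedPowerAlgebra.dp_zero]
      · simp [dpPred])
    (fun n r m => by
      refine TrivSqZeroExt.ext ?_ ?_
      · simp [DividedPowerAlgebra.dp_smul]
      · rcases n with - | n
        · simp [dpPred]
        · simp only [dpPred_succ, map_smul, DividedPowerAlgebra.dp_smul, smul_smul,
            TrivSqZeroExt.snd_add, TrivSqZeroExt.snd_inl, TrivSqZeroExt.snd_inr,
            TrivSqZeroExt.snd_smul, zero_add, smul_eq_mul]
          congr 1
          ring)
    (fun n p m => by
      refine TrivSqZeroExt.ext ?_ ?_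
      · simp [DividedPowerAlgebra.dp_mul]
      · rcases n with - | n <;> rcases p with - | p
        · simp [dpPred]
        · simp [dpPred, DividedPowerAlgebra.dp_zero]
        · simp [dpPred, DividedPowerAlgebra.dp_zero]
        -- multiplicativity amounts to Pascal's rule for the coefficients of the product
        · simp only [dpPred_succ, TrivSqZeroExt.snd_mul, TrivSqZeroExt.snd_add, TrivSqZeroExt.fst_add,
            TrivSqZeroExt.fst_inl, TrivSqZeroExt.fst_inr, TrivSqZeroExt.snd_inl,
            TrivSqZeroExt.snd_inr, add_zero, zero_add, TrivSqZeroExt.snd_smul, op_smul_eq_smul,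
            smul_eq_mul, mul_smul_comm, DividedPowerAlgebra.dp_mul]
          rw [show n + 1 + (p + 1) = (n + p + 1) + 1 by ring, show n + 1 + p = n + p + 1 by ring,
            show p + 1 + n = n + p + 1 by ring, dpPred_succ, Nat.choose_succ_succ (n + p + 1) n,
            ← Nat.choose_symm_of_eq_add (show n + p + 1 = (p + 1) + n by ring), smul_comm,
            smul_comm (f m), ← add_smul, add_comm, smul_comm])
    (fun n x y => by
      refine TrivSqZeroExt.ext ?_ ?_
      · simp [DividedPowerAlgebra.dp_add, TrivSqZeroExt.fst_sum]
      · rcases n with - | n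
        · simp [dpPred]
        · simp only [TrivSqZeroExt.snd_sum, TrivSqZeroExt.snd_mul, TrivSqZeroExt.snd_add,
            TrivSqZeroExt.fst_add, TrivSqZeroExt.fst_inl, TrivSqZeroExt.fst_inr,
            TrivSqZeroExt.snd_inl, TrivSqZeroExt.snd_inr, add_zero, zero_add, op_smul_eq_smul,
            smul_eq_mul, Finset.sum_add_distrib, map_add]
          rw [Finset.Nat.sum_antidiagonal_succ' (f := fun k : ℕ × ℕ =>
              DividedPowerAlgebra.dp R k.1 x * (f y • dpPred k.2 y)),
            Finset.Nat.sum_antidiagonal_succ (f := fun k : ℕ × ℕ =>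
              DividedPowerAlgebra.dp R k.2 y * (f x • dpPred k.1 x))]
          simp only [dpPred_succ, dpPred_zero, smul_zero, mul_zero, zero_add, mul_smul_comm,
            ← Finset.smul_sum, add_smul, DividedPowerAlgebra.dp_add]
          rw [add_comm]
          congr 2
          exact Finset.sum_congr rfl fun _ _ => mul_comm _ _)

theorem contractAlg_dp (f : M →ₗ[R] R) (n : ℕ) (m : M) :
    contractAlg f (DividedPowerAlgebra.dp R n m) =
      TrivSqZeroExt.inl (DividedPowerAlgebra.dp R n m) + TrivSqZeroExt.inr (f m • dpPred n m) :=
  DividedPowerAlgebra.lift'_apply_dp (f := fun q : ℕ × M =>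
      (TrivSqZeroExt.inl (DividedPowerAlgebra.dp R q.1 q.2) +
        TrivSqZeroExt.inr (f q.2 • dpPred q.1 q.2) : TrivSqZeroExt Γᴿ Γᴿ)) _ _ _ _ n m

theorem fst_contractAlg (f : M →ₗ[R] R) (x : Γᴿ) : (contractAlg f x).fst = x := by
  have : (TrivSqZeroExt.fstHom R Γᴿ Γᴿ).comp (contractAlg f) = AlgHom.id R _ :=
    DividedPowerAlgebra.algHom_ext fun n m => by simp [contractAlg_dp]
  exact DFunLike.congr_fun this x

/-- The contraction by a linear form `f`, a derivation with `γ_{n + 1}(m) ↦ f(m) γ_n(m)`. -/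
def contract (f : M →ₗ[R] R) : Derivation R Γᴿ Γᴿ :=
  Derivation.mk' ((TrivSqZeroExt.sndHom Γᴿ Γᴿ).restrictScalars R ∘ₗ (contractAlg f).toLinearMap)
    fun a b => by
      change (contractAlg f (a * b)).snd = a • (contractAlg f b).snd + b • (contractAlg f a).snd
      rw [map_mul, TrivSqZeroExt.snd_mul, fst_contractAlg, fst_contractAlg, op_smul_eq_smul]

theorem contract_dp (f : M →ₗ[R] R) (n : ℕ) (m : M) :
    contract f (DividedPowerAlgebra.dp R n m) = f m • dpPred n m := by
  change (contractAlg f _).snd = _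
  simp [contractAlg_dp]

variable {ι : Type*} [Fintype ι] [DecidableEq ι]

theorem derivation_prod {G : Type*} [CommRing G] [Algebra R G] (D : Derivation R G G)
    (s : Finset ι) (g : ι → G) : D (∏ j ∈ s, g j) = ∑ j ∈ s, (∏ i ∈ s.erase j, g i) • D (g j) := by
  induction s using Finset.induction_on with
  | empty => simp
  | insert a s ha ih =>
    rw [Finset.prod_insert ha, D.leibniz, Finset.sum_insert ha, Finset.erase_insert ha, ih,
      Finset.smul_sum, add_comm]
    congr 1
    refine Finset.sum_congr rfl fun j hj => ?_
    have hne : a ≠ j := fun e => ha (e ▸ hj)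
    rw [Finset.erase_insert_of_ne hne, Finset.prod_insert (by simp [ha]), smul_smul]

theorem contract_prod_dp (f : M →ₗ[R] R) (b : ι → ℕ) (m : ι → M) :
    contract f (∏ j, DividedPowerAlgebra.dp R (b j) (m j)) =
      ∑ j, if b j = 0 then 0 else f (m j) •
        ∏ i, DividedPowerAlgebra.dp R (if i = j then b i - 1 else b i) (m i) := by
  rw [derivation_prod]
  refine Finset.sum_congr rfl fun j _ => ?_
  rw [contract_dp]
  split_ifs with h
  · rw [h]; simp [dpPred]
  · obtain ⟨n, hn⟩ := Nat.exists_eq_succ_of_ne_zero h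
    rw [← Finset.mul_prod_erase _ _ (Finset.mem_univ j), if_pos rfl, smul_comm, smul_eq_mul,
      mul_comm, hn]
    congr 2
    exact Finset.prod_congr rfl fun i hi => by rw [if_neg (Finset.ne_of_mem_erase hi)]

/-- The augmentation of the divided power algebra. -/
def dpAug : Γᴿ →ₐ[R] R :=
  DividedPowerAlgebra.lift' (f := fun q : ℕ × M => if q.1 = 0 then (1 : R) else 0)
    (fun m => by simp)
    (fun n r m => by rcases n with - | n <;> simp)
    (fun n p m => by rcases n with - | n <;> rcases p with - | p <;> simp)
    (fun n x y => by
      rcases n with - | n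
      · simp
      · refine (Finset.sum_eq_zero fun q hq => ?_).symm
        obtain ⟨k, l⟩ := q
        have hkl : k + l = n + 1 := Finset.HasAntidiagonal.mem_antidiagonal.1 hq
        change (if k = 0 then (1 : R) else 0) * (if l = 0 then 1 else 0) = 0
        rcases k with - | k
        · rw [if_neg (show l ≠ 0 by omega), mul_zero]
        · rw [if_neg k.succ_ne_zero, zero_mul])

theorem dpAug_dp (n : ℕ) (m : M) :
    dpAug (DividedPowerAlgebra.dp R n m) = if n = 0 then (1 : R) else 0 :=
  DividedPowerAlgebra.lift'_apply_dp (f := fun q : ℕ × M => if q.1 = 0 then (1 : R) else 0)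
    _ _ _ _ n m

/-- The functional on the divided power algebra given by successive contractions with a family of
linear forms. On the part of degree `d` it is the polarization of `γ_d(m) ↦ ∏ k, f k m`. -/
def dpEval : {d : ℕ} → (Fin d → (M →ₗ[R] R)) → (Γᴿ →ₗ[R] R)
  | 0, _ => dpAug.toLinearMap
  | _ + 1, f => dpEval (fun k => f k.succ) ∘ₗ (contract (f 0)).toLinearMap

/-- The functional `dpEval f` takes a product of divided powers to the sum over the ways of
distributing the factors among the linear forms. -/
theorem dpEval_prod_dp {d : ℕ} (f : Fin d → (M →ₗ[R] R)) (b : ι → ℕ) (m : ι → M) :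
    dpEval f (∏ j, DividedPowerAlgebra.dp R (b j) (m j)) =
      ∑ c : Fin d → ι with ∀ j, Finset.card {k | c k = j} = b j, ∏ k, f k (m (c k)) := by
  induction d generalizing b with
  | zero =>
    change dpAug _ = _
    rw [map_prod]
    simp only [dpAug_dp, Finset.sum_filter, Finset.univ_eq_empty, Finset.filter_empty,
      Finset.card_empty, Finset.prod_empty, Finset.univ_unique, Finset.sum_singleton]
    by_cases h : ∀ j, 0 = b j
    · rw [if_pos h]
      exact Finset.prod_eq_one fun j _ => if_pos (h j).symm
    · rw [if_neg h]
      push Not at h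
      obtain ⟨j, hj⟩ := h
      exact Finset.prod_eq_zero (Finset.mem_univ j) (if_neg hj.symm)
  | succ d ih =>
    change dpEval (fun k => f k.succ) (contract (f 0) _) = _
    rw [contract_prod_dp, map_sum, Finset.sum_filter, ← (Fin.consEquiv fun _ => ι).sum_comp,
      Fintype.sum_prod_type]
    refine Finset.sum_congr rfl fun j _ => ?_
    -- the first linear form takes one factor out of the `j`-th divided power
    have hc : ∀ (c : Fin d → ι) (i : ι),
        Finset.card {k | (Fin.consEquiv fun _ => ι) (j, c) k = i} =
          (if j = i then 1 else 0) + Finset.card {k | c k = i} := by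
      intro c i
      rw [Finset.card_filter, Finset.card_filter, Fin.sum_univ_succ]
      rfl
    simp only [hc, Fin.prod_univ_succ]
    split_ifs with h
    · rw [map_zero]
      refine (Finset.sum_eq_zero fun c _ => if_neg fun hj => ?_).symm
      have := hj j
      rw [if_pos rfl, h] at this
      omega
    · rw [map_smul, ih, smul_eq_mul, Finset.mul_sum, Finset.sum_filter]
      refine Finset.sum_congr rfl fun c _ => ?_
      refine if_congr (forall_congr' fun i => ?_) rfl rfl
      by_cases hi : i = j
      · subst hi
        rw [if_pos rfl, if_pos rfl]
        omega
      · rw [if_neg hi, if_neg (Ne.symm hi), zero_add]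

end Contraction

/-! ### The norm of a module over a split algebra -/

section SplitNorm

variable {R A : Type u} [CommRing R] [CommRing A] {φ : R →+* A} {d : ℕ}
  (ε : A →+* (Fin d → R)) (hε : Function.Bijective ε) (hφ : ∀ a, ε (φ a) = fun _ => a)

/-- Over a split algebra, the norm is the product of the components. -/
theorem normPoly_split {ε : A →+* (Fin d → R)} (hε : Function.Bijective ε)
    (hφ : ∀ a, ε (φ a) = fun _ => a) {n k : ℕ} (D : DualBasis φ n) (r : Fin k → A) :
    normPoly D r = ∏ i, ∑ t, MvPolynomial.X t * MvPolynomial.C (ε (r t) i) := by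
  classical
  let e : (Fin d → R) ≃+* A := (RingEquiv.ofBijective ε hε).symm
  have he : ∀ a, ε (e a) = a := (RingEquiv.ofBijective ε hε).apply_symm_apply
  -- the matrices of the dual basis with respect to the idempotents; their product in one order is
  -- the identity
  let F : Matrix (Fin n) (Fin d) R := Matrix.of fun i l => D.f i (e (Pi.single l 1))
  let E : Matrix (Fin d) (Fin n) R := Matrix.of fun l j => ε (D.x j) l
  have hF : ∀ i a, D.f i a = ∑ l, F i l * ε a l := by
    intro i a
    have h1 : a = ∑ l, φ (ε a l) * e (Pi.single l 1) := by
      refine hε.1 ?_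
      rw [map_sum]
      funext m
      rw [Finset.sum_apply, Finset.sum_eq_single m]
      · rw [map_mul, hφ, he]; simp
      · intro l _ hl
        rw [map_mul, hφ, he]; simp [Pi.single_eq_of_ne' hl]
      · simp
    conv_lhs => rw [h1, map_sum]
    refine Finset.sum_congr rfl fun l _ => ?_
    rw [D.f_smul, mul_comm]
    rfl
  have hEF : E * F = 1 := by
    refine Matrix.ext fun l m => ?_
    have h1 := congrFun (congrArg ε (D.sum_eq (e (Pi.single m 1)))) l
    rw [he, map_sum, Finset.sum_apply] at h1
    rw [Matrix.mul_apply, Matrix.one_apply]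
    refine Eq.trans (Finset.sum_congr rfl fun i _ => ?_) (h1.trans ?_)
    · rw [map_mul, hφ, Pi.mul_apply, mul_comm]
      rfl
    · rw [Pi.single_apply]
  let Δ : Matrix (Fin d) (Fin d) (MvPolynomial (Fin k) R) :=
    Matrix.diagonal fun i => ∑ t, MvPolynomial.X t * MvPolynomial.C (ε (r t) i)
  let F' : Matrix (Fin n) (Fin d) (MvPolynomial (Fin k) R) := F.map MvPolynomial.C
  let E' : Matrix (Fin d) (Fin n) (MvPolynomial (Fin k) R) := E.map MvPolynomial.C
  -- the matrix of the norm polynomial is `1 + F (Δ - 1) E`, where `E F = 1`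
  have h1 : (Matrix.of fun i j : Fin n =>
      ∑ t, MvPolynomial.X t * MvPolynomial.C (D.f i (r t * D.x j)) +
        MvPolynomial.C ((if i = j then 1 else 0) - D.f i (D.x j))) =
      1 + F' * ((Δ - 1) * E') := by
    refine Matrix.ext fun i j => ?_
    have h2 : (Δ - 1) * E' =
        Matrix.of fun l j => (∑ t, MvPolynomial.X t * MvPolynomial.C (ε (r t) l) - 1) *
          MvPolynomial.C (ε (D.x j) l) := by
      rw [show (1 : Matrix (Fin d) (Fin d) (MvPolynomial (Fin k) R)) =
        Matrix.diagonal fun _ => 1 from Matrix.diagonal_one.symm, Matrix.diagonal_sub]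
      refine Matrix.ext fun l j => ?_
      rw [Matrix.diagonal_mul]
      rfl
    rw [h2, Matrix.add_apply, Matrix.mul_apply, Matrix.of_apply, map_sub, hF i (D.x j)]
    have h3 : (∑ t, MvPolynomial.X t * MvPolynomial.C (D.f i (r t * D.x j)) :
        MvPolynomial (Fin k) R) = ∑ l, MvPolynomial.C (F i l) *
          ((∑ t, MvPolynomial.X t * MvPolynomial.C (ε (r t) l)) *
            MvPolynomial.C (ε (D.x j) l)) := by
      simp only [hF, map_mul, Pi.mul_apply, map_sum, Finset.mul_sum, Finset.sum_mul]
      rw [Finset.sum_comm]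
      refine Finset.sum_congr rfl fun l _ => Finset.sum_congr rfl fun t _ => ?_
      ring
    rw [h3, Matrix.one_apply, apply_ite (MvPolynomial.C (σ := Fin k)), map_one, map_zero]
    simp only [F', Matrix.of_apply, Matrix.map_apply, sub_mul, mul_sub, Finset.sum_sub_distrib,
      one_mul, map_sum, map_mul]
    ring
  have hEF' : E' * F' = 1 := by
    rw [← Matrix.map_one (MvPolynomial.C (σ := Fin k)) (map_zero _) (map_one _), ← hEF,
      Matrix.map_mul]
  -- `det (1 + F B) = det (1 + B F)` removes the dual basis
  rw [normPoly, h1, Matrix.det_one_add_mul_comm, Matrix.mul_assoc, hEF', Matrix.mul_one,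
    add_sub_cancel, Matrix.det_diagonal]

/-- The coefficients of a product of linear forms, as sums over the ways of choosing one variable
from each factor. -/
theorem coeff_prod_sum_X {k : ℕ} (a : Fin k → ℕ) (s : Fin k → Fin d → R) :
    MvPolynomial.coeff (Finsupp.equivFunOnFinite.symm a)
      (∏ i, ∑ t, MvPolynomial.X t * MvPolynomial.C (s t i)) =
      ∑ c : Fin d → Fin k with ∀ t, Finset.card {i | c i = t} = a t, ∏ i, s (c i) i := by
  classical
  rw [Finset.prod_univ_sum, MvPolynomial.coeff_sum, Finset.sum_filter, Fintype.piFinset_univ]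
  refine Finset.sum_congr rfl fun c _ => ?_
  have h1 : (∏ i, MvPolynomial.X (c i) * MvPolynomial.C (s (c i) i) : MvPolynomial (Fin k) R) =
      MvPolynomial.monomial (∑ i, Finsupp.single (c i) 1) (∏ i, s (c i) i) := by
    rw [MvPolynomial.monomial_sum_index]
    rw [Finset.prod_mul_distrib, mul_comm, ← map_prod]
    rfl
  rw [h1, MvPolynomial.coeff_monomial]
  refine if_congr ?_ rfl rfl
  rw [Finsupp.ext_iff]
  refine forall_congr' fun t => ?_
  rw [Finsupp.finsetSum_apply, Finset.card_filter]
  simp [Finsupp.single_apply]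

theorem normCoeff_split {ε : A →+* (Fin d → R)} (hε : Function.Bijective ε)
    (hφ : ∀ a, ε (φ a) = fun _ => a) {n k : ℕ} (D : DualBasis φ n) (r : Fin k → A)
    (a : Fin k → ℕ) : normCoeff D r a =
      ∑ c : Fin d → Fin k with ∀ t, Finset.card {i | c i = t} = a t, ∏ i, ε (r (c i)) i := by
  rw [normCoeff, normPoly_split hε hφ]
  exact coeff_prod_sum_X a fun t i => ε (r t) i

variable {M : Type (u + 1)} [AddCommGroup M] [Module A M]

/-- The functional `dpEval` on `Gam φ M`. -/
def gamEval (f : Fin d → (ModOver φ M →ₗ[R] R)) : Gam φ M →ₗ[R] R :=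
  dpEval f

theorem gamEval_prod (f : Fin d → (ModOver φ M →ₗ[R] R)) {ι : Type} [Fintype ι] [DecidableEq ι]
    (b : ι → ℕ) (m : ι → M) : gamEval f (∏ j, gam φ (b j) (m j)) =
      ∑ c : Fin d → ι with ∀ j, Finset.card {k | c k = j} = b j, ∏ k, f k (m (c k)) :=
  dpEval_prod_dp f b m

theorem gamEval_gamProd (f : Fin d → (ModOver φ M →ₗ[R] R)) {l : ℕ} (b : Fin l → ℕ)
    (m : Fin l → M) : gamEval f (gamProd φ b m) =
      ∑ c : Fin d → Fin l with ∀ j, Finset.card {k | c k = j} = b j, ∏ k, f k (m (c k)) := by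
  refine (gamEval_prod f b m).trans ?_
  congr!

/-- If each linear form is semilinear for one of the `d` components of the algebra, the functional
turns the multiplication by an element of `Γ^d` of the algebra into the multiplication by a
coefficient of its norm. Both sides are sums over maps to pairs of an algebra index and a module
index, counted by their matrices of multiplicities. -/
theorem gamEval_gamAct (f : Fin d → (ModOver φ M →ₗ[R] R)) (e : A → Fin d → R)
    (hf : ∀ k (a : A) (m : M), f k (a • m : M) = e a k * f k m) {k l : ℕ} (a : Fin k → ℕ)
    (r : Fin k → A) (b : Fin l → ℕ) (m : Fin l → M) : gamEval f (gamAct φ d a r b m) =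
      (∑ c : Fin d → Fin k with ∀ t, Finset.card {i | c i = t} = a t, ∏ i, e (r (c i)) i) *
        gamEval f (gamProd φ b m) := by
  classical
  have h1 : ∀ C : Fin k → Fin l → Fin (d + 1),
      gamEval f (∏ i, ∏ j, gam φ (C i j) (r i • m j)) =
        ∑ c : Fin d → Fin k × Fin l with ∀ q, Finset.card {i | c i = q} = (C q.1 q.2 : ℕ),
          ∏ i, f i (r (c i).1 • m (c i).2 : M) := by
    intro C
    rw [← Fintype.prod_prod_type' fun i j => gam φ (C i j) (r i • m j)]
    exact gamEval_prod f (fun q : Fin k × Fin l => (C q.1 q.2 : ℕ)) fun q => r q.1 • m q.2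
  have hs1 : ∀ (c : Fin d → Fin k × Fin l) (i : Fin k),
      ∑ j, Finset.card {t | c t = (i, j)} = Finset.card {t | (c t).1 = i} := by
    intro c i
    simp only [Finset.card_filter]
    rw [Finset.sum_comm]
    refine Finset.sum_congr rfl fun t _ => ?_
    simp [Prod.ext_iff, ite_and]
  have hs2 : ∀ (c : Fin d → Fin k × Fin l) (j : Fin l),
      ∑ i, Finset.card {t | c t = (i, j)} = Finset.card {t | (c t).2 = j} := by
    intro c j
    simp only [Finset.card_filter]
    rw [Finset.sum_comm]
    refine Finset.sum_congr rfl fun t _ => ?_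
    simp [Prod.ext_iff, ite_and]
  -- only the matrix of multiplicities of `c` contributes to the sum over matrices
  have h2 : ∀ c : Fin d → Fin k × Fin l, (∑ C : Fin k → Fin l → Fin (d + 1),
      if (∀ i, ∑ j, (C i j : ℕ) = a i) ∧ ∀ j, ∑ i, (C i j : ℕ) = b j then
        (if ∀ q, Finset.card {i | c i = q} = (C q.1 q.2 : ℕ) then
          ∏ i, f i (r (c i).1 • m (c i).2 : M) else 0) else 0) =
      if (∀ i, Finset.card {t | (c t).1 = i} = a i) ∧ ∀ j, Finset.card {t | (c t).2 = j} = b j then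
        ∏ i, f i (r (c i).1 • m (c i).2 : M) else 0 := by
    intro c
    have hlt : ∀ q, Finset.card {i | c i = q} < d + 1 := fun q =>
      Nat.lt_succ_of_le ((Finset.card_le_univ _).trans (Fintype.card_fin d).le)
    rw [Finset.sum_eq_single fun i j => ⟨Finset.card {t | c t = (i, j)}, hlt _⟩]
    · simp [hs1, hs2]
    · intro C _ hC
      rw [if_neg (c := ∀ q, _), ite_self]
      intro hq
      exact hC (funext fun i => funext fun j => Fin.ext (hq (i, j)).symm)
    · simp
  rw [gamAct, map_sum, Finset.sum_filter]
  simp only [h1, Finset.sum_filter]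
  have h3 : ∀ C : Fin k → Fin l → Fin (d + 1),
      (if (∀ i, ∑ j, (C i j : ℕ) = a i) ∧ ∀ j, ∑ i, (C i j : ℕ) = b j then
        ∑ c : Fin d → Fin k × Fin l, (if ∀ q, Finset.card {i | c i = q} = (C q.1 q.2 : ℕ) then
          ∏ i, f i (r (c i).1 • m (c i).2 : M) else 0) else 0) =
      ∑ c : Fin d → Fin k × Fin l,
        if (∀ i, ∑ j, (C i j : ℕ) = a i) ∧ ∀ j, ∑ i, (C i j : ℕ) = b j then
        (if ∀ q, Finset.card {i | c i = q} = (C q.1 q.2 : ℕ) then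
          ∏ i, f i (r (c i).1 • m (c i).2 : M) else 0) else 0 := fun C => by
    split_ifs
    · rfl
    · simp
  simp only [h3]
  rw [Finset.sum_comm]
  simp only [h2]
  rw [gamEval_gamProd, Finset.sum_filter, Finset.sum_mul_sum, ← Finset.sum_product',
    Finset.univ_product_univ]
  refine Fintype.sum_equiv (Equiv.arrowProdEquivProdArrow _ _ _) _ _ fun c => ?_
  change _ = (if ∀ t, Finset.card {i | (c i).1 = t} = a t then ∏ i, e (r (c i).1) i else 0) *
    (if ∀ j, Finset.card {i | (c i).2 = j} = b j then ∏ i, f i (m (c i).2) else 0)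
  rw [ite_zero_mul_ite_zero]
  refine if_congr Iff.rfl ?_ rfl
  rw [← Finset.prod_mul_distrib]
  exact Finset.prod_congr rfl fun i _ => hf i _ _

end SplitNorm

/-! ### Base change of modules and of multilinear maps -/

section Multilinear

variable {R S : Type*} [CommRing R] [CommRing S] [Algebra R S] {M N Q : Type*}
  [AddCommGroup M] [Module R M] [AddCommGroup N] [Module R N] [Module S N] [IsScalarTower R S N]
  [AddCommGroup Q] [Module R Q] [Module S Q] [IsScalarTower R S Q] {g : M →ₗ[R] N}

theorem multilinear_ext_of_span {X : Type*} {g : X → N}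
    (hg : Submodule.span S (Set.range g) = ⊤) {d : ℕ}
    {T T' : MultilinearMap S (fun _ : Fin d => N) Q}
    (h : ∀ m : Fin d → X, T (fun i => g (m i)) = T' fun i => g (m i)) : T = T' := by
  induction d with
  | zero =>
    ext x
    have := h Fin.elim0
    rwa [Subsingleton.elim (fun i => g (Fin.elim0 i)) x] at this
  | succ d ih =>
    have : T.curryLeft = T'.curryLeft := by
      refine LinearMap.ext_on_range hg fun m => ih fun v => ?_
      rw [MultilinearMap.curryLeft_apply, MultilinearMap.curryLeft_apply]
      convert h (Fin.cons m v) using 2 <;>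
      · funext i
        refine Fin.cases ?_ (fun i => ?_) i <;> simp
    ext x
    rw [← Fin.cons_self_tail x]
    exact congrArg (fun L : N →ₗ[S] MultilinearMap S (fun _ : Fin d => N) Q => L (x 0) (Fin.tail x))
      this

theorem span_range_of_isBaseChange (hg : IsBaseChange S g) :
    Submodule.span S (Set.range g) = ⊤ :=
  Submodule.eq_top_iff'.2 fun x => hg.inductionOn x (· ∈ Submodule.span S (Set.range g))
    (zero_mem _) (fun m => Submodule.subset_span ⟨m, rfl⟩)
    (fun s _ h => Submodule.smul_mem _ s h) fun _ _ h h' => add_mem h h'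

theorem isBaseChange_of_lift (hs : Submodule.span S (Set.range g) = ⊤)
    (h : ∃ F : N →ₗ[S] TensorProduct R S M, ∀ n, F (g n) = TensorProduct.tmul R 1 n) :
    IsBaseChange S g := by
  obtain ⟨F, hF⟩ := h
  have hb := TensorProduct.isBaseChange R M S
  have h1 : ∀ m, hb.lift g (TensorProduct.tmul R 1 m) = g m := hb.lift_eq g
  refine IsBaseChange.of_equiv (LinearEquiv.ofLinearMap (hb.lift g) F
    (LinearMap.ext_on_range hs fun m => ?_) (hb.algHom_ext _ _ fun m => ?_)) h1
  · rw [LinearMap.comp_apply, hF, h1]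
    rfl
  · change F (hb.lift g (TensorProduct.tmul R 1 m)) = TensorProduct.tmul R 1 m
    rw [h1, hF]

/-- Multilinear maps extend along a base change of modules, one argument at a time. -/
theorem exists_multilinear_extension (hg : IsBaseChange S g) {d : ℕ}
    (P : MultilinearMap R (fun _ : Fin d => M) Q) :
    ∃ T : MultilinearMap S (fun _ : Fin d => N) Q, ∀ m, T (fun i => g (m i)) = P m := by
  have hs : Submodule.span S (Set.range g) = ⊤ := span_range_of_isBaseChange hg
  induction d with
  | zero =>
    refine ⟨MultilinearMap.constOfIsEmpty S _ (P Fin.elim0), fun m => ?_⟩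
    rw [Subsingleton.elim m Fin.elim0]
    rfl
  | succ d ih =>
    choose T hT using fun m => ih (P.curryLeft m)
    let L : M →ₗ[R] MultilinearMap S (fun _ : Fin d => N) Q :=
      { toFun := T
        map_add' := fun x y => multilinear_ext_of_span hs fun m => by
          rw [add_apply, hT, hT, hT, map_add, add_apply]
        map_smul' := fun r x => multilinear_ext_of_span hs fun m => by
          rw [RingHom.id_apply, smul_apply, hT, hT, map_smul,
            smul_apply] }
    have : IsScalarTower R S (MultilinearMap S (fun _ : Fin d => N) Q) :=
      ⟨fun r s T => MultilinearMap.ext fun v => smul_assoc r s (T v)⟩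
    refine ⟨(hg.lift L).uncurryLeft, fun m => ?_⟩
    rw [LinearMap.uncurryLeft_apply, hg.lift_eq]
    exact (hT _ _).trans (by
      rw [MultilinearMap.curryLeft_apply]
      exact congrArg P (Fin.cons_self_tail m))

end Multilinear

section IsBC

variable {R S : Type*} [CommRing R] [CommRing S] {ρ : R →+* S} {N N' : Type*} [AddCommGroup N]
  [Module R N] [AddCommGroup N'] [Module S N']

/-- A semilinear map, as a linear map to the module with restricted scalars. -/
def restrictLin {R S : Type*} [CommRing R] [CommRing S] {ρ : R →+* S} {N N' : Type*}
    [AddCommGroup N] [Module R N] [AddCommGroup N'] [Module S N'] (g : N →ₛₗ[ρ] N') :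
    letI := Module.compHom N' ρ
    N →ₗ[R] N' :=
  letI := Module.compHom N' ρ
  { toFun := g
    map_add' := map_add g
    map_smul' := g.map_smulₛₗ }

/-- The semilinear map `g` over `ρ : R → S` is a base change: it identifies its target with
`S ⊗[R] N`. -/
def IsBC (ρ : R →+* S) (g : N →ₛₗ[ρ] N') : Prop :=
  letI := ρ.toAlgebra
  letI := Module.compHom N' ρ
  haveI : IsScalarTower R S N' := ⟨fun r s x => mul_smul (ρ r) s x⟩
  IsBaseChange S (restrictLin g)

theorem IsBC.span_range {g : N →ₛₗ[ρ] N'} (h : IsBC ρ g) :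
    Submodule.span S (Set.range g) = ⊤ := by
  let := ρ.toAlgebra
  let := Module.compHom N' ρ
  have : IsScalarTower R S N' := ⟨fun r s x => mul_smul (ρ r) s x⟩
  exact span_range_of_isBaseChange (g := restrictLin g) h

theorem IsBC.ext {g : N →ₛₗ[ρ] N'} (h : IsBC ρ g) {Q : Type*} [AddCommGroup Q] [Module S Q]
    {F F' : N' →ₗ[S] Q} (hF : ∀ n, F (g n) = F' (g n)) : F = F' :=
  LinearMap.ext_on_range h.span_range hF

theorem IsBC.exists_lift {g : N →ₛₗ[ρ] N'} (h : IsBC ρ g) {Q : Type*} [AddCommGroup Q] [Module S Q]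
    (f : N →ₛₗ[ρ] Q) : ∃ F : N' →ₗ[S] Q, ∀ n, F (g n) = f n := by
  let := ρ.toAlgebra
  let := Module.compHom N' ρ
  have : IsScalarTower R S N' := ⟨fun r s x => mul_smul (ρ r) s x⟩
  let := Module.compHom Q ρ
  have : IsScalarTower R S Q := ⟨fun r s x => mul_smul (ρ r) s x⟩
  exact ⟨IsBaseChange.lift (f := restrictLin g) h (restrictLin f),
    fun n => IsBaseChange.lift_eq (f := restrictLin g) h (restrictLin f) n⟩

/-- A semilinear map is a base change if it spans its target, and if the universal semilinear map
factors through it. -/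
theorem IsBC.of_lift {g : N →ₛₗ[ρ] N'} (hs : Submodule.span S (Set.range g) = ⊤)
    (h : letI := ρ.toAlgebra
      ∃ F : N' →ₗ[S] TensorProduct R S N, ∀ n, F (g n) = TensorProduct.tmul R 1 n) :
    IsBC ρ g := by
  let := ρ.toAlgebra
  let := Module.compHom N' ρ
  have : IsScalarTower R S N' := ⟨fun r s x => mul_smul (ρ r) s x⟩
  exact isBaseChange_of_lift (g := restrictLin g) hs h

end IsBC

/-! ### The norm over an algebra which becomes split -/

section NormSplit

/-- A splitting of an algebra `φ : R → A` and of an `A`-module `M`: isomorphisms of `A` with `R ^ d`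
and of `M` with the module `(R ^ ι) ^ d` over `R ^ d`. -/
structure NormSplit {R A : Type u} [CommRing R] [CommRing A] (φ : R →+* A) (d : ℕ) (ι : Type)
    (M : Type (u + 1)) [AddCommGroup M] [Module A M] where
  /-- the isomorphism of algebras -/
  ε : A →+* (Fin d → R)
  ε_bij : Function.Bijective ε
  ε_φ (a : R) : ε (φ a) = fun _ => a
  /-- the isomorphism of modules -/
  μ : M →+ (Fin d → ι → R)
  μ_bij : Function.Bijective μ
  μ_smul (a : A) (m : M) (k : Fin d) (i : ι) : μ (a • m) k i = ε a k * μ m k i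

namespace NormSplit

variable {R A : Type u} [CommRing R] [CommRing A] {φ : R →+* A} {d : ℕ} {ι : Type}
  {M : Type (u + 1)} [AddCommGroup M] [Module A M] (s : NormSplit φ d ι M)

/-- The linear form on `M` given by the coordinate with index `(k, K k)`. -/
def form (K : Fin d → ι) (k : Fin d) : ModOver φ M →ₗ[R] R where
  toFun m := s.μ (show M from m) k (K k)
  map_add' m n := by
    change s.μ ((show M from m) + (show M from n)) k (K k) = _
    rw [map_add]
    rfl
  map_smul' r m := by
    change s.μ (φ r • (show M from m)) k (K k) = _
    rw [s.μ_smul, s.ε_φ]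
    rfl

theorem form_smul (K : Fin d → ι) (k : Fin d) (a : A) (m : M) :
    s.form K k (a • m : M) = s.ε a k * s.form K k m := s.μ_smul a m k (K k)

/-- The map from the norm of `M` to the tensor product of the `d` components of `M`. -/
def normEval : NormMod φ d M →ₗ[R] ((Fin d → ι) → R) :=
  Submodule.liftQ _ ((LinearMap.pi fun K => gamEval (s.form K)).comp (gamDeg φ d M).subtype) (by
    intro z hz
    have : normRel φ d M ≤ LinearMap.ker (LinearMap.pi fun K => gamEval (s.form K)) := by
      refine Submodule.span_le.2 ?_
      rintro _ ⟨n, k, l, D, a, r, b, m, -, -, rfl⟩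
      refine LinearMap.mem_ker.2 (funext fun K => ?_)
      change gamEval (s.form K) _ = 0
      rw [map_sub, map_smul, gamEval_gamAct _ s.ε (s.form_smul K),
        normCoeff_split s.ε_bij s.ε_φ, smul_eq_mul, sub_self]
    exact this hz)

/-- The class in the norm of the product `∏ j, γ_{b j}(m j)`. -/
def _root_.SegreNorm.normProd (φ : R →+* A) {d l : ℕ} (b : Fin l → ℕ) (hb : ∑ j, b j = d)
    (m : Fin l → M) : NormMod φ d M :=
  Submodule.Quotient.mk ⟨gamProd φ b m, Submodule.subset_span ⟨l, b, m, hb, rfl⟩⟩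

theorem normEval_normProd {l : ℕ} (b : Fin l → ℕ) (hb : ∑ j, b j = d) (m : Fin l → M)
    (K : Fin d → ι) : s.normEval (normProd φ b hb m) K =
      ∑ c : Fin d → Fin l with ∀ j, Finset.card {k | c k = j} = b j, ∏ k, s.μ (m (c k)) k (K k) :=
  gamEval_gamProd (s.form K) b m

theorem normEval_normMk (m : M) (K : Fin d → ι) :
    s.normEval (normMk φ d m) K = ∏ k, s.μ m k (K k) := by
  have h1 : normMk φ d m = normProd φ (l := 1) (fun _ => d) (by simp) fun _ => m :=
    congrArg Submodule.Quotient.mk (Subtype.ext (by simp [gamProd]))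
  rw [h1, normEval_normProd, Finset.sum_filter, Fintype.sum_unique, if_pos]
  intro j
  have : ({k | (default : Fin d → Fin 1) k = j} : Finset (Fin d)) = Finset.univ :=
    Finset.filter_true_of_mem fun k _ => Subsingleton.elim _ _
  rw [this, Finset.card_univ, Fintype.card_fin]

theorem _root_.SegreNorm.span_normProd : Submodule.span R
    {z : NormMod φ d M | ∃ (l : ℕ) (b : Fin l → ℕ) (hb : ∑ j, b j = d) (m : Fin l → M),
      z = normProd φ b hb m} = ⊤ := by
  rw [Submodule.eq_top_iff']
  intro z
  obtain ⟨⟨x, hx⟩, rfl⟩ := Submodule.Quotient.mk_surjective _ z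
  unfold gamDeg at hx
  induction hx using Submodule.span_induction with
  | mem x h =>
    obtain ⟨l, b, m, hb, rfl⟩ := h
    exact Submodule.subset_span ⟨l, b, hb, m, rfl⟩
  | zero => exact zero_mem (Submodule.span R _)
  | add x y hx hy h h' => exact add_mem h h'
  | smul r x hx h => exact Submodule.smul_mem _ r h

end NormSplit

/-- Functions all of whose fibres have one element are permutations. -/
theorem sum_fibres_one {R : Type*} [CommSemiring R] {d : ℕ} (F : Fin d → Fin d → R) :
    ∑ c : Fin d → Fin d with ∀ j, Finset.card {k | c k = j} = 1, ∏ k, F k (c k) =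
      ∑ σ : Equiv.Perm (Fin d), ∏ i, F (σ i) i := by
  have h : ∀ c : Fin d → Fin d, (∀ j, Finset.card {k | c k = j} = 1) →
      Function.Bijective c := fun c hc => by
    refine (Finite.injective_iff_bijective).1 fun a b hab => ?_
    obtain ⟨x, hx⟩ := Finset.card_eq_one.1 (hc (c b))
    have ha : a ∈ ({k | c k = c b} : Finset (Fin d)) := by simp [hab]
    have hb : b ∈ ({k | c k = c b} : Finset (Fin d)) := by simp
    rw [hx, Finset.mem_singleton] at ha hb
    rw [ha, hb]
  symm
  refine Finset.sum_bij (fun σ _ => (⇑σ⁻¹ : Fin d → Fin d)) (fun σ _ => ?_) (fun σ _ τ _ hst => ?_)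
    (fun c hc => ?_) (fun σ _ => ?_)
  · refine Finset.mem_filter.2 ⟨Finset.mem_univ _, fun j => Finset.card_eq_one.2 ⟨σ j, ?_⟩⟩
    ext k
    simp [Equiv.symm_apply_eq]
  · exact inv_injective (DFunLike.coe_injective hst)
  · refine ⟨(Equiv.ofBijective c (h c (Finset.mem_filter.1 hc).2))⁻¹, Finset.mem_univ _, ?_⟩
    rw [inv_inv]
    rfl
  · refine (Fintype.prod_equiv σ _ _ fun i => ?_)
    exact congrArg (F (σ i)) (Equiv.symm_apply_apply σ i).symm

/-- The polarization of the product of the linear forms `f k`. -/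
def permMulti {S N : Type*} [CommRing S] [AddCommGroup N] [Module S N] {d : ℕ}
    (f : Fin d → (N →ₗ[S] S)) : MultilinearMap S (fun _ : Fin d => N) S :=
  ∑ σ : Equiv.Perm (Fin d), (MultilinearMap.mkPiAlgebra S (Fin d) S).compLinearMap fun i => f (σ i)

theorem permMulti_apply {S N : Type*} [CommRing S] [AddCommGroup N] [Module S N] {d : ℕ}
    (f : Fin d → (N →ₗ[S] S)) (n : Fin d → N) :
    permMulti f n = ∑ σ : Equiv.Perm (Fin d), ∏ i, f (σ i) (n i) := by
  simp [permMulti]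

theorem permMulti_of_eq_zero {S N : Type*} [CommRing S] [AddCommGroup N] [Module S N] {d : ℕ}
    (f : Fin d → (N →ₗ[S] S)) (n : Fin d → N) (h : ∀ i j, i ≠ j → f i (n j) = 0) :
    permMulti f n = ∏ i, f i (n i) := by
  rw [permMulti_apply, Finset.sum_eq_single 1]
  · rfl
  · intro σ _ hσ
    obtain ⟨i, hi⟩ : ∃ i, σ i ≠ i := by
      by_contra hc
      push Not at hc
      exact hσ (Equiv.ext hc)
    exact Finset.prod_eq_zero (Finset.mem_univ i) (h _ _ hi)
  · simp

variable {R A : Type u} [CommRing R] [CommRing A] {φ : R →+* A} {d : ℕ}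
  {M : Type (u + 1)} [AddCommGroup M] [Module A M]

/-- The product of `d` elements as an element of the norm. -/
def normMulti (φ : R →+* A) (d : ℕ) (M : Type (u + 1)) [AddCommGroup M] [Module A M] :
    MultilinearMap R (fun _ : Fin d => ModOver φ M) (NormMod φ d M) :=
  have key : ∀ (m : Fin d → ModOver φ M),
      (∏ i, DividedPowerAlgebra.embed R (ModOver φ M) (m i) : Gam φ M) ∈ gamDeg φ d M := fun m =>
    Submodule.subset_span ⟨d, fun _ => 1, m, by simp, rfl⟩
  let P : MultilinearMap R (fun _ : Fin d => ModOver φ M) (Gam φ M) :=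
    (MultilinearMap.mkPiAlgebra R (Fin d) (Gam φ M)).compLinearMap fun _ =>
      (DividedPowerAlgebra.embed R (ModOver φ M))
  (Submodule.mkQ _).compMultilinearMap (P.codRestrict (gamDeg φ d M) key)

theorem normEval_normMulti {ι : Type} (s : NormSplit φ d ι M) (m : Fin d → M) (K : Fin d → ι) :
    s.normEval (normMulti φ d M m) K = permMulti (s.form K) m := by
  refine (s.normEval_normProd (fun _ => 1) (by simp) m K).trans (Eq.trans ?_ (permMulti_apply (s.form K) m).symm)
  exact sum_fibres_one fun k j => s.μ (m j) k (K k)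

theorem exists_eq_ite_of_sum_eq_one {l : ℕ} {x : Fin l → ℕ} (h : ∑ j, x j = 1) :
    ∃ j, ∀ j', x j' = if j = j' then 1 else 0 := by
  obtain ⟨j, -, hj⟩ := Finset.exists_ne_zero_of_sum_ne_zero (h.trans_ne one_ne_zero)
  refine ⟨j, fun j' => ?_⟩
  have h1 := Finset.add_sum_erase Finset.univ x (Finset.mem_univ j)
  split_ifs with hjj
  · subst hjj
    omega
  · have h2 := Finset.single_le_sum (fun i _ => Nat.zero_le (x i))
      (Finset.mem_erase.2 ⟨Ne.symm hjj, Finset.mem_univ j'⟩)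
    omega

/-- The multiplication by a product of `d` elements `γ_1` of the algebra: matrices with all row
sums equal to one are the graphs of maps. -/
theorem gamAct_one (r : Fin d → A) {l : ℕ} (b : Fin l → ℕ) (m : Fin l → M) :
    gamAct φ d (fun _ => 1) r b m =
      ∑ c : Fin d → Fin l with ∀ j, Finset.card {k | c k = j} = b j,
        ∏ i, gam φ 1 (r i • m (c i)) := by
  symm
  have hlt : ∀ (c : Fin d → Fin l) (i : Fin d) (j : Fin l),
      (if c i = j then 1 else 0) < d + 1 := fun c i j => by
    have := i.pos
    split_ifs <;> omega
  refine Finset.sum_bij (fun c _ i j => ⟨if c i = j then 1 else 0, hlt c i j⟩) (fun c hc => ?_)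
    (fun c _ c' _ h => ?_) (fun C hC => ?_) fun c _ => ?_
  · refine Finset.mem_filter.2 ⟨Finset.mem_univ _, fun i => ?_, fun j => ?_⟩
    · simp
    · rw [← (Finset.mem_filter.1 hc).2 j, Finset.card_filter]
  · funext i
    have := congrArg Fin.val (congrFun (congrFun h i) (c i))
    simp only [if_true] at this
    by_contra hne
    rw [if_neg (Ne.symm hne)] at this
    exact one_ne_zero this
  · obtain ⟨-, h1, h2⟩ := Finset.mem_filter.1 hC
    choose c hc using fun i => exists_eq_ite_of_sum_eq_one (h1 i)
    refine ⟨c, Finset.mem_filter.2 ⟨Finset.mem_univ _, fun j => ?_⟩, ?_⟩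
    · rw [← h2 j, Finset.card_filter]
      exact Finset.sum_congr rfl fun i _ => (hc i j).symm
    · exact funext fun i => funext fun j => Fin.ext (hc i j).symm
  · refine Finset.prod_congr rfl fun i _ => ?_
    rw [Finset.prod_eq_single (c i)]
    · simp
    · intro j _ hj
      dsimp only
      rw [if_neg (Ne.symm hj)]
      exact DividedPowerAlgebra.dp_zero (R := R) (M := ModOver φ M)
    · simp

/-- The relations of the norm given by a product of `d` elements of the algebra. -/
theorem normMulti_smul {n : ℕ} (D : DualBasis φ n) (r : Fin d → A) {l : ℕ} (b : Fin l → ℕ)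
    (hb : ∑ j, b j = d) (m : Fin l → M) :
    ∑ c : Fin d → Fin l with ∀ j, Finset.card {k | c k = j} = b j,
      normMulti φ d M (fun i => (r i • m (c i) : M)) =
        normCoeff D r (fun _ => 1) • normProd φ b hb m := by
  let z (c : Fin d → Fin l) : gamDeg φ d M := ⟨gamProd φ (fun _ => 1) fun i => r i • m (c i),
    Submodule.subset_span ⟨d, fun _ => 1, _, by simp, rfl⟩⟩
  have h1 : ∑ c : Fin d → Fin l with ∀ j, Finset.card {k | c k = j} = b j,
      normMulti φ d M (fun i => (r i • m (c i) : M)) =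
      Submodule.mkQ ((normRel φ d M).comap (gamDeg φ d M).subtype)
        (∑ c : Fin d → Fin l with ∀ j, Finset.card {k | c k = j} = b j, z c) := by
    rw [map_sum]
    rfl
  rw [h1]
  refine (Submodule.Quotient.eq _).2 (Submodule.subset_span
    ⟨n, d, l, D, fun _ => 1, r, b, m, by simp, hb, ?_⟩)
  rw [gamAct_one]
  change (gamDeg φ d M).subtype (∑ c : Fin d → Fin l with _, z c) - _ = _
  rw [map_sum]
  rfl

variable {S B : Type u} [CommRing S] [CommRing B] {ψ : S →+* B} {N : Type (u + 1)}
  [AddCommGroup N] [Module B N] {ρ : R →+* S} {τ : A →+* B}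

/-- A semilinear map over a homomorphism of algebras, regarded as semilinear over the base
rings. -/
def modOverMap (comm : τ.comp φ = ψ.comp ρ) (g : M →ₛₗ[τ] N) :
    ModOver φ M →ₛₗ[ρ] ModOver ψ N where
  toFun m := g m
  map_add' := map_add g
  map_smul' r m := (g.map_smulₛₗ (φ r) m).trans
    (congrArg (fun b : B => (b • g m : N)) (RingHom.congr_fun comm r))

theorem normMap_normProd (comm : τ.comp φ = ψ.comp ρ) (g : M →ₛₗ[τ] N)
    (hD : ∀ (n : ℕ) (D : DualBasis φ n), ∃ D' : DualBasis ψ n, (∀ j, D'.x j = τ (D.x j)) ∧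
      ∀ j a, D'.f j (τ a) = ρ (D.f j a)) {l : ℕ} (b : Fin l → ℕ) (hb : ∑ j, b j = d)
    (m : Fin l → M) :
    normMap d comm g hD (normProd φ b hb m) = normProd ψ b hb fun j => g (m j) := by
  refine (Submodule.mapQ_apply _ _ _ _).trans ?_
  exact congrArg Submodule.Quotient.mk (Subtype.ext (gamMap_gamProd comm g b m))

end NormSplit

section NormBaseChange

variable {R A S B : Type u} [CommRing R] [CommRing A] [CommRing S] [CommRing B] {φ : R →+* A}
  {ψ : S →+* B} {ρ : R →+* S} {τ : A →+* B} {d : ℕ} {ι : Type} [Fintype ι]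
  {M : Type (u + 1)} [AddCommGroup M] [Module A M] {N : Type (u + 1)} [AddCommGroup N] [Module B N]
  (comm : τ.comp φ = ψ.comp ρ) (g : M →ₛₗ[τ] N)
  (hD : ∀ (n : ℕ) (D : DualBasis φ n), ∃ D' : DualBasis ψ n, (∀ j, D'.x j = τ (D.x j)) ∧
      ∀ j a, D'.f j (τ a) = ρ (D.f j a))

/-- The basis of `N` given by a splitting. -/
def NormSplit.basis (s : NormSplit ψ d ι N) (k : Fin d) (i : ι) : N :=
  haveI := Classical.decEq ι
  (Equiv.ofBijective s.μ s.μ_bij).symm (Pi.single k (Pi.single i 1))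

theorem NormSplit.μ_basis [DecidableEq ι] (s : NormSplit ψ d ι N) (k : Fin d) (i : ι) :
    s.μ (s.basis k i) = Pi.single k (Pi.single i 1) := by
  refine ((Equiv.ofBijective s.μ s.μ_bij).apply_symm_apply _).trans ?_
  congr!

/-- The idempotents of `B` given by a splitting. -/
def NormSplit.idem (s : NormSplit ψ d ι N) (k : Fin d) : B :=
  (Equiv.ofBijective s.ε s.ε_bij).symm (Pi.single k 1)

theorem NormSplit.ε_idem (s : NormSplit ψ d ι N) (k : Fin d) : s.ε (s.idem k) = Pi.single k 1 :=
  (Equiv.ofBijective s.ε s.ε_bij).apply_symm_apply _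

theorem NormSplit.idem_smul (s : NormSplit ψ d ι N) (k : Fin d) (n : N) :
    s.idem k • n = ∑ i, ψ (s.μ n k i) • s.basis k i := by
  classical
  refine s.μ_bij.1 (funext fun l => funext fun j => ?_)
  rw [s.μ_smul, s.ε_idem, map_sum, Finset.sum_apply, Finset.sum_apply]
  simp only [s.μ_smul, s.ε_φ, s.μ_basis]
  by_cases h : k = l
  · subst h
    simp [Pi.single_apply]
  · simp [Pi.single_eq_of_ne' h]

/-- A semilinear map on the norm of a module which becomes split is determined by its values on
products, because a product of divided powers is a sum of products of `d` elements, after the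
multiplication by the product of the idempotents of the splitting. -/
theorem exists_multilinear_norm (s : NormSplit ψ d ι N) {n : ℕ} (D : DualBasis φ n)
    (hτ : letI := ψ.toAlgebra; Submodule.span S (Set.range τ) = ⊤)
    (hg : IsBC ρ (modOverMap comm g)) {Q : Type*} [AddCommGroup Q] [Module S Q]
    (f : NormMod φ d M →ₛₗ[ρ] Q) :
    ∃ T : MultilinearMap S (fun _ : Fin d => ModOver ψ N) Q,
      (∀ m : Fin d → M, T (fun i => g (m i)) = f (normMulti φ d M m)) ∧
      ∀ z, f z = ∑ K : Fin d → ι, s.normEval (normMap d comm g hD z) K •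
        T fun i => s.basis i (K i) := by
  classical
  obtain ⟨T, hT⟩ : ∃ T : MultilinearMap S (fun _ : Fin d => ModOver ψ N) Q,
      ∀ m : Fin d → M, T (fun i => g (m i)) = f (normMulti φ d M m) := by
    let := ρ.toAlgebra
    let := Module.compHom (ModOver ψ N) ρ
    have : IsScalarTower R S (ModOver ψ N) := ⟨fun r s x => mul_smul (ρ r) s x⟩
    let := Module.compHom Q ρ
    have : IsScalarTower R S Q := ⟨fun r s x => mul_smul (ρ r) s x⟩
    exact exists_multilinear_extension (g := restrictLin (modOverMap comm g)) hg
      ((restrictLin f).compMultilinearMap (normMulti φ d M))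
  refine ⟨T, hT, fun z => ?_⟩
  have hz : z ∈ (⊤ : Submodule R (NormMod φ d M)) := trivial
  rw [← span_normProd] at hz
  induction hz using Submodule.span_induction with
  | zero => simp
  | add x y _ _ h h' => simp only [map_add, h, h', Pi.add_apply, add_smul, Finset.sum_add_distrib]
  | smul r x _ h =>
    simp only [map_smulₛₗ, h, Finset.smul_sum, smul_smul, RingHom.id_apply, Pi.smul_apply,
      smul_eq_mul]
  | mem z hz =>
    obtain ⟨l, b, hb, m, rfl⟩ := hz
    -- both sides of the relation, as multilinear functions of the elements of the algebra
    have h1 : f (normProd φ b hb m) =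
        ∑ c : Fin d → Fin l with ∀ j, Finset.card {k | c k = j} = b j,
          T fun i => s.idem i • g (m (c i)) := by
      let := ψ.toAlgebra
      let E (k : Fin d) : B →ₗ[S] S :=
        { toFun := fun y => s.ε y k
          map_add' := fun x y => congrFun (map_add s.ε x y) k
          map_smul' := fun a y => by
            change s.ε (ψ a * y) k = _
            rw [map_mul, s.ε_φ]
            rfl }
      let V (n : N) : B →ₗ[S] ModOver ψ N :=
        { toFun := fun y => (y • n : N)
          map_add' := fun x y => add_smul x y n
          map_smul' := fun a y => mul_smul (ψ a) y n }
      let X : MultilinearMap S (fun _ : Fin d => B) Q :=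
        ∑ c : Fin d → Fin l with ∀ j, Finset.card {k | c k = j} = b j,
          T.compLinearMap fun i => V (g (m (c i)))
      let Y : MultilinearMap S (fun _ : Fin d => B) Q :=
        ((LinearMap.id : S →ₗ[S] S).smulRight (f (normProd φ b hb m))).compMultilinearMap
          (permMulti E)
      have hX : ∀ y : Fin d → B, X y =
          ∑ c : Fin d → Fin l with ∀ j, Finset.card {k | c k = j} = b j,
            T fun i => y i • g (m (c i)) := fun y => by
        simp only [X, sum_apply]
        rfl
      have hXY : X = Y := by
        refine multilinear_ext_of_span hτ fun r => ?_
        obtain ⟨D', h⟩ := hD n D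
        have h2 := congrArg f (normMulti_smul D r b hb m)
        rw [map_smulₛₗ, map_sum, ← normCoeff_baseChange D D' h.1 h.2,
          normCoeff_split s.ε_bij s.ε_φ, sum_fibres_one fun k j => s.ε (τ (r j)) k] at h2
        rw [hX]
        refine Eq.trans (Finset.sum_congr rfl fun c _ => ?_) (h2.trans ?_)
        · rw [← hT]
          exact congrArg T (funext fun i => (g.map_smulₛₗ _ _).symm)
        · exact congrArg (fun a : S => a • f (normProd φ b hb m)) (permMulti_apply E _).symm
      have h3 := hX s.idem
      rw [← h3, hXY]
      change _ = permMulti E s.idem • f (normProd φ b hb m)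
      rw [permMulti_of_eq_zero]
      · have : ∀ i, E i (s.idem i) = 1 := fun i =>
          (congrFun (s.ε_idem i) i).trans (Pi.single_eq_same i 1)
        simp [this]
      · intro i j hij
        exact (congrFun (s.ε_idem j) i).trans (Pi.single_eq_of_ne hij 1)
    have h2 : ∀ c : Fin d → Fin l, (T fun i => s.idem i • g (m (c i))) =
        ∑ K : Fin d → ι, (∏ i, s.μ (g (m (c i))) i (K i)) • T fun i => s.basis i (K i) := by
      intro c
      have : (fun i => s.idem i • g (m (c i)) : Fin d → N) =
          fun i => ∑ t, ψ (s.μ (g (m (c i))) i t) • s.basis i t :=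
        funext fun i => s.idem_smul i _
      rw [this]
      refine (T.map_sum _).trans (Finset.sum_congr rfl fun K _ => ?_)
      exact T.map_smul_univ (fun i => s.μ (g (m (c i))) i (K i)) fun i => s.basis i (K i)
    rw [h1]
    simp only [h2, normMap_normProd, s.normEval_normProd]
    rw [Finset.sum_comm]
    simp only [Finset.sum_smul]

/-- The norm of a module which becomes split after a base change becomes the tensor product of the
components. -/
theorem isBC_normEval (s : NormSplit ψ d ι N) {n : ℕ} (D : DualBasis φ n)
    (hτ : letI := ψ.toAlgebra; Submodule.span S (Set.range τ) = ⊤)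
    (hg : IsBC ρ (modOverMap comm g)) :
    IsBC ρ (s.normEval.comp (normMap d comm g hD)) := by
  classical
  refine IsBC.of_lift ?_ ?_
  -- the image spans, since it contains the tensor products of basis vectors
  · let Q := Submodule.span S (Set.range (s.normEval.comp (normMap d comm g hD)))
    let f : NormMod φ d M →ₛₗ[ρ] Q :=
      { toFun := fun z => ⟨s.normEval.comp (normMap d comm g hD) z, Submodule.subset_span ⟨z, rfl⟩⟩
        map_add' := fun x y => Subtype.ext (map_add _ x y)
        map_smul' := fun r x => Subtype.ext (map_smulₛₗ _ r x) }
    obtain ⟨T, hT, -⟩ := exists_multilinear_norm comm g hD s D hτ hg f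
    let H : MultilinearMap S (fun _ : Fin d => ModOver ψ N) ((Fin d → ι) → S) :=
      MultilinearMap.pi fun K => permMulti (s.form K)
    have hTH : Q.subtype.compMultilinearMap T = H := by
      refine multilinear_ext_of_span hg.span_range fun m => ?_
      refine (congrArg Subtype.val (hT m)).trans (funext fun K => ?_)
      change s.normEval (normMap d comm g hD (normMulti φ d M m)) K = permMulti (s.form K) _
      refine (congrArg (fun z => s.normEval z K) (normMap_normProd comm g hD _ (by simp) m)).trans ?_
      exact normEval_normMulti s (fun i => g (m i)) K
    -- vectors supported at distinct components: of all permutations only one contributes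
    have hH : ∀ K : Fin d → ι, H (fun i => s.basis i (K i)) = Pi.single K 1 := by
      intro K
      funext K'
      change permMulti (s.form K') _ = _
      refine (permMulti_of_eq_zero (s.form K') (fun i => s.basis i (K i)) fun i j hij => ?_).trans ?_
      · change s.μ (s.basis j (K j)) i (K' i) = 0
        rw [s.μ_basis, Pi.single_eq_of_ne hij]
        rfl
      · have : ∀ i, s.form K' i (s.basis i (K i)) = if K' i = K i then 1 else 0 := fun i => by
          change s.μ (s.basis i (K i)) i (K' i) = _
          rw [s.μ_basis, Pi.single_eq_same, Pi.single_apply]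
        rw [Finset.prod_congr rfl fun i _ => this i, Pi.single_apply]
        split_ifs with h
        · subst h; simp
        · obtain ⟨i, hi⟩ := Function.ne_iff.1 h
          exact Finset.prod_eq_zero (Finset.mem_univ i) (if_neg hi)
    rw [Submodule.eq_top_iff']
    intro x
    rw [← Finset.univ_sum_single x]
    refine Submodule.sum_mem _ fun K _ => ?_
    have : (Pi.single K (x K) : (Fin d → ι) → S) = x K • Pi.single K 1 := by
      rw [← Pi.single_smul, smul_eq_mul, mul_one]
    rw [this, ← hH, ← hTH]
    exact Submodule.smul_mem _ _ (T _).2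
  -- the universal multilinear map on the norm, extended to the split module, is the inverse
  · let := ρ.toAlgebra
    let f : NormMod φ d M →ₛₗ[ρ] TensorProduct R S (NormMod φ d M) :=
      { toFun := fun z => TensorProduct.tmul R 1 z
        map_add' := fun x y => TensorProduct.tmul_add _ _ _
        map_smul' := fun r x => by
          rw [← TensorProduct.smul_tmul, TensorProduct.smul_tmul', Algebra.smul_def, mul_one,
            smul_eq_mul, mul_one]
          rfl }
    obtain ⟨T, -, hT⟩ := exists_multilinear_norm comm g hD s D hτ hg f
    refine ⟨∑ K : Fin d → ι, (LinearMap.proj K : ((Fin d → ι) → S) →ₗ[S] S).smulRight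
      (T fun i => s.basis i (K i)), fun z => ?_⟩
    refine Eq.trans ?_ (hT z).symm
    simp

end NormBaseChange

/-! ### Base change and faithfully flat descent of semilinear maps -/

section BaseChange

variable {A B C : Type*} [CommRing A] [CommRing B] [CommRing C] {ρ : A →+* B} {σ : B →+* C}
  {N N' N'' : Type*} [AddCommGroup N] [Module A N] [AddCommGroup N'] [Module B N']
  [AddCommGroup N''] [Module C N'']

theorem IsBC.comp {τ : A →+* C} (hτ : τ = σ.comp ρ) {g : N →ₛₗ[ρ] N'} {h : N' →ₛₗ[σ] N''}
    {k : N →ₛₗ[τ] N''} (hk : ∀ n, k n = h (g n)) (hg : IsBC ρ g) (hh : IsBC σ h) : IsBC τ k := by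
  subst hτ
  refine IsBC.of_lift ?_ ?_
  · rw [eq_top_iff, ← hh.span_range, Submodule.span_le]
    rintro _ ⟨n', rfl⟩
    have h1 : n' ∈ Submodule.span B (Set.range g) := hg.span_range ▸ trivial
    induction h1 using Submodule.span_induction with
    | mem x hx =>
      obtain ⟨n, rfl⟩ := hx
      exact Submodule.subset_span ⟨n, hk n⟩
    | zero => rw [map_zero]; exact zero_mem _
    | add x y _ _ hx hy => rw [map_add]; exact add_mem hx hy
    | smul b x _ hx => rw [map_smulₛₗ]; exact Submodule.smul_mem _ _ hx
  · let := (σ.comp ρ).toAlgebra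
    let f0 : N →ₛₗ[σ.comp ρ] TensorProduct A C N :=
      { toFun := fun n => TensorProduct.tmul A 1 n
        map_add' := fun x y => TensorProduct.tmul_add _ _ _
        map_smul' := fun a x => by
          rw [TensorProduct.tmul_smul]
          exact algebra_compatible_smul C a _ }
    let := Module.compHom (TensorProduct A C N) σ
    let f1 : N →ₛₗ[ρ] TensorProduct A C N :=
      { toFun := f0
        map_add' := map_add f0
        map_smul' := f0.map_smulₛₗ }
    obtain ⟨F1, hF1⟩ := hg.exists_lift f1
    let f2 : N' →ₛₗ[σ] TensorProduct A C N :=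
      { toFun := F1
        map_add' := map_add F1
        map_smul' := F1.map_smul }
    obtain ⟨F2, hF2⟩ := hh.exists_lift f2
    exact ⟨F2, fun n => by rw [hk, hF2]; exact hF1 n⟩

theorem IsBC.bijective {M M' : Type*} [AddCommGroup M] [Module A M] [AddCommGroup M'] [Module A M']
    {g : M →ₗ[A] M'} (h : IsBC (RingHom.id A) g) : Function.Bijective g := by
  obtain ⟨F, hF⟩ := h.exists_lift LinearMap.id
  have h1 : g.comp F = LinearMap.id := h.ext fun n => by
    rw [LinearMap.comp_apply, hF]; rfl
  exact Function.bijective_iff_has_inverse.2 ⟨F, hF, LinearMap.congr_fun h1⟩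

/-- The comparison map of a base change. -/
theorem IsBC.bijective_lift {g : N →ₛₗ[ρ] N'} (h : IsBC ρ g) :
    letI := ρ.toAlgebra
    ∃ e : TensorProduct A B N ≃ₗ[B] N', ∀ b n, e (TensorProduct.tmul A b n) = b • g n := by
  let := ρ.toAlgebra
  let := Module.compHom N' ρ
  have : IsScalarTower A B N' := ⟨fun r s x => mul_smul (ρ r) s x⟩
  exact ⟨IsBaseChange.equiv (f := restrictLin g) h,
    fun b n => IsBaseChange.equiv_tmul (f := restrictLin g) h b n⟩

theorem IsBC.of_equiv {g : N →ₛₗ[ρ] N'}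
    (h : letI := ρ.toAlgebra
      ∃ L : TensorProduct A B N →ₗ[B] N', (∀ n, L (TensorProduct.tmul A 1 n) = g n) ∧
        Function.Bijective L) : IsBC ρ g := by
  let := ρ.toAlgebra
  let := Module.compHom N' ρ
  have : IsScalarTower A B N' := ⟨fun r s x => mul_smul (ρ r) s x⟩
  obtain ⟨L, hL, hb⟩ := h
  exact IsBaseChange.of_equiv (f := restrictLin g) (LinearEquiv.ofBijective L hb) hL

/-- A semilinear map is a base change if it becomes one after a faithfully flat base change of its
target. -/
theorem IsBC.of_comp {τ : A →+* C} (hτ : τ = σ.comp ρ) {g : N →ₛₗ[ρ] N'} {h : N' →ₛₗ[σ] N''}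
    {k : N →ₛₗ[τ] N''} (hk : ∀ n, k n = h (g n)) (hσ : σ.FaithfullyFlat) (hK : IsBC τ k)
    (hh : IsBC σ h) : IsBC ρ g := by
  subst hτ
  let := ρ.toAlgebra
  let := σ.toAlgebra
  let := (σ.comp ρ).toAlgebra
  have : IsScalarTower A B C := IsScalarTower.of_algebraMap_eq' rfl
  have : Module.FaithfullyFlat B C := hσ
  obtain ⟨e1, h1⟩ := hK.bijective_lift
  obtain ⟨e2, h2⟩ := hh.bijective_lift
  let := Module.compHom N' ρ
  have : IsScalarTower A B N' := ⟨fun r s x => mul_smul (ρ r) s x⟩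
  let L : TensorProduct A B N →ₗ[B] N' :=
    (IsBaseChange.lift (TensorProduct.isBaseChange A N B) (restrictLin g))
  have hL : ∀ n, L (TensorProduct.tmul A 1 n) = g n := fun n =>
    IsBaseChange.lift_eq (TensorProduct.isBaseChange A N B) (restrictLin g) n
  refine IsBC.of_equiv ⟨L, hL, ?_⟩
  -- after the base change to `C` the comparison map is that of `k`, which is bijective
  rw [← Module.FaithfullyFlat.lTensor_bijective_iff_bijective B C]
  have h3 : ∀ x, e2 (L.lTensor C x) =
      e1 (TensorProduct.AlgebraTensorModule.cancelBaseChange A B C C N x) := by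
    intro x
    induction x with
    | zero => simp
    | add x y hx hy => simp only [map_add, hx, hy]
    | tmul c y =>
      induction y with
      | zero => simp
      | add x y hx hy => simp only [TensorProduct.tmul_add, map_add, hx, hy]
      | tmul b n =>
        have h4 : TensorProduct.tmul A b n = b • TensorProduct.tmul A (1 : B) n := by
          rw [TensorProduct.smul_tmul', smul_eq_mul, mul_one]
        rw [LinearMap.lTensor_tmul, h2, TensorProduct.AlgebraTensorModule.cancelBaseChange_tmul,
          h1, h4, map_smul, hL, map_smulₛₗ, hk, smul_smul]
        congr 1
        rw [Algebra.smul_def, mul_comm]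
        rfl
  have h5 : Function.Bijective fun x => e2 (L.lTensor C x) := by
    simp only [h3]
    exact e1.bijective.comp (LinearEquiv.bijective _)
  exact (Function.Bijective.of_comp_iff' e2.bijective _).1 h5

/-- Faithfully flat descent: a semilinear map which compares the beginnings of two exact sequences
is a base change if the maps between the next terms of the sequences are base changes. -/
theorem IsBC.of_exact (hρ : ρ.Flat) {M1 M2 N1 N2 N3 : Type*} [AddCommGroup M1] [Module A M1]
    [AddCommGroup M2] [Module A M2] [AddCommGroup N1] [Module B N1] [AddCommGroup N2] [Module B N2]
    [AddCommGroup N3] [Module B N3] {i : N →ₗ[A] M1} {δ : M1 →ₗ[A] M2} (hi : Function.Injective i)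
    (hδ : Function.Exact i δ) {α : N →ₛₗ[ρ] N1} {β : M1 →ₛₗ[ρ] N2} {γ : M2 →ₛₗ[ρ] N3}
    {q : N1 →ₗ[B] N2} {s : N2 →ₗ[B] N3} (hq : Function.Injective q) (hs : ∀ n, s (q n) = 0)
    (hα : ∀ n, q (α n) = β (i n)) (hsβ : ∀ m, s (β m) = γ (δ m)) (hβ : IsBC ρ β)
    (hγ : IsBC ρ γ) : IsBC ρ α := by
  let := ρ.toAlgebra
  have : Module.Flat A B := hρ
  obtain ⟨e1, h1⟩ := hβ.bijective_lift
  obtain ⟨e2, h2⟩ := hγ.bijective_lift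
  let := Module.compHom N1 ρ
  have : IsScalarTower A B N1 := ⟨fun r s x => mul_smul (ρ r) s x⟩
  let L : TensorProduct A B N →ₗ[B] N1 :=
    (IsBaseChange.lift (TensorProduct.isBaseChange A N B) (restrictLin α))
  have hL : ∀ n, L (TensorProduct.tmul A 1 n) = α n := fun n =>
    IsBaseChange.lift_eq (TensorProduct.isBaseChange A N B) (restrictLin α) n
  have hL' : ∀ b n, L (TensorProduct.tmul A b n) = b • α n := fun b n => by
    rw [← hL, ← map_smul, TensorProduct.smul_tmul', smul_eq_mul, mul_one]
  -- the comparison map is part of a map from the first sequence, which stays exact after the flat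
  -- base change, to the second
  have h3 : ∀ x, q (L x) = e1 (i.lTensor B x) := by
    intro x
    induction x with
    | zero => simp
    | add x y hx hy => simp only [map_add, hx, hy]
    | tmul b n => rw [hL', map_smul, hα, LinearMap.lTensor_tmul, h1]
  have h4 : ∀ x, s (e1 x) = e2 (δ.lTensor B x) := by
    intro x
    induction x with
    | zero => simp
    | add x y hx hy => simp only [map_add, hx, hy]
    | tmul b n => rw [h1, map_smul, hsβ, LinearMap.lTensor_tmul, h2]
  refine IsBC.of_equiv ⟨L, hL, ?_, fun n => ?_⟩
  · intro x y hxy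
    refine Module.Flat.lTensor_preserves_injective_linearMap (M := B) i hi (e1.injective ?_)
    rw [← h3, ← h3, hxy]
  · have h5 : δ.lTensor B (e1.symm (q n)) = 0 := e2.injective (by
      rw [← h4, LinearEquiv.apply_symm_apply, hs, map_zero])
    obtain ⟨y, hy⟩ := (Module.Flat.lTensor_exact B hδ _).1 h5
    refine ⟨y, hq ?_⟩
    rw [h3, hy, LinearEquiv.apply_symm_apply]

end BaseChange

section Free

theorem single_smul_algebra {R A κ : Type*} [CommSemiring R] [CommSemiring A] [Algebra R A]
    [DecidableEq κ] (k : κ) (r : R) (a : A) :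
    (Pi.single k (r • a) : κ → A) = algebraMap R A r • Pi.single k a := by
  rw [Algebra.smul_def, ← smul_eq_mul, Pi.single_smul]

/-- Sections of a free module over a cocartesian square of rings. -/
theorem isBC_of_free {R A S B : CommRingCat.{u}} {φ : R ⟶ A} {ψ : S ⟶ B}
    {ρ : R ⟶ S} {τ : A ⟶ B} (sq : IsPushout ρ φ ψ τ) {κ : Type*} [Finite κ] {M N : Type (u + 1)}
    [AddCommGroup M] [Module A M] [AddCommGroup N] [Module B N] (e : (κ → A) ≃ₗ[A] M)
    (e' : (κ → B) ≃ₗ[B] N) (comm : τ.hom.comp φ.hom = ψ.hom.comp ρ.hom) (g : M →ₛₗ[τ.hom] N)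
    (hg : ∀ v, g (e v) = e' fun k => τ (v k)) :
    IsBC ρ.hom (modOverMap (φ := φ.hom) (ψ := ψ.hom) comm g) := by
  classical
  have := Fintype.ofFinite κ
  algebraize [φ.hom, ψ.hom, ρ.hom, τ.hom, τ.hom.comp φ.hom]
  have t1 : IsScalarTower R S B := .of_algebraMap_eq' comm
  have t2 : IsScalarTower R A B := .of_algebraMap_eq' rfl
  have hp : Algebra.IsPushout R S A B := CommRingCat.isPushout_iff_isPushout.1 sq
  have hb : IsBaseChange S (IsScalarTower.toAlgHom R A B).toLinearMap := hp.out
  have hsingle : ∀ k a, g (e (Pi.single k a)) = e' (Pi.single k (τ a)) := fun k a => by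
    rw [hg]
    congr 1
    funext l
    by_cases h : l = k
    · subst h; simp
    · simp [Pi.single_eq_of_ne h]
  refine IsBC.of_lift ?_ ?_
  -- the image spans: this is checked on multiples of basis vectors
  · rw [Submodule.eq_top_iff']
    intro n
    obtain ⟨v, rfl⟩ := e'.surjective n
    have hv : ∀ (k : κ) (b : B), e' (Pi.single k b) ∈ (Submodule.span S (Set.range
        (modOverMap (φ := φ.hom) (ψ := ψ.hom) comm g))) := by
      intro k b
      refine hb.inductionOn b (fun b => (e' (Pi.single k b) : ModOver ψ.hom N) ∈ _) ?_ ?_ ?_ ?_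
      · rw [Pi.single_zero, map_zero]; exact zero_mem _
      · intro a
        exact Submodule.subset_span ⟨e (Pi.single k a), hsingle k a⟩
      · intro s b h
        have h1 : (e' (Pi.single k (s • b)) : ModOver ψ.hom N) =
            s • (show ModOver ψ.hom N from e' (Pi.single k b)) := by
          exact (congrArg e' (single_smul_algebra k s b)).trans (map_smul e' _ _)
        rw [h1]
        exact Submodule.smul_mem _ _ h
      · intro b b' h h'
        rw [Pi.single_add, map_add]
        exact add_mem h h'
    have h1 : v = ∑ k, Pi.single k (v k) := (Finset.univ_sum_single v).symm
    rw [h1, map_sum]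
    exact sum_mem fun k _ => hv k (v k)
  -- the inverse, assembled from the copies of the base change of rings
  · let T := TensorProduct R S (ModOver φ.hom M)
    let f (k : κ) : A →ₗ[R] T :=
      { toFun := fun a => TensorProduct.tmul R 1 (show ModOver φ.hom M from e (Pi.single k a))
        map_add' := fun a b => by
          rw [← TensorProduct.tmul_add]
          congr 1
          rw [Pi.single_add, map_add]
          rfl
        map_smul' := fun r a => by
          rw [RingHom.id_apply, ← TensorProduct.tmul_smul]
          congr 1
          exact (congrArg e (single_smul_algebra k r a)).trans (map_smul e _ _) }
    let F : ModOver ψ.hom N →ₗ[S] T :=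
      { toFun := fun n => ∑ k, hb.lift (f k) (e'.symm n k)
        map_add' := fun x y => by
          rw [← Finset.sum_add_distrib]
          refine Finset.sum_congr rfl fun k _ => ?_
          rw [← map_add]
          exact congrArg _ (congrFun (map_add e'.symm x y) k)
        map_smul' := fun s x => by
          rw [Finset.smul_sum]
          refine Finset.sum_congr rfl fun k _ => ?_
          rw [RingHom.id_apply, ← map_smul, Algebra.smul_def]
          exact congrArg _ (congrFun (map_smul e'.symm (ψ s) (show N from x)) k) }
    refine ⟨F, fun m => ?_⟩
    obtain ⟨v, rfl⟩ := e.surjective m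
    change ∑ k, hb.lift (f k) (e'.symm (g (e v)) k) = _
    simp only [hg, LinearEquiv.symm_apply_apply]
    have h1 : ∀ k, hb.lift (f k) (τ (v k)) = f k (v k) := fun k => hb.lift_eq (f k) (v k)
    simp only [h1]
    change ∑ k, TensorProduct.tmul R 1 (show ModOver φ.hom M from e (Pi.single k (v k))) = _
    rw [← TensorProduct.tmul_sum]
    congr 1
    refine (map_sum e (fun k => Pi.single k (v k)) Finset.univ).symm.trans ?_
    rw [Finset.univ_sum_single]

end Free

/-! ### Quasi-coherence of locally free sheaves of modules -/

section Quasicoherent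

variable {S : Scheme.{u}}

section OvPull

variable {U V V' : Over S} (v : V ⟶ U) (v' : V' ⟶ U)

/-- The fibre product of two objects over a third one. -/
def ovPull : Over S := Over.mk (Limits.pullback.fst v.left v'.left ≫ V.hom)

/-- The first projection. -/
def ovFst : ovPull v v' ⟶ V := Over.homMk (Limits.pullback.fst v.left v'.left)

/-- The second projection. -/
def ovSnd : ovPull v v' ⟶ V' := Over.homMk (Limits.pullback.snd v.left v'.left) (by
  change Limits.pullback.snd v.left v'.left ≫ V'.hom = Limits.pullback.fst v.left v'.left ≫ V.hom
  rw [← Over.w v, ← Over.w v', Limits.pullback.condition_assoc])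

theorem ovPull_condition : ovFst v v' ≫ v = ovSnd v v' ≫ v' :=
  Over.OverMorphism.ext Limits.pullback.condition

theorem isPullback_ovPull : IsPullback (ovFst v v').left (ovSnd v v').left v.left v'.left :=
  IsPullback.of_hasPullback v.left v'.left

variable {v v'}

/-- The morphism to the fibre product given by its components. -/
def ovLift {Z : Over S} (a : Z ⟶ V) (b : Z ⟶ V') (h : a ≫ v = b ≫ v') : Z ⟶ ovPull v v' :=
  Over.homMk (Limits.pullback.lift a.left b.left (congrArg Over.Hom.left h)) (by
    change _ ≫ Limits.pullback.fst v.left v'.left ≫ V.hom = _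
    rw [Limits.pullback.lift_fst_assoc, Over.w])

theorem ovLift_fst {Z : Over S} (a : Z ⟶ V) (b : Z ⟶ V') (h : a ≫ v = b ≫ v') :
    ovLift a b h ≫ ovFst v v' = a := Over.OverMorphism.ext (Limits.pullback.lift_fst _ _ _)

theorem ovLift_snd {Z : Over S} (a : Z ⟶ V) (b : Z ⟶ V') (h : a ≫ v = b ≫ v') :
    ovLift a b h ≫ ovSnd v v' = b := Over.OverMorphism.ext (Limits.pullback.lift_snd _ _ _)

instance [IsAffine U.left] [IsAffine V.left] [IsAffine V'.left] : IsAffine (ovPull v v').left :=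
  .of_isPullback (isPullback_ovPull v v')

end OvPull

/-- A covering of an affine scheme for the flat topology by one affine scheme. -/
structure IsAffCover {U V : Over S} (v : V ⟶ U) : Prop where
  isAffine : IsAffine V.left
  flat : Flat v.left
  surjective : Surjective v.left
  locallyOfFinitePresentation : LocallyOfFinitePresentation v.left

namespace IsAffCover

variable {U V V' : Over S} {v : V ⟶ U}

theorem mem (h : IsAffCover v) : Sieve.generate (Presieve.singleton v) ∈ fppf S U :=
  have := h.flat
  have := h.surjective
  have := h.locallyOfFinitePresentation
  fppf_singleton v

theorem snd [IsAffine U.left] [IsAffine V'.left] (h : IsAffCover v) (v' : V' ⟶ U) :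
    IsAffCover (ovSnd v v') :=
  have := h.isAffine
  have := h.flat
  have := h.surjective
  have := h.locallyOfFinitePresentation
  { isAffine := inferInstance
    flat := inferInstanceAs (Flat (Limits.pullback.snd v.left v'.left))
    surjective := inferInstanceAs (Surjective (Limits.pullback.snd v.left v'.left))
    locallyOfFinitePresentation :=
      inferInstanceAs (LocallyOfFinitePresentation (Limits.pullback.snd v.left v'.left)) }

theorem faithfullyFlat [IsAffine U.left] (h : IsAffCover v) : v.left.appTop.hom.FaithfullyFlat :=
  have := h.isAffine
  (Flat.flat_and_surjective_iff_faithfullyFlat_of_isAffine v.left).1 ⟨h.flat, h.surjective⟩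

theorem ext {F : (Over S)ᵒᵖ ⥤ Type w} (h : IsAffCover v) (hF : Presieve.IsSheaf (fppf S) F)
    {a b : F.obj (op U)} (hab : F.map v.op a = F.map v.op b) : a = b :=
  sheaf_ext hF h.mem (by
    rintro Y _ ⟨_, g, _, ⟨⟩, rfl⟩
    rw [op_comp, F.map_comp, types_comp_apply, types_comp_apply, hab])

theorem glue {F : (Over S)ᵒᵖ ⥤ Type w} (h : IsAffCover v) (hF : Presieve.IsSheaf (fppf S) F)
    (x : F.obj (op V)) (hx : ∀ (Z : Over S) (a b : Z ⟶ V), a ≫ v = b ≫ v →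
      F.map a.op x = F.map b.op x) : ∃ t : F.obj (op U), F.map v.op t = x := by
  have key : ∀ (Y : Over S) (f : Y ⟶ U), Sieve.generate (Presieve.singleton v) f →
      ∃ g : Y ⟶ V, g ≫ v = f := by
    rintro Y _ ⟨_, g, _, ⟨⟩, rfl⟩
    exact ⟨g, rfl⟩
  choose g hg using key
  obtain ⟨t, ht⟩ := sheaf_glue hF h.mem (fun Y f hf => F.map (g Y f hf).op x) fun Y Z f k hf => by
    refine (hx _ _ (k ≫ g Y f hf) ?_).trans (F.map_comp_apply _ _ _)
    rw [hg, Category.assoc, hg]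
  have hv : Sieve.generate (Presieve.singleton v) v := Sieve.le_generate _ _ _ ⟨⟩
  refine ⟨t, (ht V v hv).trans ?_⟩
  refine (hx _ _ (𝟙 V) ?_).trans (by rw [op_id, F.map_id]; rfl)
  rw [hg, Category.id_comp]

end IsAffCover

/-- A basis of the restriction of `M` to the schemes over `V`. -/
structure FreeSec (M : OMod S) (κ : Type) (V : Over S) where
  /-- the isomorphism on sections -/
  app (Z : Over S) (z : Z ⟶ V) : (κ → Γ(Z.left, ⊤)) ≃ₗ[Γ(Z.left, ⊤)] Sec M Z
  app_map (Z W : Over S) (z : Z ⟶ V) (w : W ⟶ Z) (v : κ → Γ(Z.left, ⊤)) :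
    res M w (app Z z v) = app W (w ≫ z) (fun i => w.left.appTop (v i))

/-- Restriction of a basis. -/
def FreeSec.res {M : OMod S} {κ : Type} {V V' : Over S} (b : FreeSec M κ V) (f : V' ⟶ V) :
    FreeSec M κ V' where
  app Z z := b.app Z (z ≫ f)
  app_map Z W z w v := by rw [b.app_map, Category.assoc]

/-- The basis given by a section of a torsor framing the module. -/
def ModFraming.freeSec {G : (Over S)ᵒᵖ ⥤ GrpCat.{u}} {P : RightGSet G} {κ : Type} {L : LinAct G κ}
    {M : OMod S} (e : ModFraming P L M) {V : Over S} (p : P.F.obj (op V)) : FreeSec M κ V where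
  app Z z := e.app (P.F.map z.op p)
  app_map Z W z w v := by
    rw [e.app_map, op_comp, P.F.map_comp]
    rfl

theorem comp_appTop_hom {U V W : Over S} (v : V ⟶ U) (w : W ⟶ V) :
    (w ≫ v).left.appTop.hom = w.left.appTop.hom.comp v.left.appTop.hom := by
  rw [Over.comp_left, Scheme.Hom.comp_appTop]
  rfl

variable {M : OMod S} {κ : Type} [Finite κ]

theorem isBC_snd {U V V' : Over S} [IsAffine U.left] [IsAffine V.left] [IsAffine V'.left]
    (v : V ⟶ U) (v' : V' ⟶ U) (b : FreeSec M κ V')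
    (comm : (ovSnd v v').left.appTop.hom.comp v'.left.appTop.hom =
      (ovFst v v').left.appTop.hom.comp v.left.appTop.hom) :
    IsBC v.left.appTop.hom (modOverMap (φ := v'.left.appTop.hom)
      (ψ := (ovFst v v').left.appTop.hom) comm (res M (ovSnd v v'))) :=
  isBC_of_free (isPushout_appTop_of_isPullback (isPullback_ovPull v v')) (b.app V' (𝟙 V'))
    (b.app _ (ovSnd v v')) comm _ fun v => by
      rw [b.app_map, Category.comp_id]

/-- A module over `B` as a module over `A`, along `A → B`, receives the semilinear maps over
`A → B` as linear maps. -/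
def toModOver {A B : Type u} [CommRing A] [CommRing B] {ρ : A →+* B} {N : Type w} [AddCommGroup N]
    [Module A N] {N' : Type (u + 1)} [AddCommGroup N'] [Module B N'] (g : N →ₛₗ[ρ] N') :
    N →ₗ[A] ModOver ρ N' where
  toFun n := g n
  map_add' := map_add g
  map_smul' := g.map_smulₛₗ

/-- Sections over an affine cover of a sheaf which is free on the cover are a base change of those
over the base. The Čech sequences of the cover and of its pullback to itself are exact, and from
the second term on they are base changes of each other because the modules there are free. -/
theorem isBC_res_of_cover (hM : Presieve.IsSheaf (fppf S) (secF M)) {U V : Over S} [IsAffine U.left]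
    {v : V ⟶ U} (hv : IsAffCover v) (b : FreeSec M κ V) : IsBC v.left.appTop.hom (res M v) := by
  have := hv.isAffine
  -- the fibre square of the cover, and the fibre product of the cover with it
  let W := ovPull v v
  let p1 : W ⟶ V := ovFst v v
  let p2 : W ⟶ V := ovSnd v v
  let w : W ⟶ U := p1 ≫ v
  have hw : p2 ≫ v = w := (ovPull_condition v v).symm
  let W3 := ovPull v w
  let q1 : W3 ⟶ V := ovFst v w
  let q23 : W3 ⟶ W := ovSnd v w
  have h3 : q1 ≫ v = q23 ≫ w := ovPull_condition v w
  let q12 : W3 ⟶ W := ovLift q1 (q23 ≫ p1) (by rw [h3, Category.assoc])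
  let q13 : W3 ⟶ W := ovLift q1 (q23 ≫ p2) (by rw [h3, Category.assoc, hw])
  have e12 : q12 ≫ p1 = q1 := ovLift_fst _ _ _
  have e13 : q13 ≫ p1 = q1 := ovLift_fst _ _ _
  have e12' : q12 ≫ p2 = q23 ≫ p1 := ovLift_snd _ _ _
  have e13' : q13 ≫ p2 = q23 ≫ p2 := ovLift_snd _ _ _
  have c {X Y Z : Over S} (x : Y ⟶ X) (y : Z ⟶ Y) (z : Z ⟶ X) (h : y ≫ x = z) :
      y.left.appTop.hom.comp x.left.appTop.hom =
        z.left.appTop.hom.comp (RingHom.id _) := by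
    rw [← h, comp_appTop_hom]; rfl
  have cβ : p2.left.appTop.hom.comp v.left.appTop.hom =
      p1.left.appTop.hom.comp v.left.appTop.hom := by
    rw [← comp_appTop_hom, ← comp_appTop_hom, hw]
  have cγ : q23.left.appTop.hom.comp w.left.appTop.hom =
      q1.left.appTop.hom.comp v.left.appTop.hom := by
    rw [← comp_appTop_hom, ← comp_appTop_hom, h3]
  have hβ := isBC_snd v v b cβ
  have hγ := isBC_snd v w (b.res p1) cγ
  -- the Čech sequence over `U` and its pullback to `V`
  let i : Sec M U →ₗ[Γ(U.left, ⊤)] ModOver v.left.appTop.hom (Sec M V) := toModOver (res M v)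
  let δ1 : ModOver v.left.appTop.hom (Sec M V) →ₗ[Γ(U.left, ⊤)]
      ModOver w.left.appTop.hom (Sec M W) :=
    modOverMap (ρ := RingHom.id _) (c v p1 w rfl) (res M p1)
  let δ2 : ModOver v.left.appTop.hom (Sec M V) →ₗ[Γ(U.left, ⊤)]
      ModOver w.left.appTop.hom (Sec M W) :=
    modOverMap (ρ := RingHom.id _) (c v p2 w hw) (res M p2)
  let q : Sec M V →ₗ[Γ(V.left, ⊤)] ModOver p1.left.appTop.hom (Sec M W) := toModOver (res M p1)
  let s1 : ModOver p1.left.appTop.hom (Sec M W) →ₗ[Γ(V.left, ⊤)]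
      ModOver q1.left.appTop.hom (Sec M W3) :=
    modOverMap (ρ := RingHom.id _) (c p1 q12 q1 e12) (res M q12)
  let s2 : ModOver p1.left.appTop.hom (Sec M W) →ₗ[Γ(V.left, ⊤)]
      ModOver q1.left.appTop.hom (Sec M W3) :=
    modOverMap (ρ := RingHom.id _) (c p1 q13 q1 e13) (res M q13)
  have hres {X Y Z Z' : Over S} (x : Y ⟶ X) (y : Z ⟶ Y) (x' : Z' ⟶ X) (y' : Z ⟶ Z')
      (h : y ≫ x = y' ≫ x') (m : Sec M X) : res M y (res M x m) = res M y' (res M x' m) := by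
    rw [← res_comp, ← res_comp, h]
  refine IsBC.of_exact (i := i) (δ := δ1 - δ2) (q := q) (s := s1 - s2) hv.faithfullyFlat.flat
    ?_ ?_ ?_ ?_ ?_ ?_ hβ hγ
  · exact fun x y hxy => hv.ext hM hxy
  · intro m
    constructor
    · intro h
      have h1 : res M p1 m = res M p2 m := sub_eq_zero.1 h
      refine hv.glue hM m fun Z a b hab => ?_
      let l : Z ⟶ W := ovLift a b hab
      have ha : l ≫ p1 = a := ovLift_fst _ _ _
      have hb : l ≫ p2 = b := ovLift_snd _ _ _
      let m' : Sec M V := m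
      have h2 : res M (l ≫ p1) m' = res M (l ≫ p2) m' := by
        rw [res_comp, res_comp]
        exact congrArg (res M l) h1
      rw [ha, hb] at h2
      exact h2
    · rintro ⟨n, rfl⟩
      refine sub_eq_zero.2 ?_
      exact hres v p1 v p2 hw.symm n
  · intro x y hxy
    -- the diagonal splits the restriction along the first projection
    let Δ : V ⟶ W := ovLift (𝟙 V) (𝟙 V) rfl
    have hΔ : Δ ≫ p1 = 𝟙 V := ovLift_fst _ _ _
    have h : ∀ x : Sec M V, res M Δ (res M p1 x) = x := fun x => by
      rw [← res_comp, hΔ, res_id]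
    exact (h x).symm.trans ((congrArg (res M Δ) hxy).trans (h y))
  · intro n
    refine sub_eq_zero.2 ?_
    exact hres p1 q12 p1 q13 (e12.trans e13.symm) n
  · intro n
    exact hres v p1 v p2 hw.symm n
  · intro m
    have h1 : res M q12 (res M p2 m) = res M q23 (res M p1 m) := hres _ _ _ _ e12' m
    have h2 : res M q13 (res M p2 m) = res M q23 (res M p2 m) := hres _ _ _ _ e13' m
    exact (congrArg₂ (fun a b : Sec M W3 => a - b) h1 h2).trans
      (map_sub (res M q23) _ _).symm

theorem isBC_res_of_free {U V : Over S} [IsAffine U.left] [IsAffine V.left] (b : FreeSec M κ U)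
    (v : V ⟶ U) : IsBC v.left.appTop.hom (res M v) := by
  have sq : IsPushout v.left.appTop (𝟙 Γ(U.left, ⊤)) (𝟙 Γ(V.left, ⊤)) v.left.appTop :=
    IsPushout.of_vert_isIso ⟨by simp⟩
  exact isBC_of_free sq (b.app U (𝟙 U)) (b.app V v) rfl (res M v) fun x => by
    rw [b.app_map, Category.comp_id]

/-- Sheaves of modules which are locally free of finite rank are quasi-coherent. -/
theorem isBC_res (hM : Presieve.IsSheaf (fppf S) (secF M)) {U U' V : Over S} [IsAffine U.left]
    [IsAffine U'.left] (u : U' ⟶ U) {v : V ⟶ U} (hv : IsAffCover v) (b : FreeSec M κ V) :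
    IsBC u.left.appTop.hom (res M u) := by
  have := hv.isAffine
  have h1 := isBC_res_of_cover hM hv b
  have h2 := isBC_res_of_free b (ovFst v u)
  have h3 := isBC_res_of_cover hM (hv.snd u) (b.res (ovFst v u))
  let k : Sec M U →ₛₗ[(ovFst v u ≫ v).left.appTop.hom] Sec M (ovPull v u) := res M (ovFst v u ≫ v)
  have hk : IsBC _ k := IsBC.comp (comp_appTop_hom _ _) (fun n => res_comp M v (ovFst v u) n) h1 h2
  refine IsBC.of_comp (by rw [ovPull_condition]; exact comp_appTop_hom _ _) (k := k)
    (h := res M (ovSnd v u)) (fun n => ?_) (hv.snd u).faithfullyFlat hk h3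
  change res M (ovFst v u ≫ v) n = _
  rw [← res_comp, ovPull_condition]

end Quasicoherent

/-! ### The norm in the presence of an isomorphism with the split pair -/

section SplitNorm

theorem ModFraming.app_act_symm {X : Scheme.{u}} {G : (Over X)ᵒᵖ ⥤ GrpCat.{u}} {P : RightGSet G}
    {ι : Type} {L : LinAct G ι} {M : OMod X} (e : ModFraming P L M) {Y : Over X}
    (p : P.F.obj (op Y)) (g : G.obj (op Y)) (m : Sec M Y) :
    (e.app (P.act p g)).symm m = L.act g⁻¹ ((e.app p).symm m) := by
  rw [LinearEquiv.symm_apply_eq, e.app_act, L.act_inv_act, LinearEquiv.apply_symm_apply]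

variable {S T : Scheme.{u}} {f : T ⟶ S} {F : CommRingCat.{u} ⥤ GrpCat.{u}} [PreservesFinPow F]
  {P : RightGSet (onSch F T)} {d : ℕ}

namespace SplitIso

variable {X : Over S} (p : SplitIso f P d X)

/-- The scheme `X`, as a scheme over `T` by the point with index `k`. -/
def fib (k : Fin d) : Over T := Over.mk (p.pt X (𝟙 X) (LocallyConstant.const X.left k)).left

/-- The section of `T ×[S] X` over `X` with index `k`. -/
def sect (k : Fin d) : p.fib k ⟶ (Over.pullback f).obj X :=
  Over.homMk (toPullback (𝟙 X) (p.pt X (𝟙 X) (LocallyConstant.const X.left k)))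
    (toPullback_snd _ _)

theorem comp_sect_fst (k : Fin d) {A : Scheme.{u}} (a : A ⟶ X.left) :
    (a ≫ (p.sect k).left) ≫ Limits.pullback.fst X.hom f = a := by
  refine (Category.assoc _ _ _).trans ((congrArg (a ≫ ·) (toPullback_fst _ _)).trans ?_)
  exact Category.comp_id a

theorem comp_sect_snd (k : Fin d) {A : Scheme.{u}} (a : A ⟶ X.left) :
    (a ≫ (p.sect k).left) ≫ Limits.pullback.snd X.hom f =
      a ≫ (p.pt X (𝟙 X) (LocallyConstant.const X.left k)).left := by
  exact (Category.assoc _ _ _).trans (congrArg (a ≫ ·) (toPullback_snd _ _))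

theorem sect_fst (k : Fin d) : (p.sect k).left ≫ Limits.pullback.fst X.hom f = 𝟙 X.left :=
  toPullback_fst _ _

/-- A section of a sheaf on `T ×[S] X` is given by its restrictions to the `d` copies of `X`. -/
theorem bijective_sect {B : (Over T)ᵒᵖ ⥤ Type w} (hB : Presieve.IsSheaf (fppf T) B) :
    Function.Bijective fun (b : B.obj (op ((Over.pullback f).obj X))) (k : Fin d) =>
      (B.map (p.sect k).op b : B.obj (op (p.fib k))) := by
  let TX := (Over.pullback f).obj X
  let W : Over S := Over.mk (Limits.pullback.fst X.hom f ≫ X.hom)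
  let w : W ⟶ X := Over.homMk (Limits.pullback.fst X.hom f)
  let t : W ⟶ Over.mk f := Over.homMk (Limits.pullback.snd X.hom f) Limits.pullback.condition.symm
  -- the index of the tautological point; its fibres are the `d` copies of `X`
  obtain ⟨i, hi⟩ := (p.pt_bijective W w).2 t
  let i' : LocallyConstant TX.left (Fin d) := i
  have hsect : ∀ k, lcPull (p.sect k).left i' = LocallyConstant.const _ k := by
    intro k
    let s : X ⟶ W := Over.homMk (p.sect k).left (by
      refine (Category.assoc _ _ _).symm.trans ((congrArg (· ≫ X.hom) (p.sect_fst k)).trans ?_)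
      exact Category.id_comp X.hom)
    have hs : s ≫ w = 𝟙 X := Over.OverMorphism.ext (p.sect_fst k)
    have ht : s ≫ t = p.pt X (𝟙 X) (LocallyConstant.const X.left k) :=
      Over.OverMorphism.ext (toPullback_snd _ _)
    rw [← hi, p.pt_map, hs] at ht
    exact (p.pt_bijective X (𝟙 X)).1 ht
  have hfac : ∀ (Z : Over T) (z : Z ⟶ TX) (k : Fin d),
      lcPull z.left i' = LocallyConstant.const _ k →
        ∃ y : Z ⟶ p.fib k, y.left = z.left ≫ Limits.pullback.fst X.hom f ∧ y ≫ p.sect k = z := by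
    intro Z z k hk
    have hz : z.left ≫ Limits.pullback.snd X.hom f = Z.hom := Over.w z
    let Z' : Over S := Over.mk (Z.hom ≫ f)
    let z' : Z' ⟶ W := Over.homMk z.left (by
      change z.left ≫ Limits.pullback.fst X.hom f ≫ X.hom = Z.hom ≫ f
      rw [Limits.pullback.condition, ← Category.assoc, hz])
    have h1 : z' ≫ t = (z' ≫ w) ≫ p.pt X (𝟙 X) (LocallyConstant.const X.left k) := by
      rw [← hi, p.pt_map, p.pt_map, Category.comp_id]
      congr 1
    have h2 : (z.left ≫ Limits.pullback.fst X.hom f) ≫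
        (p.pt X (𝟙 X) (LocallyConstant.const X.left k)).left = Z.hom :=
      (congrArg Over.Hom.left h1).symm.trans hz
    refine ⟨Over.homMk (z.left ≫ Limits.pullback.fst X.hom f) h2, rfl, ?_⟩
    refine Over.OverMorphism.ext (Limits.pullback.hom_ext ?_ ?_)
    · exact p.comp_sect_fst k (z.left ≫ Limits.pullback.fst X.hom f)
    · exact (p.comp_sect_snd k (z.left ≫ Limits.pullback.fst X.hom f)).trans (h2.trans hz.symm)
  constructor
  · intro a b hab
    refine sheaf_ext_fibres hB i' fun Z z k hk => ?_
    obtain ⟨y, -, rfl⟩ := hfac Z z k hk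
    rw [op_comp, map_comp_apply', map_comp_apply']
    exact congrArg _ (congrFun hab k)
  · intro x
    let R : Sieve TX :=
      { arrows := fun Z z => ∃ k, lcPull z.left i' = LocallyConstant.const Z.left k
        downward_closed := by
          rintro Z Y z ⟨k, hk⟩ y
          refine ⟨k, ?_⟩
          refine LocallyConstant.ext fun v => ?_
          exact LocallyConstant.congr_fun hk (y.left v) }
    choose κ hκ using fun (Z : Over T) (z : Z ⟶ TX) (hz : R z) => hz
    choose y hy hy' using hfac
    -- a scheme that maps to two different copies is empty, and has one section
    have huniq : ∀ (Z : Over T) (z z' : Z ⟶ TX) (k l : Fin d) (hk) (hl), z = z' →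
        B.map (y Z z k hk).op (x k) = B.map (y Z z' l hl).op (x l) := by
      rintro Z z _ k l hk hl rfl
      by_cases h : IsEmpty Z.left
      · exact sheaf_subsingleton hB _ _
      · rw [not_isEmpty_iff] at h
        obtain ⟨v⟩ := h
        obtain rfl : k = l := LocallyConstant.congr_fun (hk.symm.trans hl) v
        rfl
    obtain ⟨b, hb⟩ := sheaf_glue hB (R := R)
      (fppf_fibres i' R fun V v k hk => ⟨k, hk⟩)
      (fun Z z hz => B.map (y Z z (κ Z z hz) (hκ Z z hz)).op (x (κ Z z hz)))
      (fun Y Z z g hz => by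
        have h1 : lcPull (g ≫ z).left i' = LocallyConstant.const Z.left (κ Y z hz) := by
          refine LocallyConstant.ext fun v => ?_
          exact LocallyConstant.congr_fun (hκ Y z hz) (g.left v)
        refine (huniq _ _ _ _ (κ Y z hz) _ h1 rfl).trans ?_
        rw [← map_comp_apply', ← op_comp]
        refine congrArg (fun q : _ ⟶ p.fib (κ Y z hz) => B.map q.op (x (κ Y z hz))) ?_
        refine Over.OverMorphism.ext ?_
        rw [Over.comp_left, hy, hy, Over.comp_left, Category.assoc]
        rfl)
    refine ⟨b, funext fun k => ?_⟩
    refine (hb _ (p.sect k) ⟨k, hsect k⟩).trans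
      ((huniq _ _ _ _ k _ (hsect k) rfl).trans ?_)
    have : y _ (p.sect k) k (hsect k) = 𝟙 _ := by
      refine Over.OverMorphism.ext ?_
      rw [hy, sect_fst]
      rfl
    rw [this, op_id, map_id_apply']

variable {ι : Type} {ρ : LinRep F ι} {M : OMod T}

/-- The trivialization over the copy of `X` with index `k`. -/
def frm (k : Fin d) : P.F.obj (op (p.fib k)) :=
  p.triv X (𝟙 X) (LocallyConstant.const X.left k)

/-- The coordinates on the copy of `X` with index `k` of a section over `T ×[S] X`. -/
def coord (e : ModFraming P (ρ.lin T) M) (m : Sec M ((Over.pullback f).obj X)) (k : Fin d) :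
    ι → Γ(X.left, ⊤) :=
  (e.app (p.frm k)).symm (SegreNorm.res M (p.sect k) m)

theorem coord_smul (e : ModFraming P (ρ.lin T) M) (a : Γ(((Over.pullback f).obj X).left, ⊤))
    (m : Sec M ((Over.pullback f).obj X)) (k : Fin d) (i : ι) :
    p.coord e (a • m) k i =
      (show Γ(X.left, ⊤) from (p.sect k).left.appTop a) * p.coord e m k i := by
  have h : (e.app (p.frm k)).symm (SegreNorm.res M (p.sect k) (a • m)) =
      (p.sect k).left.appTop a • (e.app (p.frm k)).symm (SegreNorm.res M (p.sect k) m) := by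
    rw [map_smulₛₗ, map_smul]
  exact congrFun h i

/-- The splitting of the module of sections over `T ×[S] X` given by an isomorphism with the split
pair over `X`. -/
def normSplit (hM : Presieve.IsSheaf (fppf T) (secF M)) (e : ModFraming P (ρ.lin T) M) :
    NormSplit (phi f X).hom d ι (Sec M ((Over.pullback f).obj X)) where
  ε := RingHom.pi fun k => (p.sect k).left.appTop.hom
  ε_bij := p.bijective_sect (isSheaf_functions T)
  ε_φ a := funext fun k => by
    change (p.sect k).left.appTop ((Limits.pullback.fst X.hom f).appTop a) = a
    rw [← CommRingCat.comp_apply, ← Scheme.Hom.comp_appTop, sect_fst]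
    exact ConcreteCategory.congr_hom Scheme.Hom.id_appTop a
  μ :=
    { toFun := fun m k => p.coord e m k
      map_zero' := funext fun k => by
        refine (congrArg (e.app (p.frm k)).symm (map_zero (SegreNorm.res M (p.sect k)))).trans ?_
        exact map_zero _
      map_add' := fun m n => funext fun k => by
        refine (congrArg (e.app (p.frm k)).symm
          (map_add (SegreNorm.res M (p.sect k)) m n)).trans ?_
        exact map_add _ _ _ }
  μ_bij := by
    have h := p.bijective_sect hM
    constructor
    · intro m n hmn
      exact h.1 (funext fun k => (e.app (p.frm k)).symm.injective (congrFun hmn k))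
    · intro v
      obtain ⟨m, hm⟩ := h.2 fun k => e.app (p.frm k) (v k)
      refine ⟨m, funext fun k => ?_⟩
      exact (congrArg (e.app (p.frm k)).symm (congrFun hm k)).trans
        (LinearEquiv.symm_apply_apply _ _)
  μ_smul a m k i := p.coord_smul e a m k i

/-- The coordinates with respect to two isomorphisms with the split pair over the same copy of the
base differ by the element of the group which relates the trivializations. -/
theorem coord_congr {q : SplitIso f P d X} (e : ModFraming P (ρ.lin T) M) {k l : Fin d}
    (g : q.fib l ⟶ p.fib k) (hg : g.left = 𝟙 X.left) (a : (onSch F T).obj (op (q.fib l)))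
    (h : q.frm l = P.act (P.F.map g.op (p.frm k)) a)
    (m : Sec M ((Over.pullback f).obj X)) :
    q.coord e m l = ρ.act (R := Γ(X.left, ⊤)) (show F.obj Γ(X.left, ⊤) from a)⁻¹ (p.coord e m k) := by
  have h1 : g ≫ p.sect k = q.sect l := by
    have h3 : g.left ≫ (p.pt X (𝟙 X) (LocallyConstant.const X.left k)).left =
      (q.pt X (𝟙 X) (LocallyConstant.const X.left l)).left := Over.w g
    refine Over.OverMorphism.ext (Limits.pullback.hom_ext ?_ ?_)
    · exact (p.comp_sect_fst k g.left).trans (hg.trans (q.sect_fst l).symm)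
    · exact (p.comp_sect_snd k g.left).trans (h3.trans (toPullback_snd _ _).symm)
  have h2 := e.app_symm_map g (p.frm k) (SegreNorm.res M (p.sect k) m)
  rw [← SegreNorm.res_comp, h1] at h2
  have h4 : (fun i => g.left.appTop (p.coord e m k i)) = p.coord e m k := by
    funext i
    rw [hg]
    exact ConcreteCategory.congr_hom Scheme.Hom.id_appTop _
  rw [← h4]
  refine Eq.trans ?_ (congrArg ((ρ.lin T).act (Y := q.fib l) a⁻¹) h2)
  refine (congrArg (fun x => (e.app x).symm (SegreNorm.res M (q.sect l) m)) h).trans ?_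
  exact e.app_act_symm _ _ _

/-- The coordinates are compatible with restriction. -/
theorem coord_res (e : ModFraming P (ρ.lin T) M) {X' : Over S} (v : X' ⟶ X)
    (m : Sec M ((Over.pullback f).obj X)) (k : Fin d) :
    (p.res v).coord e (SegreNorm.res M ((Over.pullback f).map v) m) k =
      fun i => v.left.appTop (p.coord e m k i) := by
  have hw : v.left ≫ (p.pt X (𝟙 X) (LocallyConstant.const X.left k)).left =
      ((p.res v).pt X' (𝟙 X') (LocallyConstant.const X'.left k)).left := by
    have h := p.pt_map X' X (𝟙 X) v (LocallyConstant.const X.left k)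
    rw [Category.comp_id] at h
    change _ = (p.pt X' (𝟙 X' ≫ v) _).left
    rw [Category.id_comp]
    exact congrArg Over.Hom.left h
  let g : (p.res v).fib k ⟶ p.fib k := Over.homMk v.left hw
  have h1 : (p.res v).sect k ≫ (Over.pullback f).map v = g ≫ p.sect k := by
    refine Over.OverMorphism.ext (Limits.pullback.hom_ext ?_ ?_)
    · refine Eq.trans ?_ (p.comp_sect_fst k v.left).symm
      refine (Category.assoc _ _ _).trans ((congrArg (((p.res v).sect k).left ≫ ·)
        (isPullback_pullback f v).w.symm).trans ?_)
      refine (Category.assoc _ _ _).symm.trans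
        ((congrArg (· ≫ v.left) ((p.res v).sect_fst k)).trans ?_)
      exact Category.id_comp v.left
    · refine (Over.w ((p.res v).sect k ≫ (Over.pullback f).map v)).trans
        (Over.w (g ≫ p.sect k)).symm
  have h2 : P.F.map g.op (p.frm k) = (p.res v).frm k :=
    p.map_triv (𝟙 X) v (𝟙 X' ≫ v) (by simp) (LocallyConstant.const X.left k) g rfl
  have h3 := e.app_symm_map g (p.frm k) (SegreNorm.res M (p.sect k) m)
  rw [← SegreNorm.res_comp, ← h1, SegreNorm.res_comp, h2] at h3
  exact h3

end SplitIso

end SplitNorm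

/-! ### Equivariance of the values of norms -/

section Tens

variable {d : ℕ} {ι κ : Type}

/-- The coordinates of the pure tensor `v 0 ⊗ ⋯ ⊗ v (d - 1)`, for an enumeration `τ` of the basis of
the tensor power. -/
def tens {R : Type*} [CommRing R] (τ : (Fin d → ι) ≃ κ) (v : Fin d → ι → R) : κ → R :=
  fun x => ∏ k, v k (τ.symm x k)

/-- A homomorphism on the semidirect product is given by tensor products of a representation and by
permutations of tensor factors. -/
structure SegreDatum.IsTensor {F F' : CommRingCat.{u} ⥤ GrpCat.{u}} (D : SegreDatum F F' d)
    (ρ : LinRep F ι) (ρ' : LinRep F' κ) (τ : (Fin d → ι) ≃ κ) : Prop where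
  seg {R : CommRingCat.{u}} (A : Fin d → F.obj R) (v : Fin d → ι → R) :
    ρ'.act (D.seg R A) (tens τ v) = tens τ fun k => ρ.act (A k) (v k)
  perm {R : CommRingCat.{u}} (g : Equiv.Perm (Fin d)) (v : Fin d → ι → R) :
    ρ'.act (D.perm R g) (tens τ v) = tens τ fun k => v (g⁻¹ k)

section Ext

variable {R A R' : Type u} [CommRing R] [CommRing A] [CommRing R'] {φ : R →+* A} {σ : R →+* R'}
  {M : Type (u + 1)} [AddCommGroup M] [Module A M] {N : Type w} [AddCommGroup N] [Module R' N]

theorem NormMod.ext_map {f g : NormMod φ d M →ₛₗ[σ] N}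
    (h : ∀ (l : ℕ) (b : Fin l → ℕ) (hb : ∑ j, b j = d) (m : Fin l → M),
      f (normProd φ b hb m) = g (normProd φ b hb m)) : f = g := by
  refine LinearMap.ext_on (span_normProd (φ := φ) (M := M) (d := d)) ?_
  rintro _ ⟨l, b, hb, m, rfl⟩
  exact h l b hb m

theorem NormMod.ext_comp {R'' : Type u} [CommRing R''] {σ' : R' →+* R''} {σ'' : R →+* R''}
    (hσ : σ'' = σ'.comp σ) {N' : Type w'} [AddCommGroup N'] [Module R'' N']
    {f : NormMod φ d M →ₛₗ[σ] N} {g : N →ₛₗ[σ'] N'} {k : NormMod φ d M →ₛₗ[σ''] N'}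
    (h : ∀ (l : ℕ) (b : Fin l → ℕ) (hb : ∑ j, b j = d) (m : Fin l → M),
      k (normProd φ b hb m) = g (f (normProd φ b hb m))) (z : NormMod φ d M) : k z = g (f z) := by
  subst hσ
  have : RingHomCompTriple σ σ' (σ'.comp σ) := ⟨rfl⟩
  exact LinearMap.congr_fun (NormMod.ext_map (f := k) (g := g.comp f) h) z

/-- Application of a ring homomorphism to the coordinates. -/
def coordMap (σ : R →+* R') (κ : Type) : (κ → R) →ₛₗ[σ] (κ → R') where
  toFun v i := σ (v i)
  map_add' v w := funext fun i => map_add σ _ _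
  map_smul' r v := funext fun i => map_mul σ _ _

end Ext

variable {R A : Type u} [CommRing R] [CommRing A] {φ : R →+* A}
  {M : Type (u + 1)} [AddCommGroup M] [Module A M]

/-- The map from the norm to the tensor power, with an enumeration of the basis. -/
def NormSplit.value (s : NormSplit φ d ι M) (τ : (Fin d → ι) ≃ κ) : NormMod φ d M →ₗ[R] (κ → R) :=
  (LinearEquiv.funCongrLeft R R τ.symm).toLinearMap.comp s.normEval

theorem NormSplit.value_normProd (s : NormSplit φ d ι M) (τ : (Fin d → ι) ≃ κ) {l : ℕ}
    (b : Fin l → ℕ) (hb : ∑ j, b j = d) (m : Fin l → M) : s.value τ (normProd φ b hb m) =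
      ∑ c : Fin d → Fin l with ∀ j, Finset.card {k | c k = j} = b j,
        tens τ fun k => s.μ (m (c k)) k := by
  funext x
  rw [Finset.sum_apply]
  exact s.normEval_normProd b hb m (τ.symm x)

theorem NormSplit.value_normMk (s : NormSplit φ d ι M) (τ : (Fin d → ι) ≃ κ) (m : M) :
    s.value τ (normMk φ d m) = tens τ (s.μ m) :=
  funext fun x => s.normEval_normMk m (τ.symm x)

theorem sum_comp_perm {N : Type*} [AddCommMonoid N] {l : ℕ} (b : Fin l → ℕ)
    (g : Equiv.Perm (Fin d)) (G : (Fin d → Fin l) → N) :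
    ∑ c : Fin d → Fin l with ∀ j, Finset.card {k | c k = j} = b j, G (fun k => c (g k)) =
      ∑ c : Fin d → Fin l with ∀ j, Finset.card {k | c k = j} = b j, G c := by
  refine Finset.sum_equiv (g.symm.arrowCongr (Equiv.refl _)) (fun c => ?_) (fun c _ => rfl)
  simp only [Finset.mem_filter, Finset.mem_univ, true_and]
  have h : ∀ j, Finset.card {k | (g.symm.arrowCongr (Equiv.refl (Fin l))) c k = j} =
      Finset.card {k | c k = j} := fun j =>
    Finset.card_equiv g fun k => by simp [Equiv.arrowCongr]
  simp only [h]

end Tens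

section Equivariance

variable {S T : Scheme.{u}} {f : T ⟶ S} {F F' : CommRingCat.{u} ⥤ GrpCat.{u}} [PreservesFinPow F]
  [PreservesFinPow F'] {P : RightGSet (onSch F T)} {d : ℕ} {ι κ : Type} {ρ : LinRep F ι}
  {ρ' : LinRep F' κ} {M : OMod T} {D : SegreDatum F F' d} {τ : (Fin d → ι) ≃ κ}

theorem normOnRes_normProd [IsAffineHom f] {U V : Over S} [IsAffine U.left] [IsAffine V.left]
    (v : V ⟶ U) {l : ℕ} (b : Fin l → ℕ) (hb : ∑ j, b j = d)
    (m : Fin l → Sec M ((Over.pullback f).obj U)) :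
    normOnRes f d M v (normProd _ b hb m) =
      normProd _ b hb fun j => res M ((Over.pullback f).map v) (m j) :=
  normMap_normProd (phi_comp f v) _ _ b hb m

theorem normOnRes_comp [IsAffineHom f] {U V W : Over S} [IsAffine U.left] [IsAffine V.left]
    [IsAffine W.left] (v : V ⟶ U) (w : W ⟶ V) (z : NormOn f d M U) :
    normOnRes f d M (w ≫ v) z = normOnRes f d M w (normOnRes f d M v z) := by
  refine NormMod.ext_comp (comp_appTop_hom v w) (fun l b hb m => ?_) z
  rw [normOnRes_normProd, normOnRes_normProd, normOnRes_normProd]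
  congr 1
  funext j
  rw [← res_comp, ← Functor.map_comp]

/-- Families of functions may be compared on affine schemes on which a given locally constant
function is constant. -/
theorem fibres_ext_affine {X : Over S} {υ : Type} (i : LocallyConstant X.left υ)
    {v w : κ → Γ(X.left, ⊤)} (h : ∀ (V : Over S) (y : V ⟶ X) (g : υ), IsAffine V.left →
      lcPull y.left i = LocallyConstant.const _ g →
        (fun k => y.left.appTop (v k)) = fun k => y.left.appTop (w k)) : v = w := by
  let R : Sieve X := Sieve.generate fun V v => IsAffine V.left ∧ ∃ g,
    lcPull v.left i = LocallyConstant.const _ g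
  have hR : R ∈ fppf S X := by
    refine fppf_of_affine R (fiberOpen i) (fun x => ⟨i x, rfl⟩) ?_
    intro g V v hV _ hv
    exact Sieve.le_generate _ _ _ ⟨hV, g, LocallyConstant.ext fun y => hv y⟩
  funext k
  refine functions_ext hR ?_
  rintro _ _ ⟨V, y, v, ⟨hV, g, hg⟩, rfl⟩
  rw [Over.comp_left, Scheme.Hom.comp_appTop, CommRingCat.comp_apply, CommRingCat.comp_apply]
  exact congrArg _ (congrFun (h V v g hV hg) k)

namespace SplitIso

variable {X : Over S} (p : SplitIso f P d X)

theorem exists_frm {j : LocallyConstant X.left (Fin d)} {l : Fin d}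
    (hj : j = LocallyConstant.const _ l) : ∃ g : Over.mk (p.pt X (𝟙 X) j).left ⟶ p.fib l,
      g.left = 𝟙 X.left ∧ p.triv X (𝟙 X) j = P.F.map g.op (p.frm l) := by
  subst hj
  exact ⟨𝟙 _, rfl, (map_id_apply' _ _).symm⟩

theorem lcApply_const {W : Scheme.{u}} {σ : LocallyConstant W (Equiv.Perm (Fin d))}
    {g : Equiv.Perm (Fin d)} (h : σ = LocallyConstant.const _ g) (k : Fin d) :
    lcApply σ (LocallyConstant.const W k) = LocallyConstant.const W (g k) := by
  subst h; rfl

theorem coord_act (e : ModFraming P (ρ.lin T) M) (a : WreathSections F d X.left)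
    {g : Equiv.Perm (Fin d)} (ha : a.right = LocallyConstant.const _ g)
    (m : Sec M ((Over.pullback f).obj X)) (k : Fin d) :
    (p.act a).coord e m k = ρ.act (a.left (g k))⁻¹ (p.coord e m (g k)) := by
  have ha' : lcPull (𝟙 X : X ⟶ X).left a.right = LocallyConstant.const _ g := by
    rw [ha]; rfl
  obtain ⟨y, hy, hy'⟩ := p.exists_frm (lcApply_const ha' k)
  have h1 : (glue F (lcApply (lcPull (𝟙 X : X ⟶ X).left a.right) (LocallyConstant.const _ k))
      fun k => F.map (𝟙 X : X ⟶ X).left.appTop (a.left k)) = a.left (g k) := by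
    rw [lcApply_const ha' k, glue_const]
    exact map_appTop_id _
  refine p.coord_congr (q := p.act a) e (k := g k) (l := k) y hy (a.left (g k)) ?_ m
  exact congrArg₂ P.act hy' h1

variable (hM : Presieve.IsSheaf (fppf T) (secF M)) (e : ModFraming P (ρ.lin T) M)

/-- The coordinates of an element of the norm of `M`. -/
def normVal (τ : (Fin d → ι) ≃ κ) : NormOn f d M X →ₗ[Γ(X.left, ⊤)] (κ → Γ(X.left, ⊤)) :=
  (p.normSplit hM e).value τ

theorem normVal_normProd {l : ℕ} (b : Fin l → ℕ) (hb : ∑ j, b j = d)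
    (m : Fin l → Sec M ((Over.pullback f).obj X)) : p.normVal hM e τ (normProd _ b hb m) =
      ∑ c : Fin d → Fin l with ∀ j, Finset.card {k | c k = j} = b j,
        tens τ fun k => p.coord e (m (c k)) k :=
  (p.normSplit hM e).value_normProd τ b hb m

theorem normVal_normMk (m : Sec M ((Over.pullback f).obj X)) :
    p.normVal hM e τ (normMk _ d m) = tens τ (p.coord e m) :=
  (p.normSplit hM e).value_normMk τ m

theorem normVal_res [IsAffineHom f] {U V : Over S} [IsAffine U.left] [IsAffine V.left]
    (p : SplitIso f P d U) (v : V ⟶ U) (z : NormOn f d M U) :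
    (p.res v).normVal hM e τ (normOnRes f d M v z) =
      fun i => v.left.appTop (p.normVal hM e τ z i) := by
  let k : NormOn f d M U →ₛₗ[v.left.appTop.hom] (κ → Γ(V.left, ⊤)) :=
    (coordMap v.left.appTop.hom κ).comp (p.normVal hM e τ)
  refine (NormMod.ext_comp (k := k) (RingHom.id_comp _).symm (fun l b hb m => ?_) z).symm
  change coordMap v.left.appTop.hom κ (p.normVal hM e τ _) = _
  rw [normOnRes_normProd, normVal_normProd, normVal_normProd]
  funext i
  rw [Finset.sum_apply]
  refine (congrArg v.left.appTop.hom (Finset.sum_apply i _ _)).trans ?_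
  refine (map_sum v.left.appTop.hom _ _).trans ?_
  refine Finset.sum_congr rfl fun c _ => ?_
  refine (map_prod v.left.appTop.hom _ _).trans ?_
  refine Finset.prod_congr rfl fun k _ => ?_
  exact (congrFun (p.coord_res e v (m (c k)) k) _).symm

/-- Equivariance of the value of the norm for a constant permutation: sections of the group act on
the factors of a tensor product, and a permutation permutes the factors in the sum over
distributions. -/
theorem normVal_act_const (hD : D.IsTensor ρ ρ' τ) (a : WreathSections F d X.left)
    {g : Equiv.Perm (Fin d)} (ha : a.right = LocallyConstant.const _ g) (z : NormOn f d M X) :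
    ρ'.act (D.homSections X.left a) ((p.act a).normVal hM e τ z) = p.normVal hM e τ z := by
  have h1 : D.homSections X.left a = D.seg _ a.left * D.perm _ g := by
    change D.seg _ a.left * glue F' a.right (fun g => D.perm _ g) = _
    rw [ha, glue_const]
  refine (NormMod.ext_comp (k := p.normVal hM e τ) (f := (p.act a).normVal hM e τ)
    (g := (ρ'.act (D.homSections X.left a)).toLinearMap) (RingHom.id_comp _).symm
    (fun l b hb m => ?_) z).symm
  rw [normVal_normProd, normVal_normProd, LinearEquiv.coe_coe, h1, map_mul, map_sum]
  symm
  refine Eq.trans (Finset.sum_congr rfl fun c _ => ?_) (sum_comp_perm b g⁻¹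
    fun c => tens τ fun k => p.coord e (m (c k)) k)
  rw [LinearEquiv.mul_apply, hD.perm, hD.seg]
  congr 1
  funext k
  have hk : g (g⁻¹ k) = k := g.apply_symm_apply k
  rw [p.coord_act e a ha, hk, map_inv]
  exact (ρ.act (a.left k)).apply_symm_apply _

theorem act_res {V : Over S} (v : V ⟶ X) (a : WreathSections F d X.left) :
    (p.res v).act (wreathRes F d v.left a) = (p.act a).res v :=
  ((splitIsos f P d).act_map v.op p a).symm

theorem _root_.SegreNorm.SegreDatum.map_homSections {V : Over S} (v : V ⟶ X)
    (a : WreathSections F d X.left) : F'.map v.left.appTop (D.homSections X.left a) =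
      D.homSections V.left (wreathRes F d v.left a) :=
  (ConcreteCategory.congr_hom ((D.hom S).naturality v.op) a).symm

theorem normVal_act [IsAffineHom f] [IsAffine X.left] (hD : D.IsTensor ρ ρ' τ)
    (a : WreathSections F d X.left) (z : NormOn f d M X) :
    ρ'.act (D.homSections X.left a) ((p.act a).normVal hM e τ z) = p.normVal hM e τ z := by
  refine fibres_ext_affine a.right fun V v σ hV hσ => ?_
  have h2 := (p.res v).normVal_act_const hM e hD (wreathRes F d v.left a) hσ
    (normOnRes f d M v z)
  have h3 := (p.act a).normVal_res hM e (τ := τ) v z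
  have h4 := p.normVal_res hM e (τ := τ) v z
  have h5 := D.map_homSections v a
  rw [p.act_res, h3, h4] at h2
  refine (ρ'.act_map v.left.appTop _ _).trans (Eq.trans ?_ h2)
  exact congrArg (fun g => ρ'.act g fun i =>
    v.left.appTop ((p.act a).normVal hM e τ z i)) h5

end SplitIso

end Equivariance

/-! ### The norm after an fppf base change -/

/-- A base change along the second map of a cocartesian square of rings is a base change along the
first. -/
theorem IsBC.modOver {R A S B : CommRingCat.{u}} {φ : R ⟶ A} {ψ : S ⟶ B} {ρ : R ⟶ S} {τ : A ⟶ B}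
    (sq : IsPushout ρ φ ψ τ) {M N : Type (u + 1)} [AddCommGroup M] [Module A M] [AddCommGroup N]
    [Module B N] (comm : τ.hom.comp φ.hom = ψ.hom.comp ρ.hom) {g : M →ₛₗ[τ.hom] N}
    (hg : IsBC τ.hom g) : IsBC ρ.hom (modOverMap (φ := φ.hom) (ψ := ψ.hom) comm g) := by
  algebraize [φ.hom, ψ.hom, ρ.hom, τ.hom, τ.hom.comp φ.hom]
  have t1 : IsScalarTower R S B := .of_algebraMap_eq' comm
  have t2 : IsScalarTower R A B := .of_algebraMap_eq' rfl
  have hp : Algebra.IsPushout R S A B := CommRingCat.isPushout_iff_isPushout.1 sq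
  let i1 : Module A (ModOver φ.hom M) := inferInstanceAs (Module A M)
  have i2 : IsScalarTower R A (ModOver φ.hom M) := ⟨fun r a m => by
    rw [Algebra.smul_def]; exact mul_smul (φ r) a (show M from m)⟩
  let c := Algebra.IsPushout.cancelBaseChange R S A B (ModOver φ.hom M)
  obtain ⟨e, he⟩ := hg.bijective_lift
  let L : TensorProduct R S (ModOver φ.hom M) →+ ModOver ψ.hom N :=
    e.toLinearMap.toAddMonoidHom.comp c.symm.toLinearMap.toAddMonoidHom
  refine IsBC.of_equiv ⟨{ L with map_smul' := fun s x => ?_ }, fun n => ?_, ?_⟩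
  · change e (c.symm (s • x)) = ψ s • e (c.symm x)
    rw [map_smul]
    refine (congrArg e (algebraMap_smul B s (c.symm x)).symm).trans ?_
    exact e.map_smul _ _
  · change e (c.symm (TensorProduct.tmul R 1 n)) = g n
    have : c.symm (TensorProduct.tmul R 1 n) = TensorProduct.tmul A 1 n :=
      (LinearEquiv.symm_apply_eq _).2 (Algebra.IsPushout.cancelBaseChange_tmul R S A B (ModOver φ.hom M) n).symm
    rw [this]
    exact (he 1 n).trans (one_smul _ _)
  · exact e.bijective.comp c.symm.bijective

theorem span_range_of_isPushout {R A S B : CommRingCat.{u}} {φ : R ⟶ A} {ψ : S ⟶ B} {ρ : R ⟶ S}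
    {τ : A ⟶ B} (sq : IsPushout ρ φ ψ τ) :
    letI := ψ.hom.toAlgebra; Submodule.span S (Set.range τ.hom) = ⊤ := by
  have comm : τ.hom.comp φ.hom = ψ.hom.comp ρ.hom := (congrArg CommRingCat.Hom.hom sq.w).symm
  algebraize [φ.hom, ψ.hom, ρ.hom, τ.hom, τ.hom.comp φ.hom]
  have t1 : IsScalarTower R S B := .of_algebraMap_eq' comm
  have t2 : IsScalarTower R A B := .of_algebraMap_eq' rfl
  have hp : Algebra.IsPushout R S A B := CommRingCat.isPushout_iff_isPushout.1 sq
  have hb : IsBaseChange S (IsScalarTower.toAlgHom R A B).toLinearMap := hp.out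
  rw [Submodule.eq_top_iff']
  intro x
  refine hb.inductionOn x (· ∈ Submodule.span S (Set.range τ.hom)) (zero_mem _)
    (fun a => Submodule.subset_span ⟨a, rfl⟩) (fun s _ h => Submodule.smul_mem _ s h)
    fun _ _ h h' => add_mem h h'

theorem IsBC.linearEquiv_comp {A B : Type*} [CommRing A] [CommRing B] {ρ : A →+* B}
    {N N' N'' : Type*} [AddCommGroup N] [Module A N] [AddCommGroup N'] [Module B N']
    [AddCommGroup N''] [Module B N''] {g : N →ₛₗ[ρ] N'} (hg : IsBC ρ g) (e : N' ≃ₗ[B] N'') :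
    IsBC ρ (e.toLinearMap.comp g) := by
  obtain ⟨L, hL⟩ := hg.bijective_lift
  let := ρ.toAlgebra
  refine IsBC.of_equiv ⟨e.toLinearMap.comp L.toLinearMap, fun n => ?_, e.bijective.comp L.bijective⟩
  change e (L _) = e (g n)
  rw [hL, one_smul]

/-- A finite flat algebra of finite presentation is projective, hence has a dual basis. -/
theorem exists_dualBasis {R A : Type u} [CommRing R] [CommRing A] {φ : R →+* A} (h1 : φ.Finite)
    (h2 : φ.Flat) (h3 : φ.FinitePresentation) : ∃ n, Nonempty (DualBasis φ n) := by
  let := φ.toAlgebra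
  have : Module.Finite R A := h1
  have : Module.Flat R A := h2
  have : Algebra.FinitePresentation R A := h3
  have : Module.FinitePresentation R A := .of_finite_of_finitePresentation R A
  have : Module.Projective R A := Module.Flat.projective_of_finitePresentation
  obtain ⟨n, p, hp⟩ := Module.Finite.exists_fin' R A
  obtain ⟨s, hs⟩ := Module.projective_lifting_property p LinearMap.id hp
  refine ⟨n, ⟨{
    x := fun j => p (Pi.single j 1)
    f := fun j => ((LinearMap.proj j).comp s).toAddMonoidHom
    f_smul := fun j r a => congrFun (s.map_smul r a) j
    sum_eq := fun a => ?_ }⟩⟩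
  refine Eq.trans ?_ (LinearMap.congr_fun hs a)
  change _ = p (s a)
  conv_rhs => rw [← Finset.univ_sum_single (s a), map_sum]
  refine Finset.sum_congr rfl fun j _ => ?_
  have : (Pi.single j (s a j) : Fin n → R) = s a j • Pi.single j 1 := by
    rw [← Pi.single_smul, smul_eq_mul, mul_one]
  rw [this, map_smul]
  rfl

section Geometry

variable {S T : Scheme.{u}} {f : T ⟶ S} {F : CommRingCat.{u} ⥤ GrpCat.{u}} [PreservesFinPow F]
  {P : RightGSet (onSch F T)} {d : ℕ} {ι κ : Type} {ρ : LinRep F ι} {M : OMod T}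

theorem IsAffCover.pullback [IsAffineHom f] {U V : Over S} {v : V ⟶ U} (hv : IsAffCover v) :
    IsAffCover ((Over.pullback f).map v) := by
  have := hv.isAffine
  have := hv.flat
  have := hv.surjective
  have := hv.locallyOfFinitePresentation
  have h := isPullback_pullback f v
  refine ⟨?_, ?_, ?_, ?_⟩
  · change IsAffine (Limits.pullback V.hom f)
    exact isAffine_of_isAffineHom (Limits.pullback.fst V.hom f)
  · exact MorphismProperty.of_isPullback h inferInstance
  · exact MorphismProperty.of_isPullback h inferInstance
  · exact MorphismProperty.of_isPullback h inferInstance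

variable [IsFinite f] [Etale f]

theorem isBC_normVal [Fintype ι] (hP : IsTorsor (fppf T) P)
    (hM : Presieve.IsSheaf (fppf T) (secF M)) (e : ModFraming P (ρ.lin T) M) (τ : (Fin d → ι) ≃ κ)
    {U V : Over S} [IsAffine U.left] [IsAffine V.left] {v : V ⟶ U} (hv : IsAffCover v)
    (p : SplitIso f P d V) :
    IsBC v.left.appTop.hom ((p.normVal hM e τ).comp (normOnRes f d M v)) := by
  have : IsAffine ((Over.pullback f).obj U).left := by
    change IsAffine (Limits.pullback U.hom f)
    exact isAffine_of_isAffineHom (Limits.pullback.fst U.hom f)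
  have : Flat f := inferInstance
  let g := Limits.pullback.fst U.hom f
  obtain ⟨n, ⟨D⟩⟩ := exists_dualBasis (φ := (phi f U).hom) g.finite_appTop g.flat_appTop
    g.finitePresentation_appTop
  obtain ⟨q, -⟩ := (p.bijective_sect hP.isSheaf).2 fun k => p.frm k
  have h1 := isBC_res_of_cover hM hv.pullback (e.freeSec q)
  have h2 := IsBC.modOver (φ := phi f U) (ψ := phi f V) (isPushout_appTop_of_isPullback (isPullback_pullback f v))
    (phi_comp f v) h1
  have hτ := span_range_of_isPushout (φ := phi f U) (ψ := phi f V)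
    (isPushout_appTop_of_isPullback (isPullback_pullback f v))
  have h3 := isBC_normEval (phi_comp f v) (SegreNorm.res M ((Over.pullback f).map v))
    (phi_dualBasis f v) (p.normSplit hM e) D hτ h2
  exact h3.linearEquiv_comp (LinearEquiv.funCongrLeft Γ(V.left, ⊤) Γ(V.left, ⊤) τ.symm)

end Geometry

/-! ### The norm as an associated module -/

section NormAssoc

variable {S T : Scheme.{u}} {f : T ⟶ S} [IsAffineHom f] {F F' : CommRingCat.{u} ⥤ GrpCat.{u}}
  [PreservesFinPow F] [PreservesFinPow F'] {P : RightGSet (onSch F T)} {d : ℕ} {ι κ : Type}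
  {ρ : LinRep F ι} {ρ' : LinRep F' κ} {M : OMod T} {D : SegreDatum F F' d} {τ : (Fin d → ι) ≃ κ}

theorem vec_ext_affine {Z : Over S} {v w : κ → Γ(Z.left, ⊤)}
    (h : ∀ (V : Over S) (y : V ⟶ Z) [IsAffine V.left],
      (fun i => y.left.appTop (v i)) = fun i => y.left.appTop (w i)) : v = w :=
  sheaf_ext_affine (isSheaf_powF κ) fun V y hV => @h V y hV

theorem SplitIso.res_res {Z V W : Over S} (p : SplitIso f P d Z) (y : V ⟶ Z) (x : W ⟶ V) :
    (p.res y).res x = p.res (x ≫ y) :=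
  ((splitIsos f P d).map_comp_apply y.op x.op p).symm

theorem appTop_appTop {Z V W : Over S} (y : V ⟶ Z) (x : W ⟶ V) (a : Γ(Z.left, ⊤)) :
    x.left.appTop (y.left.appTop a) = (x ≫ y).left.appTop a := by
  rw [Over.comp_left, Scheme.Hom.comp_appTop]; rfl

theorem NormSec.app_congr {X U : Over S} [IsAffine U.left] (s : NormSec f d M X) {x x' : U ⟶ X}
    (h : x = x') : s.app U x = s.app U x' := by rw [h]

variable (hM : Presieve.IsSheaf (fppf T) (secF M)) (e : ModFraming P (ρ.lin T) M)

namespace NormSec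

variable {X : Over S}

variable (τ) in
theorem exists_val (s : NormSec f d M X) {Z : Over S} (z : Z ⟶ X) (p : SplitIso f P d Z) :
    ∃ v : κ → Γ(Z.left, ⊤), ∀ (V : Over S) (y : V ⟶ Z) [IsAffine V.left],
      (fun i => y.left.appTop (v i)) = (p.res y).normVal hM e τ (s.app V (y ≫ z)) := by
  obtain ⟨v, hv⟩ := sheaf_glue_affine (isSheaf_powF κ) (X := Z)
    (fun V y _ => (p.res y).normVal hM e τ (s.app V (y ≫ z))) fun U V u v hU hV => by
      refine ((p.res u).normVal_res hM e v _).symm.trans ?_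
      rw [s.app_map, p.res_res, s.app_congr (Category.assoc _ _ _)]
  exact ⟨v, fun V y hV => hv V y hV⟩

variable (τ) in
/-- The coordinates of a section of the norm. -/
def val (s : NormSec f d M X) {Z : Over S} (z : Z ⟶ X) (p : SplitIso f P d Z) : κ → Γ(Z.left, ⊤) :=
  (s.exists_val τ hM e z p).choose

theorem appTop_val (s : NormSec f d M X) {Z V : Over S} (z : Z ⟶ X) (p : SplitIso f P d Z)
    (y : V ⟶ Z) [IsAffine V.left] : (fun i => y.left.appTop (s.val τ hM e z p i)) =
      (p.res y).normVal hM e τ (s.app V (y ≫ z)) :=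
  (s.exists_val τ hM e z p).choose_spec V y

theorem val_of_isAffine (s : NormSec f d M X) {Z : Over S} [IsAffine Z.left] (z : Z ⟶ X)
    (p : SplitIso f P d Z) : s.val τ hM e z p = p.normVal hM e τ (s.app Z z) := by
  have h := s.appTop_val (τ := τ) hM e z p (𝟙 Z)
  have h1 : p.res (𝟙 Z) = p := (splitIsos f P d).map_id_apply p
  rw [h1, s.app_congr (Category.id_comp z)] at h
  refine Eq.trans (funext fun i => ?_) h
  exact (ConcreteCategory.congr_hom Scheme.Hom.id_appTop _).symm

theorem val_res (s : NormSec f d M X) {Z W : Over S} (z : Z ⟶ X) (w : W ⟶ Z)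
    (p : SplitIso f P d Z) : s.val τ hM e (w ≫ z) (p.res w) =
      fun i => w.left.appTop (s.val τ hM e z p i) :=
  vec_ext_affine fun V y _ => by
    refine (s.appTop_val hM e (w ≫ z) (p.res w) y).trans ?_
    rw [SplitIso.res_res, s.app_congr (Category.assoc y w z).symm]
    refine (s.appTop_val hM e z p (y ≫ w)).symm.trans ?_
    exact funext fun i => (appTop_appTop _ _ _).symm

theorem val_act (hD : D.IsTensor ρ ρ' τ) (s : NormSec f d M X) {Z : Over S} (z : Z ⟶ X)
    (p : SplitIso f P d Z) (a : WreathSections F d Z.left) :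
    ρ'.act (D.homSections Z.left a) (s.val τ hM e z (p.act a)) = s.val τ hM e z p :=
  vec_ext_affine fun V y _ => by
    refine (ρ'.act_map y.left.appTop _ _).trans ?_
    rw [s.appTop_val hM e z p y]
    refine Eq.trans ?_ ((p.res y).normVal_act hM e hD (wreathRes F d y.left a) (s.app V (y ≫ z)))
    rw [p.act_res, ← s.appTop_val hM e z (p.act a) y]
    exact congrArg (fun g => ρ'.act g _) (D.map_homSections y a)

variable (hD : D.IsTensor ρ ρ' τ)

/-- The section of the associated module given by the coordinates. -/
def toAssoc (s : NormSec f d M X) :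
    AssocSec (splitIsos f P d) ((ρ'.lin S).comp (D.hom S)) X :=
  AssocSec.mk' (fun Z z p => s.val τ hM e z p)
    (fun Z W z w p => s.val_res hM e z w p)
    (fun Z z p a => by
      refine Eq.trans ?_ (congrArg _ (s.val_act hM e hD z p a))
      rw [map_inv]
      exact ((ρ'.act _).symm_apply_apply _).symm)

/-- The comparison of the norm with the associated module. -/
def toAssocLin (X : Over S) : NormSec f d M X →ₗ[Γ(X.left, ⊤)]
    AssocSec (splitIsos f P d) ((ρ'.lin S).comp (D.hom S)) X where
  toFun s := s.toAssoc hM e hD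
  map_add' s t := AssocSec.ext_val fun Z z p => vec_ext_affine fun V y _ => by
    refine ((s + t).appTop_val hM e z p y).trans ((map_add _ _ _).trans ?_)
    rw [← s.appTop_val hM e z p y, ← t.appTop_val hM e z p y]
    exact funext fun i => (map_add y.left.appTop.hom _ _).symm
  map_smul' a s := AssocSec.ext_val fun Z z p => vec_ext_affine fun V y _ => by
    refine ((a • s).appTop_val hM e z p y).trans ((map_smul _ _ _).trans ?_)
    rw [← s.appTop_val hM e z p y, ← appTop_appTop]
    exact funext fun i => (map_mul y.left.appTop.hom _ _).symm

theorem toAssoc_res (s : NormSec f d M X) {Y : Over S} (y : Y ⟶ X) :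
    (NormSec.res y s).toAssoc hM e hD = EqvSec.res y (s.toAssoc hM e hD) :=
  AssocSec.ext_val fun Z z p => vec_ext_affine fun V v _ => by
    refine ((NormSec.res y s).appTop_val hM e z p v).trans ?_
    refine Eq.trans ?_ (s.appTop_val hM e (z ≫ y) p v).symm
    exact congrArg _ (s.app_congr (Category.assoc v z y))

end NormSec

/-- The section of the norm over an affine scheme given by an element of the norm. -/
def NormSec.ofNorm {U : Over S} [IsAffine U.left] :
    NormOn f d M U →ₗ[Γ(U.left, ⊤)] NormSec f d M U where
  toFun n := ⟨fun V _ v => normOnRes f d M v n, fun V W _ _ v w => (normOnRes_comp v w n).symm⟩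
  map_add' m n := NormSec.ext_app fun V _ v => map_add _ _ _
  map_smul' a n := NormSec.ext_app fun V _ v => map_smulₛₗ _ _ _

theorem NormSec.ofNorm_app {U : Over S} [IsAffine U.left] (s : NormSec f d M U) :
    NormSec.ofNorm (f := f) (d := d) (M := M) (s.app U (𝟙 U)) = s :=
  NormSec.ext_app fun V _ v => (s.app_map U V (𝟙 U) v).trans (s.app_congr (Category.comp_id v))

end NormAssoc

section Bijective

variable {S T : Scheme.{u}} {f : T ⟶ S} {F F' : CommRingCat.{u} ⥤ GrpCat.{u}}
  [PreservesFinPow F] [PreservesFinPow F'] {P : RightGSet (onSch F T)} {d : ℕ} {ι κ : Type}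
  {ρ : LinRep F ι} {ρ' : LinRep F' κ} {M : OMod T} {D : SegreDatum F F' d} {τ : (Fin d → ι) ≃ κ}
  (hM : Presieve.IsSheaf (fppf T) (secF M)) (e : ModFraming P (ρ.lin T) M)
  [IsFinite f] [Etale f] [Fintype ι] [Finite κ] (hP : IsTorsor (fppf T) P)
  (hT : IsTorsor (fppf S) (splitIsos f P d)) (hD : D.IsTensor ρ ρ' τ)

include hP hT in
/-- Over an affine scheme, the norm is the associated module: over a cover where the torsor has a
point both become the tensor product of the components, and the comparison descends. -/
theorem NormSec.bijective_of_isAffine (U : Over S) [IsAffine U.left] :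
    Function.Bijective (NormSec.toAssocLin (f := f) hM e hD U) := by
  obtain ⟨R, hR, hne⟩ := hT.locally_nonempty U
  obtain ⟨V, v, h1, h2, h3, h4, ⟨p⟩⟩ := exists_affine_cover hT.isSheaf hR hne
  have hv : IsAffCover v := ⟨h1, h2, h3, h4⟩
  let L := (ρ'.lin S).comp (D.hom S)
  let E := assocFraming hT L
  have hK := isBC_normVal hP hM e τ hv p
  have hh : IsBC v.left.appTop.hom (SegreNorm.res (assocMod (splitIsos f P d) L) v) :=
    isBC_res_of_cover (isSheaf_assocMod _ _) hv (E.freeSec p)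
  have hh' := hh.linearEquiv_comp (E.app p).symm
  let c : NormOn f d M U →ₗ[Γ(U.left, ⊤)] NormSec f d M U := NormSec.ofNorm
  let g : NormOn f d M U →ₗ[Γ(U.left, ⊤)] Sec (assocMod (splitIsos f P d) L) U :=
    (NormSec.toAssocLin hM e hD U).comp c
  -- a map which becomes a base change along the cover is bijective
  have hg : IsBC (RingHom.id _) g := by
    refine IsBC.of_comp rfl (fun n => ?_) hv.faithfullyFlat hK hh'
    have h5 := (c n).val_of_isAffine (τ := τ) hM e v p
    refine h5.symm.trans ?_
    exact congrArg (fun v => (c n).val τ hM e v p) (Category.id_comp v).symm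
  have hb := hg.bijective
  refine ⟨fun s t hst => ?_, fun t => ?_⟩
  · have hs : c (s.app U (𝟙 U)) = s := s.ofNorm_app
    have ht : c (t.app U (𝟙 U)) = t := t.ofNorm_app
    rw [← hs, ← ht] at hst ⊢
    exact congrArg c (hb.1 hst)
  · obtain ⟨n, hn⟩ := hb.2 t
    exact ⟨c n, hn⟩

include hP hT in
/-- The affine case determines the comparison everywhere, since a section of the norm is a
compatible family of sections over affine schemes. -/
theorem NormSec.bijective_toAssocLin (X : Over S) :
    Function.Bijective (NormSec.toAssocLin (f := f) hM e hD X) := by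
  have hb := fun (U : Over S) [IsAffine U.left] =>
    NormSec.bijective_of_isAffine hM e hP hT hD U
  refine ⟨fun s t hst => NormSec.ext_app fun U _ x => ?_, fun t => ?_⟩
  · have h : NormSec.res x s = NormSec.res x t := (hb U).1 (by
      refine (s.toAssoc_res hM e hD x).trans (Eq.trans ?_ (t.toAssoc_res hM e hD x).symm)
      exact congrArg (EqvSec.res x) hst)
    have h' := congrArg (fun r : NormSec f d M U => r.app U (𝟙 U)) h
    exact ((s.app_congr (Category.id_comp x)).symm.trans h').trans (t.app_congr (Category.id_comp x))
  · choose n hn using fun (U : Over S) (hU : IsAffine U.left) (x : U ⟶ X) =>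
      (hb U).2 (EqvSec.res x t)
    have hres : ∀ (U V : Over S) (hU : IsAffine U.left) (hV : IsAffine V.left) (x : U ⟶ X)
        (v : V ⟶ U), NormSec.res v (n U hU x) = n V hV (v ≫ x) := by
      intro U V hU hV x v
      refine (hb V).1 (((n U hU x).toAssoc_res hM e hD v).trans
        (Eq.trans ?_ (hn V hV (v ≫ x)).symm))
      refine (congrArg (EqvSec.res v) (hn U hU x)).trans ?_
      exact AssocSec.ext_val fun Z z p => t.app_congr (Category.assoc z v x) p
    refine ⟨⟨fun U hU x => (n U hU x).app U (𝟙 U), fun U V hU hV x v => ?_⟩, ?_⟩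
    · rw [(n U hU x).app_map, ← hres U V hU hV x v]
      exact (n U hU x).app_congr ((Category.comp_id v).trans (Category.id_comp v).symm)
    · refine AssocSec.ext_val fun Z z p => vec_ext_affine fun V y hV => ?_
      refine (NormSec.appTop_val hM e _ z p y).trans ?_
      let p' : SplitIso f P d Z := p
      have h1 := (n V hV (y ≫ z)).val_of_isAffine (τ := τ) hM e (𝟙 V) (p'.res y)
      have h2 : (n V hV (y ≫ z)).val τ hM e (𝟙 V) (p'.res y) =
          t.val (𝟙 V ≫ y ≫ z) (p'.res y) :=
        congrArg (fun r : AssocSec (splitIsos f P d) ((ρ'.lin S).comp (D.hom S)) V =>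
          r.val (𝟙 V) (p'.res y)) (hn V hV (y ≫ z))
      have h3 : t.val (y ≫ z) (p'.res y) = fun i => y.left.appTop (t.val z p' i) :=
        AssocSec.val_map t z y p'
      refine h1.symm.trans (h2.trans (Eq.trans ?_ h3))
      exact t.app_congr (Category.id_comp _) _

end Bijective

/-! ### The framing of the norm and the Segre homomorphisms -/

section NormFraming

variable {S T : Scheme.{u}} {f : T ⟶ S} {F F' : CommRingCat.{u} ⥤ GrpCat.{u}}
  [PreservesFinPow F] [PreservesFinPow F'] {P : RightGSet (onSch F T)} {d : ℕ} {ι κ : Type}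
  {ρ : LinRep F ι} {ρ' : LinRep F' κ} {M : OMod T} {D : SegreDatum F F' d} {τ : (Fin d → ι) ≃ κ}
  (hM : Presieve.IsSheaf (fppf T) (secF M)) (e : ModFraming P (ρ.lin T) M)
  [IsFinite f] [Etale f] [Fintype ι] [Finite κ] (hP : IsTorsor (fppf T) P)
  (hT : IsTorsor (fppf S) (splitIsos f P d)) (hD : D.IsTensor ρ ρ' τ)

/-- The isomorphism of the associated module with the norm. -/
def assocEquivNorm (Y : Over S) :
    Sec (assocMod (splitIsos f P d) ((ρ'.lin S).comp (D.hom S))) Y ≃ₗ[Γ(Y.left, ⊤)]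
      Sec (normMod f d M) Y :=
  (LinearEquiv.ofBijective (NormSec.toAssocLin (f := f) hM e hD Y)
    (NormSec.bijective_toAssocLin hM e hP hT hD Y)).symm

theorem res_assocEquivNorm {Y Z : Over S} (z : Z ⟶ Y)
    (m : Sec (assocMod (splitIsos f P d) ((ρ'.lin S).comp (D.hom S))) Y) :
    res (normMod f d M) z (assocEquivNorm hM e hP hT hD Y m) =
      assocEquivNorm hM e hP hT hD Z (res _ z m) := by
  rw [← LinearEquiv.symm_apply_eq]
  obtain ⟨s, rfl⟩ := (assocEquivNorm hM e hP hT hD Y).symm.surjective m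
  rw [LinearEquiv.apply_symm_apply]
  exact NormSec.toAssoc_res hM e hD s z

include hM e hP hT hD in
theorem isSheaf_normMod : Presieve.IsSheaf (fppf S) (secF (normMod f d M)) := by
  refine Presieve.isSheaf_iso _ (P := secF (assocMod (splitIsos f P d)
    ((ρ'.lin S).comp (D.hom S)))) (NatIso.ofComponents (fun Y =>
      (assocEquivNorm hM e hP hT hD Y.unop).toEquiv.toIso) ?_) (isSheaf_assocMod _ _)
  intro Y Z z
  ext m
  exact (res_assocEquivNorm hM e hP hT hD z.unop m).symm

/-- The norm is the module associated with the torsor of isomorphisms from the split pair. -/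
def normFraming : ModFraming (splitIsos f P d) ((ρ'.lin S).comp (D.hom S)) (normMod f d M) :=
  (assocFraming hT _).trans (assocEquivNorm hM e hP hT hD) (res_assocEquivNorm hM e hP hT hD)

theorem res_nu {X Y : Over S} (y : Y ⟶ X) (m : Sec M ((Over.pullback f).obj X)) :
    res (normMod f d M) y (nu f d M X m) = nu f d M Y (res M ((Over.pullback f).map y) m) := by
  refine NormSec.ext_app (f := f) (d := d) (M := M) fun U _ x => ?_
  change normMk _ d (res M ((Over.pullback f).map (x ≫ y)) m) = _
  rw [Functor.map_comp, res_comp]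
  rfl

theorem normFraming_coord {Y : Over S} (p : SplitIso f P d Y)
    (m : Sec M ((Over.pullback f).obj Y)) :
    (normFraming hM e hP hT hD).app (Y := Y) p (tens τ (p.coord e m)) = nu f d M Y m := by
  refine ((normFraming hM e hP hT hD).app (Y := Y) p).symm.injective
    ((LinearEquiv.symm_apply_apply _ _).trans ?_)
  change tens τ (p.coord e m) = NormSec.val τ hM e (nu f d M Y m : NormSec f d M Y) (𝟙 Y) p
  refine vec_ext_affine fun V y _ => ?_
  refine Eq.trans ?_ (NormSec.appTop_val hM e (nu f d M Y m : NormSec f d M Y) (𝟙 Y) p y).symm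
  refine Eq.trans ?_ ((p.res y).normVal_normMk hM e _).symm
  rw [Category.comp_id]
  funext i
  refine (map_prod y.left.appTop.hom _ _).trans ?_
  refine Finset.prod_congr rfl fun k _ => ?_
  exact (congrFun (p.coord_res e y m k) _).symm

end NormFraming

section Segre

variable {R : CommRingCat.{u}} {d r : ℕ}

/-- The matrices in the image of the Segre homomorphism act on tensor products of vectors factor by
factor and by permutation of the factors. -/
theorem isTensor_segreGL (r d : ℕ) :
    (segreGL.{u} r d).IsTensor (glRep r) (glRep (r ^ d)) (tensorIdx r d) where
  seg {R} A v := by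
    funext K
    change (kron fun k => (A k).1).mulVec (tens (tensorIdx r d) v) K =
      ∏ k, (A k).1.mulVec (v k) ((tensorIdx r d).symm K k)
    simp only [Matrix.mulVec, dotProduct]
    rw [Finset.prod_univ_sum, ← (tensorIdx r d).sum_comp, Fintype.piFinset_univ]
    refine Finset.sum_congr rfl fun J _ => ?_
    refine Eq.trans ?_ Finset.prod_mul_distrib.symm
    rw [tens, Equiv.symm_apply_apply]
    obtain ⟨I, rfl⟩ := (tensorIdx r d).surjective K
    rw [Equiv.symm_apply_apply]
    exact congrArg (· * ∏ k, v k (J k)) (kron_apply _ I J)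
  perm {R} g v := by
    funext K
    change (permMat r R g).1.mulVec (tens (tensorIdx r d) v) K = _
    simp only [Matrix.mulVec, dotProduct]
    have h : ∀ L, (permMat r R g).1 K L = if (permIdx r g).symm K = L then 1 else 0 := fun L => by
      rw [permMat_apply]
      simp only [Equiv.symm_apply_eq]
    simp only [h, ite_mul, one_mul, zero_mul, Finset.sum_ite_eq, Finset.mem_univ, if_true]
    obtain ⟨I, rfl⟩ := (tensorIdx r d).surjective K
    have h2 : (permIdx r g).symm (tensorIdx r d I) = tensorIdx r d (fun k => I (g k)) := by
      rw [Equiv.symm_apply_eq, permIdx_tensorIdx]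
      congr 1
      funext k
      exact congrArg I (g.apply_symm_apply k).symm
    rw [h2, tens, tens, Equiv.symm_apply_apply, Equiv.symm_apply_apply]
    refine Fintype.prod_equiv g _ _ fun k => ?_
    exact congrArg (fun l => v l (I (g k))) (g.symm_apply_apply k).symm

/-- The numbering of the entries of matrices of size `r ^ d` by families of entries of matrices of
size `r`. -/
def pairIdx (r d : ℕ) : (Fin d → Fin r × Fin r) ≃ Fin (r ^ d) × Fin (r ^ d) :=
  (Equiv.arrowProdEquivProdArrow (Fin d) _ _).trans
    (Equiv.prodCongr (tensorIdx r d) (tensorIdx r d))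

theorem matVec_tens (v : Fin d → Fin r × Fin r → R) :
    matVec (r ^ d) R (tens (pairIdx r d) v) = kron fun k => matVec r R (v k) := rfl

/-- The analogue for matrix algebras, with tensor products of matrices for those of vectors. -/
theorem isTensor_segrePGL (r d : ℕ) :
    (segrePGL.{u} r d).IsTensor (pglRep r) (pglRep (r ^ d)) (pairIdx r d) where
  seg {R} A v := (matVec (r ^ d) R).injective (tensorAut_kron A fun k => matVec r R (v k))
  perm {R} g v := (matVec (r ^ d) R).injective (permAut_kron g fun k => matVec r R (v k))

end Segre

section Algebra

variable {S T : Scheme.{u}} {f : T ⟶ S} {d r : ℕ} {P : RightGSet (onSch (PGLFun.{u} r) T)}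
  {M : OMod T} {A : AlgStr M} (e : ModFraming P ((pglRep r).lin T) M) (he : e.IsAlg A)

theorem matVec_app_symm_one (he : e.IsAlg A) {Y : Over T} (q : P.F.obj (op Y)) :
    matVec r _ ((e.app q).symm (A.one Y)) = 1 := by
  rw [← he.app_one q, LinearEquiv.symm_apply_apply]
  exact (matVec r _).apply_symm_apply 1

theorem matVec_app_symm_mul (he : e.IsAlg A) {Y : Over T} (q : P.F.obj (op Y)) (a b : Sec M Y) :
    matVec r _ ((e.app q).symm (A.mul Y a b)) =
      matVec r _ ((e.app q).symm a) * matVec r _ ((e.app q).symm b) := by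
  refine (matVec r _).symm.injective ((e.app q).injective ?_)
  rw [he.app_mul, LinearEquiv.symm_apply_apply, LinearEquiv.symm_apply_apply,
    LinearEquiv.symm_apply_apply, LinearEquiv.apply_symm_apply, LinearEquiv.apply_symm_apply,
    LinearEquiv.apply_symm_apply]

/-- The Kronecker product of the coordinates of a section of an algebra. -/
def SplitIso.kronCoord {Y : Over S} (p : SplitIso f P d Y) (m : Sec M ((Over.pullback f).obj Y)) :
    Matrix (Fin (r ^ d)) (Fin (r ^ d)) Γ(Y.left, ⊤) := kron fun k => matVec r _ (p.coord e m k)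

theorem SplitIso.kronCoord_one (he : e.IsAlg A) {Y : Over S} (p : SplitIso f P d Y) :
    p.kronCoord e (A.one _) = 1 := by
  refine (congrArg kron (funext fun k => ?_)).trans kron_one
  refine (congrArg (fun m => matVec r _ ((e.app (p.frm k)).symm m)) (A.res_one (p.sect k))).trans ?_
  exact matVec_app_symm_one e he (p.frm k)

theorem SplitIso.kronCoord_mul (he : e.IsAlg A) {Y : Over S} (p : SplitIso f P d Y)
    (a b : Sec M ((Over.pullback f).obj Y)) :
    p.kronCoord e (A.mul _ a b) = p.kronCoord e a * p.kronCoord e b := by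
  refine (congrArg kron (funext fun k => ?_)).trans (kron_mul _ _)
  refine (congrArg (fun m => matVec r _ ((e.app (p.frm k)).symm m))
    (A.res_mul (p.sect k) a b)).trans ?_
  exact matVec_app_symm_mul e he (p.frm k) _ _

variable (hM : Presieve.IsSheaf (fppf T) (secF M)) [IsFinite f] [Etale f]
  (hP : IsTorsor (fppf T) P) (hT : IsTorsor (fppf S) (splitIsos f P d))

/-- The framing of the norm of an algebra. -/
def algNormFraming : ModFraming (splitIsos f P d) (((pglRep (r ^ d)).lin S).comp (PSeg r d S))
    (normMod f d M) :=
  normFraming hM e hP hT (isTensor_segrePGL r d)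

theorem algNormFraming_kronCoord {Y : Over S} (p : SplitIso f P d Y)
    (m : Sec M ((Over.pullback f).obj Y)) :
    (algNormFraming e hM hP hT).app (Y := Y) p ((matVec _ _).symm (p.kronCoord e m)) =
      nu f d M Y m :=
  (congrArg ((algNormFraming e hM hP hT).app (Y := Y) p)
    ((LinearEquiv.symm_apply_eq _).2 (matVec_tens _).symm)).trans
    (normFraming_coord hM e hP hT (isTensor_segrePGL r d) p m)

/-- The algebra structures on the norm which are compatible with the universal norm are those for
which the framing consists of isomorphisms of algebras. -/
theorem isAlg_algNormFraming_iff (he : e.IsAlg A) (B : AlgStr (normMod f d M)) :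
    (algNormFraming e hM hP hT).IsAlg B ↔
      (∀ X : Over S, B.one X = nu f d M X (A.one ((Over.pullback f).obj X))) ∧
        ∀ (X : Over S) (a b : Sec M ((Over.pullback f).obj X)),
          B.mul X (nu f d M X a) (nu f d M X b) =
            nu f d M X (A.mul ((Over.pullback f).obj X) a b) := by
  let E := algNormFraming e hM hP hT
  have hE : ∀ {Y : Over S} (p : SplitIso f P d Y) (m : Sec M ((Over.pullback f).obj Y)),
      E.app (Y := Y) p ((matVec _ _).symm (p.kronCoord e m)) = nu f d M Y m :=
    fun p m => algNormFraming_kronCoord e hM hP hT p m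
  have hN := isSheaf_normMod hM e hP hT (isTensor_segrePGL r d)
  constructor
  · intro h
    refine ⟨fun X => sec_ext hN (hT.sieve_mem X) fun Z z ⟨p⟩ => ?_,
      fun X a b => sec_ext hN (hT.sieve_mem X) fun Z z ⟨p⟩ => ?_⟩
    · rw [B.res_one, res_nu, A.res_one, ← hE p, p.kronCoord_one e he]
      exact (h.app_one p).symm
    · rw [B.res_mul, res_nu, res_nu, res_nu, A.res_mul, ← hE p, ← hE p, ← hE p,
        p.kronCoord_mul e he]
      exact (h.app_mul p _ _).symm
  · rintro ⟨h1, h2⟩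
    -- every family of matrices is the family of coordinates of a section
    have hsurj : ∀ {Y : Over S} (p : SplitIso f P d Y)
        (X : Fin d → Matrix (Fin r) (Fin r) Γ(Y.left, ⊤)),
        ∃ m, p.kronCoord e m = kron X := fun p X => by
      obtain ⟨m, hm⟩ := (p.normSplit hM e).μ_bij.2 fun k => (matVec r _).symm (X k)
      refine ⟨m, congrArg kron (funext fun k => ?_)⟩
      refine (congrArg (matVec r _) (congrFun hm k)).trans ?_
      exact (matVec r _).apply_symm_apply _
    refine ⟨fun {Y} p => ?_, fun {Y} p a b => ?_⟩
    · rw [h1 Y]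
      refine Eq.trans ?_ (hE p _)
      exact congrArg (fun X => E.app p ((matVec (r ^ d) Γ(Y.left, ⊤)).symm X))
        (SplitIso.kronCoord_one e he (Y := Y) p).symm
    · let c := (matVec (r ^ d) Γ(Y.left, ⊤)).symm.trans (E.app p)
      have hc : ∀ X, (c.symm (c X)) = X := c.symm_apply_apply
      let β : Matrix (Fin (r ^ d)) (Fin (r ^ d)) Γ(Y.left, ⊤) →ₗ[Γ(Y.left, ⊤)]
          Matrix (Fin (r ^ d)) (Fin (r ^ d)) Γ(Y.left, ⊤) →ₗ[Γ(Y.left, ⊤)]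
          Matrix (Fin (r ^ d)) (Fin (r ^ d)) Γ(Y.left, ⊤) :=
        ((B.mul Y).compl₁₂ c.toLinearMap c.toLinearMap).compr₂ c.symm.toLinearMap
      have hβ : ∀ X Z : Fin d → Matrix (Fin r) (Fin r) Γ(Y.left, ⊤),
          β (kron X) (kron Z) = kron X * kron Z := by
        intro X Z
        obtain ⟨m, hm⟩ := hsurj p X
        obtain ⟨n, hn⟩ := hsurj p Z
        rw [← hm, ← hn, ← p.kronCoord_mul e he]
        change c.symm (B.mul Y (c _) (c _)) = _
        have hc' : ∀ m, c (p.kronCoord e m) = nu f d M Y m := hE p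
        rw [hc', hc', h2, ← hc', hc]
      -- tensor products span the matrix algebra, so products extend in each argument
      have h3 : ∀ (X : Fin d → Matrix (Fin r) (Fin r) Γ(Y.left, ⊤)) b,
          β (kron X) b = kron X * b := fun X b =>
        LinearMap.congr_fun (f := β (kron X)) (g := LinearMap.mulLeft _ (kron X))
          (kron_ext fun Z => hβ X Z) b
      have h4 : β a b = a * b :=
        LinearMap.congr_fun (f := β.flip b) (g := LinearMap.mulRight _ b)
          (kron_ext fun X => h3 X b) a
      change c (a * b) = B.mul Y (c a) (c b)
      rw [← h4]
      exact c.apply_symm_apply _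

end Algebra

section Pairs

variable {S : Scheme.{u}} {d r : ℕ}

theorem ModEt.isSheaf (x : ModEt S d r) : Presieve.IsSheaf (fppf x.T) (secF x.M) :=
  (isSheaf_secF_iff _).2 x.isLocFree.isSheaf

theorem ModEt.isTorsor_isom (x : ModEt S d r) : IsTorsor (fppf S) x.isom :=
  isTorsor_splitIsos x.finrank_eq (isTorsor_frames x.isLocFree)

theorem ModEt.exists_norm (x : ModEt S d r) : ∃ _ : IsLocFree x.norm (r ^ d),
    (x.isom.push (Seg r d S)).Isom (frames x.norm (r ^ d)) := by
  let E := normFraming x.isSheaf (framesFraming x.M r) (isTorsor_frames x.isLocFree)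
    x.isTorsor_isom (isTensor_segreGL r d)
  have hN := isSheaf_normMod x.isSheaf (framesFraming x.M r) (isTorsor_frames x.isLocFree)
    x.isTorsor_isom (isTensor_segreGL r d)
  have h := E.isLocFree x.isTorsor_isom hN
  exact ⟨h, E.isom_push_frames x.isTorsor_isom h⟩

theorem AzuEt.isSheaf (x : AzuEt S d r) : Presieve.IsSheaf (fppf x.T) (secF x.M) :=
  (isSheaf_secF_iff _).2 x.isAzumaya.isSheaf

theorem AzuEt.isTorsor_isom (x : AzuEt S d r) : IsTorsor (fppf S) x.isom :=
  isTorsor_splitIsos x.finrank_eq (isTorsor_algFrames x.isAzumaya)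

/-- The framing of the norm of an Azumaya algebra. -/
def AzuEt.framing (x : AzuEt S d r) :
    ModFraming x.isom (((pglRep (r ^ d)).lin S).comp (PSeg r d S)) x.norm :=
  algNormFraming (algFramesFraming x.A r) x.isSheaf (isTorsor_algFrames x.isAzumaya)
    x.isTorsor_isom

theorem AzuEt.isAlg_framing_iff (x : AzuEt S d r) (B : AlgStr x.norm) :
    x.framing.IsAlg B ↔ x.IsNormAlg B :=
  (isAlg_algNormFraming_iff (algFramesFraming x.A r) x.isSheaf (isTorsor_algFrames x.isAzumaya)
    x.isTorsor_isom (isAlg_algFramesFraming x.A r) B).trans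
    ⟨fun h => ⟨h.1, h.2⟩, fun h => ⟨h.1, h.2⟩⟩

theorem AzuEt.isSheaf_norm (x : AzuEt S d r) : Presieve.IsSheaf (fppf S) (secF x.norm) :=
  isSheaf_normMod x.isSheaf (algFramesFraming x.A r) (isTorsor_algFrames x.isAzumaya)
    x.isTorsor_isom (isTensor_segrePGL r d)

theorem AzuEt.existsUnique_isNormAlg (x : AzuEt S d r) : ∃! B : AlgStr x.norm, x.IsNormAlg B := by
  refine ⟨_, (x.isAlg_framing_iff _).1 ((isAlg_assocFraming x.isTorsor_isom (PSeg r d S)).trans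
    _ (res_assocEquivNorm x.isSheaf (algFramesFraming x.A r) (isTorsor_algFrames x.isAzumaya)
    x.isTorsor_isom (isTensor_segrePGL r d))), fun B hB => ?_⟩
  exact ((x.isAlg_framing_iff B).2 hB).ext x.isTorsor_isom x.isSheaf_norm
    ((isAlg_assocFraming x.isTorsor_isom (PSeg r d S)).trans
    _ (res_assocEquivNorm x.isSheaf (algFramesFraming x.A r) (isTorsor_algFrames x.isAzumaya)
    x.isTorsor_isom (isTensor_segrePGL r d)))

theorem AzuEt.exists_norm (x : AzuEt S d r) {B : AlgStr x.norm} (hB : x.IsNormAlg B) :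
    ∃ _ : IsAzumaya B (r ^ d), (x.isom.push (PSeg r d S)).Isom (algFrames B (r ^ d)) := by
  have h := (x.isAlg_framing_iff B).2 hB
  have h' := h.isAzumaya x.isTorsor_isom x.isSheaf_norm
  exact ⟨h', h.isom_push_frames x.isTorsor_isom h'⟩

end Pairs

/-! ### The sheaf of functions on the twist of the indices -/

section IndexAlgebra

variable {S : Scheme.{u}} {F : CommRingCat.{u} ⥤ GrpCat.{u}} [PreservesFinPow F] {d : ℕ}

/-- The action of a locally constant permutation on functions on the set of indices. -/
def lcPermLin {X : Scheme.{u}} : LocallyConstant X (Equiv.Perm (Fin d)) →*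
    ((Fin d → Γ(X, ⊤)) ≃ₗ[Γ(X, ⊤)] (Fin d → Γ(X, ⊤))) :=
  (LinearMap.GeneralLinearGroup.generalLinearEquiv Γ(X, ⊤)
    (Fin d → Γ(X, ⊤))).toMonoidHom.comp (MonoidHom.toHomUnits
  { toFun := fun σ =>
      { toFun := fun v k => lcEval (lcApply σ⁻¹ (LocallyConstant.const X k)) v
        map_add' := fun v v' => funext fun k => map_add (lcEval _) v v'
        map_smul' := fun a v => funext fun k => eq_of_germ_eq fun x => by
          change _ = X.presheaf.germ ⊤ x trivial (a * _)
          rw [map_mul, germ_lcEval, germ_lcEval, ← map_mul]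
          rfl }
    map_one' := LinearMap.ext fun v => funext fun k => lcEval_const k v
    map_mul' := fun σ τ => LinearMap.ext fun v => funext fun k => eq_of_germ_eq fun x => by
      refine (germ_lcEval _ _ x).trans (Eq.trans ?_ (germ_lcEval _ _ x).symm)
      exact (germ_lcEval (lcApply τ⁻¹ (LocallyConstant.const X
        (lcApply σ⁻¹ (LocallyConstant.const X k) x))) v x).symm })

theorem lcPermLin_apply {X : Scheme.{u}} (σ : LocallyConstant X (Equiv.Perm (Fin d)))
    (v : Fin d → Γ(X, ⊤)) (k : Fin d) :
    lcPermLin σ v k = lcEval (lcApply σ⁻¹ (LocallyConstant.const X k)) v := rfl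

theorem lcEval_lcPermLin {X : Scheme.{u}} (σ : LocallyConstant X (Equiv.Perm (Fin d)))
    (i : LocallyConstant X (Fin d)) (v : Fin d → Γ(X, ⊤)) :
    lcEval i (lcPermLin σ v) = lcEval (lcApply σ⁻¹ i) v :=
  eq_of_germ_eq fun x => by
    rw [germ_lcEval, germ_lcEval, lcPermLin_apply, germ_lcEval]
    rfl

theorem lcPermLin_mul {X : Scheme.{u}} (σ : LocallyConstant X (Equiv.Perm (Fin d)))
    (v v' : Fin d → Γ(X, ⊤)) : lcPermLin σ (v * v') = lcPermLin σ v * lcPermLin σ v' :=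
  funext fun _ => map_mul (lcEval _) v v'

theorem lcPermLin_one {X : Scheme.{u}} (σ : LocallyConstant X (Equiv.Perm (Fin d))) :
    lcPermLin σ (1 : Fin d → Γ(X, ⊤)) = 1 :=
  funext fun _ => map_one (lcEval _)

variable (F d S) in
/-- The action of the semidirect product on functions on the set of indices. -/
def idxLin : LinAct (wreath F d S) (Fin d) where
  act {Y} := (lcPermLin (X := Y.left)).comp SemidirectProduct.rightHom
  act_map {Y Z} z g v := funext fun k => appTop_lcEval z.left _ v

variable (P : RightGSet (wreath F d S))

/-- The algebra of functions on the twist of the set of indices by a torsor. -/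
abbrev IdxAlg (Y : Over S) : Type (u + 1) := AssocSec P (idxLin S F d) Y

namespace IdxAlg

variable {P} {Y : Over S}

instance : One (IdxAlg P Y) := ⟨AssocSec.mk' (fun _ _ _ => 1)
  (fun _ _ _ w _ => funext fun _ => (map_one w.left.appTop.hom).symm)
  (fun _ _ _ _ => (lcPermLin_one _).symm)⟩

instance : Mul (IdxAlg P Y) := ⟨fun s t => AssocSec.mk' (fun _ z p => s.val z p * t.val z p)
  (fun _ _ z w p => by
    rw [AssocSec.val_map, AssocSec.val_map]
    exact funext fun _ => (map_mul w.left.appTop.hom _ _).symm)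
  (fun _ z p g => by
    rw [AssocSec.val_act, AssocSec.val_act]
    exact (lcPermLin_mul _ _ _).symm)⟩

theorem one_val {Z : Over S} (z : Z ⟶ Y) (p : P.F.obj (op Z)) :
    (1 : IdxAlg P Y).val z p = 1 := rfl

instance : CommRing (IdxAlg P Y) where
  __ := (inferInstance : AddCommGroup (IdxAlg P Y))
  left_distrib s t w := AssocSec.ext_val fun _ z p => mul_add (s.val z p) (t.val z p) (w.val z p)
  right_distrib s t w := AssocSec.ext_val fun _ z p => add_mul (s.val z p) (t.val z p) (w.val z p)
  zero_mul s := AssocSec.ext_val fun _ z p => zero_mul (s.val z p)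
  mul_zero s := AssocSec.ext_val fun _ z p => mul_zero (s.val z p)
  mul_assoc s t w := AssocSec.ext_val fun _ z p => mul_assoc (s.val z p) (t.val z p) (w.val z p)
  one_mul s := AssocSec.ext_val fun _ z p => one_mul (s.val z p)
  mul_one s := AssocSec.ext_val fun _ z p => mul_one (s.val z p)
  mul_comm s t := AssocSec.ext_val fun _ z p => mul_comm (s.val z p) (t.val z p)

instance : Algebra Γ(Y.left, ⊤) (IdxAlg P Y) := Algebra.ofModule
  (fun a s t => AssocSec.ext_val fun _ z p => smul_mul_assoc (z.left.appTop a) (s.val z p) _)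
  (fun a s t => AssocSec.ext_val fun _ z p => mul_smul_comm (z.left.appTop a) (s.val z p) _)

theorem algebraMap_val (a : Γ(Y.left, ⊤)) {Z : Over S} (z : Z ⟶ Y) (p : P.F.obj (op Z)) :
    (algebraMap Γ(Y.left, ⊤) (IdxAlg P Y) a).val z p = fun _ => z.left.appTop a := by
  rw [Algebra.algebraMap_eq_smul_one, AssocSec.smul_val, one_val]
  exact funext fun _ => mul_one _

/-- Restriction of functions. -/
def res {Y' : Over S} (y : Y' ⟶ Y) : IdxAlg P Y →+* IdxAlg P Y' where
  toFun := EqvSec.res y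
  map_one' := rfl
  map_mul' _ _ := rfl
  map_zero' := rfl
  map_add' _ _ := rfl

/-- The values of functions at a section of the torsor. -/
def evalHom {Z : Over S} (z : Z ⟶ Y) (p : P.F.obj (op Z)) :
    IdxAlg P Y →+* (Fin d → Γ(Z.left, ⊤)) where
  toFun s := s.val z p
  map_one' := rfl
  map_mul' _ _ := rfl
  map_zero' := rfl
  map_add' _ _ := rfl

/-- The values of functions at a section of the torsor, as a semilinear map. -/
def evalLin {Z : Over S} (z : Z ⟶ Y) (p : P.F.obj (op Z)) :
    IdxAlg P Y →ₛₗ[z.left.appTop.hom] (Fin d → Γ(Z.left, ⊤)) where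
  toFun s := s.val z p
  map_add' _ _ := rfl
  map_smul' _ _ := rfl

variable (hP : IsTorsor (fppf S) P)
include hP

theorem exists_cover (Y : Over S) [IsAffine Y.left] :
    ∃ (V : Over S) (v : V ⟶ Y), IsAffCover v ∧ Nonempty (P.F.obj (op V)) := by
  obtain ⟨R, hR, h⟩ := hP.locally_nonempty Y
  obtain ⟨V, v, h1, h2, h3, h4, h5⟩ := exists_affine_cover hP.isSheaf hR h
  exact ⟨V, v, ⟨h1, h2, h3, h4⟩, h5⟩

theorem isBC_res {U U' : Over S} [IsAffine U.left] [IsAffine U'.left] (u : U' ⟶ U) :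
    IsBC u.left.appTop.hom (SegreNorm.res (assocMod P (idxLin S F d)) u) := by
  obtain ⟨V, v, hv, ⟨p⟩⟩ := exists_cover hP U
  exact SegreNorm.isBC_res (isSheaf_assocMod P _) u hv ((assocFraming hP _).freeSec p)

theorem isBC_evalLin {U U' : Over S} [IsAffine U.left] [IsAffine U'.left] (u : U' ⟶ U)
    (p : P.F.obj (op U')) : IsBC u.left.appTop.hom (evalLin u p) := by
  have h := (isBC_res hP u).linearEquiv_comp ((assocFraming hP (idxLin S F d)).app p).symm
  have e : (((assocFraming hP (idxLin S F d)).app p).symm.toLinearMap.comp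
      (SegreNorm.res (assocMod P (idxLin S F d)) u)) = evalLin u p :=
    LinearMap.ext fun (s : IdxAlg P U) => congrArg (fun t => s.val t p) (Category.id_comp u)
  rwa [e] at h

theorem small (U : Over S) [IsAffine U.left] : Small.{u} (IdxAlg P U) := by
  obtain ⟨V, v, hv, ⟨p⟩⟩ := exists_cover hP U
  refine small_of_injective (f := fun s : IdxAlg P U => s.val v p) fun s t h => ?_
  refine hv.ext (isSheaf_assocMod P (idxLin S F d)) (EqvSec.ext_of_point (J := fppf S) hP p ?_)
  exact (s.app_congr (Category.id_comp v) p).trans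
    (Eq.trans h (t.app_congr (Category.id_comp v) p).symm)

end IdxAlg

/-- A base change of modules which underlies a homomorphism of algebras gives a cocartesian
square of rings. -/
theorem isPushout_of_isBC {A B C D : CommRingCat.{u}} {ρ : A ⟶ B} {α : A ⟶ C} {β : B ⟶ D}
    {g : C ⟶ D} (sq : ρ ≫ β = α ≫ g) {N : Type w} {N' : Type w'} [AddCommGroup N] [Module A N]
    [AddCommGroup N'] [Module B N'] (e : C ≃+ N) (e' : D ≃+ N')
    (he : ∀ a c, e (α a * c) = a • e c) (he' : ∀ b x, e' (β b * x) = b • e' x)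
    {h : N →ₛₗ[ρ.hom] N'} (hh : ∀ c, e' (g c) = h (e c)) (hbc : IsBC ρ.hom h) :
    IsPushout ρ α β g := by
  algebraize [α.hom, β.hom, ρ.hom, g.hom, β.hom.comp ρ.hom]
  have t1 : IsScalarTower A B D := .of_algebraMap_eq' rfl
  have t2 : IsScalarTower A C D := .of_algebraMap_eq' (congrArg CommRingCat.Hom.hom sq)
  refine CommRingCat.isPushout_iff_isPushout.2 ⟨?_⟩
  obtain ⟨L, hL⟩ := hbc.bijective_lift
  let eA : C ≃ₗ[A] N := { e with map_smul' := he }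
  let eB : D ≃ₗ[B] N' := { e' with map_smul' := he' }
  refine IsBaseChange.of_equiv ((eA.baseChange A B C N).trans (L.trans eB.symm)) fun c => ?_
  change eB.symm (L (TensorProduct.tmul A 1 (e c))) = g c
  rw [hL, one_smul, ← hh]
  exact eB.symm_apply_apply (g c)

end IndexAlgebra

/-! ### The twist of the constant scheme of indices -/

section RelativeSpectrum

variable {S : Scheme.{u}}

/-- An affine open subscheme as a scheme over `S`. -/
def ovOpen (U : S.AffineZariskiSite) : Over S := Over.mk U.1.ι

instance (U : S.AffineZariskiSite) : IsAffine (ovOpen U).left := U.2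

/-- The inclusion of affine open subschemes. -/
def ovIncl {U' U : S.AffineZariskiSite} (h : U' ⟶ U) : ovOpen U' ⟶ ovOpen U :=
  Over.homMk (S.homOfLE (Scheme.AffineZariskiSite.toOpens_mono h.le)) (S.homOfLE_ι _)

instance (U : S.AffineZariskiSite) (Z : Over S) : Subsingleton (Z ⟶ ovOpen U) :=
  ⟨fun a b => Over.OverMorphism.ext ((cancel_mono U.1.ι).1 ((Over.w a).trans (Over.w b).symm))⟩

theorem cover_trans {𝒰 : S.OpenCover} [Category 𝒰.I₀] [𝒰.LocallyDirected] [Small.{u} 𝒰.I₀]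
    [Quiver.IsThin 𝒰.I₀] (D : 𝒰.RelativeGluingData) {i j : 𝒰.I₀} (h : i ⟶ j) :
    D.functor.map h ≫ D.cover.f j = D.cover.f i :=
  Limits.colimit.w D.functor h

/-- The relative spectrum of a quasi-coherent algebra, given by its sections over the affine open
subschemes. -/
theorem exists_relSpec (R : S.AffineZariskiSiteᵒᵖ ⥤ CommRingCat.{u})
    (α : ∀ U : S.AffineZariskiSite, Γ((ovOpen U).left, ⊤) ⟶ R.obj (op U))
    (hα : ∀ {U' U : S.AffineZariskiSite} (h : U' ⟶ U),
      IsPushout (ovIncl h).left.appTop (α U) (α U') (R.map h.op)) :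
    ∃ (T : Scheme.{u}) (f : T ⟶ S) (i : ∀ U, Spec (R.obj (op U)) ⟶ T),
      (∀ U, IsPullback (i U) (Spec.map (α U) ≫ (ovOpen U).left.isoSpec.inv) f (ovOpen U).hom) ∧
        ∀ {U' U : S.AffineZariskiSite} (h : U' ⟶ U), Spec.map (R.map h.op) ≫ i U = i U' := by
  have sq {U' U : S.AffineZariskiSite} (h : U' ⟶ U) :
      IsPullback (Spec.map (R.map h.op)) (Spec.map (α U') ≫ (ovOpen U').left.isoSpec.inv)
        (Spec.map (α U) ≫ (ovOpen U).left.isoSpec.inv) (ovIncl h).left := by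
    have h1 := (isPullback_SpecMap_of_isPushout _ _ _ _ (hα h).flip)
    exact h1.paste_vert (IsPullback.of_vert_isIso ⟨Scheme.isoSpec_inv_naturality (ovIncl h).left⟩)
  let D : (Scheme.AffineZariskiSite.directedCover S).RelativeGluingData :=
    { functor := R.rightOp ⋙ Scheme.Spec
      natTrans :=
        { app := fun U => Spec.map (α U) ≫ (ovOpen U).left.isoSpec.inv
          naturality := fun U' U h => (sq h).w }
      equifibered := fun U' U h => sq h }
  exact ⟨D.glued, D.toBase, fun U => D.cover.f U,
    fun U => (D.isPullback_natTrans_ι_toBase U).flip, fun h => cover_trans D h⟩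

end RelativeSpectrum

section IndexScheme

variable {S : Scheme.{u}} {F : CommRingCat.{u} ⥤ GrpCat.{u}} [PreservesFinPow F] {d : ℕ}
  {P : RightGSet (wreath F d S)} (hP : IsTorsor (fppf S) P)

/-- The ring of functions on the twist of the set of indices over an affine open subscheme. -/
def idxRing : S.AffineZariskiSiteᵒᵖ ⥤ CommRingCat.{u} where
  obj U := haveI := IdxAlg.small hP (ovOpen U.unop); .of (Shrink.{u} (IdxAlg P (ovOpen U.unop)))
  map {U U'} h :=
    haveI := IdxAlg.small hP (ovOpen U.unop)
    haveI := IdxAlg.small hP (ovOpen U'.unop)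
    CommRingCat.ofHom ((Shrink.ringEquiv (IdxAlg P (ovOpen U'.unop))).symm.toRingHom.comp
      ((IdxAlg.res (ovIncl h.unop)).comp (Shrink.ringEquiv (IdxAlg P (ovOpen U.unop))).toRingHom))
  map_id U := by
    have := IdxAlg.small hP (ovOpen U.unop)
    ext1
    refine RingHom.ext fun s => ?_
    refine (Shrink.ringEquiv (IdxAlg P (ovOpen U.unop))).injective ?_
    refine ((Shrink.ringEquiv (IdxAlg P (ovOpen U.unop))).apply_symm_apply _).trans ?_
    exact AssocSec.ext_val fun Z z p => congrArg
      (fun z => AssocSec.val (Shrink.ringEquiv (IdxAlg P (ovOpen U.unop)) s) z p)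
      (Subsingleton.elim _ _)
  map_comp {U U' U''} h h' := by
    have := IdxAlg.small hP (ovOpen U.unop)
    have := IdxAlg.small hP (ovOpen U'.unop)
    have := IdxAlg.small hP (ovOpen U''.unop)
    ext1
    refine RingHom.ext fun s => congrArg (Shrink.ringEquiv (IdxAlg P (ovOpen U''.unop))).symm ?_
    refine Eq.trans ?_ (congrArg (IdxAlg.res (ovIncl h'.unop))
      ((Shrink.ringEquiv (IdxAlg P (ovOpen U'.unop))).apply_symm_apply _).symm)
    exact AssocSec.ext_val fun Z z p => congrArg
      (fun z => AssocSec.val (Shrink.ringEquiv (IdxAlg P (ovOpen U.unop)) s) z p)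
      (Subsingleton.elim _ _)

/-- The sections of the ring of functions. -/
def idxRingEquiv (U : S.AffineZariskiSite) : (idxRing hP).obj (op U) ≃+* IdxAlg P (ovOpen U) :=
  haveI := IdxAlg.small hP (ovOpen U)
  Shrink.ringEquiv (IdxAlg P (ovOpen U))

theorem idxRingEquiv_map {U U' : S.AffineZariskiSite} (h : U' ⟶ U) (s : (idxRing hP).obj (op U)) :
    idxRingEquiv hP U' ((idxRing hP).map h.op s) =
      IdxAlg.res (ovIncl h) (idxRingEquiv hP U s) :=
  (idxRingEquiv hP U').apply_symm_apply _

/-- The structure homomorphism of the ring of functions. -/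
def idxRingMap (U : S.AffineZariskiSite) : Γ((ovOpen U).left, ⊤) ⟶ (idxRing hP).obj (op U) :=
  CommRingCat.ofHom ((idxRingEquiv hP U).symm.toRingHom.comp
    (algebraMap Γ((ovOpen U).left, ⊤) (IdxAlg P (ovOpen U))))

theorem idxRingEquiv_idxRingMap (U : S.AffineZariskiSite) (a : Γ((ovOpen U).left, ⊤)) :
    idxRingEquiv hP U (idxRingMap hP U a) = algebraMap _ _ a :=
  (idxRingEquiv hP U).apply_symm_apply _

theorem idxRingEquiv_mul (U : S.AffineZariskiSite) (a : Γ((ovOpen U).left, ⊤))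
    (s : (idxRing hP).obj (op U)) : (idxRingEquiv hP U).toAddEquiv (idxRingMap hP U a * s) =
      a • (idxRingEquiv hP U).toAddEquiv s := by
  change idxRingEquiv hP U (idxRingMap hP U a * s) = a • idxRingEquiv hP U s
  rw [map_mul, idxRingEquiv_idxRingMap, Algebra.smul_def]

theorem isPushout_idxRing {U U' : S.AffineZariskiSite} (h : U' ⟶ U) :
    IsPushout (ovIncl h).left.appTop (idxRingMap hP U) (idxRingMap hP U')
      ((idxRing hP).map h.op) := by
  refine isPushout_of_isBC ?_ (idxRingEquiv hP U).toAddEquiv (idxRingEquiv hP U').toAddEquiv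
    (idxRingEquiv_mul hP U) (idxRingEquiv_mul hP U') (fun c => ?_) (IdxAlg.isBC_res hP (ovIncl h))
  · ext1
    refine RingHom.ext fun a => (idxRingEquiv hP U').injective ?_
    refine (idxRingEquiv_idxRingMap hP U' _).trans
      (Eq.trans ?_ (idxRingEquiv_map hP h (idxRingMap hP U a)).symm)
    rw [idxRingEquiv_idxRingMap]
    refine AssocSec.ext_val fun Z z p => ?_
    refine (IdxAlg.algebraMap_val _ z p).trans
      (Eq.trans ?_ (IdxAlg.algebraMap_val a (z ≫ ovIncl h) p).symm)
    rw [Over.comp_left, Scheme.Hom.comp_appTop]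
    rfl
  · exact idxRingEquiv_map hP h c

/-- The values of functions at a section of the torsor, as a homomorphism of rings. -/
def idxEval {U : S.AffineZariskiSite} {Z : Over S} (z : Z ⟶ ovOpen U) (p : P.F.obj (op Z)) :
    (idxRing hP).obj (op U) →+* (Fin d → Γ(Z.left, ⊤)) :=
  (IdxAlg.evalHom z p).comp (idxRingEquiv hP U).toRingHom

theorem isPushout_idxEval {U : S.AffineZariskiSite} {Z : Over S} [IsAffine Z.left]
    (z : Z ⟶ ovOpen U) (p : P.F.obj (op Z)) :
    IsPushout z.left.appTop (idxRingMap hP U)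
      (CommRingCat.ofHom (algebraMap Γ(Z.left, ⊤) (Fin d → Γ(Z.left, ⊤))))
      (CommRingCat.ofHom (idxEval hP z p)) := by
  refine isPushout_of_isBC ?_ (idxRingEquiv hP U).toAddEquiv (AddEquiv.refl _)
    (idxRingEquiv_mul hP U) (fun b x => funext fun k => rfl) (fun c => rfl)
    (IdxAlg.isBC_evalLin hP z p)
  ext1
  refine RingHom.ext fun a => ?_
  change _ = AssocSec.val (idxRingEquiv hP U (idxRingMap hP U a)) z p
  rw [idxRingEquiv_idxRingMap, IdxAlg.algebraMap_val]
  rfl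

/-- The ring of functions is finite étale of constant rank. -/
theorem finite_idxRingMap (U : S.AffineZariskiSite) : (idxRingMap hP U).hom.Finite ∧
    (idxRingMap hP U).hom.Etale := by
  obtain ⟨V, v, hv, ⟨p⟩⟩ := IdxAlg.exists_cover hP (ovOpen U)
  have := hv.isAffine
  have sq := isPushout_idxEval hP v p
  have hf := hv.faithfullyFlat
  have comm : RingHom.comp (algebraMap Γ(V.left, ⊤) (Fin d → Γ(V.left, ⊤))) v.left.appTop.hom =
    (idxEval hP v p).comp (idxRingMap hP U).hom := congrArg CommRingCat.Hom.hom sq.w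
  algebraize [v.left.appTop.hom, (idxRingMap hP U).hom, idxEval hP v p,
    RingHom.comp (algebraMap Γ(V.left, ⊤) (Fin d → Γ(V.left, ⊤))) v.left.appTop.hom]
  have t2 : IsScalarTower Γ((ovOpen U).left, ⊤) ((idxRing hP).obj (op U)) (Fin d → Γ(V.left, ⊤)) :=
    .of_algebraMap_eq' comm
  have hp : Algebra.IsPushout Γ((ovOpen U).left, ⊤) Γ(V.left, ⊤) ((idxRing hP).obj (op U))
    (Fin d → Γ(V.left, ⊤)) := CommRingCat.isPushout_iff_isPushout.1 sq
  have := hp.symm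
  constructor
  · exact RingHom.Finite.codescendsAlong_faithfullyFlat (R' := Γ(V.left, ⊤))
      (S' := Fin d → Γ(V.left, ⊤)) hf (RingHom.finite_algebraMap.2 inferInstance)
  · exact RingHom.Etale.codescendsAlong_faithfullyFlat (R' := Γ(V.left, ⊤))
      (S' := Fin d → Γ(V.left, ⊤)) hf (RingHom.etale_algebraMap.2 inferInstance)

end IndexScheme

section GlueOpen

variable {S T Y : Scheme.{u}} (y : Y ⟶ S)

theorem hom_ext_of_open {t t' : Y ⟶ T} (h : ∀ U : S.AffineZariskiSite,
    Limits.pullback.fst y U.1.ι ≫ t = Limits.pullback.fst y U.1.ι ≫ t') : t = t' :=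
  Scheme.Cover.hom_ext ((Scheme.AffineZariskiSite.directedCover S).pullback₁ y) _ _ h

theorem exists_hom_of_open (g : ∀ U : S.AffineZariskiSite, Limits.pullback y U.1.ι ⟶ T)
    (hg : ∀ (U' U : S.AffineZariskiSite) (_ : U' ⟶ U)
      (c : Limits.pullback y U'.1.ι ⟶ Limits.pullback y U.1.ι),
      c ≫ Limits.pullback.fst y U.1.ι = Limits.pullback.fst y U'.1.ι → c ≫ g U = g U') :
    ∃ t : Y ⟶ T, ∀ U, Limits.pullback.fst y U.1.ι ≫ t = g U :=
  ⟨Scheme.OpenCover.glueMorphismsOfLocallyDirected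
      ((Scheme.AffineZariskiSite.directedCover S).pullback₁ y) g
      fun {_ _} h => hg _ _ h _ (Scheme.Cover.trans_map _ h),
    Scheme.OpenCover.map_glueMorphismsOfLocallyDirected
      ((Scheme.AffineZariskiSite.directedCover S).pullback₁ y) g
      fun {_ _} h => hg _ _ h _ (Scheme.Cover.trans_map _ h)⟩

/-- The restriction of a scheme over `S` to an affine open subscheme. -/
def restrOpen (Y : Over S) (U : S.AffineZariskiSite) : Over S :=
  Over.mk (Limits.pullback.fst Y.hom U.1.ι ≫ Y.hom)

/-- The inclusion of the restriction. -/
def restrFst (Y : Over S) (U : S.AffineZariskiSite) : restrOpen Y U ⟶ Y :=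
  Over.homMk (Limits.pullback.fst Y.hom U.1.ι)

/-- The projection of the restriction. -/
def restrSnd (Y : Over S) (U : S.AffineZariskiSite) : restrOpen Y U ⟶ ovOpen U :=
  Over.homMk (Limits.pullback.snd Y.hom U.1.ι) Limits.pullback.condition.symm

theorem exists_restr {Y Z : Over S} {U : S.AffineZariskiSite} (k : Z ⟶ Y) (z : Z ⟶ ovOpen U) :
    ∃ l : Z ⟶ restrOpen Y U, l ≫ restrFst Y U = k :=
  ⟨Over.homMk (Limits.pullback.lift k.left z.left ((Over.w k).trans (Over.w z).symm))
    ((Limits.pullback.lift_fst_assoc _ _ _ _).trans (Over.w k)),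
    Over.OverMorphism.ext (Limits.pullback.lift_fst _ _ _)⟩

end GlueOpen

section IndexSchemePoints

variable {S T : Scheme.{u}} {F : CommRingCat.{u} ⥤ GrpCat.{u}} [PreservesFinPow F] {d : ℕ}
  {P : RightGSet (wreath F d S)} {hP : IsTorsor (fppf S) P} {f : T ⟶ S}

variable (hP f) in
/-- The structure of the relative spectrum of the functions on the twist of the set of indices. -/
structure IdxSpec where
  /-- the affine open subschemes -/
  i (U : S.AffineZariskiSite) : Spec ((idxRing hP).obj (op U)) ⟶ T
  isPullback (U : S.AffineZariskiSite) :
    IsPullback (i U) (Spec.map (idxRingMap hP U) ≫ (ovOpen U).left.isoSpec.inv) f (ovOpen U).hom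
  w {U' U : S.AffineZariskiSite} (h : U' ⟶ U) : Spec.map ((idxRing hP).map h.op) ≫ i U = i U'

variable (hP) in
theorem exists_idxSpec : ∃ (T : Scheme.{u}) (f : T ⟶ S), Nonempty (IdxSpec hP f) := by
  obtain ⟨T, f, i, h, h'⟩ := exists_relSpec (idxRing hP) (idxRingMap hP) (isPushout_idxRing hP)
  exact ⟨T, f, ⟨⟨i, h, h'⟩⟩⟩

namespace IdxSpec

variable (D : IdxSpec hP f)
include D

theorem of_forall {Q : MorphismProperty Scheme.{u}} (hQ : IsZariskiLocalAtTarget Q)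
    (h : ∀ U, Q (Spec.map (idxRingMap hP U))) : Q f := by
  refine (IsZariskiLocalAtTarget.iff_of_openCover
    (Scheme.AffineZariskiSite.directedCover S)).2 fun U => ?_
  change Q (Limits.pullback.snd f (ovOpen U).hom)
  rw [← Q.cancel_left_of_respectsIso (D.isPullback U).isoPullback.hom,
    (D.isPullback U).isoPullback_hom_snd, Q.cancel_right_of_respectsIso]
  exact h U

theorem isFinite : IsFinite f :=
  D.of_forall (@HasAffineProperty.instIsZariskiLocalAtTarget @IsFinite _
    IsFinite.instHasAffinePropertyAndIsAffineFiniteCarrierObjOppositeOpensCarrierCarrierCommRingCatPresheafOpOpensTopHomAppTop)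
      fun U => (IsFinite.SpecMap_iff _).2 (finite_idxRingMap hP U).1

theorem etale : Etale f :=
  D.of_forall (@HasRingHomProperty.instIsZariskiLocalAtTarget @Etale _
    Etale.instHasRingHomPropertyEtale) fun U => (@HasRingHomProperty.Spec_iff @Etale _ Etale.instHasRingHomPropertyEtale _ _ _).2 (finite_idxRingMap hP U).2

/-- The degree may be computed after a cover over which the torsor has a point, where the algebra
is a power of the base ring. -/
theorem finrank_eq (s : S) : f.finrank s = d := by
  have := D.isFinite
  have := D.etale
  obtain ⟨U, hU⟩ : ∃ U : S.AffineZariskiSite, s ∈ U.1 := by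
    obtain ⟨U, hU⟩ := TopologicalSpace.Opens.mem_iSup.1
      ((iSup_affineOpens_eq_top S).ge (Set.mem_univ s))
    exact ⟨U, hU⟩
  obtain ⟨V, v, hv, ⟨p⟩⟩ := IdxAlg.exists_cover hP (ovOpen U)
  have := hv.isAffine
  have := hv.surjective
  -- over the cover, the scheme is the spectrum of a power of the base ring
  have h0 := isPullback_SpecMap_of_isPushout _ _ _ _ (isPushout_idxEval hP v p).flip
  have sq := (h0.paste_vert (IsPullback.of_vert_isIso (fst := Spec.map v.left.appTop) (snd := 𝟙 _)
    (f := (ovOpen U).left.isoSpec.inv) (g := Spec.map v.left.appTop ≫ (ovOpen U).left.isoSpec.inv)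
    ⟨(Category.id_comp _).symm⟩)).paste_horiz (D.isPullback U)
  rw [Category.comp_id] at sq
  obtain ⟨y, hy⟩ := v.left.surjective (show (ovOpen U).left from ⟨s, hU⟩)
  obtain ⟨x, rfl⟩ := V.left.isoSpec.inv.surjective y
  have h1 := Scheme.Hom.finrank_of_isPullback _ _ _ _ sq x
  have h2 : ((Spec.map v.left.appTop ≫ (ovOpen U).left.isoSpec.inv) ≫ (ovOpen U).hom) x = s := by
    rw [Scheme.isoSpec_inv_naturality]
    simp only [Scheme.Hom.comp_apply]
    exact congrArg (ovOpen U).hom hy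
  rw [h2] at h1
  have : Nontrivial Γ(V.left, ⊤) := x.nontrivial
  refine h1.symm.trans ((Scheme.Hom.finrank_SpecMap_algebraMap Γ(V.left, ⊤)
    (Fin d → Γ(V.left, ⊤)) x).trans ?_)
  rw [Module.rankAtStalk_eq_finrank_of_free, Module.finrank_fin_fun]
  rfl

/-- The point of the scheme given by an index, over an affine open subscheme. -/
def ptAff {U : S.AffineZariskiSite} {Z : Over S} (z : Z ⟶ ovOpen U) (p : P.F.obj (op Z))
    (v : LocallyConstant Z.left (Fin d)) : Z.left ⟶ T :=
  Z.left.toSpecΓ ≫ Spec.map (CommRingCat.ofHom ((lcEval v).comp (idxEval hP z p))) ≫ D.i U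

theorem comp_ptAff {U : S.AffineZariskiSite} {Z Z' : Over S} (z : Z ⟶ ovOpen U) (k : Z' ⟶ Z)
    (p : P.F.obj (op Z)) (v : LocallyConstant Z.left (Fin d)) :
    k.left ≫ D.ptAff z p v = D.ptAff (k ≫ z) (P.F.map k.op p) (lcPull k.left v) := by
  rw [ptAff, ptAff, Scheme.toSpecΓ_naturality_assoc, ← Spec.map_comp_assoc]
  congr 3
  ext1
  refine RingHom.ext fun s => ?_
  refine (appTop_lcEval k.left v _).trans ?_
  exact congrArg (lcEval (lcPull k.left v))
    (AssocSec.val_map (idxRingEquiv hP U s) z k p).symm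

theorem ptAff_incl {U U' : S.AffineZariskiSite} (h : U' ⟶ U) {Z : Over S} (z : Z ⟶ ovOpen U')
    (p : P.F.obj (op Z)) (v : LocallyConstant Z.left (Fin d)) :
    D.ptAff (z ≫ ovIncl h) p v = D.ptAff z p v := by
  rw [ptAff, ptAff, ← D.w h, ← Spec.map_comp_assoc]
  congr 3
  ext1
  refine RingHom.ext fun s => ?_
  refine congrArg (fun t => lcEval v (AssocSec.val t z p)) (idxRingEquiv_map hP h s).symm

theorem ptAff_hom {U : S.AffineZariskiSite} {Z : Over S} (z : Z ⟶ ovOpen U) (p : P.F.obj (op Z))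
    (v : LocallyConstant Z.left (Fin d)) : D.ptAff z p v ≫ f = Z.hom := by
  have h : idxRingMap hP U ≫ CommRingCat.ofHom ((lcEval v).comp (idxEval hP z p)) =
      z.left.appTop := by
    ext1
    refine RingHom.ext fun a => ?_
    change lcEval v (AssocSec.val (idxRingEquiv hP U (idxRingMap hP U a)) z p) = _
    rw [idxRingEquiv_idxRingMap, IdxAlg.algebraMap_val]
    exact eq_of_germ_eq fun x => germ_lcEval _ _ x
  rw [ptAff, Category.assoc, Category.assoc, (D.isPullback U).w, Category.assoc,
    ← Spec.map_comp_assoc]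
  refine (congrArg (fun φ => Z.left.toSpecΓ ≫ Spec.map φ ≫ (ovOpen U).left.isoSpec.inv ≫
    (ovOpen U).hom) h).trans ?_
  rw [← Scheme.toSpecΓ_naturality_assoc, Scheme.toSpecΓ_isoSpec_inv_assoc, Over.w]

/-- The points over affine open subschemes of the base glue. -/
theorem exists_pt {Y : Over S} (p : P.F.obj (op Y)) (v : LocallyConstant Y.left (Fin d)) :
    ∃ t : Y ⟶ Over.mk f, ∀ (U : S.AffineZariskiSite) (Z : Over S) (k : Z ⟶ Y) (z : Z ⟶ ovOpen U),
      (k ≫ t).left = D.ptAff z (P.F.map k.op p) (lcPull k.left v) := by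
  obtain ⟨t, ht⟩ := exists_hom_of_open Y.hom
    (fun U => D.ptAff (restrSnd Y U) (P.F.map (restrFst Y U).op p) (lcPull (restrFst Y U).left v))
    fun U' U h c' hc' => by
      let c : restrOpen Y U' ⟶ restrOpen Y U :=
        Over.homMk c' ((Category.assoc _ _ _).symm.trans (hc' =≫ Y.hom))
      have hc : c ≫ restrFst Y U = restrFst Y U' := Over.OverMorphism.ext hc'
      refine (D.comp_ptAff (restrSnd Y U) c _ _).trans ?_
      rw [Subsingleton.elim (c ≫ restrSnd Y U) (restrSnd Y U' ≫ ovIncl h), D.ptAff_incl h,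
        ← P.map_comp_apply, ← op_comp, hc]
      refine congrArg (D.ptAff (restrSnd Y U') (P.F.map (restrFst Y U').op p)) ?_
      exact congrArg (fun e => lcPull (Over.Hom.left e) v) hc
  have htf : t ≫ f = Y.hom := hom_ext_of_open Y.hom fun U => by
    rw [← Category.assoc, ht]
    exact (D.ptAff_hom _ _ _).trans (Over.w (restrFst Y U)).symm
  refine ⟨Over.homMk t htf, fun U Z k z => ?_⟩
  obtain ⟨l, rfl⟩ := exists_restr k z
  refine (Category.assoc l.left (restrFst Y U).left t).trans ?_
  refine (congrArg (l.left ≫ ·) (ht U)).trans ((D.comp_ptAff (restrSnd Y U) l _ _).trans ?_)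
  rw [Subsingleton.elim z (l ≫ restrSnd Y U), ← P.map_comp_apply]
  rfl

end IdxSpec
end IndexSchemePoints

/-! ### Points of the twist of the scheme of indices -/

section IndexSchemeFraming

variable {S T : Scheme.{u}} {F : CommRingCat.{u} ⥤ GrpCat.{u}} [PreservesFinPow F] {d : ℕ}
  {P : RightGSet (wreath F d S)} {hP : IsTorsor (fppf S) P} {f : T ⟶ S}

theorem toSpecΓ_SpecMap_injective {X : Scheme.{u}} {R : CommRingCat.{u}} {φ ψ : R ⟶ Γ(X, ⊤)}
    (h : X.toSpecΓ ≫ Spec.map φ = X.toSpecΓ ≫ Spec.map ψ) : φ = ψ := by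
  have := congrArg Scheme.Hom.appTop h
  simpa [Scheme.ΓSpecIso_naturality] using this

theorem exists_toSpecΓ_SpecMap {X : Scheme.{u}} {R : CommRingCat.{u}} (m : X ⟶ Spec R) :
    ∃ φ : R ⟶ Γ(X, ⊤), m = X.toSpecΓ ≫ Spec.map φ :=
  ⟨(Scheme.ΓSpecIso R).inv ≫ m.appTop, by
    rw [Spec.map_comp, ← Scheme.toSpecΓ_naturality_assoc]
    simp⟩

theorem over_hom_ext {X Y : Over S} {t t' : Y ⟶ X} (h : ∀ (U : S.AffineZariskiSite) (Z : Over S)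
    (k : Z ⟶ Y) (_ : Z ⟶ ovOpen U), (k ≫ t).left = (k ≫ t').left) : t = t' :=
  Over.OverMorphism.ext (hom_ext_of_open Y.hom fun U => h U _ (restrFst Y U) (restrSnd Y U))

/-- The morphism to an open subscheme through which a scheme over `S` factors. -/
def homOpen (U : S.Opens) {Z : Over S} (h : ∀ x, Z.hom x ∈ U) : Z ⟶ Over.mk U.ι :=
  Over.homMk (IsOpenImmersion.lift U.ι Z.hom (by
    rintro _ ⟨x, rfl⟩
    rw [Scheme.Opens.range_ι]
    exact h x)) (IsOpenImmersion.lift_fac _ _ _)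

namespace IdxSpec

variable (D : IdxSpec hP f)

/-- The point of the scheme given by an index. -/
def pt {Y : Over S} (p : P.F.obj (op Y)) (v : LocallyConstant Y.left (Fin d)) : Y ⟶ Over.mk f :=
  (D.exists_pt p v).choose

theorem comp_pt {Y : Over S} (p : P.F.obj (op Y)) (v : LocallyConstant Y.left (Fin d))
    {U : S.AffineZariskiSite} {Z : Over S} (k : Z ⟶ Y) (z : Z ⟶ ovOpen U) :
    (k ≫ D.pt p v).left = D.ptAff z (P.F.map k.op p) (lcPull k.left v) :=
  (D.exists_pt p v).choose_spec U Z k z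

theorem pt_left {U : S.AffineZariskiSite} {Z : Over S} (z : Z ⟶ ovOpen U) (p : P.F.obj (op Z))
    (v : LocallyConstant Z.left (Fin d)) : (D.pt p v).left = D.ptAff z p v := by
  have h := D.comp_pt p v (𝟙 Z) z
  rw [Category.id_comp, op_id, P.map_id_apply] at h
  exact h

theorem map_pt {Y Z : Over S} (g : Z ⟶ Y) (p : P.F.obj (op Y))
    (v : LocallyConstant Y.left (Fin d)) :
    g ≫ D.pt p v = D.pt (P.F.map g.op p) (lcPull g.left v) :=
  over_hom_ext fun U W k z => by
    rw [D.comp_pt _ _ k z, ← Category.assoc, D.comp_pt p v (k ≫ g) z, op_comp, P.map_comp_apply]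
    rfl

theorem pt_act {Y : Over S} (p : P.F.obj (op Y)) (a : WreathSections F d Y.left)
    (v : LocallyConstant Y.left (Fin d)) :
    D.pt (P.act p a) (lcApply a.right⁻¹ v) = D.pt p v :=
  over_hom_ext fun U W k z => by
    rw [D.comp_pt _ _ k z, D.comp_pt _ _ k z, ptAff, ptAff]
    congr 3
    ext1
    refine RingHom.ext fun s => ?_
    let s' : IdxAlg P (ovOpen U) := idxRingEquiv hP U s
    let b : WreathSections F d W.left := wreathRes F d k.left a
    change lcEval (lcApply b.right⁻¹ (lcPull k.left v)) (s'.val z (P.F.map k.op (P.act p a))) =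
      lcEval (lcPull k.left v) (s'.val z (P.F.map k.op p))
    have h1 : s'.val z (P.F.map k.op (P.act p a)) = lcPermLin b.right⁻¹ (s'.val z (P.F.map k.op p)) :=
      (congrArg (s'.val z) (P.act_map k.op p a)).trans (s'.val_act z _ _)
    rw [h1, lcEval_lcPermLin, inv_inv, lcApply_inv_lcApply]

/-- Over an affine scheme where the torsor has a point, the algebra becomes a power of the base
ring, and the homomorphisms from a power of a ring are given by locally constant indices. -/
theorem pt_bijective_aff {U : S.AffineZariskiSite} {Z W : Over S} [IsAffine Z.left]
    (z : Z ⟶ ovOpen U) (p : P.F.obj (op Z)) (k : W ⟶ Z) :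
    Function.Bijective (D.pt (P.F.map k.op p)) := by
  have sq := isPushout_idxEval hP z p
  -- the homomorphism to the functions on `W` given by an index
  let χ (v : LocallyConstant W.left (Fin d)) :
      CommRingCat.of (Fin d → Γ(Z.left, ⊤)) ⟶ Γ(W.left, ⊤) :=
    CommRingCat.ofHom ((lcEval v).comp (k.left.appTop.hom.compLeft (Fin d)))
  have hχ1 (v) : CommRingCat.ofHom (algebraMap Γ(Z.left, ⊤) (Fin d → Γ(Z.left, ⊤))) ≫ χ v =
      k.left.appTop := by
    ext1
    exact RingHom.ext fun a => eq_of_germ_eq fun x => germ_lcEval _ _ x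
  have hχ2 (v) : CommRingCat.ofHom (idxEval hP z p) ≫ χ v =
      CommRingCat.ofHom ((lcEval v).comp (idxEval hP (k ≫ z) (P.F.map k.op p))) := by
    ext1
    refine RingHom.ext fun s => congrArg (lcEval v) ?_
    exact (AssocSec.val_map (idxRingEquiv hP U s) z k p).symm
  have hpt (v) : (D.pt (P.F.map k.op p) v).left =
      (W.left.toSpecΓ ≫ Spec.map (CommRingCat.ofHom (idxEval hP z p) ≫ χ v)) ≫ D.i U := by
    rw [hχ2, Category.assoc]
    exact D.pt_left (k ≫ z) _ v
  -- the affine piece of `T` is the pullback of an open immersion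
  have hmono {X : Scheme.{u}} {m m' : X ⟶ Spec ((idxRing hP).obj (op U))}
      (h : m ≫ D.i U = m' ≫ D.i U) : m = m' := by
    refine (D.isPullback U).hom_ext h ((cancel_mono U.1.ι).1 ?_)
    change (m ≫ _) ≫ (ovOpen U).hom = (m' ≫ _) ≫ (ovOpen U).hom
    refine (Category.assoc _ _ _).trans (Eq.trans ?_ (Category.assoc _ _ _).symm)
    rw [← (D.isPullback U).w, ← Category.assoc, h, Category.assoc]
  constructor
  · intro v v' h
    have h1 := congrArg Over.Hom.left h
    rw [hpt, hpt] at h1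
    have h2 := sq.hom_ext ((hχ1 v).trans (hχ1 v').symm) (toSpecΓ_SpecMap_injective (hmono h1))
    refine lc_ext fun j => ?_
    have h3 := congrArg (fun φ : CommRingCat.of (Fin d → Γ(Z.left, ⊤)) ⟶ Γ(W.left, ⊤) =>
      φ (Pi.single j (1 : Γ(Z.left, ⊤)))) h2
    have h4 : (fun l => k.left.appTop ((Pi.single j 1 : Fin d → Γ(Z.left, ⊤)) l)) =
        (Pi.single j 1 : Fin d → Γ(W.left, ⊤)) := by
      funext l
      rw [Pi.single_apply, Pi.single_apply]
      split_ifs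
      · exact map_one k.left.appTop.hom
      · exact map_zero k.left.appTop.hom
    rw [lcInd, lcInd, ← h4]
    exact h3
  · intro t
    -- a point of `T` is a homomorphism from the ring of the piece, hence from the pushout
    obtain ⟨m, hm1, hm2⟩ := (D.isPullback U).exists_lift t.left (k ≫ z).left
      ((Over.w t).trans (Over.w (k ≫ z)).symm)
    obtain ⟨φ, rfl⟩ := exists_toSpecΓ_SpecMap m
    have hφ : idxRingMap hP U ≫ φ = z.left.appTop ≫ k.left.appTop := by
      refine toSpecΓ_SpecMap_injective ((cancel_mono (ovOpen U).left.isoSpec.inv).1 ?_)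
      rw [Spec.map_comp, Category.assoc, Category.assoc]
      refine ((Category.assoc _ _ _).symm.trans hm2).trans ?_
      rw [← Scheme.Hom.comp_appTop, ← Over.comp_left, ← Scheme.toSpecΓ_naturality,
        Category.assoc, Scheme.toSpecΓ_isoSpec_inv, Category.comp_id]
    obtain ⟨v, hv⟩ := exists_lc_of_ringHom (sq.desc k.left.appTop φ hφ.symm).hom
    have hv' : χ v = sq.desc k.left.appTop φ hφ.symm := by
      ext1
      refine RingHom.ext fun a => Eq.trans ?_ (hv a).symm
      refine congrArg (lcEval v) (funext fun j => ?_)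
      exact (ConcreteCategory.congr_hom (sq.inl_desc k.left.appTop φ hφ.symm) (a j)).symm
    refine ⟨v, Over.OverMorphism.ext ?_⟩
    refine (hpt v).trans (Eq.trans ?_ hm1)
    exact congrArg (fun e => (W.left.toSpecΓ ≫ Spec.map e) ≫ D.i U)
      ((congrArg (CommRingCat.ofHom (idxEval hP z p) ≫ ·) hv').trans
        (sq.inr_desc k.left.appTop φ hφ.symm))

/-- A point of the torsor identifies the points of the relative spectrum with the indices; this is
local, and follows from the affine case. -/
theorem pt_bijective {Y : Over S} (p : P.F.obj (op Y)) : Function.Bijective (D.pt p) := by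
  let R : Sieve Y := Sieve.generate fun Z _ => IsAffine Z.left ∧ ∃ U, Nonempty (Z ⟶ ovOpen U)
  have hR : R ∈ fppf S Y := by
    refine fppf_of_affine R (fun U : S.AffineZariskiSite => Y.hom ⁻¹ᵁ U.1) (fun x => ?_)
      fun U Z k hZ _ hk => Sieve.le_generate _ _ _ ⟨hZ, U, ⟨?_⟩⟩
    · obtain ⟨U, hU⟩ := TopologicalSpace.Opens.mem_iSup.1
        ((iSup_affineOpens_eq_top S).ge (Set.mem_univ (Y.hom x)))
      exact ⟨U, hU⟩
    · exact homOpen U.1 fun x => by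
        rw [← Over.w k]
        exact hk x
  have h := bijective_of_locally (A := lcF S (Fin d)) (B := yoneda.obj (Over.mk f))
    (isSheaf_lcF _) (isSheaf_yoneda _) (fun Z k v => D.pt (P.F.map k.op p) v)
    (fun Z W k g v => ?_) hR ?_ Y (𝟙 Y)
  · rw [op_id] at h
    rwa [P.map_id_apply] at h
  · refine (D.map_pt g _ v).trans ?_
    rw [op_comp, P.map_comp_apply]
    rfl
  · rintro W _ ⟨Z, k, u, ⟨hZ, U, ⟨z⟩⟩, rfl⟩
    have := D.pt_bijective_aff z (P.F.map u.op p) k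
    rw [← P.map_comp_apply] at this
    exact this

/-- The relative spectrum is the twist of the constant sheaf of indices. -/
def framing : Framing P (lcSet S F d) (yoneda.obj (Over.mk f)) where
  app p := Equiv.ofBijective _ (D.pt_bijective p)
  app_map g p v := D.map_pt g p v
  app_act p a v := D.pt_act p a v

end IdxSpec
end IndexSchemeFraming

/-! ### The torsor on the cover attached to a torsor under the semidirect product -/

section TorsorOfWreath

variable {S T : Scheme.{u}} {F : CommRingCat.{u} ⥤ GrpCat.{u}} [PreservesFinPow F] {d : ℕ}
  {P : RightGSet (wreath F d S)} {f : T ⟶ S}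
  (φ : Framing P (lcSet S F d) (yoneda.obj (Over.mk f)))

/-- The tautological point of `T` over a scheme over `T`. -/
def overPt (f : T ⟶ S) (Y : Over T) : (Over.map f).obj Y ⟶ Over.mk f := Over.homMk Y.hom

theorem map_overPt {Y Z : Over T} (h : Z ⟶ Y) : (Over.map f).map h ≫ overPt f Y = overPt f Z :=
  Over.OverMorphism.ext (Over.w h)

/-- The index of the tautological point. -/
def overIdx {Y : Over T} (p : P.F.obj (op ((Over.map f).obj Y))) :
    LocallyConstant Y.left (Fin d) := (φ.app p).symm (overPt f Y)

/-- The pair of the index of the tautological point and the unit. -/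
def overPair {Y : Over T} (p : P.F.obj (op ((Over.map f).obj Y))) :
    (pairSet S F d).F.obj (op ((Over.map f).obj Y)) := (overIdx φ p, (1 : F.obj Γ(Y.left, ⊤)))

namespace EqvSec

variable {X Z W : Over S} (s : EqvSec P (pairSet S F d) X)

/-- The index of a pair. -/
def fst (z : Z ⟶ X) (p : P.F.obj (op Z)) : LocallyConstant Z.left (Fin d) := (s.app Z z p).1

/-- The section of the group in a pair. -/
def snd (z : Z ⟶ X) (p : P.F.obj (op Z)) : F.obj Γ(Z.left, ⊤) := (s.app Z z p).2

theorem fst_map (z : Z ⟶ X) (w : W ⟶ Z) (p : P.F.obj (op Z)) :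
    s.fst (w ≫ z) (P.F.map w.op p) = lcPull w.left (s.fst z p) :=
  congrArg Prod.fst (s.app_map Z W z w p)

theorem snd_map (z : Z ⟶ X) (w : W ⟶ Z) (p : P.F.obj (op Z)) :
    s.snd (w ≫ z) (P.F.map w.op p) = F.map w.left.appTop (s.snd z p) :=
  congrArg Prod.snd (s.app_map Z W z w p)

theorem fst_act (z : Z ⟶ X) (p : P.F.obj (op Z)) (a : WreathSections F d Z.left) :
    s.fst z (P.act p a) = lcApply a.right⁻¹ (s.fst z p) :=
  congrArg Prod.fst (s.app_act Z z p a)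

theorem snd_act (z : Z ⟶ X) (p : P.F.obj (op Z)) (a : WreathSections F d Z.left) :
    s.snd z (P.act p a) = (glue F (s.fst z p) a.left)⁻¹ * s.snd z p :=
  congrArg Prod.snd (s.app_act Z z p a)

theorem ext_pair {s t : EqvSec P (pairSet S F d) X}
    (h : ∀ (Z : Over S) (z : Z ⟶ X) (p : P.F.obj (op Z)), s.fst z p = t.fst z p)
    (h' : ∀ (Z : Over S) (z : Z ⟶ X) (p : P.F.obj (op Z)), s.snd z p = t.snd z p) : s = t :=
  EqvSec.ext (funext fun Z => funext fun z => funext fun p => Prod.ext (h Z z p) (h' Z z p))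

/-- The operation of the group on the second components. -/
def actSnd (x : F.obj Γ(X.left, ⊤)) : EqvSec P (pairSet S F d) X where
  app Z z p := ((s.fst z p, s.snd z p * F.map z.left.appTop x) :
    LocallyConstant Z.left (Fin d) × F.obj Γ(Z.left, ⊤))
  app_map Z W z w p := by
    refine Prod.ext (s.fst_map z w p) ?_
    change s.snd (w ≫ z) (P.F.map w.op p) * F.map (w ≫ z).left.appTop x =
      F.map w.left.appTop (s.snd z p * F.map z.left.appTop x)
    rw [map_mul, snd_map, Over.comp_left, Scheme.Hom.comp_appTop, F.map_comp]
    rfl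
  app_act Z z p a := by
    refine Prod.ext (s.fst_act z p a) ?_
    exact (congrArg (· * _) (s.snd_act z p a)).trans (mul_assoc _ _ _)

theorem snd_actSnd (x : F.obj Γ(X.left, ⊤)) (p : P.F.obj (op X)) :
    (s.actSnd x).snd (𝟙 X) p = s.snd (𝟙 X) p * x :=
  congrArg (s.snd (𝟙 X) p * ·) (map_appTop_id x)

end EqvSec

/-- A section over `Y` of the `F`-torsor on `T` attached to a torsor under the semidirect product:
an equivariant family of pairs of an index and a section of `F`, in which the index is that of the
tautological point. -/
abbrev BaseSec (Y : Over T) : Type (u + 1) :=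
  {s : EqvSec P (pairSet S F d) ((Over.map f).obj Y) // ∀ (Z : Over S)
    (z : Z ⟶ (Over.map f).obj Y) (p : P.F.obj (op Z)),
    s.fst z p = (φ.app p).symm (z ≫ overPt f Y)}

namespace BaseSec

variable {φ} {Y Z : Over T}

/-- The section of `F` given by a point of the torsor. -/
def snd (s : BaseSec φ Y) (p : P.F.obj (op ((Over.map f).obj Y))) : F.obj Γ(Y.left, ⊤) :=
  s.1.snd (𝟙 _) p

theorem ext_of_point (hP : IsTorsor (fppf S) P) {s t : BaseSec φ Y}
    (p : P.F.obj (op ((Over.map f).obj Y))) (h : s.snd p = t.snd p) : s = t :=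
  Subtype.ext (EqvSec.ext_of_point (J := fppf S) hP p
    (Prod.ext ((s.2 _ _ p).trans (t.2 _ _ p).symm) h))

theorem snd_pact (s : BaseSec φ Y) (p : P.F.obj (op ((Over.map f).obj Y)))
    (a : WreathSections F d Y.left) :
    s.snd (P.act p a) = (glue F (overIdx φ p) a.left)⁻¹ * s.snd p := by
  refine (EqvSec.snd_act s.1 (𝟙 _) p a).trans ?_
  rw [s.2, Category.id_comp]
  rfl

/-- Restriction of sections. -/
def res (h : Z ⟶ Y) (s : BaseSec φ Y) : BaseSec φ Z where
  val := s.1.res ((Over.map f).map h)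
  property W w p := by
    refine (s.2 W _ p).trans ?_
    rw [Category.assoc, map_overPt]

/-- The operation of `F` on the second components. -/
def act (s : BaseSec φ Y) (x : F.obj Γ(Y.left, ⊤)) : BaseSec φ Y where
  val := s.1.actSnd x
  property := s.2

theorem snd_act (s : BaseSec φ Y) (x : F.obj Γ(Y.left, ⊤))
    (p : P.F.obj (op ((Over.map f).obj Y))) : (s.act x).snd p = s.snd p * x :=
  EqvSec.snd_actSnd s.1 x p

variable (φ) in
/-- The section given by a point of the torsor. -/
def point (hP : IsTorsor (fppf S) P) (p : P.F.obj (op ((Over.map f).obj Y))) : BaseSec φ Y where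
  val := EqvSec.ofPoint hP p (overPair φ p)
  property Z z q := by
    obtain ⟨a, rfl, -⟩ := hP.simply_transitive (P.F.map z.op p) q
    refine (EqvSec.fst_act _ _ _ a).trans (Eq.trans ?_ (φ.app_symm_act _ a _).symm)
    refine congrArg (lcApply (show WreathSections F d Z.left from a).right⁻¹) ?_
    exact (congrArg Prod.fst (EqvSec.ofPoint_app hP p (overPair φ p) Z z)).trans
      (φ.app_symm_map z p (overPt f Y)).symm

theorem snd_point (hP : IsTorsor (fppf S) P) (p : P.F.obj (op ((Over.map f).obj Y))) :
    (point φ hP p).snd p = 1 :=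
  congrArg Prod.snd (EqvSec.ofPoint_app_self hP p (overPair φ p))

theorem res_point (hP : IsTorsor (fppf S) P) (h : Z ⟶ Y)
    (p : P.F.obj (op ((Over.map f).obj Y))) :
    (point φ hP p).res h = point φ hP (P.F.map ((Over.map f).map h).op p) := by
  refine ext_of_point hP (P.F.map ((Over.map f).map h).op p) (Eq.trans ?_ (snd_point hP _).symm)
  have h1 : ((point φ hP p).res h).snd (P.F.map ((Over.map f).map h).op p) =
      (point φ hP p).1.snd ((Over.map f).map h ≫ 𝟙 _) (P.F.map ((Over.map f).map h).op p) :=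
    congrArg (fun k => (point φ hP p).1.snd k (P.F.map ((Over.map f).map h).op p))
      ((Category.id_comp _).trans (Category.comp_id _).symm)
  refine h1.trans ((EqvSec.snd_map _ _ _ p).trans ?_)
  exact (congrArg (F.map h.left.appTop) (snd_point hP p)).trans (map_one (F.map h.left.appTop).hom)

theorem point_act (hP : IsTorsor (fppf S) P) (p : P.F.obj (op ((Over.map f).obj Y)))
    (a : WreathSections F d Y.left) : point φ hP (P.act p a) =
      (point φ hP p).act (glue F (overIdx φ p) a.left) := by
  refine ext_of_point hP (P.act p a) ((snd_point hP _).trans (Eq.symm ?_))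
  rw [snd_act, snd_pact, snd_point, mul_one, inv_mul_cancel]

theorem act_bijective (hP : IsTorsor (fppf S) P) (p : P.F.obj (op ((Over.map f).obj Y)))
    (s : BaseSec φ Y) : Function.Bijective s.act := by
  refine ⟨fun x y hxy => ?_, fun t => ⟨(s.snd p)⁻¹ * t.snd p, ?_⟩⟩
  · exact mul_left_cancel ((s.snd_act x p).symm.trans ((congrArg (fun t => snd t p) hxy).trans
      (s.snd_act y p)))
  · exact ext_of_point hP p ((s.snd_act _ p).trans (mul_inv_cancel_left _ _))

end BaseSec

/-- The sections of the attached torsor, among all equivariant families. -/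
def baseSub : Subfunctor ((Over.map f).op ⋙ EqvSec.presheaf P (pairSet S F d)) where
  obj Y := {s | ∀ (Z : Over S) (z : Z ⟶ (Over.map f).obj Y.unop) (p : P.F.obj (op Z)),
    EqvSec.fst (X := (Over.map f).obj Y.unop) s z p = (φ.app p).symm (z ≫ overPt f Y.unop)}
  map h s hs := (BaseSec.res (φ := φ) h.unop ⟨s, hs⟩).2

/-- The `F`-torsor on `T` attached to a torsor under the semidirect product. -/
def baseTorsor : RightGSet (onSch F T) where
  F := (baseSub φ).toFunctor
  act {Y} s x := BaseSec.act (φ := φ) (Y := Y.unop) s x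
  act_map h s x := by
    refine Subtype.ext (EqvSec.ext_pair (fun _ _ _ => rfl) fun Z z p => congrArg (_ * ·) ?_)
    change F.map (z.left ≫ h.unop.left).appTop x = F.map z.left.appTop (F.map h.unop.left.appTop x)
    rw [Scheme.Hom.comp_appTop, F.map_comp]
    rfl

/-- Pairs of an index and a section of the group form a sheaf, componentwise. -/
theorem isSheaf_pairSet (hF : Presieve.IsSheaf (fppf S) (onSch F S ⋙ forget GrpCat)) :
    Presieve.IsSheaf (fppf S) (pairSet S F d).F := by
  intro X R hR x hx
  rw [Presieve.compatible_iff_sieveCompatible] at hx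
  let x' (Y : Over S) (g : Y ⟶ X) (hg : R g) : LocallyConstant Y.left (Fin d) × F.obj Γ(Y.left, ⊤) :=
    x g hg
  have hx' (Y Z : Over S) (g : Y ⟶ X) (k : Z ⟶ Y) (hg : R g) :
      x' Z (k ≫ g) (R.downward_closed hg k) = pairRes k.left (x' Y g hg) := hx g k hg
  obtain ⟨i, hi⟩ := sheaf_glue (isSheaf_lcF (S := S) (Fin d)) hR (fun Y g hg => (x' Y g hg).1)
    fun Y Z g k hg => congrArg Prod.fst (hx' Y Z g k hg)
  obtain ⟨a, ha⟩ := sheaf_glue hF hR (fun Y g hg => (x' Y g hg).2)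
    fun Y Z g k hg => congrArg Prod.snd (hx' Y Z g k hg)
  refine ⟨(i, a), fun Y g hg => Prod.ext (hi Y g hg) (ha Y g hg), fun t ht => ?_⟩
  have ht' (Y : Over S) (g : Y ⟶ X) (hg : R g) : pairRes g.left t = x' Y g hg := ht g hg
  exact Prod.ext
    (sheaf_ext (isSheaf_lcF (S := S) (Fin d)) hR fun Y g hg =>
      (congrArg Prod.fst (ht' Y g hg)).trans (hi Y g hg).symm)
    (sheaf_ext hF hR fun Y g hg => (congrArg Prod.snd (ht' Y g hg)).trans (ha Y g hg).symm)

theorem isSheaf_baseSub (hF : Presieve.IsSheaf (fppf S) (onSch F S ⋙ forget GrpCat)) :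
    Presieve.IsSheaf (fppf T) (baseSub φ).toFunctor := by
  refine (Subfunctor.isSheaf_iff _ (Functor.op_comp_isSheaf_of_isSheaf_type (Over.map f) (fppf T)
    (EqvSec.isSheaf_presheaf (isSheaf_pairSet hF)))).2 fun Y s hs Z z p => ?_
  have h := (GrothendieckTopology.over_map_coverPreserving Scheme.fppfTopology f).cover_preserve hs
  refine sheaf_ext (isSheaf_lcF (S := S) (Fin d)) ((fppf S).pullback_stable z h)
    fun W w ⟨V, v, k, hv, hk⟩ => ?_
  let s' : EqvSec P (pairSet S F d) ((Over.map f).obj Y.unop) := s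
  have h1 : s'.fst (k ≫ (Over.map f).map v) (P.F.map w.op p) =
      (φ.app (P.F.map w.op p)).symm (k ≫ overPt f V) := hv W k _
  rw [← map_overPt v, ← Category.assoc, ← hk] at h1
  refine (s'.fst_map z w p).symm.trans (h1.trans ?_)
  rw [Category.assoc]
  exact φ.app_symm_map w p (z ≫ overPt f Y.unop)

/-- Locally on `S` the torsor has a point, and evaluation there identifies the attached sheaf with
the group. -/
theorem isTorsor_baseTorsor (hP : IsTorsor (fppf S) P)
    (hF : Presieve.IsSheaf (fppf S) (onSch F S ⋙ forget GrpCat))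
    (hF' : Presieve.IsSheaf (fppf T) (onSch F T ⋙ forget GrpCat)) :
    IsTorsor (fppf T) (baseTorsor φ) where
  isSheaf := isSheaf_baseSub φ hF
  act_one {Y} s := by
    refine Subtype.ext (EqvSec.ext_pair (fun _ _ _ => rfl) fun Z z p => ?_)
    exact (congrArg (_ * ·) (map_one (F.map z.left.appTop).hom)).trans (mul_one _)
  act_mul {Y} s x y := by
    refine Subtype.ext (EqvSec.ext_pair (fun _ _ _ => rfl) fun Z z p => ?_)
    exact (congrArg (_ * ·) (map_mul (F.map z.left.appTop).hom x y)).trans (mul_assoc _ _ _).symm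
  simply_transitive {Y} s t := by
    -- that the action is simply transitive is local, and clear where `P` has a point
    have h := bijective_of_locally (J := fppf T) (A := onSch F T ⋙ forget GrpCat)
      (B := (baseSub φ).toFunctor) hF' (isSheaf_baseSub φ hF)
      (fun Z z x => (baseTorsor φ).act ((baseTorsor φ).F.map z.op s) x)
      (fun Z W z w x => ?_) (R := (IsTorsor.sieve P _).functorPullback (Over.map f))
      ((Over.map f).cover_lift (fppf T) (fppf S) (IsTorsor.sieve_mem hP _))
      (fun Z z ⟨p⟩ => BaseSec.act_bijective hP p _) Y.unop (𝟙 _)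
    · rw [op_id] at h
      have h' := h.existsUnique t
      rwa [RightGSet.map_id_apply] at h'
    · refine ((baseTorsor φ).act_map w.op _ x).trans ?_
      rw [op_comp, RightGSet.map_comp_apply]
      rfl
  locally_nonempty Y := ⟨(IsTorsor.sieve P _).functorPullback (Over.map f),
    (Over.map f).cover_lift (fppf T) (fppf S) (IsTorsor.sieve_mem hP _),
    fun Z z ⟨p⟩ => ⟨BaseSec.point φ hP p⟩⟩

/-- The morphism from the scheme underlying a point, regarded over `S` through the point. -/
def overBack {W : Over S} (t : W ⟶ Over.mk f) : (Over.map f).obj (Over.mk t.left) ⟶ W :=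
  Over.homMk (𝟙 _) ((Category.id_comp _).trans (Over.w t).symm)

theorem overBack_overPt {W : Over S} (t : W ⟶ Over.mk f) :
    overBack t ≫ t = overPt f (Over.mk t.left) := Over.OverMorphism.ext (Category.id_comp _)

variable {φ}

theorem map_map_eq {G : (Over S)ᵒᵖ ⥤ GrpCat.{u}} (P : RightGSet G) {X Y Y' Z : Over S} (a : X ⟶ Y)
    (b : Y ⟶ Z) (a' : X ⟶ Y') (b' : Y' ⟶ Z) (h : a.left ≫ b.left = a'.left ≫ b'.left)
    (p : P.F.obj (op Z)) : P.F.map a.op (P.F.map b.op p) = P.F.map a'.op (P.F.map b'.op p) := by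
  rw [← P.map_comp_apply, ← P.map_comp_apply, ← op_comp, ← op_comp,
    show a ≫ b = a' ≫ b' from Over.OverMorphism.ext h]

/-- The point of the total space of the attached torsor given by a point and an index. -/
def baseTot (hP : IsTorsor (fppf S) P) {W : Over S} (p : P.F.obj (op W))
    (i : LocallyConstant W.left (Fin d)) : TotSec f (baseTorsor φ) W :=
  ⟨φ.app p i, BaseSec.point φ hP (P.F.map (overBack (φ.app p i)).op p)⟩

theorem map_point (hP : IsTorsor (fppf S) P) {Y Z : Over T} (h : Z ⟶ Y)
    (p : P.F.obj (op ((Over.map f).obj Y))) : (baseTorsor φ).F.map h.op (BaseSec.point φ hP p) =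
      BaseSec.point φ hP (P.F.map ((Over.map f).map h).op p) := BaseSec.res_point hP h p

theorem res_baseTot (hP : IsTorsor (fppf S) P) {W V : Over S} (v : V ⟶ W) (p : P.F.obj (op W))
    (i : LocallyConstant W.left (Fin d)) : (baseTot (φ := φ) hP p i).res v =
      baseTot hP (P.F.map v.op p) (lcPull v.left i) := by
  refine TotSec.ext' (φ.app_map v p i) fun g hg => ?_
  refine (congrArg _ (map_point hP _ (P.F.map (overBack (φ.app p i)).op p))).trans ?_
  refine (map_point hP g _).trans (congrArg (BaseSec.point φ hP) ?_)
  refine (congrArg _ (P.map_comp_apply _ _ p).symm).trans (map_map_eq P _ (_ ≫ _) _ _ ?_ p)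
  change g.left ≫ v.left ≫ 𝟙 _ = 𝟙 _ ≫ v.left
  rw [hg, Category.comp_id]
  rfl

/-- The formation of the point of the total space is equivariant for the action of the semidirect
product by which it acts on isomorphisms from the split pair. -/
theorem baseTot_act (hP : IsTorsor (fppf S) P) {W : Over S} (p : P.F.obj (op W))
    (a : WreathSections F d W.left) (i : LocallyConstant W.left (Fin d)) :
    baseTot (φ := φ) hP (P.act p a) i =
      (baseTot hP p (lcApply a.right i)).act (glue F (lcApply a.right i) a.left) := by
  have h0 : lcApply a.right⁻¹ (lcApply a.right i) = i := lcApply_inv_lcApply a.right⁻¹ i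
  have h1 : φ.app (P.act p a) i = φ.app p (lcApply a.right i) :=
    (congrArg (φ.app (P.act p a)) h0.symm).trans (φ.app_act p a (lcApply a.right i))
  refine TotSec.ext' h1 fun g hg => ?_
  let t := φ.app p (lcApply a.right i)
  have h2 : overIdx φ (P.F.map (overBack t).op p) = lcApply a.right i := by
    refine (congrArg (φ.app (P.F.map (overBack t).op p)).symm (overBack_overPt t).symm).trans ?_
    refine (φ.app_symm_map (overBack t) p t).trans ?_
    exact congrArg (lcPull (overBack t).left) ((φ.app p).symm_apply_apply _)
  refine (map_point hP g _).trans ?_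
  have h3 : P.F.map ((Over.map f).map g).op (P.F.map (overBack (φ.app (P.act p a) i)).op (P.act p a)) =
      P.act (P.F.map (overBack t).op p) ((wreath F d S).map (overBack t).op a) := by
    refine Eq.trans ?_ (P.act_map (overBack t).op p a)
    refine (map_map_eq P _ _ (𝟙 _) (overBack t) ?_ (P.act p a)).trans
      (P.map_id_apply (P.F.map (overBack t).op (P.act p a)))
    exact congrArg (· ≫ 𝟙 W.left) hg
  refine (congrArg (BaseSec.point φ hP) h3).trans ((BaseSec.point_act hP _ _).trans ?_)
  refine congrArg (BaseSec.act _) ?_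
  refine congrArg₂ (glue F (X := W.left)) h2 (funext fun k => ?_)
  exact map_appTop_id (X := W) (a.left k)

/-- A torsor under the semidirect product is the torsor of isomorphisms of the pair attached to it:
a point takes an index to the corresponding point of `T`, with the corresponding section of the
attached torsor. -/
theorem isom_splitIsos_baseTorsor [IsFinite f] [Etale f] (hd : ∀ s, f.finrank s = d)
    (hP : IsTorsor (fppf S) P) (hQ : IsTorsor (fppf T) (baseTorsor φ)) :
    P.Isom (splitIsos f (baseTorsor φ) d) :=
  isom_of_map hP (isTorsor_splitIsos hd hQ)
    (fun X p => SplitIso.ofTot (X := X.unop) (fun W w i => baseTot hP (P.F.map w.op p) i)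
      (fun V W w v i => by
        rw [res_baseTot, op_comp, P.map_comp_apply])
      (fun W w => (φ.app (P.F.map w.op p)).bijective))
    (fun X Y u p => SplitIso.tot_injective (X := Y.unop) fun W w i =>
      congrArg (fun q => baseTot hP q i) (P.map_comp_apply u w.op p).symm)
    (fun X p a => SplitIso.tot_injective (X := X.unop) fun W w i =>
      (congrArg (fun q => baseTot hP q i) (P.act_map w.op p a)).trans (baseTot_act hP _ _ i))

end TorsorOfWreath

/-! ### Classification of pairs by torsors -/

section Classification

theorem H1.mk_eq_iff {C : Type (u + 1)} [Category.{u} C] {J : GrothendieckTopology C}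
    {G : Cᵒᵖ ⥤ GrpCat.{u}} {P Q : RightGSet G} (hP : IsTorsor J P) (hQ : IsTorsor J Q) :
    H1.mk hP = H1.mk hQ ↔ P.Isom Q :=
  ⟨fun h => Quotient.exact h, fun h => Quotient.sound h⟩

theorem H1.map_mk_eq {C : Type (u + 1)} [Category.{u} C] {J : GrothendieckTopology C}
    {G H : Cᵒᵖ ⥤ GrpCat.{u}} (φ : G ⟶ H) (hH : Presieve.IsSheaf J (H ⋙ forget GrpCat))
    {P : RightGSet G} {Q : RightGSet H} (hP : IsTorsor J P) (hQ : IsTorsor J Q)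
    (h : (P.push φ).Isom Q) : H1.map φ hH (H1.mk hP) = H1.mk hQ :=
  Quotient.sound h

theorem isom_of_push_id {C : Type (u + 1)} [Category.{u} C] {J : GrothendieckTopology C}
    {G : Cᵒᵖ ⥤ GrpCat.{u}} (hG : Presieve.IsSheaf J (G ⋙ forget GrpCat)) {P Q : RightGSet G}
    (hP : IsTorsor J P) (hQ : IsTorsor J Q) (h : (P.push (𝟙 G)).Isom Q) : P.Isom Q := by
  have h1 : (P.push (𝟙 G)).Isom P :=
    isom_push_of_map hG hP hP (fun _ p => p) (fun _ _ _ _ => rfl) (fun _ _ _ => rfl)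
  have hPG := isTorsor_push (φ := 𝟙 G) hG hP
  exact (H1.mk_eq_iff hP hQ).1 (((H1.mk_eq_iff hPG hP).2 h1).symm.trans ((H1.mk_eq_iff hPG hQ).2 h))

variable {S : Scheme.{u}}

/-- An isomorphism of torsors on `T`, as a map over the identity of `T`. -/
theorem TorsorMap.nonempty_of_isom {T : Scheme.{u}} {F : CommRingCat.{u} ⥤ GrpCat.{u}}
    [PreservesFinPow F]
    {Q Q' : RightGSet (onSch F T)} (h : Q.Isom Q') : Nonempty (TorsorMap (𝟙 T) Q Q') := by
  obtain ⟨e, he⟩ := h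
  let c (Y : Over T) : Over.mk (Y.hom ≫ 𝟙 T) ⟶ Y := Over.homMk (𝟙 Y.left)
    ((Category.id_comp _).trans (Category.comp_id _).symm)
  refine ⟨⟨fun {Y} p => Q'.F.map (c Y).op (e.hom.app (op Y) p), fun {Y Z} h p => ?_,
    fun {Y} p a => ?_⟩⟩
  · refine (congrArg (Q'.F.map (c Z).op) (ConcreteCategory.congr_hom (e.hom.naturality h.op) p)).trans ?_
    exact map_map_eq Q' _ _ _ _ ((Category.id_comp _).trans (Category.comp_id _).symm) _
  · refine (congrArg (Q'.F.map (c Y).op) (he (op Y) p a)).trans ((Q'.act_map _ _ _).trans ?_)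
    exact congrArg (Q'.act _) (map_appTop_id (X := Y) a)

/-- Every torsor under the semidirect product comes from a torsor on a finite étale cover. -/
theorem exists_isom_splitIsos {F : CommRingCat.{u} ⥤ GrpCat.{u}} [PreservesFinPow F] {d : ℕ}
    (hF : ∀ X : Scheme.{u}, Presieve.IsSheaf (fppf X) (onSch F X ⋙ forget GrpCat))
    {P : RightGSet (wreath F d S)} (hP : IsTorsor (fppf S) P) :
    ∃ (T : Scheme.{u}) (f : T ⟶ S) (_ : IsFinite f) (_ : Etale f) (_ : ∀ s, f.finrank s = d)
      (Q : RightGSet (onSch F T)), IsTorsor (fppf T) Q ∧ P.Isom (splitIsos f Q d) := by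
  obtain ⟨T, f, ⟨D⟩⟩ := exists_idxSpec hP
  have := D.isFinite
  have := D.etale
  have hQ := isTorsor_baseTorsor D.framing hP (hF S) (hF T)
  exact ⟨T, f, D.isFinite, D.etale, D.finrank_eq, _, hQ,
    isom_splitIsos_baseTorsor D.finrank_eq hP hQ⟩

theorem isom_splitIsos_of_isom {T : Scheme.{u}} {f : T ⟶ S} [IsFinite f] [Etale f]
    {F : CommRingCat.{u} ⥤ GrpCat.{u}} [PreservesFinPow F] {d : ℕ} (hd : ∀ s, f.finrank s = d)
    {P : RightGSet (wreath F d S)} (hP : IsTorsor (fppf S) P)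
    {Q Q' : RightGSet (onSch F T)} (hQ : IsTorsor (fppf T) Q) (hQ' : IsTorsor (fppf T) Q')
    (h : P.Isom (splitIsos f Q d)) (h' : Q.Isom Q') : P.Isom (splitIsos f Q' d) := by
  have h1 := isTorsor_splitIsos hd hQ
  have h2 := isTorsor_splitIsos hd hQ'
  obtain ⟨θ⟩ := TorsorMap.nonempty_of_isom h'
  exact (H1.mk_eq_iff hP h2).1 (((H1.mk_eq_iff hP h1).2 h).trans ((H1.mk_eq_iff h1 h2).2
    (isom_splitIsos h1 h2 (Iso.refl T) (Category.id_comp f) θ)))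

variable {d r : ℕ}

/-- A `GL_r`-torsor on the cover is the torsor of frames of the associated module, so every torsor
comes from a pair. -/
theorem ModEt.exists_isom {P : RightGSet (wreath (GLFun.{u} r) d S)} (hP : IsTorsor (fppf S) P) :
    ∃ x : ModEt S d r, P.Isom x.isom := by
  obtain ⟨T, f, _, _, hd, Q, hQ, h⟩ := exists_isom_splitIsos (isSheaf_GL r) hP
  let L := ((glRep.{u} r).lin T).comp (𝟙 _)
  have hM := (assocFraming hQ L).isLocFree hQ (isSheaf_assocMod Q L)
  exact ⟨⟨T, f, hd, _, hM⟩, isom_splitIsos_of_isom hd hP hQ (isTorsor_frames hM) h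
    (isom_of_push_id (isSheaf_GL r T) hQ (isTorsor_frames hM)
      (ModFraming.isom_push_frames hQ hM (assocFraming hQ L)))⟩

/-- The same for Azumaya algebras and the algebra associated with a torsor under `PGL_r`. -/
theorem AzuEt.exists_isom {P : RightGSet (wreath (PGLFun.{u} r) d S)} (hP : IsTorsor (fppf S) P) :
    ∃ x : AzuEt S d r, P.Isom x.isom := by
  obtain ⟨T, f, _, _, hd, Q, hQ, h⟩ := exists_isom_splitIsos (isSheaf_PGL r) hP
  have hA := isAlg_assocFraming hQ (𝟙 (onSch (PGLFun.{u} r) T))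
  have hM := hA.isAzumaya hQ (isSheaf_assocMod Q _)
  exact ⟨⟨T, f, hd, _, _, hM⟩, isom_splitIsos_of_isom hd hP hQ (isTorsor_algFrames hM) h
    (isom_of_push_id (isSheaf_PGL r T) hQ (isTorsor_algFrames hM) (hA.isom_push_frames hQ hM))⟩

/-- Isomorphisms of the torsors of pairs come from isomorphisms of pairs. -/
theorem ModEt.isom_iff (x y : ModEt S d r) : x.isom.Isom y.isom ↔ x.Iso y := by
  constructor
  · intro h
    obtain ⟨g, hg, ⟨θ⟩⟩ := exists_torsorMap (isTorsor_frames x.isLocFree)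
      (isTorsor_frames y.isLocFree) x.isTorsor_isom h
    exact ⟨g, hg, θ.nonempty_modIso x.isLocFree y.isLocFree⟩
  · rintro ⟨g, hg, ⟨e⟩⟩
    exact isom_splitIsos x.isTorsor_isom y.isTorsor_isom g hg (e.torsorMap r)

/-- Isomorphisms of the torsors of pairs with algebras come from isomorphisms of pairs. -/
theorem AzuEt.isom_iff (x y : AzuEt S d r) : x.isom.Isom y.isom ↔ x.Iso y := by
  constructor
  · intro h
    obtain ⟨g, hg, ⟨θ⟩⟩ := exists_torsorMap (isTorsor_algFrames x.isAzumaya)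
      (isTorsor_algFrames y.isAzumaya) x.isTorsor_isom h
    exact ⟨g, hg, θ.exists_algIso x.isAzumaya y.isAzumaya⟩
  · rintro ⟨g, hg, e, he⟩
    exact isom_splitIsos x.isTorsor_isom y.isTorsor_isom g hg (e.algTorsorMap he r)

end Classification

end

end SegreNorm

theorem mainTheorem3 (S : Scheme.{u}) (d r : ℕ) :
    (∃ (hT : ∀ x : SegreNorm.ModEt S d r, SegreNorm.IsTorsor (SegreNorm.fppf S) x.isom)
      (hQ : ∀ N : SegreNorm.OMod S, SegreNorm.IsLocFree N (r ^ d) →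
        SegreNorm.IsTorsor (SegreNorm.fppf S) (SegreNorm.frames N (r ^ d))),
      (∀ c, ∃ x, SegreNorm.H1.mk (hT x) = c) ∧
      (∀ x y, SegreNorm.H1.mk (hT x) = SegreNorm.H1.mk (hT y) ↔ x.Iso y) ∧
      ∀ x, ∃ hN : SegreNorm.IsLocFree x.norm (r ^ d),
        SegreNorm.H1.map (SegreNorm.Seg r d S) (SegreNorm.isSheaf_GL (r ^ d) S)
          (SegreNorm.H1.mk (hT x)) = SegreNorm.H1.mk (hQ x.norm hN)) ∧
    (∃ (hT : ∀ x : SegreNorm.AzuEt S d r, SegreNorm.IsTorsor (SegreNorm.fppf S) x.isom)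
      (hQ : ∀ (N : SegreNorm.OMod S) (B : SegreNorm.AlgStr N), SegreNorm.IsAzumaya B (r ^ d) →
        SegreNorm.IsTorsor (SegreNorm.fppf S) (SegreNorm.algFrames B (r ^ d))),
      (∀ c, ∃ x, SegreNorm.H1.mk (hT x) = c) ∧
      (∀ x y, SegreNorm.H1.mk (hT x) = SegreNorm.H1.mk (hT y) ↔ x.Iso y) ∧
      ∀ x, (∃! B : SegreNorm.AlgStr x.norm, x.IsNormAlg B) ∧
        ∀ B : SegreNorm.AlgStr x.norm, x.IsNormAlg B →
          ∃ hB : SegreNorm.IsAzumaya B (r ^ d),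
            SegreNorm.H1.map (SegreNorm.PSeg r d S) (SegreNorm.isSheaf_PGL (r ^ d) S)
              (SegreNorm.H1.mk (hT x)) = SegreNorm.H1.mk (hQ x.norm B hB)) := by
  open SegreNorm in
  refine ⟨⟨ModEt.isTorsor_isom, fun N hN => isTorsor_frames hN, fun c => ?_, fun x y => ?_,
    fun x => ?_⟩, ⟨AzuEt.isTorsor_isom, fun N B hB => isTorsor_algFrames hB, fun c => ?_,
    fun x y => ?_, fun x => ⟨x.existsUnique_isNormAlg, fun B hB => ?_⟩⟩⟩
  · obtain ⟨⟨P, hP⟩, rfl⟩ := Quotient.exists_rep c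
    obtain ⟨x, hx⟩ := ModEt.exists_isom hP
    exact ⟨x, ((H1.mk_eq_iff hP x.isTorsor_isom).2 hx).symm⟩
  · exact (H1.mk_eq_iff _ _).trans (x.isom_iff y)
  · obtain ⟨hN, h⟩ := x.exists_norm
    exact ⟨hN, H1.map_mk_eq _ _ _ _ h⟩
  · obtain ⟨⟨P, hP⟩, rfl⟩ := Quotient.exists_rep c
    obtain ⟨x, hx⟩ := AzuEt.exists_isom hP
    exact ⟨x, ((H1.mk_eq_iff hP x.isTorsor_isom).2 hx).symm⟩
  · exact (H1.mk_eq_iff _ _).trans (x.isom_iff y)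
  · obtain ⟨hB', h⟩ := x.exists_norm hB
    exact ⟨hB', H1.map_mk_eq _ _ _ _ h⟩
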